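/- **Setting.** Let $d\ge 2$ and let $T=(T_{a_1\cdots a_d})$, $1\le a_c\le N$, be a complex tensor. The quartic melonic tensor model has weight $\exp\bigl(-N^{d-1}\bigl(T\cdot\overline T+\tfrac12\sum_{c=1}^d g_c^2B_c(T,\overline T)\bigr)\bigr)$, where $T\cdot\overline T=\sum_a|T_a|^2$ and $$B_c(T,\overline T)=\sum_{a,b}T_{a}\,\overline T_{a_1\cdots a_{c-1}b_ca_{c+1}\cdots a_d}\,T_{b}\,\overline T_{b_1\cdots b_{c-1}a_cb_{c+1}\cdots b_d}.$$ All integrals are formal: they are formal power series in $g_1,\dots,g_d$, each coefficient being a Gaussian integral. For permutations $\sigma_1,\dots,\sigma_d$ of $\{1,\dots,p\}$ consider the tensorial invariant $$\mathcal B(T,\overline T)=\sum_{i^1,\dots,i^p}\ \sum_{j^1,\dots,j^p}\ \prod_{a=1}^pT_{i^a}\overline T_{j^a}\ \prod_{a=1}^p\prod_{c=1}^d\delta_{i^a_c\,j^{\sigma_c(a)}_c},\qquad i^a,j^a\in\{1,\dots,N\}^d .$$ It is represented by the bipartite graph with white vertices and black vertices $1,\dots,p$, in which the edge of colour $c$ joins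 the white vertex $a$ to the black vertex $\sigma_c(a)$. A Wick pairing is a permutation $s$: it adds a set $E_0$ of $p$ edges of colour $0$, joining the white vertex $a$ to the black vertex $s(a)$. Let $F_c$ be the set of faces of colour $(0c)$, i.e. of the cycles of edges of colours $0$ and $c$ alternately. Put $$\alpha_c=g_c\,\frac{\sqrt{1+4\sum_qg_q^2}-1}{2i\sum_qg_q^2},\qquad G=\sum_cg_c\alpha_c ,$$ let $X_1,\dots,X_d$ be Hermitian $N\times N$ matrices, $Y_c=\mathbb 1^{\otimes(c-1)}\otimes X_c\otimes\mathbb 1^{\otimes(d-c)}$, $K=\mathbb 1^{\otimes d}+i\sum_cg_cY_c$, and $$w_s=\frac1{N^{p(d-1)}}\sum_{i^1,\dots,i^p}\sum_{j^1,\dots,j^p}\prod_{a=1}^p\Bigl[(K^{-1})_{i^a,\,j^{s(a)}}\prod_c\delta_{i^a_c\,j^{\sigma_c(a)}_c}\Bigr],\qquad \mathcal A_s=\frac{\int\prod_cdX_c\ w_s\ e^{-\frac12\sum_c\operatorname{tr}Y_c^2-\operatorname{tr}\ln K}}{\int\prod_cdX_c\ e^{-\frac12\sum_c\operatorname{tr}Y_c^2-\operatorname{tr}\ln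 K}} .$$ Let $\langle\cdot\rangle_M$ be the (formal) expectation in the model of Hermitian $N\times N$ matrices $M_1,\dots,M_d$ of weight $$\exp\Bigl(-\tfrac N2\sum_c\operatorname{tr}M_c^2+\operatorname{tr}\sum_{k\ge2}\tfrac1kN^{\frac{2-d}2k}\bigl(\textstyle\sum_c\alpha_c\mathcal M_c\bigr)^k\Bigr),\qquad \mathcal M_c=\mathbb 1^{\otimes(c-1)}\otimes M_c\otimes\mathbb 1^{\otimes(d-c)} .$$ For finitely many variables $x_v$ of colours $c(v)$, let $\overline W(x)=\bigl\langle\prod_v\operatorname{tr}\frac1{x_v-M_{c(v)}}\bigr\rangle_M=\sum_q\bigl\langle\prod_v\operatorname{tr}M_{c(v)}^{q_v}\bigr\rangle_M\prod_vx_v^{-q_v-1}$, and let $W(x)$ be the corresponding joint cumulant (connected correlation function). Both are formal series in the couplings and in $N^{\pm1/2}$. **Theorem.** (1) For every $N\ge1$, $\ \langle\mathcal B\rangle=\sum_s\mathcal A_s$, the sum over the $p!$ Wick pairings $s$. (2) For every $s$, at each order in the couplings, $\mathcal A_s$ is a Laurent polynomial in $N^{1/2}$; at each order in the couplings and in $N^{1/2}$,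 the functions $\overline W$ and $W$ of the face variables exist and their expansions in inverse powers of the variables converge where all variables have modulus $>2$ (at this order the cuts $\Gamma_c$ are $[-2,2]$). At every order in the couplings and in $N^{1/2}$, $$\mathcal A_s=\prod_{c=1}^d\Biggl[\prod_{f\in F_c}\oint\frac{dx^{(c)}_f}{2i\pi}\prod_{e\in E_0,\ e\in f}\oint\frac{dx^{(c)}_e}{2i\pi}\,\frac1{x^{(c)}_e-x^{(c)}_f}\Biggr]\Biggl[\prod_{e\in E_0}\frac1{N^{d-1}(1+iG)\bigl(1-N^{(2-d)/2}\sum_c\alpha_cx^{(c)}_e\bigr)}\Biggr]\overline W\bigl(x_{\bigcup_cF_c}\bigr),$$ where the propagators are understood as formal series, and the contours are positively oriented circles centred at $0$ around the cuts, of any radii such that all $|x^{(c)}_f|>2$ and $|x_e^{(c)}|>|x_f^{(c)}|$ for $e\in f\in F_c$. The right-hand side is also equal to the sum over all set partitions $J$ of $\bigcup_cF_c$ of the same integrals with $\overline W(x_{\bigcup_cF_c})$ replaced by $\prod_iW(x_{J_i})$. -/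

import Mathlib

noncomputable section

namespace QuarticTensor

open MvPowerSeries

/-! ### Formal series

All expectations are formal integrals: formal power series in the coupling constants
`g_1, …, g_d`, every coefficient of which is a convergent Gaussian integral. -/

/-- Formal power series in the couplings `g_1, …, g_d` (for a fixed size `N`). -/
abbrev Series (d : ℕ) : Type := MvPowerSeries (Fin d) ℂ

/-- Formal power series in the couplings whose coefficients are formal Laurent series in the
variable `h = N ^ (-1/2)`, i.e. formal series in the couplings and in `N`, `N⁻¹`. -/
abbrev NSeries (d : ℕ) : Type := MvPowerSeries (Fin d) (LaurentSeries ℂ)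

/-- Termwise integration, with respect to Lebesgue measure, of a formal power series whose
coefficients are functions on `Ω`. -/
def formalIntegral {d : ℕ} {Ω : Type} [MeasureTheory.MeasureSpace Ω] (F : Ω → Series d) :
    Series d :=
  fun m => ∫ ω, coeff m (F ω)

/-- The exponential of a formal power series without constant term. -/
def formalExp {d : ℕ} (A : Series d) : Series d :=
  (PowerSeries.exp ℂ).subst A

/-- `∑_c g_c ^ 2`. -/
def sumSq (d : ℕ) : Series d := ∑ c, (X c) ^ 2

/-- The formal power series `(√(1 + 4 ∑ g_q²) - 1) / (2 ∑ g_q²)` in the couplings; see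
`sqrt_eq` below. -/
def rootSeries (d : ℕ) : Series d :=
  (PowerSeries.mk fun k => (-1 : ℂ) ^ k * (catalan k : ℂ)).subst (sumSq d)

/-- `α_c = g_c (√(1 + 4 ∑ g_q²) - 1) / (2 i ∑ g_q²)`. -/
def alpha {d : ℕ} (c : Fin d) : Series d :=
  C (Complex.I⁻¹) * X c * rootSeries d

/-- `G = ∑_c g_c α_c`. -/
def G (d : ℕ) : Series d := ∑ c, X c * alpha c

theorem sumSq_hasSubst (d : ℕ) : PowerSeries.HasSubst (sumSq d) := by
  apply PowerSeries.HasSubst.of_constantCoeff_zero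
  simp [sumSq]

theorem rootSeries_quadratic (d : ℕ) :
    rootSeries d = 1 - sumSq d * rootSeries d ^ 2 := by
  have key : (PowerSeries.mk fun k => (-1 : ℂ) ^ k * (catalan k : ℂ))
      = 1 - PowerSeries.X * (PowerSeries.mk fun k => (-1 : ℂ) ^ k * (catalan k : ℂ)) ^ 2 := by
    ext n
    cases n with
    | zero => simp
    | succ n =>
      rw [map_sub, PowerSeries.coeff_succ_X_mul, sq, PowerSeries.coeff_mul]
      simp only [PowerSeries.coeff_mk, PowerSeries.coeff_one, Nat.succ_ne_zero, if_false]
      rw [catalan_succ', Nat.cast_sum, Finset.mul_sum, zero_sub, ← Finset.sum_neg_distrib]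
      refine Finset.sum_congr rfl fun x hx => ?_
      rw [← Finset.HasAntidiagonal.mem_antidiagonal.1 hx]
      push_cast
      ring
  have h := congrArg (PowerSeries.subst (sumSq d)) key
  rw [PowerSeries.subst_sub (sumSq_hasSubst d), PowerSeries.subst_mul (sumSq_hasSubst d),
    PowerSeries.subst_X (sumSq_hasSubst d), PowerSeries.subst_pow (sumSq_hasSubst d)] at h
  have h1 : PowerSeries.subst (sumSq d) (1 : PowerSeries ℂ) = (1 : Series d) := by
    have := PowerSeries.coe_substAlgHom (R := ℂ) (sumSq_hasSubst d)
    rw [← this, map_one]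
  rw [h1] at h
  exact h

/-- `1 + 2 (∑ g_q²) · rootSeries` is the square root of `1 + 4 ∑ g_q²` (with constant term `1`),
which justifies the description of `rootSeries`. -/
theorem sqrt_eq (d : ℕ) :
    (1 + 2 * sumSq d * rootSeries d) ^ 2 = 1 + 4 * sumSq d ∧
      constantCoeff (1 + 2 * sumSq d * rootSeries d) = 1 := by
  constructor
  · linear_combination (4 * sumSq d) * rootSeries_quadratic d
  · simp [sumSq]

/-! ### The quartic melonic tensor model -/

/-- Multi-indices `(a_1, …, a_d)` with `1 ≤ a_c ≤ N`. -/
abbrev Idx (d N : ℕ) : Type := Fin d → Fin N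

/-- Complex tensors `T_{a_1 ⋯ a_d}`. -/
abbrev Tensor (d N : ℕ) : Type := Idx d N → ℂ

/-- `T · T̄`. -/
def quadratic {d N : ℕ} (T : Tensor d N) : ℂ := ∑ a, T a * star (T a)

/-- The quartic melonic polynomial `B_c(T, T̄)`. -/
def melonic {d N : ℕ} (c : Fin d) (T : Tensor d N) : ℂ :=
  ∑ a : Idx d N, ∑ b : Idx d N,
    T a * star (T (Function.update a c (b c))) * T b * star (T (Function.update b c (a c)))

/-- `exp (- N^{d-1} (T·T̄ + ½ ∑_c g_c² B_c(T, T̄)))` as a formal power series in the couplings. -/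
def tensorWeight {d N : ℕ} (T : Tensor d N) : Series d :=
  Complex.exp (-(N : ℂ) ^ (d - 1) * quadratic T) •
    formalExp (∑ c, C (-(N : ℂ) ^ (d - 1) / 2 * melonic c T) * (X c) ^ 2)

/-- The expectation `⟨B(T, T̄)⟩` of an observable in the quartic melonic tensor model. -/
def tensorExpectation {d N : ℕ} (B : Tensor d N → ℂ) : Series d :=
  formalIntegral (fun T : Tensor d N => B T • tensorWeight T) *
    (formalIntegral fun T : Tensor d N => tensorWeight T)⁻¹

/-- The tensorial invariant of the bipartite `d`-coloured graph with white vertices and black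
vertices labelled by `Fin n`, in which the edge of colour `c` joins the white vertex `a` to the
black vertex `σ c a`. -/
def invariant {d n N : ℕ} (σ : Fin d → Equiv.Perm (Fin n)) (T : Tensor d N) : ℂ :=
  ∑ i : Fin n → Idx d N, ∑ j : Fin n → Idx d N,
    (∏ a, T (i a)) * (∏ b, star (T (j b))) *
      ∏ a, ∏ c, if i a c = j (σ c a) c then (1 : ℂ) else 0

/-! ### Hermitian matrices and the intermediate field representation -/

/-- Real coordinates on the space of `N × N` Hermitian matrices, orthonormal for `tr (X Y)`
(see `trace_herm_sq`): Lebesgue measure in these coordinates is the measure `dX`. -/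
def herm {N : ℕ} (x : Fin N → Fin N → ℝ) : Matrix (Fin N) (Fin N) ℂ :=
  Matrix.of fun a b =>
    if a < b then ((x a b : ℂ) + Complex.I * x b a) / (Real.sqrt 2 : ℂ)
    else if b < a then ((x b a : ℂ) - Complex.I * x a b) / (Real.sqrt 2 : ℂ)
    else (x a a : ℂ)

theorem herm_isHermitian {N : ℕ} (x : Fin N → Fin N → ℝ) : (herm x).IsHermitian := by
  ext a b
  rcases lt_trichotomy a b with h | h | h
  · simp [herm, h, not_lt_of_gt h, sub_eq_add_neg]
  · subst h; simp [herm]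
  · simp [herm, h, not_lt_of_gt h, sub_eq_add_neg]

theorem trace_herm_sq {N : ℕ} (x : Fin N → Fin N → ℝ) :
    (herm x * herm x).trace = ∑ a, ∑ b, ((x a b : ℂ)) ^ 2 := by
  have h2 : ((Real.sqrt 2 : ℝ) : ℂ) ^ 2 = 2 := by
    rw [← Complex.ofReal_pow, Real.sq_sqrt (by norm_num)]; norm_num
  have h0 : ((Real.sqrt 2 : ℝ) : ℂ) ≠ 0 := by
    intro h; rw [h] at h2; norm_num at h2
  have hI := Complex.I_sq
  have e : ∀ a b, herm x a b * herm x b a = ((x a b : ℂ) ^ 2 + (x b a : ℂ) ^ 2) / 2 := by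
    intro a b
    rcases lt_trichotomy a b with h | h | h
    · simp only [herm, Matrix.of_apply, h, not_lt_of_gt h, if_true, if_false]
      rw [div_mul_div_comm, ← sq ((Real.sqrt 2 : ℝ) : ℂ), h2]
      linear_combination (-(x b a : ℂ) ^ 2 / 2) * hI
    · subst h; simp [herm]; ring
    · simp only [herm, Matrix.of_apply, h, not_lt_of_gt h, if_true, if_false]
      rw [div_mul_div_comm, ← sq ((Real.sqrt 2 : ℝ) : ℂ), h2]
      linear_combination (-(x a b : ℂ) ^ 2 / 2) * hI
  simp only [Matrix.trace, Matrix.diag_apply, Matrix.mul_apply, e]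
  simp only [← Finset.sum_div, Finset.sum_add_distrib]
  rw [Finset.sum_comm (f := fun a b => (x b a : ℂ) ^ 2)]
  ring

/-- `d`-tuples of Hermitian matrices, in coordinates. -/
abbrev Herms (d N : ℕ) : Type := Fin d → Fin N → Fin N → ℝ

/-- `𝟙^{⊗(c-1)} ⊗ M ⊗ 𝟙^{⊗(d-c)}`, acting in the position `c`. -/
def lift {d N : ℕ} (c : Fin d) (M : Matrix (Fin N) (Fin N) ℂ) :
    Matrix (Idx d N) (Idx d N) ℂ :=
  Matrix.of fun i j => if ∀ c', c' ≠ c → i c' = j c' then M (i c) (j c) else 0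

/-- `𝟙^{⊗d} + i ∑_c g_c Y_c`, with `Y_c` the lift of `X_c`. -/
def kernel {d N : ℕ} (x : Herms d N) : Matrix (Idx d N) (Idx d N) (Series d) :=
  1 + ∑ c, (C Complex.I * X c) • (lift c (herm (x c))).map C

/-- `exp (-½ ∑_c tr Y_c² - tr ln (𝟙^{⊗d} + i ∑_c g_c Y_c))` as a formal power series in the
couplings, the exponential of `- tr ln` being the inverse of the determinant. -/
def intermediateWeight {d N : ℕ} (x : Herms d N) : Series d :=
  Complex.exp (-(1 / 2) * ∑ c, (lift c (herm (x c)) * lift c (herm (x c))).trace) •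
    ((kernel x).det)⁻¹

/-- The weight `w(B(T, T̄))` of the Wick pairing `s`, which joins by an edge of colour `0` the
white vertex `a` to the black vertex `s a`. -/
def pairingWeight {d n N : ℕ} (σ : Fin d → Equiv.Perm (Fin n)) (s : Equiv.Perm (Fin n))
    (x : Herms d N) : Series d :=
  C (((N : ℂ) ^ (n * (d - 1)))⁻¹) *
    ∑ i : Fin n → Idx d N, ∑ j : Fin n → Idx d N,
      ∏ a, ((kernel x)⁻¹ (i a) (j (s a)) *
        ∏ c, if i a c = j (σ c a) c then (1 : Series d) else 0)

/-- The contribution of the Wick pairing `s` to the expectation of the invariant,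
`Z⁻¹ ∫ ∏ dX_c w(B(T, T̄)) exp (-½ ∑ tr Y_c² - tr ln (𝟙 + i ∑ g_c Y_c))`. -/
def wickTerm {d n : ℕ} (N : ℕ) (σ : Fin d → Equiv.Perm (Fin n)) (s : Equiv.Perm (Fin n)) :
    Series d :=
  formalIntegral (fun x : Herms d N => pairingWeight σ s x * intermediateWeight x) *
    (formalIntegral fun x : Herms d N => intermediateWeight x)⁻¹

/-! ### The matrix model and its correlation functions -/

/-- `N^{(2-d)/2} ∑_c α_c 𝓜_c`. -/
def coupled {d N : ℕ} (x : Herms d N) : Matrix (Idx d N) (Idx d N) (Series d) :=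
  ∑ c, (C (((N : ℝ) ^ ((2 - (d : ℝ)) / 2) : ℝ) : ℂ) * alpha c) • (lift c (herm (x c))).map C

/-- `tr ∑_{p ≥ 2} (N^{(2-d)p/2} / p) (∑_c α_c 𝓜_c)^p`. Since `α_c` has no constant term, only
the terms with `p ≤ |m|` contribute to the coefficient of index `m`. -/
def potential {d N : ℕ} (x : Herms d N) : Series d :=
  fun m => ∑ p ∈ Finset.Icc 2 m.degree, coeff m ((coupled x) ^ p).trace / (p : ℂ)

/-- The weight of the matrix model for `M_1, …, M_d`. -/
def matrixWeight {d N : ℕ} (x : Herms d N) : Series d :=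
  Complex.exp (-((N : ℂ) / 2) * ∑ c, (herm (x c) * herm (x c)).trace) • formalExp (potential x)

/-- `⟨∏_v tr M_{col v}^{q v}⟩` in the matrix model, for a finite set `V` of coloured variables. -/
def moment {d : ℕ} (N : ℕ) {V : Type} [Fintype V] (col : V → Fin d) (q : V → ℕ) : Series d :=
  formalIntegral (fun x : Herms d N =>
      (∏ v, ((herm (x (col v))) ^ (q v)).trace) • matrixWeight x) *
    (formalIntegral fun x : Herms d N => matrixWeight x)⁻¹

open Classical in
/-- The joint cumulant (connected expectation) `⟨∏_v tr M_{col v}^{q v}⟩_c`. -/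
def cumulant {d : ℕ} (N : ℕ) {V : Type} [Fintype V] (col : V → Fin d) (q : V → ℕ) : Series d :=
  ∑ π : Finpartition (Finset.univ : Finset V),
    (-1) ^ (π.parts.card - 1) * ((π.parts.card - 1).factorial : Series d) *
      ∏ J ∈ π.parts, moment N (fun v : J => col v) (fun v : J => q v)

/-- `A` is the expansion in `N` of `F`: every coefficient of `F N` is, for all `N ≥ 1`, a Laurent
polynomial in `h = N ^ (-1/2)`, given by the corresponding coefficient of `A`. There is at most
one such `A`. -/
def IsExpansion {d : ℕ} (F : ℕ → Series d) (A : NSeries d) : Prop :=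
  ∀ m, (coeff m A).coeff.support.Finite ∧
    ∀ N : ℕ, 1 ≤ N →
      coeff m (F N) = ∑ᶠ j : ℤ, (coeff m A).coeff j * ((Real.sqrt N : ℝ) : ℂ) ^ (-j)

/-- `W(x) = ∑_q F(q) / ∏_v x_v^{q_v + 1}` as a formal series in the couplings and in `N`, whose
coefficients are functions of `x` holomorphic for `|x_v| > 2`: at each order the defining series
in the inverse powers of the `x_v` converges there. (Order by order in the couplings, the cut
`[-2/√(1-α_c²), 2/√(1-α_c²)]` of colour `c` is `[-2, 2]`.) -/
def IsCorrelation {d : ℕ} {V : Type} [Fintype V] (F : ℕ → (V → ℕ) → Series d)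
    (W : (V → ℂ) → NSeries d) : Prop :=
  ∃ A : (V → ℕ) → NSeries d, (∀ q, IsExpansion (fun N => F N q) (A q)) ∧
    ∀ x : V → ℂ, (∀ v, 2 < ‖x v‖) → ∀ (m : Fin d →₀ ℕ) (j : ℤ),
      HasSum (fun q : V → ℕ => (coeff m (A q)).coeff j / ∏ v, x v ^ (q v + 1))
        ((coeff m (W x)).coeff j)

/-! ### Contour integrals and the Feynman rules -/

/-- `∮ ∏_v dx_v / (2 i π) f(x)` over the product of the circles `|x_v| = r_v`, each oriented
counterclockwise. -/
def contour {V : Type} [Fintype V] (r : V → ℝ) (f : (V → ℂ) → ℂ) : ℂ :=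
  ∫ θ in Set.pi Set.univ (fun _ : V => Set.Ioc 0 (2 * Real.pi)),
    (∏ v, deriv (circleMap 0 (r v)) (θ v) / (2 * Real.pi * Complex.I)) *
      f fun v => circleMap 0 (r v) (θ v)

/-- The faces of colour `(0 c)` of the graph obtained by adding to the coloured graph `σ` the
edges of colour `0` of the pairing `s`. An edge of colour `0` is labelled by its white end; from
it one leaves along colour `0` to the black vertex `s a` and along colour `c` to the white vertex
`(σ c)⁻¹ (s a)`. -/
def Face {d n : ℕ} (σ : Fin d → Equiv.Perm (Fin n)) (s : Equiv.Perm (Fin n)) (c : Fin d) :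
    Type :=
  Quotient (Equiv.Perm.SameCycle.setoid ((σ c)⁻¹ * s))

instance {d n : ℕ} (σ : Fin d → Equiv.Perm (Fin n)) (s : Equiv.Perm (Fin n)) (c : Fin d) :
    Finite (Face σ s c) :=
  inferInstanceAs (Finite (Quotient _))

instance {d n : ℕ} (σ : Fin d → Equiv.Perm (Fin n)) (s : Equiv.Perm (Fin n)) (c : Fin d) :
    Fintype (Face σ s c) :=
  Fintype.ofFinite _

/-- `⋃_c F_c`: the face `f` of colour `(0 c)` is `⟨c, f⟩`. -/
abbrev Faces {d n : ℕ} (σ : Fin d → Equiv.Perm (Fin n)) (s : Equiv.Perm (Fin n)) : Type :=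
  Σ c : Fin d, Face σ s c

/-- The face of colour `(0 c)` that contains the edge `e` of colour `0`. -/
def faceOf {d n : ℕ} (σ : Fin d → Equiv.Perm (Fin n)) (s : Equiv.Perm (Fin n)) (c : Fin d)
    (e : Fin n) : Faces σ s :=
  ⟨c, Quotient.mk (Equiv.Perm.SameCycle.setoid ((σ c)⁻¹ * s)) e⟩

/-- `h ^ k = N ^ (-k/2)`. -/
def hpow (k : ℤ) : LaurentSeries ℂ := HahnSeries.single k 1

/-- A series in the couplings alone, seen as a series in the couplings and in `N`. -/
def toN {d : ℕ} (A : Series d) : NSeries d := MvPowerSeries.map HahnSeries.C A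

/-- The propagator `1 / (N^{d-1} (1 + iG) (1 - N^{(2-d)/2} ∑_c α_c y_c))` of an edge of colour `0`
as a formal series. -/
def propagator {d : ℕ} (y : Fin d → ℂ) : NSeries d :=
  (C (hpow (-2 * ((d : ℤ) - 1))) * toN (1 + C Complex.I * G d) *
    (1 - ∑ c, C (hpow ((d : ℤ) - 2) * HahnSeries.C (y c)) * toN (alpha c)))⁻¹

/-- The contour integral attached to the pairing `s`, at order `m` in the couplings and `j` in
`h = N ^ (-1/2)`, with `W` inserted for the correlation function of the face variables:
`∏_c ∏_{f ∈ F_c} ∮ dx_f/(2iπ) ∏_{e ∈ f} ∮ dx_e^{(c)}/(2iπ) 1/(x_e^{(c)} - x_f)` applied to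
`∏_e propagator(x_e) · W(x_f)`. -/
def feynmanIntegral {d n : ℕ} (σ : Fin d → Equiv.Perm (Fin n)) (s : Equiv.Perm (Fin n))
    (rf : Faces σ s → ℝ) (re : Fin d × Fin n → ℝ) (W : (Faces σ s → ℂ) → NSeries d)
    (m : Fin d →₀ ℕ) (j : ℤ) : ℂ :=
  contour rf fun xf => contour re fun xe =>
    (∏ ce : Fin d × Fin n, 1 / (xe ce - xf (faceOf σ s ce.1 ce.2))) *
      (coeff m ((∏ e : Fin n, propagator fun c => xe (c, e)) * W xf)).coeff j

end QuarticTensor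

end

noncomputable section

namespace QuarticTensor

open MvPowerSeries

/-! ### Derivations of products, matrices and determinants -/

section Deriv

variable {k R : Type*} [CommRing k] [CommRing R] [Algebra k R] (δ : Derivation k R R)

/-! The quartic vertices are linearised by Gaussian integration. By completeness of the basis of
Hermitian matrices, `B_c` is the sum of the squares of the forms `T̄ 𝓜_p T` (`sum_theta_sq`), so the
exponential of the interaction is a Gaussian integral over Hermitian `X_c` of an exponential that is
linear in `X` and quadratic in `T` (`integral_field`). Every coefficient in the couplings is a
polynomial against a Gaussian weight, hence Fubini applies (`numerator_eq`). Integrating over `T`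
first uses Wick's theorem with propagator `K⁻¹` (`pertE_wick`) and produces the factor `1 / det K`
(`pertE_one_mul_det`). This is part (1).

For part (2), each `X_c` is translated by `α_c` times the identity (`gaussF_shift`). The quadratic
equation behind the `α_c` makes the translated kernel equal to `(1 + iG)(1 - ∑ α_c Y_c)` (`saddle`,
`evT_one_fieldT`). The cross term of the translated Gaussian cancels the linear term of `-tr ln`
(`shift_integrand`), and the rescaling by `N^{(2-d)/2}` gives the weight of the matrix model
(`wickTerm_eq`).

The inverse of `1 - ∑ α_c 𝓜_c` is then expanded as a Neumann series. Lifts of different colours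
commute, so powers of the sum are sums of tensor products. The index sums of the graph decouple
colour by colour into traces along the cycles of `σ_c⁻¹ s`, that is, along the faces
(`sum_prod_cycles`, `pairSumF_tens`). Thus a Wick term is, at each order in the couplings, a finite
combination of moments `⟨∏_f tr M^{q_f}⟩`, where `q_f` adds the exponents of the edges of the face
(`wickTerm_sub_mem`).

The dependence on `N` and the convergence for `|x| > 2` come from the loop equations of the Gaussian
model (`loop_equation`). Their recursion shows that a Gaussian moment of `k` traces is `N^k` times a
polynomial in `N⁻²` with natural coefficients (`exists_wordPoly`). A majorant built on Catalan
numbers bounds this polynomial at one small positive point, and positivity converts this into a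
bound on each coefficient, of the form a power of the degree times `2 ^ degree`
(`wordPoly_coeff_le`). This growth passes to the moments and cumulants of the interacting model
order by order (`momL_tame`, `cumL_tame`).

The contour integrals undo the generating functions. Cauchy's formula sets every edge variable equal
to the variable of its face, and the integral over a face variable extracts one coefficient of the
correlation function. This reproduces the expansion of the Wick term (`feynmanIntegral_eq`). The
version with cumulants follows from linearity and the inversion between moments and cumulants
(`sum_prod_cumul`).

Identities between formal series are obtained either modulo all powers of the degree filtration or
from uniqueness for a differential equation in the Euler derivation (`eulerD_ode_unique`). -/

theorem deriv_prod {ι : Type*} [DecidableEq ι] (s : Finset ι) (f : ι → R) :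
    δ (∏ i ∈ s, f i) = ∑ i ∈ s, (∏ j ∈ s.erase i, f j) * δ (f i) := by
  induction s using Finset.induction_on with
  | empty => simp
  | insert a s ha ih =>
    rw [Finset.prod_insert ha, δ.leibniz, ih, Finset.sum_insert ha, Finset.erase_insert ha,
      smul_eq_mul, smul_eq_mul, add_comm, Finset.mul_sum]
    congr 1
    refine Finset.sum_congr rfl fun i hi => ?_
    have hia : a ≠ i := fun h => ha (h ▸ hi)
    rw [Finset.erase_insert_of_ne hia, Finset.prod_insert (by simp [ha])]
    ring

theorem deriv_matrix_mul {l m n : Type*} [Fintype m] (A : Matrix l m R) (B : Matrix m n R) :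
    (A * B).map δ = A.map δ * B + A * B.map δ := by
  ext i j
  simp only [Matrix.map_apply, Matrix.mul_apply, Matrix.add_apply, map_sum, δ.leibniz, smul_eq_mul,
    ← Finset.sum_add_distrib]
  exact Finset.sum_congr rfl fun x _ => by ring

theorem deriv_matrix_one {n : Type*} [DecidableEq n] :
    (1 : Matrix n n R).map δ = 0 := by
  ext i j
  by_cases h : i = j <;> simp [h, Matrix.one_apply]

theorem deriv_matrix_inv {n : Type*} [Fintype n] [DecidableEq n] {A B : Matrix n n R}
    (h : A * B = 1) : B.map δ = -(B * A.map δ * B) := by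
  have h' : B * A = 1 := mul_eq_one_comm.1 h
  have h1 : A.map δ * B + A * B.map δ = 0 := by
    rw [← deriv_matrix_mul, h, deriv_matrix_one]
  have h2 : B * (A.map δ * B + A * B.map δ) = 0 := by rw [h1, mul_zero]
  rw [mul_add, ← mul_assoc, ← mul_assoc, h', one_mul] at h2
  exact eq_neg_of_add_eq_zero_right h2

theorem deriv_matrix_pow {n : Type*} [Fintype n] [DecidableEq n] (A : Matrix n n R) (p : ℕ) :
    (A ^ p).map δ = ∑ l ∈ Finset.range p, A ^ l * A.map δ * A ^ (p - 1 - l) := by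
  induction p with
  | zero => simp [deriv_matrix_one]
  | succ p ih =>
    rw [pow_succ, deriv_matrix_mul, ih, Finset.sum_range_succ, Finset.sum_mul]
    congr 1
    · refine Finset.sum_congr rfl fun l hl => ?_
      rw [mul_assoc, ← pow_succ]
      congr 2
      have := Finset.mem_range.1 hl
      omega
    · simp

theorem deriv_trace {n : Type*} [Fintype n] (A : Matrix n n R) :
    δ A.trace = (A.map δ).trace := by
  simp [Matrix.trace]

/-- Cyclicity of the trace makes the `p` terms of the Leibniz rule equal, although `A` need not
commute with its derivative. -/
theorem deriv_trace_pow {n : Type*} [Fintype n] [DecidableEq n] (A : Matrix n n R) (p : ℕ) :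
    δ (A ^ p).trace = p * (A ^ (p - 1) * A.map δ).trace := by
  rw [deriv_trace, deriv_matrix_pow, Matrix.trace_sum, Finset.sum_congr rfl (g := fun _ =>
    (A ^ (p - 1) * A.map δ).trace)]
  · simp
  · intro l hl
    rw [Matrix.trace_mul_comm, ← mul_assoc, ← pow_add]
    congr 3
    have := Finset.mem_range.1 hl
    omega

/-- Jacobi's formula. The Leibniz expansion is differentiated one column at a time, and each
determinant with one replaced column is a Cramer determinant, hence a component of the adjugate
applied to the new column. -/
theorem deriv_det {n : Type*} [Fintype n] [DecidableEq n] (A : Matrix n n R) :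
    δ A.det = (A.adjugate * A.map δ).trace := by
  have h1 : δ A.det = ∑ j, (A.updateCol j fun i => δ (A i j)).det := by
    simp only [Matrix.det_apply, map_sum]
    rw [Finset.sum_comm]
    refine Finset.sum_congr rfl fun s _ => ?_
    rw [← Finset.smul_sum, map_zsmul_unit]
    congr 1
    rw [deriv_prod]
    refine Finset.sum_congr rfl fun j _ => ?_
    rw [← Finset.prod_erase_mul _ _ (Finset.mem_univ j)]
    congr 1
    · refine Finset.prod_congr rfl fun i hi => ?_
      rw [Matrix.updateCol_ne (Finset.ne_of_mem_erase hi)]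
    · simp
  rw [h1]
  simp only [← Matrix.cramer_apply, Matrix.cramer_eq_adjugate_mulVec, Matrix.trace,
    Matrix.diag_apply, Matrix.mul_apply, Matrix.mulVec, dotProduct, Matrix.map_apply]

end Deriv

/-! ### The filtration by total degree -/

section Filtration

variable {σ S : Type*} [CommRing S]

/-- The ideal of power series without terms of total degree `< n`. -/
def ordIdeal (σ S : Type*) [CommRing S] (n : ℕ) : Ideal (MvPowerSeries σ S) where
  carrier := {F | ∀ m : σ →₀ ℕ, m.degree < n → coeff m F = 0}
  add_mem' {a b} ha hb m hm := by rw [map_add, ha m hm, hb m hm, add_zero]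
  zero_mem' m _ := by simp
  smul_mem' c x hx m hm := by
    classical
    rw [smul_eq_mul, coeff_mul]
    refine Finset.sum_eq_zero fun p hp => ?_
    rw [hx p.2, mul_zero]
    have := Finset.HasAntidiagonal.mem_antidiagonal.1 hp
    rw [← this, map_add] at hm
    omega

theorem mem_ordIdeal {n : ℕ} {F : MvPowerSeries σ S} :
    F ∈ ordIdeal σ S n ↔ ∀ m : σ →₀ ℕ, m.degree < n → coeff m F = 0 := Iff.rfl

theorem ordIdeal_mul_mem {p q : ℕ} {F G : MvPowerSeries σ S} (hF : F ∈ ordIdeal σ S p)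
    (hG : G ∈ ordIdeal σ S q) : F * G ∈ ordIdeal σ S (p + q) := by
  classical
  intro m hm
  rw [coeff_mul]
  refine Finset.sum_eq_zero fun x hx => ?_
  have := Finset.HasAntidiagonal.mem_antidiagonal.1 hx
  rw [← this, map_add] at hm
  by_cases h : x.1.degree < p
  · rw [hF _ h, zero_mul]
  · rw [hG _ (by omega), mul_zero]

theorem ordIdeal_anti {p q : ℕ} (h : p ≤ q) : ordIdeal σ S q ≤ ordIdeal σ S p :=
  fun _ hF m hm => hF m (hm.trans_le h)

theorem mem_ordIdeal_zero (F : MvPowerSeries σ S) : F ∈ ordIdeal σ S 0 := fun m hm => by omega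

theorem mem_ordIdeal_one {F : MvPowerSeries σ S} :
    F ∈ ordIdeal σ S 1 ↔ constantCoeff F = 0 := by
  constructor
  · intro h
    have := h 0 (by simp)
    simpa using this
  · intro h m hm
    have : m = 0 := by
      rw [← Finsupp.degree_eq_zero_iff]; omega
    rw [this]
    simpa using h

theorem X_mem_ordIdeal (i : σ) : (X i : MvPowerSeries σ S) ∈ ordIdeal σ S 1 := by
  rw [mem_ordIdeal_one]; simp

theorem ordIdeal_pow_mem {F : MvPowerSeries σ S} (hF : F ∈ ordIdeal σ S 1) (p : ℕ) :
    F ^ p ∈ ordIdeal σ S p := by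
  induction p with
  | zero => exact mem_ordIdeal_zero _
  | succ p ih => rw [pow_succ]; exact ordIdeal_mul_mem ih hF

/-- The filtration is separated, so identities involving infinite expansions can be checked on
truncations; this takes the place of convergence of formal series. -/
theorem eq_of_sub_mem_ordIdeal {F G : MvPowerSeries σ S} (h : ∀ n, F - G ∈ ordIdeal σ S n) :
    F = G := by
  ext m
  have := h (m.degree + 1) m (by omega)
  rwa [map_sub, sub_eq_zero] at this

theorem coeff_eq_of_sub_mem {n : ℕ} {F G : MvPowerSeries σ S} (h : F - G ∈ ordIdeal σ S n)
    {m : σ →₀ ℕ} (hm : m.degree < n) : coeff m F = coeff m G := by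
  have := h m hm
  rwa [map_sub, sub_eq_zero] at this

theorem mul_sub_mul_mem {I : Ideal (MvPowerSeries σ S)} {F F' G G' : MvPowerSeries σ S}
    (hF : F - F' ∈ I) (hG : G - G' ∈ I) : F * G - F' * G' ∈ I := by
  have : F * G - F' * G' = G * (F - F') + F' * (G - G') := by ring
  rw [this]
  exact I.add_mem (I.mul_mem_left _ hF) (I.mul_mem_left _ hG)

theorem prod_sub_prod_mem {I : Ideal (MvPowerSeries σ S)} {ι : Type*} (s : Finset ι)
    {F G : ι → MvPowerSeries σ S} (h : ∀ i ∈ s, F i - G i ∈ I) :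
    ∏ i ∈ s, F i - ∏ i ∈ s, G i ∈ I := by
  classical
  induction s using Finset.induction_on with
  | empty => simp
  | insert a s ha ih =>
    rw [Finset.prod_insert ha, Finset.prod_insert ha]
    exact mul_sub_mul_mem (h a (by simp)) (ih fun i hi => h i (by simp [hi]))

theorem sum_sub_sum_mem {I : Ideal (MvPowerSeries σ S)} {ι : Type*} (s : Finset ι)
    {F G : ι → MvPowerSeries σ S} (h : ∀ i ∈ s, F i - G i ∈ I) :
    ∑ i ∈ s, F i - ∑ i ∈ s, G i ∈ I := by
  rw [← Finset.sum_sub_distrib]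
  exact I.sum_mem h

theorem map_mem_ordIdeal {T : Type*} [CommRing T] (φ : S →+* T) {n : ℕ} {F : MvPowerSeries σ S}
    (hF : F ∈ ordIdeal σ S n) : MvPowerSeries.map φ F ∈ ordIdeal σ T n := by
  intro m hm
  rw [coeff_map, hF m hm, map_zero]

theorem matrix_mul_mem {ι : Type*} [Fintype ι] {p q : ℕ} {A B : Matrix ι ι (MvPowerSeries σ S)}
    (hA : ∀ i j, A i j ∈ ordIdeal σ S p) (hB : ∀ i j, B i j ∈ ordIdeal σ S q) (i j : ι) :
    (A * B) i j ∈ ordIdeal σ S (p + q) := by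
  rw [Matrix.mul_apply]
  exact Ideal.sum_mem _ fun x _ => ordIdeal_mul_mem (hA i x) (hB x j)

theorem matrix_pow_mem {ι : Type*} [Fintype ι] [DecidableEq ι]
    {B : Matrix ι ι (MvPowerSeries σ S)}
    (hB : ∀ i j, B i j ∈ ordIdeal σ S 1) (p : ℕ) (i j : ι) : (B ^ p) i j ∈ ordIdeal σ S p := by
  induction p generalizing i j with
  | zero => exact mem_ordIdeal_zero _
  | succ p ih => rw [pow_succ]; exact matrix_mul_mem (fun i j => ih i j) hB i j

/-- The truncated Neumann series. -/
theorem inv_sub_geom_mem {ι : Type*} [Fintype ι] [DecidableEq ι]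
    {B C : Matrix ι ι (MvPowerSeries σ S)} (hB : ∀ i j, B i j ∈ ordIdeal σ S 1)
    (hC : (1 - B) * C = 1) (n : ℕ) (i j : ι) :
    C i j - (∑ p ∈ Finset.range n, B ^ p) i j ∈ ordIdeal σ S n := by
  have h : C - ∑ p ∈ Finset.range n, B ^ p = B ^ n * C := by
    have h1 : (∑ p ∈ Finset.range n, B ^ p) * ((1 - B) * C) = (1 - B ^ n) * C := by
      rw [← mul_assoc, geom_sum_mul_neg]
    rw [hC, mul_one] at h1
    rw [h1, sub_mul, one_mul, sub_sub_cancel]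
  rw [← Matrix.sub_apply, h]
  exact matrix_mul_mem (matrix_pow_mem hB n) (fun _ _ => mem_ordIdeal_zero _) i j

theorem det_constantCoeff {ι : Type*} [Fintype ι] [DecidableEq ι]
    {B : Matrix ι ι (MvPowerSeries σ S)} (hB : ∀ i j, B i j ∈ ordIdeal σ S 1) :
    constantCoeff (1 + B).det = 1 := by
  rw [RingHom.map_det, map_add, map_one]
  have : constantCoeff.mapMatrix B = 0 := by
    ext i j
    simpa using mem_ordIdeal_one.1 (hB i j)
  rw [this, add_zero, Matrix.det_one]

theorem isUnit_of_constantCoeff_one {F : MvPowerSeries σ S} (h : constantCoeff F = 1) :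
    IsUnit F := by
  rw [isUnit_iff_constantCoeff, h]; exact isUnit_one

end Filtration

/-! ### The Euler derivation and exponentials -/

section Euler

variable {σ S : Type*} [CommRing S]

/-- The Euler derivation, which multiplies the terms of total degree `n` by `n`. -/
def eulerD (σ S : Type*) [CommRing S] :
    Derivation S (MvPowerSeries σ S) (MvPowerSeries σ S) :=
  Derivation.mk'
    { toFun := fun F m => (m.degree : S) * coeff m F
      map_add' := fun F G => by
        ext m
        change (m.degree : S) * coeff m (F + G) = m.degree * coeff m F + m.degree * coeff m G
        rw [map_add, mul_add]
      map_smul' := fun c F => by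
        ext m
        change (m.degree : S) * coeff m (c • F) = c * (m.degree * coeff m F)
        rw [coeff_smul]; ring }
    (by
      classical
      intro F G
      ext m
      change (m.degree : S) * coeff m (F * G) = coeff m (F * _ + G * _)
      rw [mul_comm G, map_add, coeff_mul, coeff_mul, coeff_mul, Finset.mul_sum,
        ← Finset.sum_add_distrib]
      refine Finset.sum_congr rfl fun p hp => ?_
      change _ = coeff p.1 F * (p.2.degree * coeff p.2 G) + p.1.degree * coeff p.1 F * coeff p.2 G
      rw [← Finset.HasAntidiagonal.mem_antidiagonal.1 hp, map_add]
      push_cast; ring)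

theorem coeff_eulerD (F : MvPowerSeries σ S) (m : σ →₀ ℕ) :
    coeff m (eulerD σ S F) = m.degree * coeff m F := rfl

theorem map_eulerD {T : Type*} [CommRing T] (φ : S →+* T) (F : MvPowerSeries σ S) :
    MvPowerSeries.map φ (eulerD σ S F) = eulerD σ T (MvPowerSeries.map φ F) := by
  ext m
  simp [coeff_eulerD]

theorem eulerD_mem {F : MvPowerSeries σ S} {n : ℕ} (hF : F ∈ ordIdeal σ S n) :
    eulerD σ S F ∈ ordIdeal σ S n := by
  intro m hm
  rw [coeff_eulerD, hF m hm, mul_zero]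

theorem eulerD_mem_one (F : MvPowerSeries σ S) : eulerD σ S F ∈ ordIdeal σ S 1 := by
  rw [mem_ordIdeal_one, ← coeff_zero_eq_constantCoeff_apply, coeff_eulerD]
  simp

theorem natCast_cancel [Algebra ℂ S] {n : ℕ} (hn : n ≠ 0) {x y : S} (h : (n : S) * x = n * y) :
    x = y := by
  have h1 : (algebraMap ℂ S (n : ℂ)⁻¹) * (n : S) = 1 := by
    rw [← map_natCast (algebraMap ℂ S), ← map_mul, inv_mul_cancel₀ (by exact_mod_cast hn), map_one]
  calc x = (algebraMap ℂ S (n : ℂ)⁻¹) * (n * x) := by rw [← mul_assoc, h1, one_mul]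
    _ = y := by rw [h, ← mul_assoc, h1, one_mul]

/-- On the part of degree `n` the Euler derivation is multiplication by `n`, which is injective for
`n > 0` over a `ℂ`-algebra, while `H` raises the degree. The coefficients of `Y` therefore vanish
degree by degree. This uniqueness is the source of the identities for exponentials, determinants and
partition functions. -/
theorem eulerD_ode_unique [Algebra ℂ S] {H Y : MvPowerSeries σ S} (hH : H ∈ ordIdeal σ S 1)
    (h : eulerD σ S Y = H * Y) (hY : constantCoeff Y = 0) : Y = 0 := by
  have key : ∀ n, Y ∈ ordIdeal σ S n := by
    intro n
    induction n with
    | zero => exact mem_ordIdeal_zero _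
    | succ n ih =>
      intro m hm
      by_cases h0 : m.degree = 0
      · rw [Finsupp.degree_eq_zero_iff] at h0
        rw [h0]; simpa using hY
      · have h1 : coeff m (eulerD σ S Y) = 0 := by
          rw [h]
          exact ordIdeal_mul_mem hH ih m (by omega)
        rw [coeff_eulerD] at h1
        exact natCast_cancel h0 (by rw [h1, mul_zero])
  refine eq_of_sub_mem_ordIdeal fun n => ?_
  rw [sub_zero]; exact key n

theorem eq_of_eulerD_eq [Algebra ℂ S] {F G : MvPowerSeries σ S}
    (h : eulerD σ S F = eulerD σ S G) (h0 : constantCoeff F = constantCoeff G) : F = G := by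
  rw [← sub_eq_zero]
  refine eulerD_ode_unique (H := 0) (Ideal.zero_mem _) ?_ ?_
  · rw [map_sub, h, sub_self, zero_mul]
  · rw [map_sub, h0, sub_self]

/-- Apply a derivation of the coefficient ring to each coefficient. -/
def coeffDeriv {k : Type*} [CommRing k] [Algebra k S] (δ : Derivation k S S) :
    Derivation k (MvPowerSeries σ S) (MvPowerSeries σ S) :=
  Derivation.mk'
    { toFun := fun F m => δ (coeff m F)
      map_add' := fun F G => by
        ext m
        change δ (coeff m (F + G)) = δ (coeff m F) + δ (coeff m G)
        rw [map_add, map_add]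
      map_smul' := fun c F => by
        ext m
        change δ (c • coeff m F) = c • δ (coeff m F)
        rw [δ.map_smul] }
    (by
      classical
      intro F G
      ext m
      change δ (coeff m (F * G)) = coeff m (F * _ + G * _)
      rw [mul_comm G, map_add, coeff_mul, coeff_mul, coeff_mul, map_sum,
        ← Finset.sum_add_distrib]
      refine Finset.sum_congr rfl fun p hp => ?_
      change _ = coeff p.1 F * δ (coeff p.2 G) + δ (coeff p.1 F) * coeff p.2 G
      rw [δ.leibniz, smul_eq_mul, smul_eq_mul]; ring)

theorem coeff_coeffDeriv {k : Type*} [CommRing k] [Algebra k S] (δ : Derivation k S S)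
    (F : MvPowerSeries σ S) (m : σ →₀ ℕ) : coeff m (coeffDeriv δ F) = δ (coeff m F) := rfl

theorem coeffDeriv_map_C {k T : Type*} [CommRing k] [CommRing T] [Algebra k S]
    (δ : Derivation k S S) (φ : T →+* S) (hφ : ∀ x, δ (φ x) = 0) (F : MvPowerSeries σ T) :
    coeffDeriv δ (MvPowerSeries.map φ F) = 0 := by
  ext m
  rw [coeff_coeffDeriv, coeff_map, hφ]; simp

theorem coeffDeriv_C {k : Type*} [CommRing k] [Algebra k S]
    (δ : Derivation k S S) (x : S) : coeffDeriv δ (C (σ := σ) x) = C (δ x) := by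
  classical
  ext m
  rw [coeff_coeffDeriv, coeff_C, coeff_C]
  split_ifs <;> simp

variable [Algebra ℂ S]

/-- The exponential of a power series without constant term. -/
def fexp (A : MvPowerSeries σ S) : MvPowerSeries σ S := (PowerSeries.exp ℂ).subst A

theorem formalExp_eq {d : ℕ} (A : Series d) : formalExp A = fexp A := rfl

theorem coeff_fexp {A : MvPowerSeries σ S} (hA : A ∈ ordIdeal σ S 1) {m : σ →₀ ℕ} {n : ℕ}
    (hm : m.degree < n) :
    coeff m (fexp A) = coeff m (∑ p ∈ Finset.range n, C (algebraMap ℂ S (1 / p.factorial)) * A ^ p) := by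
  rw [fexp, PowerSeries.coeff_subst (PowerSeries.HasSubst.of_constantCoeff_zero
    (mem_ordIdeal_one.1 hA)), finsum_eq_sum_of_support_subset (s := Finset.range n)]
  · rw [map_sum]
    refine Finset.sum_congr rfl fun p _ => ?_
    rw [coeff_C_mul, PowerSeries.coeff_exp, Algebra.smul_def]
    simp
  · intro p hp
    by_contra h
    refine hp ?_
    change _ • coeff m (A ^ p) = 0
    rw [ordIdeal_pow_mem hA p m, smul_zero]
    simp at h
    omega

theorem fexp_sub_mem {A : MvPowerSeries σ S} (hA : A ∈ ordIdeal σ S 1) (n : ℕ) :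
    fexp A - ∑ p ∈ Finset.range n, C (algebraMap ℂ S (1 / p.factorial)) * A ^ p ∈
      ordIdeal σ S n := by
  intro m hm
  rw [map_sub, coeff_fexp hA hm, sub_self]

theorem constantCoeff_fexp {A : MvPowerSeries σ S} (hA : A ∈ ordIdeal σ S 1) :
    constantCoeff (fexp A) = 1 := by
  rw [← coeff_zero_eq_constantCoeff_apply, coeff_fexp hA (n := 1) (by simp)]
  simp

theorem eulerD_fexp {A : MvPowerSeries σ S} (hA : A ∈ ordIdeal σ S 1) :
    eulerD σ S (fexp A) = eulerD σ S A * fexp A := by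
  refine eq_of_sub_mem_ordIdeal fun n => ?_
  -- The truncation is taken at `n + 1` because differentiating the exponential sum lowers its index
  -- by one.
  have h1 := eulerD_mem (fexp_sub_mem hA (n + 1))
  rw [map_sub] at h1
  have h2 := (ordIdeal σ S n).mul_mem_left (eulerD σ S A) (fexp_sub_mem hA n)
  have h3 : eulerD σ S (∑ p ∈ Finset.range (n + 1), C (algebraMap ℂ S (1 / p.factorial)) * A ^ p) =
      eulerD σ S A * ∑ p ∈ Finset.range n, C (algebraMap ℂ S (1 / p.factorial)) * A ^ p := by
    rw [map_sum, Finset.sum_range_succ', Finset.mul_sum]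
    simp only [← MvPowerSeries.smul_eq_C_mul, Derivation.map_smul]
    rw [pow_zero, Derivation.map_one_eq_zero, smul_zero, add_zero]
    refine Finset.sum_congr rfl fun p _ => ?_
    rw [Derivation.leibniz_pow, Nat.add_sub_cancel, smul_eq_mul, nsmul_eq_mul,
      MvPowerSeries.smul_eq_C_mul, MvPowerSeries.smul_eq_C_mul]
    have h4 : C (σ := σ) (algebraMap ℂ S (1 / p.factorial)) =
        C (algebraMap ℂ S (1 / (p + 1).factorial)) * ((p + 1 : ℕ) : MvPowerSeries σ S) := by
      rw [← map_natCast (C (σ := σ) (R := S)), ← map_mul, ← map_natCast (algebraMap ℂ S),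
        ← map_mul, Nat.factorial_succ]
      congr 2
      have := Nat.factorial_ne_zero p
      push_cast
      field_simp
    rw [h4]; ring
  rw [h3] at h1
  have h4 := (ordIdeal σ S n).sub_mem (ordIdeal_anti (Nat.le_succ n) h1) h2
  have h5 : eulerD σ S (fexp A) - eulerD σ S A * fexp A = eulerD σ S (fexp A) -
      eulerD σ S A * ∑ p ∈ Finset.range n, C (algebraMap ℂ S (1 / p.factorial)) * A ^ p -
      eulerD σ S A * (fexp A - ∑ p ∈ Finset.range n, C (algebraMap ℂ S (1 / p.factorial)) * A ^ p) := by
    ring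
  rw [h5]; exact h4

theorem eq_fexp {A Y : MvPowerSeries σ S} (hA : A ∈ ordIdeal σ S 1)
    (h : eulerD σ S Y = eulerD σ S A * Y) (h0 : constantCoeff Y = 1) : Y = fexp A := by
  rw [← sub_eq_zero]
  refine eulerD_ode_unique (eulerD_mem_one A) ?_ ?_
  · rw [map_sub, h, eulerD_fexp hA, mul_sub]
  · rw [map_sub, h0, constantCoeff_fexp hA, sub_self]

theorem fexp_add {A B : MvPowerSeries σ S} (hA : A ∈ ordIdeal σ S 1) (hB : B ∈ ordIdeal σ S 1) :
    fexp (A + B) = fexp A * fexp B := by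
  refine (eq_fexp ((ordIdeal σ S 1).add_mem hA hB) ?_ ?_).symm
  · rw [Derivation.leibniz, eulerD_fexp hA, eulerD_fexp hB, map_add, smul_eq_mul, smul_eq_mul]
    ring
  · rw [map_mul, constantCoeff_fexp hA, constantCoeff_fexp hB, mul_one]

theorem map_fexp {T : Type*} [CommRing T] [Algebra ℂ T] (φ : S →+* T) {A : MvPowerSeries σ S}
    (hA : A ∈ ordIdeal σ S 1) :
    MvPowerSeries.map φ (fexp A) = fexp (MvPowerSeries.map φ A) := by
  refine eq_fexp (map_mem_ordIdeal φ hA) ?_ ?_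
  · rw [← map_eulerD, eulerD_fexp hA, map_mul, map_eulerD]
  · rw [constantCoeff_map, constantCoeff_fexp hA, map_one]

/-- Since `δ` commutes with the Euler derivation, the difference of the two sides satisfies the same
Euler equation as `fexp A`, with zero constant term. -/
theorem coeffDeriv_fexp (δ : Derivation ℂ S S) {A : MvPowerSeries σ S}
    (hA : A ∈ ordIdeal σ S 1) : coeffDeriv δ (fexp A) = coeffDeriv δ A * fexp A := by
  have comm : ∀ F : MvPowerSeries σ S,
      eulerD σ S (coeffDeriv δ F) = coeffDeriv δ (eulerD σ S F) := by
    intro F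
    ext m
    rw [coeff_eulerD, coeff_coeffDeriv, coeff_coeffDeriv, coeff_eulerD, δ.leibniz]
    simp
  rw [← sub_eq_zero]
  refine eulerD_ode_unique (eulerD_mem_one A) ?_ ?_
  · rw [map_sub, comm, eulerD_fexp hA, Derivation.leibniz, Derivation.leibniz, eulerD_fexp hA, comm]
    simp only [smul_eq_mul]
    ring
  · rw [map_sub, map_mul, constantCoeff_fexp hA, ← coeff_zero_eq_constantCoeff_apply,
      ← coeff_zero_eq_constantCoeff_apply, coeff_coeffDeriv, coeff_coeffDeriv,
      coeff_zero_eq_constantCoeff_apply, coeff_zero_eq_constantCoeff_apply, constantCoeff_fexp hA,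
      mem_ordIdeal_one.1 hA]
    simp

/-- `-tr ln (1 - B) = ∑_{p ≥ 1} tr B ^ p / p` determines the determinant of `1 - B`. -/
theorem det_mul_fexp {ι : Type*} [Fintype ι] [DecidableEq ι] {B : Matrix ι ι (MvPowerSeries σ S)}
    (hB : ∀ i j, B i j ∈ ordIdeal σ S 1) {P : MvPowerSeries σ S} (hP : P ∈ ordIdeal σ S 1)
    (h : ∀ n, P - ∑ p ∈ Finset.Ico 1 n, C (algebraMap ℂ S (1 / p)) * (B ^ p).trace ∈
      ordIdeal σ S n) :
    (1 - B).det * fexp P = 1 := by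
  have hdet : IsUnit (1 - B).det := by
    refine isUnit_of_constantCoeff_one ?_
    rw [sub_eq_add_neg]
    exact det_constantCoeff fun i j => (ordIdeal σ S 1).neg_mem (hB i j)
  set Cc := (1 - B)⁻¹ with hC
  have hC1 : (1 - B) * Cc = 1 := Matrix.mul_nonsing_inv _ hdet
  -- Differentiating `tr B ^ p / p` gives `tr (B ^ (p - 1) DB)`, and the geometric sum turns this
  -- into `tr ((1 - B)⁻¹ DB)`. By Jacobi's formula this is minus the logarithmic derivative of the
  -- determinant, so the product has zero Euler derivative.
  have hDP : eulerD σ S P = (Cc * B.map (eulerD σ S)).trace := by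
    refine eq_of_sub_mem_ordIdeal fun n => ?_
    have h1 := eulerD_mem (h (n + 1))
    rw [map_sub, map_sum, Finset.sum_Ico_eq_sum_range] at h1
    have h2 : ∀ p, eulerD σ S (C (algebraMap ℂ S (1 / ((1 + p : ℕ) : ℂ))) * (B ^ (1 + p)).trace) =
        (B ^ p * B.map (eulerD σ S)).trace := by
      intro p
      rw [← MvPowerSeries.smul_eq_C_mul, Derivation.map_smul, deriv_trace_pow,
        Nat.add_sub_cancel_left, MvPowerSeries.smul_eq_C_mul, ← mul_assoc,
        ← map_natCast (C (σ := σ) (R := S)), ← map_mul, ← map_natCast (algebraMap ℂ S), ← map_mul,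
        one_div_mul_cancel (by norm_cast; omega), map_one, map_one, one_mul]
    rw [Finset.sum_congr rfl fun p _ => h2 p, ← Matrix.trace_sum, ← Finset.sum_mul,
      Nat.add_sub_cancel] at h1
    have h3 : (Cc * B.map (eulerD σ S)).trace -
        ((∑ p ∈ Finset.range n, B ^ p) * B.map (eulerD σ S)).trace ∈ ordIdeal σ S n := by
      rw [← Matrix.trace_sub, ← sub_mul, Matrix.trace]
      refine Ideal.sum_mem _ fun i _ => ?_
      rw [Matrix.diag_apply, Matrix.mul_apply]
      refine Ideal.sum_mem _ fun j _ => ?_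
      exact Ideal.mul_mem_right _ _ (inv_sub_geom_mem hB hC1 n i j)
    have h4 := (ordIdeal σ S n).sub_mem (ordIdeal_anti (Nat.le_succ n) h1) h3
    rwa [sub_sub_sub_cancel_right] at h4
  refine eq_of_eulerD_eq ?_ ?_
  · have hadj : (1 - B).adjugate = (1 - B).det • Cc := by
      rw [hC, Matrix.inv_def, smul_smul, Ring.mul_inverse_cancel _ hdet, one_smul]
    have hmap : (1 - B).map (eulerD σ S) = -B.map (eulerD σ S) := by
      ext1 i j
      simp only [Matrix.map_apply, Matrix.sub_apply, map_sub, Matrix.neg_apply]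
      have := congrFun (congrFun (deriv_matrix_one (eulerD σ S) (n := ι)) i) j
      rw [Matrix.map_apply] at this
      rw [this, Matrix.zero_apply, zero_sub]
    rw [Derivation.map_one_eq_zero, Derivation.leibniz, deriv_det, eulerD_fexp hP, hDP, hadj, hmap,
      Matrix.smul_mul, Matrix.trace_smul, mul_neg, Matrix.trace_neg]
    simp only [smul_eq_mul]
    ring
  · rw [map_mul, constantCoeff_fexp hP, sub_eq_add_neg, det_constantCoeff (B := -B) fun i j =>
      (ordIdeal σ S 1).neg_mem (hB i j), map_one, mul_one]

end Euler

/-! ### Gaussian moments -/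

/-- The moments of the real Gaussian of variance `1 / a`. -/
def gm (a : ℂ) : ℕ → ℂ
  | 0 => 1
  | 1 => 0
  | k + 2 => (k + 1) / a * gm a k

section GaussE

variable {I S : Type*} [Fintype I] [CommRing S] [Algebra ℂ S]

/-- The Gaussian expectation of a polynomial, with independent variables of variance `1 / a`. -/
def gaussE (a : ℂ) : MvPolynomial I S →ₗ[S] S :=
  (MvPolynomial.basisMonomials I S).constr S fun k => algebraMap ℂ S (∏ i, gm a (k i))

theorem gaussE_monomial (a : ℂ) (k : I →₀ ℕ) (s : S) :
    gaussE a (MvPolynomial.monomial k s) = s * algebraMap ℂ S (∏ i, gm a (k i)) := by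
  have h : MvPolynomial.monomial k s = s • MvPolynomial.basisMonomials I S k := by
    simp [MvPolynomial.smul_monomial]
  rw [h, map_smul, gaussE, Module.Basis.constr_basis, smul_eq_mul]

theorem gaussE_C (a : ℂ) (s : S) : gaussE a (MvPolynomial.C s : MvPolynomial I S) = s := by
  rw [← MvPolynomial.monomial_zero', gaussE_monomial]
  simp [gm]

/-- Gaussian integration by parts. On a monomial the variables other than `i` factor out, and what
remains is the recursion that defines `gm`. -/
theorem gaussE_X_mul (a : ℂ) (i : I) (P : MvPolynomial I S) :
    gaussE a (MvPolynomial.X i * P) = algebraMap ℂ S (1 / a) * gaussE a (MvPolynomial.pderiv i P) := by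
  classical
  induction P using MvPolynomial.induction_on' with
  | add p q hp hq => rw [mul_add, map_add, hp, hq, map_add, map_add, mul_add]
  | monomial k s =>
    rw [MvPolynomial.X, MvPolynomial.monomial_mul, one_mul, MvPolynomial.pderiv_monomial,
      gaussE_monomial, gaussE_monomial,
      ← Finset.mul_prod_erase _ (fun j => gm a ((Finsupp.single i 1 + k : I →₀ ℕ) j)) (Finset.mem_univ i),
      ← Finset.mul_prod_erase _ (fun j => gm a ((k - Finsupp.single i 1 : I →₀ ℕ) j)) (Finset.mem_univ i)]
    have h1 : ∏ j ∈ Finset.univ.erase i, gm a ((Finsupp.single i 1 + k : I →₀ ℕ) j) =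
        ∏ j ∈ Finset.univ.erase i, gm a (k j) := by
      refine Finset.prod_congr rfl fun j hj => ?_
      simp [Finsupp.single_eq_of_ne (Finset.ne_of_mem_erase hj)]
    have h2 : ∏ j ∈ Finset.univ.erase i, gm a ((k - Finsupp.single i 1 : I →₀ ℕ) j) =
        ∏ j ∈ Finset.univ.erase i, gm a (k j) := by
      refine Finset.prod_congr rfl fun j hj => ?_
      simp [Finsupp.single_eq_of_ne (Finset.ne_of_mem_erase hj)]
    rw [h1, h2]
    set Q := ∏ j ∈ Finset.univ.erase i, gm a (k j)
    simp only [Finsupp.add_apply, Finsupp.single_eq_same, Finsupp.tsub_apply]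
    rcases hk : k i with _ | n
    · simp [gm]
    · rw [show 1 + (n + 1) = n + 2 by ring, gm, Nat.add_sub_cancel, map_mul, map_mul, map_mul,
        show ((n : ℂ) + 1) / a = (1 / a) * ((n + 1 : ℕ) : ℂ) by push_cast; ring, map_mul,
        map_natCast]
      ring

theorem gaussE_map {T : Type*} [CommRing T] [Algebra ℂ T] (φ : S →ₐ[ℂ] T) (a : ℂ)
    (P : MvPolynomial I S) :
    gaussE a (MvPolynomial.map (φ : S →+* T) P) = φ (gaussE a P) := by
  induction P using MvPolynomial.induction_on' with
  | add p q hp hq => rw [map_add, map_add, hp, hq, map_add, map_add]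
  | monomial k s =>
    rw [MvPolynomial.map_monomial, gaussE_monomial, gaussE_monomial, map_mul, φ.commutes]
    rfl

variable {σ : Type*}

/-- Coefficientwise Gaussian expectation. -/
def gaussF (a : ℂ) : MvPowerSeries σ (MvPolynomial I S) →+ MvPowerSeries σ S where
  toFun F m := gaussE a (coeff m F)
  map_zero' := by ext m; exact map_zero (gaussE (I := I) (S := S) a)
  map_add' F G := by
    ext m
    change gaussE a (coeff m (F + G)) = gaussE a (coeff m F) + gaussE a (coeff m G)
    rw [map_add, map_add]

theorem coeff_gaussF (a : ℂ) (F : MvPowerSeries σ (MvPolynomial I S)) (m : σ →₀ ℕ) :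
    coeff m (gaussF a F) = gaussE a (coeff m F) := rfl

/-- Scalar series as series with polynomial coefficients. -/
abbrev scal (I : Type*) {σ S : Type*} [CommRing S] :
    MvPowerSeries σ S →+* MvPowerSeries σ (MvPolynomial I S) := MvPowerSeries.map MvPolynomial.C

theorem gaussF_scal_mul (a : ℂ) (A : MvPowerSeries σ S) (F : MvPowerSeries σ (MvPolynomial I S)) :
    gaussF a (scal I A * F) = A * gaussF a F := by
  classical
  ext m
  rw [coeff_gaussF, coeff_mul, coeff_mul, map_sum]
  refine Finset.sum_congr rfl fun p _ => ?_
  rw [coeff_map, ← MvPolynomial.smul_eq_C_mul, map_smul, smul_eq_mul, coeff_gaussF]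

theorem gaussF_scal (a : ℂ) (A : MvPowerSeries σ S) : gaussF a (scal I A) = A := by
  ext m
  rw [coeff_gaussF, coeff_map, gaussE_C]

/-- Differentiation of the coefficients with respect to the variable `i`. -/
def pd {I S σ : Type*} [CommRing S] [Algebra ℂ S] (i : I) :
    Derivation ℂ (MvPowerSeries σ (MvPolynomial I S)) (MvPowerSeries σ (MvPolynomial I S)) :=
  coeffDeriv ((MvPolynomial.pderiv (R := S) i).restrictScalars ℂ)

theorem gaussF_X_mul (a : ℂ) (i : I) (F : MvPowerSeries σ (MvPolynomial I S)) :
    gaussF a (C (MvPolynomial.X i) * F) = C (algebraMap ℂ S (1 / a)) * gaussF a (pd i F) := by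
  ext m
  rw [coeff_gaussF, coeff_C_mul, gaussE_X_mul, coeff_C_mul, coeff_gaussF]
  rfl

theorem gaussF_map {T : Type*} [CommRing T] [Algebra ℂ T] (φ : S →ₐ[ℂ] T) (a : ℂ)
    (F : MvPowerSeries σ (MvPolynomial I S)) :
    gaussF a (MvPowerSeries.map (MvPolynomial.map (φ : S →+* T)) F) =
      MvPowerSeries.map (φ : S →+* T) (gaussF a F) := by
  ext m
  rw [coeff_gaussF, coeff_map, coeff_map, coeff_gaussF, gaussE_map]
  rfl

theorem pd_scal (i : I) (A : MvPowerSeries σ S) : pd i (scal I A) = 0 :=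
  coeffDeriv_map_C _ _ (fun x => by
    change MvPolynomial.pderiv i (MvPolynomial.C x) = 0
    simp) A

theorem pd_X (i j : I) [DecidableEq I] :
    pd i (C (MvPolynomial.X j) : MvPowerSeries σ (MvPolynomial I S)) = if i = j then 1 else 0 := by
  rw [pd, coeffDeriv_C]
  change C (MvPolynomial.pderiv i (MvPolynomial.X j)) = _
  rw [MvPolynomial.pderiv_X]
  by_cases h : i = j
  · subst h; simp
  · simp [h]

end GaussE

/-! ### Gaussian integrals -/

open MeasureTheory

/-- The functions `ξ_i` are, with respect to the weight `w`, independent real Gaussian variables of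
variance `1 / a`, as far as their moments are concerned; `Z` is the total mass. -/
structure IsGaussian {I Ω : Type} [Fintype I] [MeasureSpace Ω] (ξ : I → Ω → ℂ) (w : Ω → ℂ)
    (a Z : ℂ) : Prop where
  integrable : ∀ k : I → ℕ, Integrable fun ω => (∏ i, ξ i ω ^ k i) * w ω
  integral : ∀ k : I → ℕ, ∫ ω, (∏ i, ξ i ω ^ k i) * w ω = (∏ i, gm a (k i)) * Z
  ne_zero : Z ≠ 0

theorem gaussian_integrable_one {a : ℝ} (ha : 0 < a) (k : ℕ) :
    Integrable fun x : ℝ => (x : ℂ) ^ k * Complex.exp (-(a / 2 : ℂ) * (x : ℂ) ^ 2) := by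
  have h := integrable_rpow_mul_exp_neg_mul_sq (b := a / 2) (by positivity) (s := (k : ℝ))
    (by have : (0 : ℝ) ≤ k := by positivity
        linarith)
  have h2 := h.ofReal (𝕜 := ℂ)
  refine h2.congr (Filter.Eventually.of_forall fun x => ?_)
  simp [Real.rpow_natCast]

/-- The derivative of `x ^ (k + 1)` times the Gaussian is integrable with zero integral, which is
the recursion of `gm`; for the first moment the Gaussian itself is differentiated. -/
theorem gaussian_integral_one {a : ℝ} (ha : 0 < a) :
    ∀ k : ℕ, ∫ x : ℝ, (x : ℂ) ^ k * Complex.exp (-(a / 2 : ℂ) * (x : ℂ) ^ 2) =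
      gm a k * ∫ x : ℝ, Complex.exp (-(a / 2 : ℂ) * (x : ℂ) ^ 2)
  | 0 => by simp [gm]
  | 1 => by
    have hd : ∀ x : ℝ, HasDerivAt (fun x : ℝ => Complex.exp (-(a / 2 : ℂ) * (x : ℂ) ^ 2))
        ((-a : ℂ) * ((x : ℂ) ^ 1 * Complex.exp (-(a / 2 : ℂ) * (x : ℂ) ^ 2))) x := by
      intro x
      have h1 : HasDerivAt (fun z : ℂ => Complex.exp (-(a / 2 : ℂ) * z ^ 2))
          (Complex.exp (-(a / 2 : ℂ) * (x : ℂ) ^ 2) * (-(a / 2 : ℂ) * (2 * (x : ℂ)))) (x : ℂ) := by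
        have := ((hasDerivAt_pow 2 (x : ℂ)).const_mul (-(a / 2 : ℂ))).cexp
        simpa using this
      have h2 := h1.comp_ofReal
      convert h2 using 1
      ring
    have h0 := gaussian_integrable_one ha 0
    have h := integral_eq_zero_of_hasDerivAt_of_integrable hd
      ((gaussian_integrable_one ha 1).const_mul _) (by simpa using h0)
    rw [integral_const_mul] at h
    have ha' : (-a : ℂ) ≠ 0 := by
      rw [neg_ne_zero]; exact_mod_cast ha.ne'
    rw [(mul_eq_zero.1 h).resolve_left ha', gm, zero_mul]
  | k + 2 => by
    have hd : ∀ x : ℝ, HasDerivAt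
        (fun x : ℝ => (x : ℂ) ^ (k + 1) * Complex.exp (-(a / 2 : ℂ) * (x : ℂ) ^ 2))
        ((k + 1 : ℂ) * ((x : ℂ) ^ k * Complex.exp (-(a / 2 : ℂ) * (x : ℂ) ^ 2)) -
          a * ((x : ℂ) ^ (k + 2) * Complex.exp (-(a / 2 : ℂ) * (x : ℂ) ^ 2))) x := by
      intro x
      have h1 : HasDerivAt (fun z : ℂ => z ^ (k + 1) * Complex.exp (-(a / 2 : ℂ) * z ^ 2))
          (((k + 1 : ℕ) : ℂ) * (x : ℂ) ^ k * Complex.exp (-(a / 2 : ℂ) * (x : ℂ) ^ 2) +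
            (x : ℂ) ^ (k + 1) *
              (Complex.exp (-(a / 2 : ℂ) * (x : ℂ) ^ 2) * (-(a / 2 : ℂ) * (2 * (x : ℂ)))))
          (x : ℂ) := by
        have := (hasDerivAt_pow (k + 1) (x : ℂ)).fun_mul
          ((hasDerivAt_pow 2 (x : ℂ)).const_mul (-(a / 2 : ℂ))).cexp
        simpa using this
      have h2 := h1.comp_ofReal
      convert h2 using 1
      push_cast
      ring
    have h := integral_eq_zero_of_hasDerivAt_of_integrable hd
      (((gaussian_integrable_one ha k).const_mul _).sub
        ((gaussian_integrable_one ha (k + 2)).const_mul _)) (gaussian_integrable_one ha (k + 1))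
    rw [integral_sub ((gaussian_integrable_one ha k).const_mul _)
      ((gaussian_integrable_one ha (k + 2)).const_mul _), integral_const_mul, integral_const_mul,
      gaussian_integral_one ha k] at h
    have ha' : (a : ℂ) ≠ 0 := by exact_mod_cast ha.ne'
    rw [gm]
    generalize ∫ x : ℝ, Complex.exp (-(a / 2 : ℂ) * (x : ℂ) ^ 2) = J at *
    generalize ∫ x : ℝ, (x : ℂ) ^ (k + 2) * Complex.exp (-(a / 2 : ℂ) * (x : ℂ) ^ 2) = J' at *
    field_simp
    linear_combination -h

theorem isGaussian_real {a : ℝ} (ha : 0 < a) :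
    ∃ Z, IsGaussian (I := Unit) (fun _ (x : ℝ) => (x : ℂ))
      (fun x => Complex.exp (-(a / 2 : ℂ) * (x : ℂ) ^ 2)) a Z := by
  refine ⟨∫ x : ℝ, Complex.exp (-(a / 2 : ℂ) * (x : ℂ) ^ 2), fun k => ?_, fun k => ?_, ?_⟩
  · simpa using gaussian_integrable_one ha (k ())
  · simpa using gaussian_integral_one ha (k ())
  · rw [integral_gaussian_complex (by simpa using ha)]
    have : (Real.pi : ℂ) / (a / 2 : ℂ) ≠ 0 := by
      have : (a : ℂ) ≠ 0 := by exact_mod_cast ha.ne'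
      have := Real.pi_ne_zero
      simp [*]
    rw [Complex.cpow_ne_zero_iff]
    exact Or.inl this

theorem IsGaussian.pi {I Ω J : Type} [Fintype I] [Fintype J] [MeasureSpace Ω]
    [SigmaFinite (volume : Measure Ω)] {ξ : I → Ω → ℂ} {w : Ω → ℂ} {a Z : ℂ}
    (h : IsGaussian ξ w a Z) :
    IsGaussian (I := J × I) (Ω := J → Ω) (fun p ω => ξ p.2 (ω p.1)) (fun ω => ∏ j, w (ω j)) a
      (Z ^ Fintype.card J) where
  integrable k := by
    have h1 := Integrable.fintype_prod_dep (ι := J) (E := fun _ => Ω) (μ := fun _ => volume)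
      (f := fun j ω => (∏ i, ξ i ω ^ k (j, i)) * w ω) fun j => h.integrable fun i => k (j, i)
    refine h1.congr (Filter.Eventually.of_forall fun ω => ?_)
    simp [Finset.prod_mul_distrib, Fintype.prod_prod_type]
  integral k := by
    have h1 := integral_fintype_prod_volume_eq_prod (ι := J) (E := fun _ => Ω)
      (f := fun j ω => (∏ i, ξ i ω ^ k (j, i)) * w ω)
    simp only [fun j => h.integral fun i => k (j, i)] at h1
    rw [Finset.prod_mul_distrib, Finset.prod_const, Finset.card_univ,
      ← Fintype.prod_prod_type' (f := fun j i => gm a (k (j, i)))] at h1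
    rw [← h1]
    simp [Finset.prod_mul_distrib, Fintype.prod_prod_type]
  ne_zero := pow_ne_zero _ h.ne_zero

theorem IsGaussian.reindex {I I' Ω : Type} [Fintype I] [Fintype I'] [MeasureSpace Ω]
    {ξ : I → Ω → ℂ} {w : Ω → ℂ} {a Z : ℂ} (h : IsGaussian ξ w a Z) (e : I' ≃ I)
    {ξ' : I' → Ω → ℂ} {w' : Ω → ℂ} (hξ : ∀ i ω, ξ' i ω = ξ (e i) ω) (hw : ∀ ω, w' ω = w ω) :
    IsGaussian ξ' w' a Z where
  integrable k := by
    refine (h.integrable fun i => k (e.symm i)).congr (Filter.Eventually.of_forall fun ω => ?_)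
    simp only [hξ, hw]
    rw [← e.prod_comp]
    simp
  integral k := by
    have := h.integral fun i => k (e.symm i)
    rw [← e.prod_comp] at this
    simp only [Equiv.symm_apply_apply] at this
    rw [← this]
    congr 1
    ext ω
    rw [hw, ← e.prod_comp]
    simp [hξ]
  ne_zero := h.ne_zero

/-- For the weight `exp (-a |z|²)` the real and imaginary parts have variance `1 / (2 a)` each,
hence the parameter `2 * a`. -/
theorem isGaussian_complex {a : ℝ} (ha : 0 < a) :
    ∃ Z, IsGaussian (I := Bool) (fun b (z : ℂ) => if b then (z.im : ℂ) else (z.re : ℂ))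
      (fun z => Complex.exp (-(a : ℂ) * (z * star z))) (2 * a : ℝ) Z := by
  obtain ⟨Z, hZ⟩ := isGaussian_real (a := 2 * a) (by positivity)
  have e := Complex.volume_preserving_equiv_real_prod
  have hw : ∀ (k : Bool → ℕ) (z : ℂ),
      (∏ b, (if b then (z.im : ℂ) else (z.re : ℂ)) ^ k b) * Complex.exp (-(a : ℂ) * (z * star z)) =
      (fun p : ℝ × ℝ =>
        ((p.1 : ℂ) ^ k false * Complex.exp (-(((2 * a : ℝ) : ℂ) / 2 : ℂ) * (p.1 : ℂ) ^ 2)) *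
        ((p.2 : ℂ) ^ k true * Complex.exp (-(((2 * a : ℝ) : ℂ) / 2 : ℂ) * (p.2 : ℂ) ^ 2)))
        (Complex.measurableEquivRealProd z) := by
    intro k z
    have h1 : z * star z = (z.re : ℂ) ^ 2 + (z.im : ℂ) ^ 2 := by
      rw [Complex.star_def, Complex.mul_conj, Complex.normSq_apply]
      push_cast; ring
    have h2 : Complex.exp (-(a : ℂ) * (z * star z)) =
        Complex.exp (-(((2 * a : ℝ) : ℂ) / 2 : ℂ) * (z.re : ℂ) ^ 2) *
        Complex.exp (-(((2 * a : ℝ) : ℂ) / 2 : ℂ) * (z.im : ℂ) ^ 2) := by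
      rw [← Complex.exp_add, h1]
      congr 1
      push_cast; ring
    rw [h2]
    simp only [Fintype.prod_bool, Complex.measurableEquivRealProd_apply]
    simp
    ring
  have i1 := fun k : ℕ => hZ.integrable fun _ => k
  have i2 := fun k : ℕ => hZ.integral fun _ => k
  simp only [Finset.univ_unique, Finset.prod_singleton] at i1 i2
  refine ⟨Z ^ 2, fun k => ?_, fun k => ?_, pow_ne_zero _ hZ.ne_zero⟩
  · simp only [hw]
    exact (e.integrable_comp_emb (MeasurableEquiv.measurableEmbedding _)).2
      ((i1 (k false)).mul_prod (i1 (k true)))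
  · refine (integral_congr_ae (Filter.Eventually.of_forall (hw k))).trans
      ((e.integral_comp (MeasurableEquiv.measurableEmbedding _) (fun p : ℝ × ℝ =>
        ((p.1 : ℂ) ^ k false * Complex.exp (-(((2 * a : ℝ) : ℂ) / 2 : ℂ) * (p.1 : ℂ) ^ 2)) *
        ((p.2 : ℂ) ^ k true * Complex.exp (-(((2 * a : ℝ) : ℂ) / 2 : ℂ) * (p.2 : ℂ) ^ 2)))).trans ?_)
    rw [Measure.volume_eq_prod]
    refine (integral_prod_mul
      (fun x : ℝ => (x : ℂ) ^ k false * Complex.exp (-(((2 * a : ℝ) : ℂ) / 2 : ℂ) * (x : ℂ) ^ 2))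
      (fun x : ℝ => (x : ℂ) ^ k true * Complex.exp (-(((2 * a : ℝ) : ℂ) / 2 : ℂ) * (x : ℂ) ^ 2))).trans ?_
    rw [i2, i2, Fintype.prod_bool]
    ring

/-- The coordinates of `d`-tuples of Hermitian matrices. -/
abbrev HIdx (d N : ℕ) : Type := Fin d × Fin N × Fin N

/-- The coordinates as functions. -/
def hcoord {d N : ℕ} (i : HIdx d N) (x : Herms d N) : ℂ := (x i.1 i.2.1 i.2.2 : ℂ)

/-- The coordinates of `herm` are orthonormal for the trace form, so the weight is a product of
one-dimensional Gaussians. -/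
theorem isGaussian_herms (d N : ℕ) {a : ℝ} (ha : 0 < a) :
    ∃ Z, IsGaussian (hcoord (d := d) (N := N))
      (fun x => Complex.exp (-(a / 2 : ℂ) * ∑ c, (herm (x c) * herm (x c)).trace)) a Z := by
  obtain ⟨Z, hZ⟩ := isGaussian_real ha
  refine ⟨_, ((hZ.pi (J := Fin N)).pi (J := Fin N)).pi (J := Fin d) |>.reindex
    (Equiv.prodCongr (Equiv.refl _) (Equiv.prodCongr (Equiv.refl _)
      (Equiv.prodPUnit _).symm)) ?_ ?_⟩
  · rintro ⟨c, i, j⟩ x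
    rfl
  · intro x
    simp only [← Complex.exp_sum, trace_herm_sq, Finset.mul_sum]

/-- Real and imaginary parts of the entries of a tensor. -/
def tcoord {d N : ℕ} (i : Idx d N × Bool) (T : Tensor d N) : ℂ :=
  if i.2 then ((T i.1).im : ℂ) else ((T i.1).re : ℂ)

theorem isGaussian_tensor (d N : ℕ) {a : ℝ} (ha : 0 < a) :
    ∃ Z, IsGaussian (tcoord (d := d) (N := N))
      (fun T => Complex.exp (-(a : ℂ) * quadratic T)) (2 * a : ℝ) Z := by
  obtain ⟨Z, hZ⟩ := isGaussian_complex ha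
  refine ⟨_, (hZ.pi (J := Idx d N)).reindex (Equiv.refl _) ?_ ?_⟩
  · rintro ⟨i, b⟩ T
    rfl
  · intro T
    simp only [← Complex.exp_sum, quadratic, Finset.mul_sum]

/-! ### Formal integrals as algebraic Gaussian expectations. -/

section Formal

variable {I Ω : Type} [Fintype I] [MeasureSpace Ω] {ξ : I → Ω → ℂ} {w : Ω → ℂ}

/-- Evaluation of the coefficients at the point `ω`. -/
abbrev evalAt {I Ω σ : Type*} (ξ : I → Ω → ℂ) (ω : Ω) :
    MvPowerSeries σ (MvPolynomial I ℂ) →+* MvPowerSeries σ ℂ :=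
  MvPowerSeries.map (MvPolynomial.eval fun i => ξ i ω)

theorem integrable_eval
    (h : ∀ k : I → ℕ, Integrable fun ω => (∏ i, ξ i ω ^ k i) * w ω) (P : MvPolynomial I ℂ) :
    Integrable fun ω => MvPolynomial.eval (fun i => ξ i ω) P * w ω := by
  simp only [MvPolynomial.eval_eq', Finset.sum_mul]
  refine integrable_finsetSum _ fun k _ => ?_
  simp only [mul_assoc]
  exact (h k).const_mul _

variable {a Z : ℂ}

theorem IsGaussian.integral_eval (h : IsGaussian ξ w a Z) (P : MvPolynomial I ℂ) :
    ∫ ω, MvPolynomial.eval (fun i => ξ i ω) P * w ω = gaussE a P * Z := by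
  simp only [MvPolynomial.eval_eq', Finset.sum_mul]
  rw [integral_finsetSum]
  · conv_rhs => rw [P.as_sum, map_sum, Finset.sum_mul]
    refine Finset.sum_congr rfl fun k _ => ?_
    simp only [mul_assoc]
    rw [integral_const_mul, h.integral, gaussE_monomial, mul_assoc]
    rfl
  · intro k _
    simp only [mul_assoc]
    exact (h.integrable k).const_mul _

variable {d : ℕ}

theorem IsGaussian.integrable_coeff (h : IsGaussian ξ w a Z)
    (F : MvPowerSeries (Fin d) (MvPolynomial I ℂ)) (m : Fin d →₀ ℕ) :
    Integrable fun ω => coeff m (w ω • evalAt ξ ω F) := by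
  simp only [coeff_smul, coeff_map, mul_comm (w _)]
  exact integrable_eval h.integrable _

/-- The coefficients of `F` are polynomials in the Gaussian variables, so their integrals are given
by the moments alone. This lets formal integrals be handled through `gaussF`, up to a mass `Z` that
disappears from normalised expectations. -/
theorem IsGaussian.formalIntegral_eq (h : IsGaussian ξ w a Z)
    (F : MvPowerSeries (Fin d) (MvPolynomial I ℂ)) :
    formalIntegral (fun ω => w ω • evalAt ξ ω F) = C Z * gaussF a F := by
  ext m
  change ∫ ω, coeff m (w ω • evalAt ξ ω F) = _
  simp only [coeff_smul, coeff_map, mul_comm (w _)]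
  rw [h.integral_eval, coeff_C_mul, coeff_gaussF, mul_comm]

end Formal

/-! ### Translation of formal Gaussian integrals -/

section CoeffD

variable {I S : Type*} [CommRing S] [Algebra ℂ S]

/-- The underlying function of `mvCoeffDeriv`. -/
def mvCoeffFun (δ : Derivation ℂ S S) (P : MvPolynomial I S) : MvPolynomial I S :=
  ∑ k ∈ P.support, MvPolynomial.monomial k (δ (MvPolynomial.coeff k P))

theorem coeff_mvCoeffFun (δ : Derivation ℂ S S) (P : MvPolynomial I S) (k : I →₀ ℕ) :
    MvPolynomial.coeff k (mvCoeffFun δ P) = δ (MvPolynomial.coeff k P) := by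
  classical
  rw [mvCoeffFun, MvPolynomial.coeff_sum]
  simp only [MvPolynomial.coeff_monomial]
  rw [Finset.sum_ite_eq']
  split_ifs with h
  · rfl
  · rw [MvPolynomial.notMem_support_iff.1 h, map_zero]

/-- Apply a derivation to the coefficients of a polynomial. -/
def mvCoeffDeriv (δ : Derivation ℂ S S) : Derivation ℂ (MvPolynomial I S) (MvPolynomial I S) :=
  Derivation.mk'
    { toFun := mvCoeffFun δ
      map_add' := fun P Q => by
        ext k
        simp [coeff_mvCoeffFun]
      map_smul' := fun c P => by
        ext k
        simp [coeff_mvCoeffFun, MvPolynomial.coeff_smul] }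
    (by
      classical
      intro P Q
      ext k
      change MvPolynomial.coeff k (mvCoeffFun δ (P * Q)) =
        MvPolynomial.coeff k (P * mvCoeffFun δ Q + Q * mvCoeffFun δ P)
      rw [coeff_mvCoeffFun, mul_comm Q, MvPolynomial.coeff_add, MvPolynomial.coeff_mul,
        MvPolynomial.coeff_mul, MvPolynomial.coeff_mul, map_sum, ← Finset.sum_add_distrib]
      refine Finset.sum_congr rfl fun p _ => ?_
      rw [coeff_mvCoeffFun, coeff_mvCoeffFun, δ.leibniz, smul_eq_mul, smul_eq_mul]
      ring)

theorem mvCoeffDeriv_monomial (δ : Derivation ℂ S S) (k : I →₀ ℕ) (s : S) :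
    mvCoeffDeriv δ (MvPolynomial.monomial k s) = MvPolynomial.monomial k (δ s) := by
  classical
  ext l
  change MvPolynomial.coeff l (mvCoeffFun δ _) = _
  rw [coeff_mvCoeffFun, MvPolynomial.coeff_monomial, MvPolynomial.coeff_monomial]
  split_ifs <;> simp

/-- Differentiation under the integral sign: the Gaussian moments are complex constants, which every
`ℂ`-derivation annihilates. -/
theorem gaussE_mvCoeffDeriv [Fintype I] (δ : Derivation ℂ S S) (a : ℂ) (P : MvPolynomial I S) :
    gaussE a (mvCoeffDeriv δ P) = δ (gaussE a P) := by
  induction P using MvPolynomial.induction_on' with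
  | add p q hp hq => rw [map_add, map_add, hp, hq, map_add, map_add]
  | monomial k s =>
    rw [mvCoeffDeriv_monomial, gaussE_monomial, gaussE_monomial, δ.leibniz,
      Derivation.map_algebraMap, smul_zero, zero_add, smul_eq_mul, mul_comm]

end CoeffD

section Shift

variable {I σ : Type*} [Fintype I]

/-- Differentiation with respect to the interpolation parameter. -/
def dt (I σ : Type*) : Derivation ℂ (MvPowerSeries σ (MvPolynomial I (Polynomial ℂ)))
    (MvPowerSeries σ (MvPolynomial I (Polynomial ℂ))) :=
  coeffDeriv (mvCoeffDeriv (Polynomial.derivative'.restrictScalars ℂ))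

/-- Scalar series, independent of the interpolation parameter. -/
def emb (I σ : Type*) :
    MvPowerSeries σ ℂ →+* MvPowerSeries σ (MvPolynomial I (Polynomial ℂ)) :=
  (scal I).comp (MvPowerSeries.map Polynomial.C)

/-- The interpolation parameter. -/
def tvar (I σ : Type*) : MvPowerSeries σ (MvPolynomial I (Polynomial ℂ)) :=
  C (MvPolynomial.C Polynomial.X)

/-- Specialisation of the interpolation parameter. -/
def atT (I σ : Type*) (t : ℂ) : MvPowerSeries σ (MvPolynomial I (Polynomial ℂ)) →+*
    MvPowerSeries σ (MvPolynomial I ℂ) :=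
  MvPowerSeries.map (MvPolynomial.map ((Polynomial.aeval t : Polynomial ℂ →ₐ[ℂ] ℂ) :
    Polynomial ℂ →+* ℂ))

theorem dt_emb (A : MvPowerSeries σ ℂ) : dt I σ (emb I σ A) = 0 := by
  have : emb I σ = MvPowerSeries.map ((MvPolynomial.C).comp Polynomial.C) := by
    rw [emb, scal, ← MvPowerSeries.map_comp]
  rw [this]
  refine coeffDeriv_map_C _ _ (fun x => ?_) A
  rw [RingHom.comp_apply, ← MvPolynomial.monomial_zero', mvCoeffDeriv_monomial]
  change MvPolynomial.monomial 0 (Polynomial.derivative (Polynomial.C x)) = 0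
  simp

theorem pd_emb (i : I) (A : MvPowerSeries σ ℂ) : pd i (emb I σ A) = 0 := pd_scal _ _

theorem dt_X (i : I) : dt I σ (C (MvPolynomial.X i)) = 0 := by
  rw [dt, coeffDeriv_C, MvPolynomial.X, mvCoeffDeriv_monomial, Derivation.map_one_eq_zero]
  simp

theorem dt_tvar : dt I σ (tvar I σ) = 1 := by
  rw [dt, tvar, coeffDeriv_C, ← MvPolynomial.monomial_zero', mvCoeffDeriv_monomial]
  change C (MvPolynomial.monomial 0 (Polynomial.derivative Polynomial.X)) = _
  simp

theorem pd_tvar (i : I) : pd i (tvar I σ) = 0 := by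
  rw [pd, tvar, coeffDeriv_C]
  change C (MvPolynomial.pderiv i (MvPolynomial.C Polynomial.X)) = _
  simp

theorem atT_emb (t : ℂ) (A : MvPowerSeries σ ℂ) : atT I σ t (emb I σ A) = scal I A := by
  ext m
  simp [atT, emb]

theorem atT_tvar (t : ℂ) : atT I σ t (tvar I σ) = scal I (C t) := by
  simp [atT, tvar]

theorem atT_X (t : ℂ) (i : I) : atT I σ t (C (MvPolynomial.X i)) = C (MvPolynomial.X i) := by
  simp [atT]

theorem gaussF_dt (a : ℂ) (F : MvPowerSeries σ (MvPolynomial I (Polynomial ℂ))) (m : σ →₀ ℕ) :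
    coeff m (gaussF a (dt I σ F)) = Polynomial.derivative (coeff m (gaussF a F)) := by
  rw [coeff_gaussF, dt, coeff_coeffDeriv, gaussE_mvCoeffDeriv]
  rfl

/-- Every coefficient of the expectation is a polynomial in the interpolation parameter; a vanishing
derivative makes it constant. -/
theorem gaussF_atT_eq (a : ℂ) {F : MvPowerSeries σ (MvPolynomial I (Polynomial ℂ))}
    (h : gaussF a (dt I σ F) = 0) (t s : ℂ) :
    gaussF a (atT I σ t F) = gaussF a (atT I σ s F) := by
  rw [atT, atT, gaussF_map, gaussF_map]
  ext m
  have h1 := gaussF_dt a F m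
  rw [h, map_zero] at h1
  rw [coeff_map, coeff_map, Polynomial.eq_C_of_derivative_eq_zero h1.symm]
  simp

theorem scal_mem_ordIdeal {S : Type*} [CommRing S] {A : MvPowerSeries σ S} {n : ℕ}
    (h : A ∈ ordIdeal σ S n) : scal I A ∈ ordIdeal σ (MvPolynomial I S) n :=
  map_mem_ordIdeal _ h

theorem linear_mem_ordIdeal (β : I → MvPowerSeries σ ℂ) (hβ : ∀ i, β i ∈ ordIdeal σ ℂ 1)
    (B : MvPowerSeries σ (MvPolynomial I ℂ)) :
    -(B * ∑ i, scal I (β i) * C (MvPolynomial.X i)) ∈ ordIdeal σ (MvPolynomial I ℂ) 1 :=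
  neg_mem (Ideal.mul_mem_left _ _ (Ideal.sum_mem _ fun i _ =>
    Ideal.mul_mem_right _ _ (scal_mem_ordIdeal (hβ i))))

/-- Translation by a formal series `β` without constant term in a Gaussian integral. The family `F`
interpolates between `F|_{t=0}` and its translate `F|_{t=1}`. -/
theorem gaussF_shift {a : ℂ} (ha : a ≠ 0) (β : I → MvPowerSeries σ ℂ)
    (hβ : ∀ i, β i ∈ ordIdeal σ ℂ 1) (F : MvPowerSeries σ (MvPolynomial I (Polynomial ℂ)))
    (hF : dt I σ F = ∑ i, emb I σ (β i) * pd i F) :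
    gaussF a (atT I σ 0 F) = fexp (-(C (a / 2) * ∑ i, β i ^ 2)) *
      gaussF a (atT I σ 1 F * fexp (-(scal I (C a) * ∑ i, scal I (β i) * C (MvPolynomial.X i)))) := by
  classical
  set τ := tvar I σ
  set x : I → MvPowerSeries σ (MvPolynomial I (Polynomial ℂ)) := fun i => C (MvPolynomial.X i)
  set b := fun i => emb I σ (β i)
  set U := ∑ i, b i * x i with hU
  set V := ∑ i, b i ^ 2 with hV
  -- `Θ` is the change `-a/2 ∑ ((x_i + t β_i)² - x_i²)` of the Gaussian exponent under the
  -- translation `x ↦ x + t β`.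
  set Θ := -(emb I σ (C a) * (τ * U)) - emb I σ (C (a / 2)) * (τ ^ 2 * V) with hΘ
  have hb : ∀ i, b i ∈ ordIdeal σ (MvPolynomial I (Polynomial ℂ)) 1 := fun i => by
    change scal I (MvPowerSeries.map Polynomial.C (β i)) ∈ _
    exact map_mem_ordIdeal _ (map_mem_ordIdeal _ (hβ i))
  have hUm : U ∈ ordIdeal σ (MvPolynomial I (Polynomial ℂ)) 1 :=
    Ideal.sum_mem _ fun i _ => Ideal.mul_mem_right _ _ (hb i)
  have hVm : V ∈ ordIdeal σ (MvPolynomial I (Polynomial ℂ)) 1 :=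
    Ideal.sum_mem _ fun i _ => by rw [sq]; exact Ideal.mul_mem_right _ _ (hb i)
  have hΘm : Θ ∈ ordIdeal σ (MvPolynomial I (Polynomial ℂ)) 1 :=
    Ideal.sub_mem _ (neg_mem (Ideal.mul_mem_left _ _ (Ideal.mul_mem_left _ _ hUm)))
      (Ideal.mul_mem_left _ _ (Ideal.mul_mem_left _ _ hVm))
  have dU : dt I σ U = 0 := by
    rw [hU, map_sum]
    refine Finset.sum_eq_zero fun i _ => ?_
    rw [Derivation.leibniz, dt_emb, dt_X]; simp
  have dV : dt I σ V = 0 := by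
    rw [hV, map_sum]
    refine Finset.sum_eq_zero fun i _ => ?_
    rw [Derivation.leibniz_pow, dt_emb]; simp
  have pU : ∀ i, pd i U = b i := by
    intro i
    rw [hU, map_sum, Finset.sum_eq_single i]
    · rw [Derivation.leibniz, pd_emb, pd_X]; simp
    · intro j _ hj
      rw [Derivation.leibniz, pd_emb, pd_X, if_neg hj.symm]; simp
    · simp
  have pV : ∀ i, pd i V = 0 := by
    intro i
    rw [hV, map_sum]
    refine Finset.sum_eq_zero fun j _ => ?_
    rw [Derivation.leibniz_pow, pd_emb]; simp
  have e2 : emb I σ (C (a / 2)) * 2 = emb I σ (C a) := by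
    rw [← map_ofNat (emb I σ) 2, ← map_mul, ← map_ofNat (C (σ := σ) (R := ℂ)) 2, ← map_mul,
      div_mul_cancel₀ _ two_ne_zero]
  have dΘ : dt I σ Θ = -(emb I σ (C a) * U) - emb I σ (C a) * (τ * V) := by
    rw [hΘ, map_sub, map_neg, Derivation.leibniz, Derivation.leibniz, Derivation.leibniz,
      Derivation.leibniz, Derivation.leibniz_pow, dt_emb, dt_emb, dU, dV, dt_tvar, ← e2]
    simp only [smul_eq_mul, nsmul_eq_mul]
    push_cast
    ring
  have pΘ : ∀ i, pd i Θ = -(emb I σ (C a) * (τ * b i)) := by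
    intro i
    rw [hΘ, map_sub, map_neg, Derivation.leibniz, Derivation.leibniz, Derivation.leibniz,
      Derivation.leibniz, Derivation.leibniz_pow, pd_emb, pd_emb, pU, pV, pd_tvar]
    simp only [smul_eq_mul, nsmul_eq_mul]
    ring
  set Full := F * fexp Θ with hFull
  -- The derivative in `t` is a combination of Gaussian divergences `∂_i - a x_i` applied to `Full`.
  -- Each has zero expectation by integration by parts, so the expectation does not depend on `t`.
  have dFull : dt I σ Full = ∑ i, b i * (pd i Full - emb I σ (C a) * (x i * Full)) := by
    have h1 : ∀ i, b i * (pd i Full - emb I σ (C a) * (x i * Full)) =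
        (b i * pd i F) * fexp Θ -
          (emb I σ (C a) * τ * (F * fexp Θ)) * b i ^ 2 - (emb I σ (C a) * F * fexp Θ) * (b i * x i) := by
      intro i
      rw [hFull, Derivation.leibniz, pd, coeffDeriv_fexp _ hΘm, ← pd, pΘ]
      simp only [smul_eq_mul]
      ring
    simp only [h1, Finset.sum_sub_distrib, ← Finset.sum_mul, ← Finset.mul_sum]
    rw [hFull, Derivation.leibniz, dt, coeffDeriv_fexp _ hΘm, ← dt, dΘ, hF, ← hU, ← hV]
    simp only [smul_eq_mul]
    ring
  have hz : gaussF a (dt I σ Full) = 0 := by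
    rw [dFull, map_sum]
    refine Finset.sum_eq_zero fun i _ => ?_
    have h1 : b i = scal I (MvPowerSeries.map Polynomial.C (β i)) := rfl
    have h2 : emb I σ (C a) = scal I (MvPowerSeries.map Polynomial.C (C a)) := rfl
    rw [h1, gaussF_scal_mul, map_sub, h2, gaussF_scal_mul, gaussF_X_mul, ← mul_assoc]
    have h3 : MvPowerSeries.map (σ := σ) Polynomial.C (C a) *
        C (algebraMap ℂ (Polynomial ℂ) (1 / a)) = 1 := by
      rw [MvPowerSeries.map_C, ← map_mul]
      change C (Polynomial.C a * Polynomial.C (1 / a)) = 1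
      rw [← map_mul, mul_one_div_cancel ha, map_one, map_one]
    rw [h3, one_mul, sub_self, mul_zero]
  have key := gaussF_atT_eq a hz 0 1
  have aU : ∀ t, atT I σ t U = ∑ i, scal I (β i) * C (MvPolynomial.X i) := by
    intro t
    rw [hU, map_sum]
    refine Finset.sum_congr rfl fun i _ => ?_
    rw [map_mul, atT_X, atT_emb]
  have aV : ∀ t, atT I σ t V = scal I (∑ i, β i ^ 2) := by
    intro t
    rw [hV, map_sum, map_sum]
    refine Finset.sum_congr rfl fun i _ => ?_
    rw [map_pow, map_pow, atT_emb]
  have aΘ : ∀ t, atT I σ t (fexp Θ) = fexp (atT I σ t Θ) := fun t => map_fexp _ hΘm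
  rw [hFull, map_mul (atT I σ 0), map_mul (atT I σ 1), aΘ, aΘ] at key
  have a0 : atT I σ 0 Θ = 0 := by
    rw [hΘ, map_sub, map_neg, map_mul, map_mul, map_mul, map_mul, map_pow, atT_tvar]
    simp
  have f0 : fexp (0 : MvPowerSeries σ (MvPolynomial I ℂ)) = 1 :=
    (eq_fexp (Ideal.zero_mem _) (by simp) (by simp)).symm
  have hβ2 : -(C (a / 2) * ∑ i, β i ^ 2) ∈ ordIdeal σ ℂ 1 :=
    neg_mem (Ideal.mul_mem_left _ _ (Ideal.sum_mem _ fun i _ => by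
      rw [sq]; exact Ideal.mul_mem_right _ _ (hβ i)))
  have a1 : atT I σ 1 Θ = -(scal I (C a) * ∑ i, scal I (β i) * C (MvPolynomial.X i)) +
      scal I (-(C (a / 2) * ∑ i, β i ^ 2)) := by
    rw [hΘ, map_sub, map_neg, map_mul, map_mul, map_mul, map_mul, map_pow, atT_tvar, aU, aV,
      atT_emb, atT_emb]
    simp only [map_one, one_mul, one_pow, map_neg, map_mul]
    ring
  have e1 : fexp (atT I σ 1 Θ) =
      fexp (-(scal I (C a) * ∑ i, scal I (β i) * C (MvPolynomial.X i))) *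
        scal I (fexp (-(C (a / 2) * ∑ i, β i ^ 2))) := by
    rw [a1, fexp_add (linear_mem_ordIdeal β hβ _) (scal_mem_ordIdeal hβ2), scal, map_fexp _ hβ2]
  rw [a0, f0, mul_one, e1] at key
  rw [key, ← gaussF_scal_mul]
  refine congrArg (gaussF a) ?_
  generalize fexp (-(scal I (C a) * ∑ i, scal I (β i) * C (MvPolynomial.X i))) = E1
  generalize scal I (fexp (-(C (a / 2) * ∑ i, β i ^ 2))) = E2
  generalize atT I σ 1 F = E3
  exact ((mul_left_comm E2 E3 E1).trans (congrArg _ (mul_comm E2 E1))).symm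

/-- The Gaussian integral of the exponential of a linear form. -/
theorem gaussF_fexp_linear {a : ℂ} (ha : a ≠ 0) (β : I → MvPowerSeries σ ℂ)
    (hβ : ∀ i, β i ∈ ordIdeal σ ℂ 1) :
    gaussF a (fexp (-(scal I (C a) * ∑ i, scal I (β i) * C (MvPolynomial.X i)))) =
      fexp (C (a / 2) * ∑ i, β i ^ 2) := by
  -- Translating the constant function `1` shows that the expectation of the exponential is the
  -- inverse of `exp (-a/2 ∑ β_i²)`.
  have h := gaussF_shift ha β hβ 1 (by simp [Derivation.map_one_eq_zero])
  have hm : C (a / 2) * ∑ i, β i ^ 2 ∈ ordIdeal σ ℂ 1 :=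
    Ideal.mul_mem_left _ _ (Ideal.sum_mem _ fun i _ => by
      rw [sq]; exact Ideal.mul_mem_right _ _ (hβ i))
  have f0 : fexp (0 : MvPowerSeries σ ℂ) = 1 :=
    (eq_fexp (Ideal.zero_mem _) (by simp) (by simp)).symm
  rw [map_one (atT I σ 0), map_one (atT I σ 1), one_mul, ← map_one (scal I (σ := σ) (S := ℂ)),
    gaussF_scal] at h
  have h2 : fexp (C (a / 2) * ∑ i, β i ^ 2) * fexp (-(C (a / 2) * ∑ i, β i ^ 2)) = 1 := by
    rw [← fexp_add hm (neg_mem hm), add_neg_cancel, f0]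
  calc _ = (fexp (C (a / 2) * ∑ i, β i ^ 2) * fexp (-(C (a / 2) * ∑ i, β i ^ 2))) *
        gaussF a (fexp (-(scal I (C a) * ∑ i, scal I (β i) * C (MvPolynomial.X i)))) := by
        rw [h2, one_mul]
    _ = _ := by rw [mul_assoc, ← h, mul_one]

end Shift

/-! ### Complex Gaussian vectors -/

theorem gaussE_one {I : Type*} [Fintype I] (a : ℂ) : gaussE a (1 : MvPolynomial I ℂ) = 1 := by
  rw [← map_one MvPolynomial.C, gaussE_C]

section Vector

variable {ι σ : Type*} [Fintype ι] [DecidableEq ι]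

/-- The components of a complex vector, as polynomials in the real and imaginary parts. -/
def tv (σ : Type*) (i : ι) : MvPowerSeries σ (MvPolynomial (ι × Bool) ℂ) :=
  C (MvPolynomial.X (i, false) + MvPolynomial.C Complex.I * MvPolynomial.X (i, true))

/-- The complex conjugates of the components of a complex vector. -/
def tb (σ : Type*) (i : ι) : MvPowerSeries σ (MvPolynomial (ι × Bool) ℂ) :=
  C (MvPolynomial.X (i, false) - MvPolynomial.C Complex.I * MvPolynomial.X (i, true))

/-- The Wirtinger derivative with respect to the conjugate of the component `i`. -/
def dbar (σ : Type*) (i : ι) : Derivation ℂ (MvPowerSeries σ (MvPolynomial (ι × Bool) ℂ))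
    (MvPowerSeries σ (MvPolynomial (ι × Bool) ℂ)) :=
  (1 / 2 : ℂ) • (pd (i, false) + Complex.I • pd (i, true))

theorem dbar_apply (i : ι) (F : MvPowerSeries σ (MvPolynomial (ι × Bool) ℂ)) :
    dbar σ i F = scal _ (C (1 / 2)) * (pd (i, false) F + scal _ (C Complex.I) * pd (i, true) F) := by
  have : ∀ (c : ℂ) (G : MvPowerSeries σ (MvPolynomial (ι × Bool) ℂ)),
      c • G = scal _ (C c) * G := by
    intro c G
    ext1 m
    rw [MvPowerSeries.map_C, coeff_C_mul, ← MvPolynomial.smul_eq_C_mul]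
    rfl
  rw [← this, ← this]
  rfl

theorem pd_scal_mul {I S σ : Type*} [CommRing S] [Algebra ℂ S] [Fintype I] (i : I)
    (A : MvPowerSeries σ S) (F : MvPowerSeries σ (MvPolynomial I S)) :
    pd i (scal I A * F) = scal I A * pd i F := by
  rw [Derivation.leibniz, pd_scal]; simp

theorem dbar_scal (i : ι) (A : MvPowerSeries σ ℂ) : dbar σ i (scal _ A) = 0 := by
  rw [dbar_apply, pd_scal, pd_scal]; simp

theorem tv_eq (i : ι) : tv σ i = C (MvPolynomial.X (i, false)) +
    scal _ (C Complex.I) * C (MvPolynomial.X (i, true)) := by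
  rw [tv, map_add, map_mul, MvPowerSeries.map_C]

theorem tb_eq (i : ι) : tb σ i = C (MvPolynomial.X (i, false)) -
    scal _ (C Complex.I) * C (MvPolynomial.X (i, true)) := by
  rw [tb, map_sub, map_mul, MvPowerSeries.map_C]

theorem scal_I_sq {I : Type*} : (scal I (C (σ := σ) Complex.I)) * scal I (C Complex.I) = -1 := by
  rw [← map_mul, ← map_mul, Complex.I_mul_I]; simp

theorem scal_half {I : Type*} : (scal I (C (σ := σ) (1 / 2 : ℂ))) * 2 = 1 := by
  rw [← map_ofNat (scal I (σ := σ) (S := ℂ)) 2, ← map_mul, ← map_ofNat (C (σ := σ) (R := ℂ)) 2,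
    ← map_mul]
  norm_num

theorem dbar_tv (i j : ι) : dbar σ i (tv σ j) = 0 := by
  rw [dbar_apply, tv_eq, map_add, map_add, pd_scal_mul, pd_scal_mul, pd_X, pd_X, pd_X, pd_X]
  by_cases h : i = j
  · subst h
    simp only [Prod.mk.injEq, true_and, reduceCtorEq, if_false, if_true, mul_one, mul_zero, add_zero,
      zero_add]
    rw [scal_I_sq]; ring
  · simp [h]

theorem dbar_tb (i j : ι) : dbar σ i (tb σ j) = if i = j then 1 else 0 := by
  rw [dbar_apply, tb_eq, map_sub, map_sub, pd_scal_mul, pd_scal_mul, pd_X, pd_X, pd_X, pd_X]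
  by_cases h : i = j
  · subst h
    simp only [Prod.mk.injEq, true_and, reduceCtorEq, if_false, if_true, mul_one, mul_zero, sub_zero,
      zero_sub, mul_neg]
    rw [scal_I_sq, neg_neg, one_add_one_eq_two, scal_half]
  · simp [h]

/-- Integration by parts in complex form: the integrations over the real and the imaginary part, of
variance `1 / (2 a)`, combine into the derivative with respect to the conjugate variable. -/
theorem gaussF_tv_mul {a : ℂ} (ha : a ≠ 0) (i : ι)
    (F : MvPowerSeries σ (MvPolynomial (ι × Bool) ℂ)) :
    gaussF (2 * a) (tv σ i * F) = C (1 / a) * gaussF (2 * a) (dbar σ i F) := by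
  rw [tv_eq, add_mul, map_add, mul_assoc, gaussF_scal_mul, gaussF_X_mul, gaussF_X_mul, dbar_apply,
    gaussF_scal_mul, map_add, gaussF_scal_mul, ← mul_assoc (C (1 / a)), ← map_mul]
  simp only [Algebra.algebraMap_self, RingHom.id_apply]
  rw [show (1 / (2 * a) : ℂ) = 1 / a * (1 / 2) by field_simp]
  ring

variable (A : Matrix ι ι (MvPowerSeries σ ℂ)) (a : ℂ)

/-- The quadratic form `T̄ A T`. -/
def sesq : MvPowerSeries σ (MvPolynomial (ι × Bool) ℂ) :=
  ∑ j, ∑ i, tb σ j * scal _ (A j i) * tv σ i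

/-- The Gaussian expectation perturbed by the quadratic form `A`. -/
def pertE (P : MvPowerSeries σ (MvPolynomial (ι × Bool) ℂ)) : MvPowerSeries σ ℂ :=
  gaussF (2 * a) (P * fexp (-(scal _ (C a) * sesq A)))

theorem pertE_scal_mul (B : MvPowerSeries σ ℂ) (P : MvPowerSeries σ (MvPolynomial (ι × Bool) ℂ)) :
    pertE A a (scal _ B * P) = B * pertE A a P := by
  rw [pertE, mul_assoc, gaussF_scal_mul]; rfl

theorem pertE_sum {κ : Type*} (s : Finset κ)
    (P : κ → MvPowerSeries σ (MvPolynomial (ι × Bool) ℂ)) :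
    pertE A a (∑ x ∈ s, P x) = ∑ x ∈ s, pertE A a (P x) := by
  simp only [pertE, Finset.sum_mul, map_sum]

variable {A a} (hA : ∀ i j, A i j ∈ ordIdeal σ ℂ 1) (ha : a ≠ 0)

include hA in
theorem sesq_mem : -(scal _ (C a) * sesq A) ∈ ordIdeal σ (MvPolynomial (ι × Bool) ℂ) 1 :=
  neg_mem (Ideal.mul_mem_left _ _ (Ideal.sum_mem _ fun j _ => Ideal.sum_mem _ fun i _ =>
    Ideal.mul_mem_right _ _ (Ideal.mul_mem_left _ _ (scal_mem_ordIdeal (hA j i)))))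

theorem dbar_sesq (k : ι) : dbar σ k (sesq A) = ∑ i, scal _ (A k i) * tv σ i := by
  rw [sesq, map_sum, Finset.sum_eq_single k]
  · rw [map_sum]
    refine Finset.sum_congr rfl fun i _ => ?_
    rw [Derivation.leibniz, Derivation.leibniz, dbar_tv, dbar_scal, dbar_tb, if_pos rfl]
    simp [mul_comm]
  · intro j _ hj
    rw [map_sum]
    refine Finset.sum_eq_zero fun i _ => ?_
    rw [Derivation.leibniz, Derivation.leibniz, dbar_tv, dbar_scal, dbar_tb, if_neg hj.symm]
    simp
  · simp

theorem dbar_fexp (k : ι) {B : MvPowerSeries σ (MvPolynomial (ι × Bool) ℂ)}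
    (hB : B ∈ ordIdeal σ _ 1) : dbar σ k (fexp B) = dbar σ k B * fexp B := by
  rw [dbar_apply, dbar_apply, pd, pd, coeffDeriv_fexp _ hB, coeffDeriv_fexp _ hB]
  ring

include hA in
theorem isUnit_det_one_add : IsUnit (1 + A).det :=
  isUnit_of_constantCoeff_one (det_constantCoeff hA)

include hA ha in
-- A Schwinger–Dyson equation. Integration by parts against the perturbed weight also differentiates
-- the quadratic form, which yields a linear system with matrix `1 + A` for the vector of
-- expectations of `T_k P`. Inverting it shows that the propagator is `(1 + A)⁻¹`.
theorem pertE_tv_mul (i : ι) (P : MvPowerSeries σ (MvPolynomial (ι × Bool) ℂ)) :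
    pertE A a (tv σ i * P) = C (1 / a) * ∑ j, (1 + A)⁻¹ i j * pertE A a (dbar σ j P) := by
  have h1 : ∀ j, ∑ k, (1 + A) j k * pertE A a (tv σ k * P) =
      C (1 / a) * pertE A a (dbar σ j P) := by
    intro j
    have h2 : pertE A a (tv σ j * P) = C (1 / a) * pertE A a (dbar σ j P) -
        ∑ k, A j k * pertE A a (tv σ k * P) := by
      rw [pertE, mul_assoc, gaussF_tv_mul ha, Derivation.leibniz, dbar_fexp _ (sesq_mem hA),
        Derivation.map_neg, Derivation.leibniz, dbar_scal, dbar_sesq]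
      have h3 : P • ((-(scal (ι × Bool) (C (σ := σ) a) • ∑ i, scal _ (A j i) * tv σ i + sesq A • (0 : MvPowerSeries σ (MvPolynomial (ι × Bool) ℂ)))) *
          fexp (-(scal _ (C a) * sesq A))) + fexp (-(scal _ (C a) * sesq A)) • dbar σ j P =
          dbar σ j P * fexp (-(scal _ (C a) * sesq A)) - scal _ (C a) *
            ∑ k, scal _ (A j k) * (tv σ k * P * fexp (-(scal _ (C a) * sesq A))) := by
        generalize fexp (-(scal _ (C a) * sesq A)) = E
        have h4 : ∑ k, scal _ (A j k) * (tv σ k * P * E) =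
            (∑ k, scal _ (A j k) * tv σ k) * (P * E) := by
          rw [Finset.sum_mul]
          exact Finset.sum_congr rfl fun k _ => by ring
        rw [h4]
        simp only [smul_eq_mul, mul_zero, add_zero]
        ring
      rw [h3, map_sub, gaussF_scal_mul, map_sum, mul_sub, ← mul_assoc (C (1 / a)), ← map_mul,
        one_div_mul_cancel ha, map_one, one_mul]
      simp only [gaussF_scal_mul]
      rfl
    simp only [Matrix.add_apply, add_mul, Finset.sum_add_distrib, Matrix.one_apply, ite_mul, one_mul,
      zero_mul, Finset.sum_ite_eq, Finset.mem_univ, if_true]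
    rw [h2]; ring
  have hK : (1 + A)⁻¹ * (1 + A) = 1 := Matrix.nonsing_inv_mul _ (isUnit_det_one_add hA)
  calc pertE A a (tv σ i * P)
      = ∑ k, ((1 + A)⁻¹ * (1 + A)) i k * pertE A a (tv σ k * P) := by
        simp [hK, Matrix.one_apply]
    _ = ∑ j, (1 + A)⁻¹ i j * ∑ k, (1 + A) j k * pertE A a (tv σ k * P) := by
        simp only [Matrix.mul_apply, Finset.sum_mul, Finset.mul_sum, mul_assoc]
        rw [Finset.sum_comm]
    _ = _ := by
        simp only [h1, Finset.mul_sum]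
        refine Finset.sum_congr rfl fun j _ => ?_
        ring

theorem dbar_prod_tv {κ : Type*} (s : Finset κ) (i : κ → ι) (j : ι) :
    dbar σ j (∏ x ∈ s, tv σ (i x)) = 0 := by
  classical
  rw [deriv_prod]
  simp [dbar_tv]

include hA ha in
/-- Wick's theorem. -/
theorem pertE_wick : ∀ (n : ℕ) (i j : Fin n → ι),
    pertE A a ((∏ x, tv σ (i x)) * ∏ x, tb σ (j x)) =
      C ((1 / a) ^ n) * (∑ s : Equiv.Perm (Fin n), ∏ x, (1 + A)⁻¹ (i x) (j (s x))) * pertE A a 1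
  | 0, i, j => by simp
  | n + 1, i, j => by
    -- The first `T` is contracted with the `p`-th `T̄`. The remaining `T̄` are labelled through the
    -- transposition of `0` and `p`, which is the decomposition of permutations given by
    -- `Equiv.Perm.decomposeFin`.
    have h0 : ∀ l, dbar σ l ((∏ x : Fin n, tv σ (i x.succ)) * ∏ x, tb σ (j x)) =
        ∑ p, (if l = j p then (1 : MvPowerSeries σ (MvPolynomial (ι × Bool) ℂ)) else 0) *
          ((∏ x : Fin n, tv σ (i x.succ)) * ∏ x : Fin n, tb σ (j (Equiv.swap 0 p x.succ))) := by
      intro l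
      rw [Derivation.leibniz, dbar_prod_tv, smul_zero, add_zero, deriv_prod, smul_eq_mul,
        Finset.mul_sum]
      refine Finset.sum_congr rfl fun p _ => ?_
      have h1 : ∏ x ∈ Finset.univ.erase p, tb σ (j x) =
          ∏ x : Fin n, tb σ (j (Equiv.swap 0 p x.succ)) := by
        rw [← Finset.prod_image (s := (Finset.univ : Finset (Fin n)))
          (g := fun x : Fin n => Equiv.swap 0 p x.succ) (f := fun x => tb σ (j x))]
        · refine Finset.prod_congr ?_ fun _ _ => rfl
          ext x
          simp only [Finset.mem_erase, Finset.mem_univ, and_true, Finset.mem_image, true_and]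
          constructor
          · intro hx
            have : Equiv.swap 0 p x ≠ 0 := by
              intro h
              apply hx
              have := congrArg (Equiv.swap 0 p) h
              simpa using this
            obtain ⟨y, hy⟩ := Fin.exists_succ_eq.2 this
            exact ⟨y, by rw [hy]; simp⟩
          · rintro ⟨y, rfl⟩ h
            have := congrArg (Equiv.swap 0 p) h
            simp at this
        · intro x _ y _ h
          simpa using h
      rw [h1, dbar_tb]
      ring
    rw [Fin.prod_univ_succ, mul_assoc, pertE_tv_mul hA ha]
    simp only [h0, pertE_sum]
    have h2 : ∀ l p, pertE A a ((if l = j p then 1 else 0) *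
        ((∏ x : Fin n, tv σ (i x.succ)) * ∏ x : Fin n, tb σ (j (Equiv.swap 0 p x.succ)))) =
        if l = j p then (C ((1 / a) ^ n) * (∑ s : Equiv.Perm (Fin n), ∏ x : Fin n,
          (1 + A)⁻¹ (i x.succ) (j (Equiv.swap 0 p (s x).succ))) * pertE A a 1) else 0 := by
      intro l p
      split_ifs
      · rw [one_mul, pertE_wick n (fun x => i x.succ) (fun x => j (Equiv.swap 0 p x.succ))]
      · rw [zero_mul]
        simp [pertE]
    simp only [h2, Finset.mul_sum]
    rw [Finset.sum_comm]
    simp only [mul_ite, mul_zero, Finset.sum_ite_eq', Finset.mem_univ, if_true]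
    rw [← Equiv.Perm.decomposeFin.symm.sum_comp, Fintype.sum_prod_type, Finset.sum_mul]
    refine Finset.sum_congr rfl fun p _ => ?_
    simp only [Fin.prod_univ_succ, Equiv.Perm.decomposeFin_symm_apply_zero,
      Equiv.Perm.decomposeFin_symm_apply_succ, ← Finset.mul_sum]
    rw [pow_succ, map_mul]
    ring

include hA ha in
-- The Euler derivative of the partition function is a combination of two-point functions, known
-- from Wick's theorem with one pair. It is opposite to the logarithmic derivative of the
-- determinant given by Jacobi's formula, and both factors are normalised at zero coupling.
theorem pertE_one_mul_det : pertE A a 1 * (1 + A).det = 1 := by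
  have hD : eulerD σ ℂ (pertE A a 1) =
      -((1 + A)⁻¹ * A.map (eulerD σ ℂ)).trace * pertE A a 1 := by
    have hcomm : ∀ F : MvPowerSeries σ (MvPolynomial (ι × Bool) ℂ),
        eulerD σ ℂ (gaussF (2 * a) F) = gaussF (2 * a) (eulerD σ _ F) := by
      intro F
      ext m
      rw [coeff_eulerD, coeff_gaussF, coeff_gaussF, coeff_eulerD, ← nsmul_eq_mul, ← nsmul_eq_mul,
        map_nsmul]
    have hC : ∀ x : MvPolynomial (ι × Bool) ℂ, eulerD σ _ (C x) = 0 := by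
      intro x
      have := (eulerD σ (MvPolynomial (ι × Bool) ℂ)).map_algebraMap x
      exact this
    have hs : eulerD σ _ (sesq A) = sesq (A.map (eulerD σ ℂ)) := by
      rw [sesq, sesq, map_sum]
      refine Finset.sum_congr rfl fun j _ => ?_
      rw [map_sum]
      refine Finset.sum_congr rfl fun i _ => ?_
      rw [Derivation.leibniz, Derivation.leibniz, tv, tb, hC, hC, Matrix.map_apply, map_eulerD]
      simp [mul_comm]
    have hsc : eulerD σ _ (scal (ι × Bool) (C (σ := σ) a)) = 0 := by
      rw [MvPowerSeries.map_C, hC]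
    rw [pertE, hcomm, one_mul, eulerD_fexp (sesq_mem hA), Derivation.map_neg, Derivation.leibniz, hs,
      hsc, smul_zero, add_zero, smul_eq_mul, ← mul_neg, mul_assoc, gaussF_scal_mul]
    have : -sesq (A.map (eulerD σ ℂ)) * fexp (-(scal _ (C a) * sesq A)) =
        -∑ j, ∑ i, scal _ (eulerD σ ℂ (A j i)) * (tv σ i * tb σ j *
          fexp (-(scal _ (C a) * sesq A))) := by
      rw [sesq, neg_mul, Finset.sum_mul]
      congr 1
      refine Finset.sum_congr rfl fun j _ => ?_
      rw [Finset.sum_mul]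
      refine Finset.sum_congr rfl fun i _ => ?_
      rw [Matrix.map_apply]
      ring
    rw [this, map_neg, map_sum]
    simp only [map_sum, gaussF_scal_mul]
    have h2 : ∀ i j, gaussF (2 * a) (tv σ i * tb σ j * fexp (-(scal _ (C a) * sesq A))) =
        C (1 / a) * (1 + A)⁻¹ i j * pertE A a 1 := by
      intro i j
      have := pertE_wick hA ha 1 (fun _ => i) (fun _ => j)
      simpa [pertE] using this
    simp only [h2]
    have h3 : C (σ := σ) a * C (1 / a) = 1 := by
      rw [← map_mul, mul_one_div_cancel ha, map_one]
    rw [Matrix.trace]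
    simp only [Matrix.diag_apply, Matrix.mul_apply, Matrix.map_apply]
    rw [Finset.sum_comm, mul_neg, neg_mul, Finset.mul_sum, Finset.sum_mul]
    congr 1
    refine Finset.sum_congr rfl fun i _ => ?_
    rw [Finset.mul_sum, Finset.sum_mul]
    refine Finset.sum_congr rfl fun j _ => ?_
    rw [show gaussF (2 * a) (fexp (-(scal _ (C a) * sesq A))) = pertE A a 1 by rw [pertE, one_mul]]
    linear_combination (eulerD σ ℂ (A j i) * (1 + A)⁻¹ i j * pertE A a 1) * h3
  have hdet := isUnit_det_one_add hA
  refine eq_of_eulerD_eq ?_ ?_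
  · have hadj : (1 + A).adjugate = (1 + A).det • (1 + A)⁻¹ := by
      rw [Matrix.inv_def, smul_smul, Ring.mul_inverse_cancel _ hdet, one_smul]
    have hmap : (1 + A).map (eulerD σ ℂ) = A.map (eulerD σ ℂ) := by
      ext1 i j
      simp only [Matrix.map_apply, Matrix.add_apply, map_add]
      have := congrFun (congrFun (deriv_matrix_one (eulerD σ ℂ) (n := ι)) i) j
      rw [Matrix.map_apply] at this
      rw [this, Matrix.zero_apply, zero_add]
    rw [Derivation.map_one_eq_zero, Derivation.leibniz, deriv_det, hD, hadj, hmap,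
      Matrix.smul_mul, Matrix.trace_smul]
    simp only [smul_eq_mul]
    ring
  · rw [map_mul, det_constantCoeff hA, mul_one, pertE, one_mul, ← coeff_zero_eq_constantCoeff_apply,
      coeff_gaussF, coeff_zero_eq_constantCoeff_apply, constantCoeff_fexp (sesq_mem hA), gaussE_one,
      map_one]

end Vector

/-! ### Tensor products of matrices -/

section Tens

variable {d N : ℕ} {S : Type*} [CommRing S]

/-- The tensor product of the matrices `M c`. -/
def tens (M : Fin d → Matrix (Fin N) (Fin N) S) : Matrix (Idx d N) (Idx d N) S :=
  Matrix.of fun i j => ∏ c, M c (i c) (j c)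

theorem tens_mul (M M' : Fin d → Matrix (Fin N) (Fin N) S) :
    tens M * tens M' = tens fun c => M c * M' c := by
  ext i j
  simp only [tens, Matrix.mul_apply, Matrix.of_apply, ← Finset.prod_mul_distrib]
  rw [Finset.prod_univ_sum, Fintype.piFinset_univ]

theorem tens_one : tens (fun _ => 1 : Fin d → Matrix (Fin N) (Fin N) S) = 1 := by
  ext i j
  simp only [tens, Matrix.of_apply, Matrix.one_apply]
  rw [Finset.prod_ite_zero]
  simp [funext_iff]

theorem tens_trace (M : Fin d → Matrix (Fin N) (Fin N) S) : (tens M).trace = ∏ c, (M c).trace := by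
  simp only [tens, Matrix.trace, Matrix.diag_apply, Matrix.of_apply]
  rw [Finset.prod_univ_sum, Fintype.piFinset_univ]

/-- `lift`, over any commutative ring. -/
def liftS (c : Fin d) (M : Matrix (Fin N) (Fin N) S) : Matrix (Idx d N) (Idx d N) S :=
  Matrix.of fun i j => if ∀ c', c' ≠ c → i c' = j c' then M (i c) (j c) else 0

theorem lift_eq_liftS (c : Fin d) (M : Matrix (Fin N) (Fin N) ℂ) : lift c M = liftS c M := rfl

theorem liftS_eq_tens (c : Fin d) (M : Matrix (Fin N) (Fin N) S) :
    liftS c M = tens (Function.update (fun _ => 1) c M) := by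
  ext i j
  simp only [liftS, tens, Matrix.of_apply]
  rw [← Finset.mul_prod_erase _ _ (Finset.mem_univ c), Function.update_self,
    Finset.prod_congr rfl (g := fun c' => if i c' = j c' then (1 : S) else 0), Finset.prod_ite_zero]
  · simp only [Finset.mem_erase, Finset.mem_univ, and_true, Finset.prod_const_one]
    split_ifs <;> simp
  · intro c' hc'
    rw [Function.update_of_ne (Finset.ne_of_mem_erase hc'), Matrix.one_apply]

theorem liftS_mul (c : Fin d) (M M' : Matrix (Fin N) (Fin N) S) :
    liftS c M * liftS c M' = liftS c (M * M') := by
  rw [liftS_eq_tens, liftS_eq_tens, liftS_eq_tens, tens_mul]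
  congr 1
  funext c'
  by_cases h : c' = c
  · subst h; simp
  · simp [Function.update_of_ne h]

theorem liftS_trace (c : Fin d) (M : Matrix (Fin N) (Fin N) S) :
    (liftS c M).trace = (N : S) ^ (d - 1) * M.trace := by
  rw [liftS_eq_tens, tens_trace, ← Finset.mul_prod_erase _ _ (Finset.mem_univ c),
    Function.update_self, mul_comm, Finset.prod_congr rfl (g := fun _ => (N : S)), Finset.prod_const,
    Finset.card_erase_of_mem (Finset.mem_univ c), Finset.card_univ, Fintype.card_fin]
  intro c' hc'
  rw [Function.update_of_ne (Finset.ne_of_mem_erase hc'), Matrix.trace_one, Fintype.card_fin]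

theorem liftS_map {T : Type*} [CommRing T] (φ : S →+* T) (c : Fin d)
    (M : Matrix (Fin N) (Fin N) S) : (liftS c M).map φ = liftS c (M.map φ) := by
  ext i j
  simp only [liftS, Matrix.map_apply, Matrix.of_apply]
  split_ifs <;> simp

end Tens

/-! ### Coordinates on Hermitian matrices -/

section HermCoord

variable {d N : ℕ}

/-- The coefficient of the coordinate `p` in the entry `(a, b)` of a Hermitian matrix. -/
def hcoef (p : Fin N × Fin N) (a b : Fin N) : ℂ :=
  (if p = (a, b) then
    (if a < b then 1 / (Real.sqrt 2 : ℂ) else if b < a then -Complex.I / (Real.sqrt 2 : ℂ) else 1)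
    else 0) +
  (if p = (b, a) then
    (if a < b then Complex.I / (Real.sqrt 2 : ℂ) else if b < a then 1 / (Real.sqrt 2 : ℂ) else 0)
    else 0)

theorem herm_eq_sum (x : Fin N → Fin N → ℝ) (a b : Fin N) :
    herm x a b = ∑ p : Fin N × Fin N, hcoef p a b * (x p.1 p.2 : ℂ) := by
  simp only [hcoef, add_mul, Finset.sum_add_distrib, ite_mul, zero_mul, Finset.sum_ite_eq',
    Finset.mem_univ, if_true]
  simp only [herm, Matrix.of_apply]
  rcases lt_trichotomy a b with h | h | h
  · simp only [h, not_lt_of_gt h, if_true, if_false]; ring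
  · subst h; simp
  · simp only [h, not_lt_of_gt h, if_true, if_false]; ring

/-- The entries of a Gaussian Hermitian matrix have covariance `δ_{ad} δ_{bc}`. -/
theorem hcoef_complete (a b a' b' : Fin N) :
    ∑ p : Fin N × Fin N, hcoef p a b * hcoef p a' b' = if a = b' ∧ b = a' then 1 else 0 := by
  have h2 : ((Real.sqrt 2 : ℝ) : ℂ) * ((Real.sqrt 2 : ℝ) : ℂ) = 2 := by
    rw [← Complex.ofReal_mul, Real.mul_self_sqrt (by norm_num)]; norm_num
  have h0 : ((Real.sqrt 2 : ℝ) : ℂ) ≠ 0 := by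
    intro h; rw [h] at h2; norm_num at h2
  have hI := Complex.I_mul_I
  have h3 : (1 / (Real.sqrt 2 : ℂ)) * (1 / (Real.sqrt 2 : ℂ)) = 1 / 2 := by
    rw [div_mul_div_comm, h2, one_mul]
  have h4 : (Complex.I / (Real.sqrt 2 : ℂ)) * (Complex.I / (Real.sqrt 2 : ℂ)) = -1 / 2 := by
    rw [div_mul_div_comm, h2, hI]
  simp only [hcoef, add_mul, Finset.sum_add_distrib, ite_mul, zero_mul, Finset.sum_ite_eq',
    Finset.mem_univ, if_true, Prod.mk.injEq]
  rcases lt_trichotomy a b with h | h | h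
  · have hn := not_lt_of_gt h
    have hne := h.ne
    by_cases e1 : a = a' ∧ b = b'
    · obtain ⟨rfl, rfl⟩ := e1
      simp only [h, hn, hne, hne.symm, and_self, if_true, if_false, add_zero, zero_add]
      linear_combination h3 + h4
    · by_cases e2 : a = b' ∧ b = a'
      · obtain ⟨rfl, rfl⟩ := e2
        simp only [h, hn, hne, hne.symm, and_self, if_true, if_false, add_zero, zero_add]
        linear_combination h3 - h4
      · have e3 : ¬(b = a' ∧ a = b') := fun h => e2 ⟨h.2, h.1⟩
        have e4 : ¬(b = b' ∧ a = a') := fun h => e1 ⟨h.2, h.1⟩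
        simp [e1, e2, e3, e4]
  · subst h
    by_cases e1 : a = a' ∧ a = b'
    · obtain ⟨rfl, e⟩ := e1
      subst e
      simp
    · have e2 : ¬(a = b' ∧ a = a') := fun h => e1 ⟨h.2, h.1⟩
      simp [e1, e2]
  · have hn := not_lt_of_gt h
    have hne := h.ne
    by_cases e1 : a = a' ∧ b = b'
    · obtain ⟨rfl, rfl⟩ := e1
      simp only [h, hn, hne, hne.symm, and_self, if_true, if_false, add_zero, zero_add]
      linear_combination h3 + h4
    · by_cases e2 : a = b' ∧ b = a'
      · obtain ⟨rfl, rfl⟩ := e2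
        simp only [h, hn, hne, hne.symm, and_self, if_true, if_false, add_zero, zero_add]
        linear_combination h3 - h4
      · have e3 : ¬(b = a' ∧ a = b') := fun h => e2 ⟨h.2, h.1⟩
        have e4 : ¬(b = b' ∧ a = a') := fun h => e1 ⟨h.2, h.1⟩
        simp [e1, e2, e3, e4]

/-- `hcoef p` as a matrix. -/
def hmat (p : Fin N × Fin N) : Matrix (Fin N) (Fin N) ℂ := Matrix.of fun a b => hcoef p a b

theorem lift_herm_eq_sum (c : Fin d) (x : Fin N → Fin N → ℝ) (i j : Idx d N) :
    lift c (herm x) i j = ∑ p : Fin N × Fin N, (x p.1 p.2 : ℂ) * lift c (hmat p) i j := by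
  simp only [lift, Matrix.of_apply, hmat, herm_eq_sum]
  split_ifs <;> simp [mul_comm]

/-- Contracting two lifted basis matrices exchanges their indices of colour `c` and transmits all
the others, which is the index pattern of the melonic vertex. -/
theorem lift_hmat_complete (c : Fin d) (i j k l : Idx d N) :
    ∑ p : Fin N × Fin N, lift c (hmat p) i j * lift c (hmat p) k l =
      if i = Function.update j c (l c) ∧ k = Function.update l c (j c) then 1 else 0 := by
  have e : ∀ (i j : Idx d N) (b : Fin N), (i = Function.update j c b) ↔
      (∀ c', c' ≠ c → i c' = j c') ∧ i c = b := by
    intro i j b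
    constructor
    · rintro rfl
      exact ⟨fun c' h => by rw [Function.update_of_ne h], by simp⟩
    · rintro ⟨h1, h2⟩
      funext c'
      by_cases h : c' = c
      · subst h; simp [h2]
      · rw [Function.update_of_ne h, h1 c' h]
  simp only [lift, Matrix.of_apply, hmat, e]
  by_cases h1 : ∀ c', c' ≠ c → i c' = j c'
  · by_cases h2 : ∀ c', c' ≠ c → k c' = l c'
    · simp only [if_pos h1, if_pos h2, hcoef_complete]
      simp only [eq_true h1, eq_true h2, true_and, eq_comm]
    · simp only [if_neg h2, mul_zero, Finset.sum_const_zero]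
      rw [if_neg]
      tauto
  · simp only [if_neg h1, zero_mul, Finset.sum_const_zero]
    rw [if_neg]
    tauto

/-- `T̄ 𝓜_p T` for the element `p` of the basis of Hermitian matrices in position `c`. -/
def theta (T : Tensor d N) (c : Fin d) (p : Fin N × Fin N) : ℂ :=
  ∑ i, ∑ j, star (T i) * T j * lift c (hmat p) i j

/-- This is the algebraic core of the intermediate field: the quartic vertex becomes a sum of
squares, each of which can be produced by a Gaussian integral of a linear exponential. -/
theorem sum_theta_sq (T : Tensor d N) (c : Fin d) : ∑ p, theta T c p ^ 2 = melonic c T := by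
  have h1 : ∀ p, theta T c p ^ 2 = ∑ u : Idx d N × Idx d N, ∑ v : Idx d N × Idx d N,
      (star (T u.1) * T u.2 * star (T v.1) * T v.2) *
        (lift c (hmat p) u.1 u.2 * lift c (hmat p) v.1 v.2) := by
    intro p
    rw [sq, theta, ← Fintype.sum_prod_type' (f := fun i j => star (T i) * T j * lift c (hmat p) i j),
      Finset.sum_mul_sum]
    exact Finset.sum_congr rfl fun u _ => Finset.sum_congr rfl fun v _ => by ring
  simp only [h1]
  rw [Finset.sum_comm]
  have h2 : ∀ u : Idx d N × Idx d N, ∑ p, ∑ v : Idx d N × Idx d N,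
      (star (T u.1) * T u.2 * star (T v.1) * T v.2) *
        (lift c (hmat p) u.1 u.2 * lift c (hmat p) v.1 v.2) =
      ∑ l, (if u.1 = Function.update u.2 c (l c) then star (T u.1) * T u.2 *
        star (T (Function.update l c (u.2 c))) * T l else 0) := by
    intro u
    rw [Finset.sum_comm]
    simp only [← Finset.mul_sum, lift_hmat_complete]
    rw [Fintype.sum_prod_type, Finset.sum_comm]
    refine Finset.sum_congr rfl fun l _ => ?_
    simp only [ite_and, mul_ite, mul_one, mul_zero]
    split_ifs <;> simp
  simp only [h2]
  rw [Fintype.sum_prod_type, Finset.sum_comm, melonic]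
  refine Finset.sum_congr rfl fun j _ => ?_
  rw [Finset.sum_comm]
  refine Finset.sum_congr rfl fun l _ => ?_
  simp only [Finset.sum_ite_eq', Finset.mem_univ, if_true]
  ring

end HermCoord

open MeasureTheory

/-! ### The intermediate field representation -/

section IntermediateField

variable {d N n : ℕ}

/-- `i ∑_c g_c Y_c`. -/
def fieldMat (x : Herms d N) : Matrix (Idx d N) (Idx d N) (Series d) :=
  ∑ c, (C Complex.I * X c) • (lift c (herm (x c))).map C

theorem kernel_eq (x : Herms d N) : kernel x = 1 + fieldMat x := rfl

theorem fieldMat_apply (x : Herms d N) (i j : Idx d N) :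
    fieldMat x i j = ∑ c, C Complex.I * X c * C (lift c (herm (x c)) i j) := by
  simp [fieldMat, Matrix.sum_apply]

theorem fieldMat_mem (x : Herms d N) (i j : Idx d N) : fieldMat x i j ∈ ordIdeal (Fin d) ℂ 1 := by
  rw [fieldMat_apply]
  exact Ideal.sum_mem _ fun c _ => Ideal.mul_mem_right _ _ (Ideal.mul_mem_left _ _
    (X_mem_ordIdeal c))

/-- The coupling `-N^{d-1} T̄ (i ∑_c g_c Y_c) T` of the tensor and the intermediate field. -/
def coupling (a : ℂ) (T : Tensor d N) (x : Herms d N) : Series d :=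
  -(C a * ∑ j, ∑ i, C (star (T j)) * fieldMat x j i * C (T i))

/-- The source for the intermediate field, linear in the invariants of the tensor. -/
def source (T : Tensor d N) (i : HIdx d N) : Series d :=
  C (Complex.I * theta T i.1 i.2) * X i.1

theorem source_mem (T : Tensor d N) (i : HIdx d N) : source T i ∈ ordIdeal (Fin d) ℂ 1 :=
  Ideal.mul_mem_left _ _ (X_mem_ordIdeal _)

/-- The coupling has two readings: here it is linear in the field, for the integral over `X`; in
`eval_sesq` it is quadratic in the tensor, for the integral over `T`. -/
theorem eval_source (a : ℂ) (T : Tensor d N) (x : Herms d N) :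
    evalAt hcoord x (-(scal (HIdx d N) (C a) * ∑ i, scal (HIdx d N) (source T i) *
      C (MvPolynomial.X i))) = coupling a T x := by
  have hs : ∀ A : Series d, evalAt hcoord x (scal (HIdx d N) A) = A := by
    intro A
    ext m
    simp
  rw [map_neg, map_mul, map_sum, hs, coupling]
  congr 2
  simp only [map_mul, hs, MvPowerSeries.map_C, MvPolynomial.eval_X]
  rw [Fintype.sum_prod_type]
  have h1 : ∀ c, ∑ p : Fin N × Fin N, source T (c, p) * C (hcoord (c, p) x) =
      ∑ j, ∑ i, C Complex.I * X c * C (star (T j) * T i * lift c (herm (x c)) j i) := by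
    intro c
    have : ∀ p : Fin N × Fin N, source T (c, p) * C (hcoord (c, p) x) =
        ∑ j, ∑ i, C Complex.I * X c *
          C (star (T j) * T i * ((x c p.1 p.2 : ℂ) * lift c (hmat p) j i)) := by
      intro p
      simp only [source, theta, hcoord, Finset.mul_sum, Finset.sum_mul, map_mul, map_sum]
      exact Finset.sum_congr rfl fun j _ => Finset.sum_congr rfl fun i _ => by ring
    simp only [this]
    rw [Finset.sum_comm]
    refine Finset.sum_congr rfl fun j _ => ?_
    rw [Finset.sum_comm]
    refine Finset.sum_congr rfl fun i _ => ?_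
    rw [lift_herm_eq_sum, Finset.mul_sum, map_sum, Finset.mul_sum]
  simp only [h1]
  rw [Finset.sum_comm]
  refine Finset.sum_congr rfl fun j _ => ?_
  rw [Finset.sum_comm]
  refine Finset.sum_congr rfl fun i _ => ?_
  rw [fieldMat_apply, Finset.mul_sum, Finset.sum_mul]
  refine Finset.sum_congr rfl fun c _ => ?_
  rw [map_mul, map_mul]
  ring

theorem eval_tv (T : Tensor d N) (i : Idx d N) :
    evalAt tcoord T (tv (Fin d) i) = C (T i) := by
  rw [tv, MvPowerSeries.map_C]
  congr 1
  simp [tcoord, mul_comm Complex.I, Complex.re_add_im]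

theorem eval_tb (T : Tensor d N) (i : Idx d N) :
    evalAt tcoord T (tb (Fin d) i) = C (star (T i)) := by
  rw [tb, MvPowerSeries.map_C]
  congr 1
  apply Complex.ext <;> simp [tcoord]

theorem eval_scal {I Ω : Type} (ξ : I → Ω → ℂ) (ω : Ω) (A : Series d) :
    evalAt ξ ω (scal I A) = A := by
  ext m
  simp

theorem eval_sesq (a : ℂ) (T : Tensor d N) (x : Herms d N) :
    evalAt tcoord T (-(scal (Idx d N × Bool) (C a) * sesq (fieldMat x))) = coupling a T x := by
  rw [map_neg, map_mul, eval_scal, coupling, sesq, map_sum]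
  simp only [map_sum, map_mul, eval_tv, eval_tb, eval_scal]

theorem fexp_zero {σ S : Type*} [CommRing S] [Algebra ℂ S] :
    fexp (0 : MvPowerSeries σ S) = 1 :=
  (eq_fexp (Ideal.zero_mem _) (by simp) (by simp)).symm

/-- Integration over the intermediate field. -/
theorem integral_field {a : ℝ} {Z : ℂ} (h : IsGaussian (hcoord (d := d) (N := N))
      (fun x => Complex.exp (-(a / 2 : ℂ) * ∑ c, (herm (x c) * herm (x c)).trace)) a Z)
    (ha : (a : ℂ) ≠ 0) (T : Tensor d N) :
    formalIntegral (fun x : Herms d N =>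
      Complex.exp (-(a / 2 : ℂ) * ∑ c, (herm (x c) * herm (x c)).trace) • fexp (coupling a T x)) =
    C Z * formalExp (∑ c, C (-(a : ℂ) / 2 * melonic c T) * (X c) ^ 2) := by
  have h1 := h.formalIntegral_eq (d := d) (fexp (-(scal (HIdx d N) (C (a : ℂ)) *
    ∑ i, scal (HIdx d N) (source T i) * C (MvPolynomial.X i))))
  rw [gaussF_fexp_linear ha _ (source_mem T)] at h1
  have h2 : ∀ x : Herms d N, evalAt hcoord x (fexp (-(scal (HIdx d N) (C (a : ℂ)) *
      ∑ i, scal (HIdx d N) (source T i) * C (MvPolynomial.X i)))) = fexp (coupling a T x) := by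
    intro x
    rw [← eval_source]
    exact map_fexp _ (linear_mem_ordIdeal _ (source_mem T) _)
  simp only [h2] at h1
  rw [h1, formalExp_eq]
  congr 2
  rw [Fintype.sum_prod_type, Finset.mul_sum]
  refine Finset.sum_congr rfl fun c _ => ?_
  rw [← sum_theta_sq, Finset.mul_sum, Finset.mul_sum, map_sum, Finset.sum_mul]
  refine Finset.sum_congr rfl fun p _ => ?_
  -- The square of the factor `i` in the source supplies the minus sign of the quartic term.
  rw [source, mul_pow, ← map_pow, ← mul_assoc, ← map_mul, mul_pow, Complex.I_sq]
  congr 2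
  ring

variable (σ : Fin d → Equiv.Perm (Fin n))

/-- The invariant as a polynomial in the real and imaginary parts of the tensor. -/
def invP (σ : Fin d → Equiv.Perm (Fin n)) : MvPowerSeries (Fin d) (MvPolynomial (Idx d N × Bool) ℂ) :=
  ∑ i : Fin n → Idx d N, ∑ j : Fin n → Idx d N,
    scal _ (∏ a, ∏ c, if i a c = j (σ c a) c then (1 : Series d) else 0) *
      ((∏ a, tv (Fin d) (i a)) * ∏ b, tb (Fin d) (j b))

theorem eval_invP (T : Tensor d N) : evalAt tcoord T (invP σ) = C (invariant σ T) := by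
  rw [invP, invariant, map_sum, map_sum]
  refine Finset.sum_congr rfl fun i _ => ?_
  rw [map_sum, map_sum]
  refine Finset.sum_congr rfl fun j _ => ?_
  rw [map_mul, eval_scal, map_mul (evalAt tcoord T), map_prod (evalAt tcoord T),
    map_prod (evalAt tcoord T), mul_comm, map_mul C, map_mul C, map_prod C, map_prod C, map_prod C]
  simp only [eval_tv, eval_tb]
  congr 1
  refine Finset.prod_congr rfl fun a _ => ?_
  rw [map_prod]
  refine Finset.prod_congr rfl fun c _ => ?_
  split_ifs <;> simp

/-- Integration over the tensor. -/
theorem integral_tensor {a : ℝ} {Z : ℂ} (h : IsGaussian (tcoord (d := d) (N := N))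
      (fun T => Complex.exp (-(a : ℂ) * quadratic T)) (2 * a : ℝ) Z)
    (haN : (a : ℂ) = (N : ℂ) ^ (d - 1)) (ha : (a : ℂ) ≠ 0) (x : Herms d N) :
    formalIntegral (fun T : Tensor d N => Complex.exp (-(a : ℂ) * quadratic T) •
      (C (invariant σ T) * fexp (coupling a T x))) =
    C Z * ((∑ s, pairingWeight σ s x) * ((kernel x).det)⁻¹) := by
  have hm := sesq_mem (σ := Fin d) (a := (a : ℂ)) (fieldMat_mem x)
  have h1 := h.formalIntegral_eq (d := d) (invP σ * fexp (-(scal (Idx d N × Bool) (C (a : ℂ)) *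
    sesq (fieldMat x))))
  have h2 : ∀ T : Tensor d N, evalAt tcoord T (invP σ * fexp (-(scal (Idx d N × Bool) (C (a : ℂ)) *
      sesq (fieldMat x)))) = C (invariant σ T) * fexp (coupling a T x) := by
    intro T
    rw [map_mul, eval_invP, ← eval_sesq]
    congr 1
    exact map_fexp _ hm
  simp only [h2] at h1
  rw [h1]
  congr 1
  have h3 : gaussF ((2 * a : ℝ) : ℂ) (invP σ * fexp (-(scal (Idx d N × Bool) (C (a : ℂ)) *
      sesq (fieldMat x)))) = pertE (fieldMat x) a (invP σ) := by
    rw [pertE]; push_cast; rfl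
  have hdet : pertE (fieldMat x) a 1 = ((kernel x).det)⁻¹ := by
    rw [MvPowerSeries.eq_inv_iff_mul_eq_one, kernel_eq, pertE_one_mul_det (fieldMat_mem x) ha]
    rw [kernel_eq, det_constantCoeff (fieldMat_mem x)]
    exact one_ne_zero
  rw [h3, invP, pertE_sum, ← hdet]
  simp only [pertE_sum, pertE_scal_mul, pertE_wick (fieldMat_mem x) ha, pairingWeight,
    ← kernel_eq]
  have h4 : ((1 / (a : ℂ)) ^ n) = (((N : ℂ) ^ (n * (d - 1)))⁻¹) := by
    rw [haN, mul_comm n, pow_mul, one_div, inv_pow]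
  rw [h4, ← Finset.mul_sum, Finset.sum_comm (s := (Finset.univ : Finset (Equiv.Perm (Fin n)))),
    mul_assoc, Finset.sum_mul, Finset.mul_sum]
  refine Finset.sum_congr rfl fun i _ => ?_
  rw [Finset.sum_comm (s := (Finset.univ : Finset (Equiv.Perm (Fin n)))), Finset.sum_mul,
    Finset.mul_sum]
  refine Finset.sum_congr rfl fun j _ => ?_
  simp only [Finset.prod_mul_distrib, ← Finset.sum_mul]
  ring

/-- Variables of the joint integral over the tensor and the intermediate field. -/
def jcoord (i : (Idx d N × Bool) ⊕ HIdx d N) (ω : Tensor d N × Herms d N) : ℂ :=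
  Sum.elim (fun i => tcoord i ω.1) (fun i => hcoord i ω.2) i

/-- A series with polynomial coefficients in the tensor and the intermediate field which evaluates
to `B(T) exp (coupling)`. -/
theorem exists_joint (a : ℂ) : ∃ F : MvPowerSeries (Fin d)
    (MvPolynomial ((Idx d N × Bool) ⊕ HIdx d N) ℂ), ∀ (T : Tensor d N) (x : Herms d N),
      evalAt jcoord (T, x) F = C (invariant σ T) * fexp (coupling a T x) := by
  set iT : MvPowerSeries (Fin d) (MvPolynomial (Idx d N × Bool) ℂ) →+* MvPowerSeries (Fin d)
    (MvPolynomial ((Idx d N × Bool) ⊕ HIdx d N) ℂ) :=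
      MvPowerSeries.map ((MvPolynomial.rename Sum.inl : MvPolynomial (Idx d N × Bool) ℂ →ₐ[ℂ]
        MvPolynomial ((Idx d N × Bool) ⊕ HIdx d N) ℂ) : _ →+* _)
    with hiT
  have hT : ∀ T x F, evalAt jcoord (T, x) (iT F) = evalAt tcoord T F := by
    intro T x F
    ext m
    simp only [hiT, coeff_map]
    exact MvPolynomial.eval_rename _ _ _
  set L : (c : Fin d) → Idx d N → Idx d N → MvPolynomial ((Idx d N × Bool) ⊕ HIdx d N) ℂ :=
    fun c i j => ∑ p : Fin N × Fin N, MvPolynomial.X (Sum.inr (c, p)) *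
      MvPolynomial.C (lift c (hmat p) i j) with hL
  set Q : MvPowerSeries (Fin d) (MvPolynomial ((Idx d N × Bool) ⊕ HIdx d N) ℂ) :=
    -(scal _ (C a) * ∑ j, ∑ i, iT (tb _ j) * (∑ c, scal _ (C Complex.I * X c) * C (L c j i)) *
      iT (tv _ i)) with hQ
  have hQm : Q ∈ ordIdeal _ _ 1 := by
    refine neg_mem (Ideal.mul_mem_left _ _ (Ideal.sum_mem _ fun j _ => Ideal.sum_mem _ fun i _ =>
      Ideal.mul_mem_right _ _ (Ideal.mul_mem_left _ _ (Ideal.sum_mem _ fun c _ =>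
        Ideal.mul_mem_right _ _ (scal_mem_ordIdeal (Ideal.mul_mem_left _ _ (X_mem_ordIdeal c)))))))
  refine ⟨iT (invP σ) * fexp Q, fun T x => ?_⟩
  rw [map_mul, hT, eval_invP]
  congr 1
  rw [evalAt, map_fexp _ hQm, ← evalAt]
  congr 1
  rw [hQ, map_neg, map_mul, eval_scal, coupling, map_sum]
  congr 2
  refine Finset.sum_congr rfl fun j _ => ?_
  rw [map_sum]
  refine Finset.sum_congr rfl fun i _ => ?_
  rw [map_mul, map_mul, hT, hT, eval_tb, eval_tv, map_sum, fieldMat_apply]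
  congr 2
  refine Finset.sum_congr rfl fun c _ => ?_
  rw [map_mul, eval_scal, MvPowerSeries.map_C, hL, lift_herm_eq_sum]
  congr 2
  simp [jcoord, hcoord]

/-- Each coefficient of the joint integrand is a polynomial in both sets of variables against a
product weight; this provides the integrability needed for Fubini. -/
theorem joint_integrable {aT aX ZT ZX : ℂ} {wT : Tensor d N → ℂ} {wX : Herms d N → ℂ}
    (hT : IsGaussian (tcoord (d := d) (N := N)) wT aT ZT)
    (hX : IsGaussian (hcoord (d := d) (N := N)) wX aX ZX)
    (F : MvPowerSeries (Fin d) (MvPolynomial ((Idx d N × Bool) ⊕ HIdx d N) ℂ)) (m : Fin d →₀ ℕ) :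
    Integrable (fun ω : Tensor d N × Herms d N =>
      coeff m (evalAt jcoord ω F) * (wT ω.1 * wX ω.2)) (volume.prod volume) := by
  have h := integrable_eval (ξ := jcoord (d := d) (N := N)) (w := fun ω => wT ω.1 * wX ω.2)
    (fun k => ?_) (coeff m F)
  · rw [← Measure.volume_eq_prod]; simpa using h
  · have := (hT.integrable fun i => k (Sum.inl i)).mul_prod (hX.integrable fun i => k (Sum.inr i))
    refine this.congr (Filter.Eventually.of_forall fun ω => ?_)
    simp only [Fintype.prod_sum_type, jcoord, Sum.elim_inl, Sum.elim_inr]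
    ring

/-- Lifting multiplies traces by `N^{d-1}`. The intermediate field thus carries the same scale
`N^{d-1}` as the quadratic form of the tensor. -/
theorem trace_lift_sq (x : Herms d N) :
    -(1 / 2 : ℂ) * ∑ c, (lift c (herm (x c)) * lift c (herm (x c))).trace =
      -(((N : ℂ) ^ (d - 1)) / 2) * ∑ c, (herm (x c) * herm (x c)).trace := by
  simp only [lift_eq_liftS, liftS_mul, liftS_trace, ← Finset.mul_sum]
  ring

/-- Fubini for the joint integral: integrating the field first gives the tensor model, integrating
the tensor first gives the sum over Wick pairings. The constants are chosen before `n` and `σ`, so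
they also relate the two partition functions. -/
theorem numerator_eq (hN : 1 ≤ N) : ∃ ZT ZX : ℂ, ZT ≠ 0 ∧ ZX ≠ 0 ∧
    ∀ (n : ℕ) (σ : Fin d → Equiv.Perm (Fin n)),
      C ZX * formalIntegral (fun T : Tensor d N => invariant σ T • tensorWeight T) =
        C ZT * formalIntegral (fun x : Herms d N =>
          (∑ s, pairingWeight σ s x) * intermediateWeight x) := by
  have hN0 : (0 : ℝ) < N := by exact_mod_cast hN
  set a : ℝ := (N : ℝ) ^ (d - 1) with ha
  have ha0 : 0 < a := by positivity
  have haC : (a : ℂ) = (N : ℂ) ^ (d - 1) := by rw [ha]; push_cast; rfl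
  have ha1 : (a : ℂ) ≠ 0 := by exact_mod_cast ha0.ne'
  obtain ⟨ZT, hT⟩ := isGaussian_tensor d N ha0
  obtain ⟨ZX, hX⟩ := isGaussian_herms d N ha0
  refine ⟨ZT, ZX, hT.ne_zero, hX.ne_zero, fun n σ => ?_⟩
  obtain ⟨F, hF⟩ := exists_joint (d := d) (N := N) σ a
  ext m
  have hi := joint_integrable hT hX F m
  have hswap := integral_integral_swap (f := fun T x => coeff m (evalAt jcoord (T, x) F) *
    (Complex.exp (-(a : ℂ) * quadratic T) *
      Complex.exp (-(a / 2 : ℂ) * ∑ c, (herm (x c) * herm (x c)).trace))) hi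
  have hl : ∀ T : Tensor d N, ∫ x : Herms d N, coeff m (evalAt jcoord (T, x) F) *
      (Complex.exp (-(a : ℂ) * quadratic T) *
        Complex.exp (-(a / 2 : ℂ) * ∑ c, (herm (x c) * herm (x c)).trace)) =
      ZX * coeff m (invariant σ T • tensorWeight T) := by
    intro T
    have h1 := congrArg (coeff m) (integral_field hX ha1 T)
    change ∫ x : Herms d N, coeff m _ = _ at h1
    rw [coeff_C_mul] at h1
    rw [tensorWeight, coeff_smul, coeff_smul, ← haC, mul_comm ZX, mul_assoc, mul_assoc, mul_comm _ ZX,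
      ← h1, ← integral_const_mul, ← integral_const_mul]
    congr 1
    ext x
    rw [hF, coeff_C_mul, coeff_smul]
    ring
  have hr : ∀ x : Herms d N, ∫ T : Tensor d N, coeff m (evalAt jcoord (T, x) F) *
      (Complex.exp (-(a : ℂ) * quadratic T) *
        Complex.exp (-(a / 2 : ℂ) * ∑ c, (herm (x c) * herm (x c)).trace)) =
      ZT * coeff m ((∑ s, pairingWeight σ s x) * intermediateWeight x) := by
    intro x
    have h1 := congrArg (coeff m) (integral_tensor σ hT haC ha1 x)
    change ∫ T : Tensor d N, coeff m _ = _ at h1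
    rw [coeff_C_mul] at h1
    rw [intermediateWeight, mul_smul_comm, coeff_smul, trace_lift_sq, ← haC, mul_left_comm, ← h1,
      ← integral_const_mul]
    congr 1
    ext T
    rw [hF, coeff_smul]
    ring
  simp only [hl, hr] at hswap
  rw [integral_const_mul, integral_const_mul] at hswap
  rw [coeff_C_mul, coeff_C_mul]
  exact hswap

end IntermediateField

/-! ### The translated intermediate field -/

section Kernel

variable {d N n : ℕ}

/-- The sum over indices in the weight of a Wick pairing. -/
def pairSum {R : Type*} [CommRing R] (σ : Fin d → Equiv.Perm (Fin n)) (s : Equiv.Perm (Fin n))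
    (L : Matrix (Idx d N) (Idx d N) R) : R :=
  ∑ i : Fin n → Idx d N, ∑ j : Fin n → Idx d N,
    ∏ a, (L (i a) (j (s a)) * ∏ c, if i a c = j (σ c a) c then (1 : R) else 0)

theorem pairingWeight_eq (σ : Fin d → Equiv.Perm (Fin n)) (s : Equiv.Perm (Fin n))
    (x : Herms d N) : pairingWeight σ s x =
      C (((N : ℂ) ^ (n * (d - 1)))⁻¹) * pairSum σ s (kernel x)⁻¹ := rfl

theorem map_pairSum {R T : Type*} [CommRing R] [CommRing T] (φ : R →+* T)
    (σ : Fin d → Equiv.Perm (Fin n)) (s : Equiv.Perm (Fin n)) (L : Matrix (Idx d N) (Idx d N) R) :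
    φ (pairSum σ s L) = pairSum σ s (L.map φ) := by
  simp only [pairSum, map_sum, map_prod, map_mul, Matrix.map_apply, apply_ite φ, map_one, map_zero]

theorem pairSum_smul {R : Type*} [CommRing R] (σ : Fin d → Equiv.Perm (Fin n))
    (s : Equiv.Perm (Fin n)) (r : R) (L : Matrix (Idx d N) (Idx d N) R) :
    pairSum σ s (r • L) = r ^ n * pairSum σ s L := by
  simp only [pairSum, Finset.mul_sum]
  refine Finset.sum_congr rfl fun i _ => Finset.sum_congr rfl fun j _ => ?_
  simp only [Matrix.smul_apply, smul_eq_mul, mul_assoc]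
  rw [Finset.prod_mul_distrib]
  simp

theorem deriv_pairSum {k R : Type*} [CommRing k] [CommRing R] [Algebra k R] (δ : Derivation k R R)
    (σ : Fin d → Equiv.Perm (Fin n)) (s : Equiv.Perm (Fin n)) (L : Matrix (Idx d N) (Idx d N) R)
    (h : ∀ i j, δ (L i j) = 0) : δ (pairSum σ s L) = 0 := by
  classical
  simp only [pairSum, map_sum]
  refine Finset.sum_eq_zero fun i _ => Finset.sum_eq_zero fun j _ => ?_
  rw [deriv_prod]
  refine Finset.sum_eq_zero fun a _ => ?_
  rw [δ.leibniz, h, deriv_prod]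
  have : ∀ c, δ (if i a c = j (σ c a) c then (1 : R) else 0) = 0 := by
    intro c; split_ifs <;> simp
  simp [this]

theorem map_matrix_inv {R T ι : Type*} [CommRing R] [CommRing T] [Fintype ι] [DecidableEq ι]
    (φ : R →+* T) {K : Matrix ι ι R} (h : IsUnit K.det) : (K⁻¹).map φ = (K.map φ)⁻¹ := by
  refine (Matrix.inv_eq_right_inv ?_).symm
  rw [← Matrix.map_mul, Matrix.mul_nonsing_inv _ h, Matrix.map_one φ (map_zero φ) (map_one φ)]

/-- The matrix `X_c` of coordinate polynomials. -/
def hermP {S : Type*} [CommRing S] [Algebra ℂ S] (c : Fin d) :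
    Matrix (Fin N) (Fin N) (MvPolynomial (HIdx d N) S) :=
  Matrix.of fun a b => ∑ p : Fin N × Fin N,
    MvPolynomial.C (algebraMap ℂ S (hcoef p a b)) * MvPolynomial.X (c, p)

theorem eval_hermP (c : Fin d) (x : Herms d N) :
    (hermP (S := ℂ) c).map (MvPolynomial.eval fun i => hcoord i x) = herm (x c) := by
  ext a b
  rw [herm_eq_sum]
  simp [hermP, hcoord]

/-- The translate of the coordinates. -/
def shiftB (i : HIdx d N) : Series d := if i.2.1 = i.2.2 then alpha i.1 else 0

theorem alpha_mem (c : Fin d) : (alpha c : Series d) ∈ ordIdeal (Fin d) ℂ 1 :=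
  Ideal.mul_mem_right _ _ (Ideal.mul_mem_left _ _ (X_mem_ordIdeal c))

theorem shiftB_mem (i : HIdx d N) : shiftB i ∈ ordIdeal (Fin d) ℂ 1 := by
  rw [shiftB]
  split_ifs
  · exact alpha_mem _
  · exact Ideal.zero_mem _

/-- The sum of the diagonal basis matrices is the identity, so translating the coordinates by
`shiftB` adds `α_c` times the identity to `X_c`. -/
theorem sum_hcoef_diag (a b : Fin N) :
    (∑ p : Fin N × Fin N, if p.1 = p.2 then hcoef p a b else 0) = if a = b then 1 else 0 := by
  rw [Fintype.sum_prod_type]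
  simp only [Finset.sum_ite_eq, Finset.mem_univ, if_true]
  simp only [hcoef, Finset.sum_add_distrib, Prod.mk.injEq]
  by_cases h : a = b
  · subst h; simp
  · have h1 : ∀ x : Fin N, ¬(x = a ∧ x = b) := fun x hx => h (hx.1.symm.trans hx.2)
    have h2 : ∀ x : Fin N, ¬(x = b ∧ x = a) := fun x hx => h (hx.2.symm.trans hx.1)
    simp [h, h1, h2]

/-- `i ∑_c g_c (Y_c + t α_c)`. -/
def fieldT (d N : ℕ) : Matrix (Idx d N) (Idx d N)
    (MvPowerSeries (Fin d) (MvPolynomial (HIdx d N) (Polynomial ℂ))) :=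
  Matrix.of fun i j => ∑ c, emb (HIdx d N) (Fin d) (C Complex.I * X c) *
    (C (liftS c (hermP c) i j) + if i = j then tvar _ _ * emb (HIdx d N) (Fin d) (alpha c) else 0)

theorem emb_mem_ordIdeal {A : Series d} (h : A ∈ ordIdeal (Fin d) ℂ n) :
    emb (HIdx d N) (Fin d) A ∈ ordIdeal (Fin d) _ n := by
  change scal _ (MvPowerSeries.map Polynomial.C A) ∈ _
  exact map_mem_ordIdeal _ (map_mem_ordIdeal _ h)

theorem fieldT_mem (i j : Idx d N) : fieldT d N i j ∈ ordIdeal _ _ 1 := by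
  rw [fieldT, Matrix.of_apply]
  exact Ideal.sum_mem _ fun c _ => Ideal.mul_mem_right _ _ (emb_mem_ordIdeal
    (Ideal.mul_mem_left _ _ (X_mem_ordIdeal c)))

/-- The generator of the translation. -/
def dshift (d N : ℕ) : Derivation ℂ (MvPowerSeries (Fin d) (MvPolynomial (HIdx d N) (Polynomial ℂ)))
    (MvPowerSeries (Fin d) (MvPolynomial (HIdx d N) (Polynomial ℂ))) :=
  dt _ _ - ∑ i, emb (HIdx d N) (Fin d) (shiftB i) • pd i

theorem dshift_apply (F) : dshift d N F = dt _ _ F - ∑ i, emb (HIdx d N) (Fin d) (shiftB i) * pd i F := by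
  have h : ∀ s : Finset (HIdx d N), (∑ i ∈ s, emb (HIdx d N) (Fin d) (shiftB i) • (pd i : Derivation ℂ
      (MvPowerSeries (Fin d) (MvPolynomial (HIdx d N) (Polynomial ℂ))) _)) F =
      ∑ i ∈ s, emb (HIdx d N) (Fin d) (shiftB i) * pd i F := by
    intro s
    induction s using Finset.induction_on with
    | empty => simp
    | insert a s ha ih =>
      rw [Finset.sum_insert ha, Finset.sum_insert ha, Derivation.add_apply, ih]
      rfl
  rw [dshift, Derivation.sub_apply, h]

theorem dshift_emb (A : Series d) : dshift d N (emb (HIdx d N) (Fin d) A) = 0 := by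
  rw [dshift_apply, dt_emb]
  simp [pd_emb]

theorem dshift_X (i : HIdx d N) : dshift d N (C (MvPolynomial.X i)) = -emb (HIdx d N) (Fin d) (shiftB i) := by
  rw [dshift_apply, dt_X, zero_sub]
  simp [pd_X]

theorem dshift_tvar : dshift d N (tvar _ _) = 1 := by
  rw [dshift_apply, dt_tvar]
  simp [pd_tvar]

theorem dshift_hermP (c : Fin d) (a b : Fin N) :
    dshift d N (C (hermP c a b)) = if a = b then -emb (HIdx d N) (Fin d) (alpha c) else 0 := by
  have h1 : (C (hermP c a b) : MvPowerSeries (Fin d) (MvPolynomial (HIdx d N) (Polynomial ℂ))) =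
      ∑ p : Fin N × Fin N, emb (HIdx d N) (Fin d) (C (hcoef p a b)) * C (MvPolynomial.X (c, p)) := by
    simp only [hermP, Matrix.of_apply, map_sum, map_mul, emb, RingHom.comp_apply, MvPowerSeries.map_C]
    rfl
  have h2 : ∀ p : Fin N × Fin N, dshift d N (emb (HIdx d N) (Fin d) (C (hcoef p a b)) * C (MvPolynomial.X (c, p))) =
      -emb (HIdx d N) (Fin d) (C (if p.1 = p.2 then hcoef p a b else 0) * alpha c) := by
    intro p
    rw [Derivation.leibniz, dshift_emb, dshift_X, smul_zero, add_zero, smul_neg, smul_eq_mul,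
      ← map_mul]
    refine congrArg Neg.neg (congrArg _ ?_)
    rw [shiftB]
    split_ifs <;> simp
  rw [h1, map_sum]
  simp only [h2]
  rw [Finset.sum_neg_distrib, ← map_sum, ← Finset.sum_mul, ← map_sum, sum_hcoef_diag]
  split_ifs <;> simp

theorem dshift_lift (c : Fin d) (i j : Idx d N) :
    dshift d N (C (liftS c (hermP c) i j)) = if i = j then -emb (HIdx d N) (Fin d) (alpha c) else 0 := by
  simp only [liftS, Matrix.of_apply]
  by_cases h : ∀ c', c' ≠ c → i c' = j c'
  · rw [if_pos h, dshift_hermP]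
    have : i c = j c ↔ i = j := by
      constructor
      · intro h1
        funext c'
        by_cases h2 : c' = c
        · rw [h2, h1]
        · exact h c' h2
      · rintro rfl; rfl
    simp only [this]
  · rw [if_neg h, if_neg]
    · simp
    · rintro rfl
      exact h fun _ _ => rfl

/-- `fieldT` depends on `x` and `t` only through `x + t β`, which `dshift` annihilates. The same
then holds for the inverse matrix, the determinant and `interp`, and this is the hypothesis of
`gaussF_shift`. -/
theorem dshift_fieldT (i j : Idx d N) : dshift d N (fieldT d N i j) = 0 := by
  rw [fieldT, Matrix.of_apply, map_sum]
  refine Finset.sum_eq_zero fun c _ => ?_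
  rw [Derivation.leibniz, dshift_emb, map_add, dshift_lift]
  split_ifs
  · rw [Derivation.leibniz, dshift_tvar, dshift_emb]
    simp
  · simp

theorem isUnit_det_fieldT : IsUnit (1 + fieldT d N).det :=
  isUnit_of_constantCoeff_one (det_constantCoeff fieldT_mem)

/-- The interpolation between the weight of a Wick pairing and its translate. -/
def interp (N : ℕ) (σ : Fin d → Equiv.Perm (Fin n)) (s : Equiv.Perm (Fin n)) :
    MvPowerSeries (Fin d) (MvPolynomial (HIdx d N) (Polynomial ℂ)) :=
  emb (HIdx d N) (Fin d) (C (((N : ℂ) ^ (n * (d - 1)))⁻¹)) * pairSum σ s (1 + fieldT d N)⁻¹ *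
    Ring.inverse (1 + fieldT d N).det

theorem dshift_interp (σ : Fin d → Equiv.Perm (Fin n)) (s : Equiv.Perm (Fin n)) :
    dshift d N (interp N σ s) = 0 := by
  have h0 : (1 + fieldT d N).map (dshift d N) = 0 := by
    ext1 i j
    rw [Matrix.map_apply, Matrix.add_apply, map_add, dshift_fieldT, add_zero]
    have := congrFun (congrFun (deriv_matrix_one (dshift d N) (n := Idx d N)) i) j
    rwa [Matrix.map_apply] at this
  have h1 : ((1 + fieldT d N)⁻¹).map (dshift d N) = 0 := by
    rw [deriv_matrix_inv _ (Matrix.mul_nonsing_inv _ isUnit_det_fieldT), h0]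
    simp
  have h2 : dshift d N (1 + fieldT d N).det = 0 := by
    rw [deriv_det, h0]; simp
  have h3 : dshift d N (Ring.inverse (1 + fieldT d N).det) = 0 := by
    have h4 := congrArg (dshift d N) (Ring.inverse_mul_cancel _ (isUnit_det_fieldT (d := d) (N := N)))
    rw [Derivation.leibniz, h2, smul_zero, zero_add, Derivation.map_one_eq_zero, smul_eq_mul] at h4
    exact (isUnit_det_fieldT.mul_right_eq_zero).1 h4
  rw [interp, Derivation.leibniz, h3, Derivation.leibniz, dshift_emb,
    deriv_pairSum _ _ _ _ fun i j => by
      have := congrFun (congrFun h1 i) j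
      rwa [Matrix.map_apply] at this]
  simp

/-- Evaluation at the point `x` and the value `t` of the interpolation parameter. -/
def evT (t : ℂ) (x : Herms d N) :
    MvPowerSeries (Fin d) (MvPolynomial (HIdx d N) (Polynomial ℂ)) →+* Series d :=
  (evalAt hcoord x).comp (atT _ _ t)

theorem evT_emb (t : ℂ) (x : Herms d N) (A : Series d) : evT t x (emb (HIdx d N) (Fin d) A) = A := by
  rw [evT, RingHom.comp_apply, atT_emb, eval_scal]

theorem evT_fieldT (t : ℂ) (x : Herms d N) :
    (1 + fieldT d N).map (evT t x) =
      1 + Matrix.of fun i j => ∑ c, C Complex.I * X c *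
        (C (lift c (herm (x c)) i j) + if i = j then C t * alpha c else 0) := by
  ext1 i j
  rw [Matrix.map_apply, Matrix.add_apply, Matrix.add_apply, map_add]
  congr 1
  · simp only [Matrix.one_apply]
    split_ifs <;> simp
  · rw [fieldT, Matrix.of_apply, Matrix.of_apply, map_sum]
    refine Finset.sum_congr rfl fun c _ => ?_
    rw [map_mul, evT_emb, map_add]
    congr 2
    · rw [evT, RingHom.comp_apply, atT, MvPowerSeries.map_C, MvPowerSeries.map_C]
      congr 1
      simp only [liftS, lift, Matrix.of_apply]
      split_ifs
      · rw [herm_eq_sum, hermP]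
        simp [hcoord]
      · simp
    · split_ifs
      · rw [map_mul, evT_emb, evT, RingHom.comp_apply, atT_tvar, eval_scal]
      · simp

/-- Before evaluation the coefficients form a polynomial ring, so the inverse of the determinant is
a `Ring.inverse`; evaluation returns to inverses of series over `ℂ`. -/
theorem evT_interp (t : ℂ) (x : Herms d N) (σ : Fin d → Equiv.Perm (Fin n))
    (s : Equiv.Perm (Fin n)) {K : Matrix (Idx d N) (Idx d N) (Series d)}
    (hK : (1 + fieldT d N).map (evT t x) = K) (h1 : constantCoeff K.det = 1) :
    evT t x (interp N σ s) = C (((N : ℂ) ^ (n * (d - 1)))⁻¹) * pairSum σ s K⁻¹ * (K.det)⁻¹ := by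
  rw [interp, map_mul, map_mul, evT_emb, map_pairSum, map_matrix_inv _ isUnit_det_fieldT, hK]
  congr 1
  rw [MvPowerSeries.eq_inv_iff_mul_eq_one (by rw [h1]; exact one_ne_zero), ← hK]
  have : ((1 + fieldT d N).map (evT t x)).det = evT t x (1 + fieldT d N).det :=
    (RingHom.map_det _ _).symm
  rw [this, ← map_mul, Ring.inverse_mul_cancel _ isUnit_det_fieldT, map_one]

theorem evT_zero_interp (x : Herms d N) (σ : Fin d → Equiv.Perm (Fin n))
    (s : Equiv.Perm (Fin n)) :
    evT 0 x (interp N σ s) = pairingWeight σ s x * ((kernel x).det)⁻¹ := by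
  rw [evT_interp (K := kernel x), pairingWeight_eq]
  · rw [evT_fieldT, kernel_eq]
    congr 1
    ext1 i j
    rw [fieldMat_apply]
    simp
  · rw [kernel_eq, det_constantCoeff (fieldMat_mem x)]

/-- `∑_c α_c Y_c`. -/
def alphaMat (x : Herms d N) : Matrix (Idx d N) (Idx d N) (Series d) :=
  ∑ c, alpha c • (lift c (herm (x c))).map C

theorem alphaMat_apply (x : Herms d N) (i j : Idx d N) :
    alphaMat x i j = ∑ c, alpha c * C (lift c (herm (x c)) i j) := by
  simp [alphaMat, Matrix.sum_apply]

theorem alphaMat_mem (x : Herms d N) (i j : Idx d N) : alphaMat x i j ∈ ordIdeal (Fin d) ℂ 1 := by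
  rw [alphaMat_apply]
  exact Ideal.sum_mem _ fun c _ => Ideal.mul_mem_right _ _ (alpha_mem c)

theorem G_eq (d : ℕ) : C Complex.I * G d = sumSq d * rootSeries d := by
  have hI : (C (σ := Fin d) Complex.I) * C (Complex.I⁻¹) = 1 := by
    rw [← map_mul, mul_inv_cancel₀ Complex.I_ne_zero, map_one]
  rw [G, sumSq, Finset.mul_sum, Finset.sum_mul]
  refine Finset.sum_congr rfl fun c _ => ?_
  rw [alpha]
  linear_combination (X c ^ 2 * rootSeries d) * hI

/-- With `r = rootSeries d` and `S = ∑ g_c²` one has `iG = S r`, so the claim is the quadratic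
equation `r + S r² = 1`. It makes `rootSeries` the inverse of `1 + iG`. -/
theorem one_add_G_mul (d : ℕ) : (1 + C Complex.I * G d) * rootSeries d = 1 := by
  rw [G_eq]
  linear_combination rootSeries_quadratic d

/-- The saddle point equation that fixes the translation: `α_c = -i g_c r`, where `r` is the inverse
of `1 + iG`. -/
theorem saddle (c : Fin d) : C Complex.I * X c = -(alpha c * (1 + C Complex.I * G d)) := by
  have hI : (C (σ := Fin d) Complex.I) * C Complex.I = -1 := by
    rw [← map_mul, Complex.I_mul_I]; simp
  have h := one_add_G_mul d
  rw [alpha, Complex.inv_I]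
  rw [map_neg]
  linear_combination (-C Complex.I * X c) * h

/-- After the translation the scalar part of the kernel is `1 + iG`, and by `saddle` the same factor
can be taken out of the part linear in the field. -/
theorem evT_one_fieldT (x : Herms d N) :
    (1 + fieldT d N).map (evT 1 x) = (1 + C Complex.I * G d) • (1 - alphaMat x) := by
  rw [evT_fieldT]
  ext1 i j
  rw [Matrix.add_apply, Matrix.of_apply, Matrix.smul_apply, Matrix.sub_apply, smul_eq_mul, mul_sub,
    alphaMat_apply, Finset.mul_sum]
  simp only [mul_add, Finset.sum_add_distrib, map_one, one_mul, Matrix.one_apply]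
  have h1 : ∀ c : Fin d, C Complex.I * X c * C (lift c (herm (x c)) i j) =
      -((1 + C Complex.I * G d) * (alpha c * C (lift c (herm (x c)) i j))) := by
    intro c
    rw [saddle]; ring
  simp only [h1, Finset.sum_neg_distrib]
  by_cases h : i = j
  · simp only [h, if_true]
    rw [G, Finset.mul_sum]
    simp only [mul_assoc]
    ring
  · simp only [h, if_false, mul_zero, Finset.sum_const_zero]
    ring

end Kernel

/-! ### Linearity of formal integrals and cancellation of normalisations. -/

section FormalIntegral

variable {d : ℕ} {Ω : Type} [MeasureSpace Ω]

theorem formalIntegral_sum {ι : Type*} (s : Finset ι) (F : ι → Ω → Series d)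
    (h : ∀ i ∈ s, ∀ m, Integrable fun ω => coeff m (F i ω)) :
    formalIntegral (fun ω => ∑ i ∈ s, F i ω) = ∑ i ∈ s, formalIntegral (F i) := by
  ext m
  change ∫ ω, coeff m _ = _
  rw [map_sum]
  simp only [map_sum]
  rw [integral_finsetSum _ fun i hi => h i hi m]
  rfl

theorem integrable_const_mul (A : Series d) {F : Ω → Series d}
    (h : ∀ m, Integrable fun ω => coeff m (F ω)) (m : Fin d →₀ ℕ) :
    Integrable fun ω => coeff m (A * F ω) := by
  classical
  simp only [coeff_mul]
  exact integrable_finsetSum _ fun p _ => (h p.2).const_mul _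

theorem formalIntegral_const_mul (A : Series d) {F : Ω → Series d}
    (h : ∀ m, Integrable fun ω => coeff m (F ω)) :
    formalIntegral (fun ω => A * F ω) = A * formalIntegral F := by
  classical
  ext m
  change ∫ ω, coeff m _ = _
  simp only [coeff_mul]
  rw [integral_finsetSum _ fun p _ => (h p.2).const_mul _]
  refine Finset.sum_congr rfl fun p _ => ?_
  rw [integral_const_mul]
  rfl

theorem mul_mul_inv_cancel {U : Series d} (hU : constantCoeff U ≠ 0) (A B : Series d) :
    (U * A) * (U * B)⁻¹ = A * B⁻¹ := by
  rw [MvPowerSeries.mul_inv_rev]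
  have := MvPowerSeries.mul_inv_cancel U hU
  linear_combination (A * B⁻¹) * this

end FormalIntegral

/-! ### From the intermediate field to the matrix model. -/

section Translation

variable {d N n : ℕ}

theorem intermediateWeight_eq (x : Herms d N) : intermediateWeight x =
    Complex.exp (-((((N : ℝ) ^ (d - 1) : ℝ) : ℂ) / 2) * ∑ c, (herm (x c) * herm (x c)).trace) •
      ((kernel x).det)⁻¹ := by
  rw [intermediateWeight, trace_lift_sq]
  push_cast
  rfl

theorem wick_integrand (σ : Fin d → Equiv.Perm (Fin n)) (s : Equiv.Perm (Fin n)) (x : Herms d N) :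
    pairingWeight σ s x * intermediateWeight x =
      Complex.exp (-((((N : ℝ) ^ (d - 1) : ℝ) : ℂ) / 2) * ∑ c, (herm (x c) * herm (x c)).trace) •
        evalAt hcoord x (atT _ _ 0 (interp N σ s)) := by
  have h := evT_zero_interp x σ s
  rw [evT, RingHom.comp_apply] at h
  rw [h, intermediateWeight_eq, mul_smul_comm]

theorem pairSum_zero {R : Type*} [CommRing R] (σ : Fin d → Equiv.Perm (Fin 0))
    (s : Equiv.Perm (Fin 0)) (L : Matrix (Idx d N) (Idx d N) R) : pairSum σ s L = 1 := by
  simp [pairSum]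

theorem pairingWeight_zero (σ : Fin d → Equiv.Perm (Fin 0)) (s : Equiv.Perm (Fin 0))
    (x : Herms d N) : pairingWeight σ s x = 1 := by
  rw [pairingWeight_eq, pairSum_zero]; simp

theorem tensorExpectation_eq (hN : 1 ≤ N) (σ : Fin d → Equiv.Perm (Fin n)) :
    tensorExpectation (fun T : Tensor d N => invariant σ T) =
      ∑ s : Equiv.Perm (Fin n), wickTerm N σ s := by
  have hN0 : (0 : ℝ) < N := by exact_mod_cast hN
  obtain ⟨ZT, ZX, hT, hX, h⟩ := numerator_eq (d := d) hN
  obtain ⟨Z, hZ⟩ := isGaussian_herms d N (a := (N : ℝ) ^ (d - 1)) (by positivity)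
  have h1 := h n σ
  -- For `n = 0` the invariant is `1`, so this compares the partition functions with the same two
  -- constants.
  have h0 := h 0 fun _ => 1
  have e0 : ∀ T : Tensor d N, invariant (fun _ : Fin d => (1 : Equiv.Perm (Fin 0))) T = 1 := by
    intro T; simp [invariant]
  simp only [pairingWeight_zero, e0, one_smul, Finset.univ_unique, Finset.sum_singleton,
    one_mul] at h0
  have hs : formalIntegral (fun x : Herms d N => (∑ s, pairingWeight σ s x) * intermediateWeight x)
      = ∑ s, formalIntegral fun x : Herms d N => pairingWeight σ s x * intermediateWeight x := by
    simp only [Finset.sum_mul]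
    refine formalIntegral_sum _ _ fun s _ m => ?_
    simp only [wick_integrand]
    exact hZ.integrable_coeff _ m
  have hc : constantCoeff (C (σ := Fin d) ZX) ≠ 0 := by simpa using hX
  have hc' : constantCoeff (C (σ := Fin d) ZT) ≠ 0 := by simpa using hT
  rw [tensorExpectation, ← mul_mul_inv_cancel hc, h1, h0, mul_mul_inv_cancel hc', hs,
    Finset.sum_mul]
  rfl

theorem rootSeries_constantCoeff (d : ℕ) : constantCoeff (rootSeries d) = 1 := by
  have h := congrArg constantCoeff (rootSeries_quadratic d)
  rw [map_sub, map_one, map_mul] at h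
  rw [h]
  simp [sumSq]

/-- `tr ∑_{p ≥ 2} B^p / p` for a matrix `B` of series without constant term. -/
def logTail {ι : Type*} [Fintype ι] [DecidableEq ι] (B : Matrix ι ι (Series d)) : Series d :=
  fun m => ∑ p ∈ Finset.Icc 2 m.degree, coeff m (B ^ p).trace / (p : ℂ)

theorem trace_pow_mem {ι S σ : Type*} [Fintype ι] [DecidableEq ι] [CommRing S]
    {B : Matrix ι ι (MvPowerSeries σ S)} (hB : ∀ i j, B i j ∈ ordIdeal σ S 1) (p : ℕ) :
    (B ^ p).trace ∈ ordIdeal σ S p :=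
  Ideal.sum_mem _ fun i _ => matrix_pow_mem hB p i i

theorem logTail_mem {ι : Type*} [Fintype ι] [DecidableEq ι] (B : Matrix ι ι (Series d)) :
    logTail B ∈ ordIdeal (Fin d) ℂ 1 := by
  rw [mem_ordIdeal]
  intro m hm
  change ∑ p ∈ Finset.Icc 2 m.degree, coeff m (B ^ p).trace / (p : ℂ) = 0
  rw [Finset.Icc_eq_empty (by omega), Finset.sum_empty]

theorem logTail_add_trace {ι : Type*} [Fintype ι] [DecidableEq ι] {B : Matrix ι ι (Series d)}
    (hB : ∀ i j, B i j ∈ ordIdeal (Fin d) ℂ 1) (n : ℕ) :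
    logTail B + B.trace - ∑ p ∈ Finset.Ico 1 n, C (algebraMap ℂ ℂ (1 / p)) * (B ^ p).trace ∈
      ordIdeal (Fin d) ℂ n := by
  rw [mem_ordIdeal]
  intro m hm
  have hz : ∀ p, m.degree < p → coeff m (B ^ p).trace = 0 := fun p hp =>
    mem_ordIdeal.1 (trace_pow_mem hB p) m hp
  have h1 : coeff m (logTail B) = ∑ p ∈ Finset.Icc 2 m.degree, coeff m (B ^ p).trace / (p : ℂ) :=
    rfl
  rw [map_sub, map_add, map_sum, h1, sub_eq_zero]
  have h2 : ∀ p : ℕ, coeff m (C (algebraMap ℂ ℂ (1 / p)) * (B ^ p).trace) =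
      coeff m (B ^ p).trace / (p : ℂ) := by
    intro p
    rw [coeff_C_mul]
    simp [div_eq_inv_mul]
  simp only [h2]
  have h3 : ∑ p ∈ Finset.Ico 1 n, coeff m (B ^ p).trace / (p : ℂ) =
      ∑ p ∈ Finset.Icc 1 m.degree, coeff m (B ^ p).trace / (p : ℂ) := by
    symm
    refine Finset.sum_subset (fun p hp => ?_) fun p hp hp' => ?_
    · simp only [Finset.mem_Icc, Finset.mem_Ico] at *; omega
    · rw [hz, zero_div]
      simp only [Finset.mem_Icc, Finset.mem_Ico] at *; omega
  rw [h3]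
  rcases Nat.eq_zero_or_pos m.degree with h0 | h0
  · have := hz 1 (by omega)
    rw [pow_one] at this
    rw [h0, this]; simp
  · have : Finset.Icc 1 m.degree = insert 1 (Finset.Icc 2 m.degree) := by
      ext p; simp only [Finset.mem_Icc, Finset.mem_insert]; omega
    rw [this, Finset.sum_insert (by simp), add_comm]
    simp

/-- The exponential of `-tr ln (1 - B)` is separated into its term linear in `B`, to be cancelled by
the translation, and the terms of order at least two, which form the potential. -/
theorem inv_det_one_sub {ι : Type*} [Fintype ι] [DecidableEq ι] {B : Matrix ι ι (Series d)}
    (hB : ∀ i j, B i j ∈ ordIdeal (Fin d) ℂ 1) :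
    ((1 - B).det)⁻¹ = fexp (logTail B) * fexp B.trace := by
  have ht : B.trace ∈ ordIdeal (Fin d) ℂ 1 := by
    have := trace_pow_mem hB 1; rwa [pow_one] at this
  have hd : constantCoeff (1 - B).det = 1 := by
    rw [sub_eq_add_neg]
    exact det_constantCoeff fun i j => by simpa using hB i j
  symm
  rw [MvPowerSeries.eq_inv_iff_mul_eq_one (by rw [hd]; exact one_ne_zero),
    ← fexp_add (logTail_mem B) ht, mul_comm]
  refine det_mul_fexp hB ?_ (logTail_add_trace hB)
  exact Ideal.add_mem _ (logTail_mem B) ht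

theorem trace_herm (x : Fin N → Fin N → ℝ) : (herm x).trace = ∑ a, (x a a : ℂ) := by
  simp [Matrix.trace, herm]

theorem alphaMat_trace (x : Herms d N) :
    (alphaMat x).trace = C ((N : ℂ) ^ (d - 1)) * ∑ i, shiftB i * C (hcoord i x) := by
  rw [alphaMat, Matrix.trace_sum, Fintype.sum_prod_type, Finset.mul_sum]
  refine Finset.sum_congr rfl fun c _ => ?_
  have h1 : ((lift c (herm (x c))).map (C (σ := Fin d))).trace =
      C (lift c (herm (x c))).trace := by
    simp [Matrix.trace]
  rw [Matrix.trace_smul, h1, lift_eq_liftS, liftS_trace, trace_herm, Fintype.sum_prod_type,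
    map_mul, map_sum, smul_eq_mul]
  simp only [shiftB, ite_mul, zero_mul, Finset.sum_ite_eq, Finset.mem_univ, if_true, hcoord,
    ← Finset.mul_sum]
  ring

/-- The cross term of the translated Gaussian is `exp (-tr ∑ α_c Y_c)`, the inverse of the linear
factor of `inv_det_one_sub`. The powers of `rootSeries` come from the factor `1 + iG` of the `n`
propagators and of the determinant. -/
theorem shift_integrand (σ : Fin d → Equiv.Perm (Fin n)) (s : Equiv.Perm (Fin n)) (x : Herms d N) :
    evalAt hcoord x (atT _ _ 1 (interp N σ s) * fexp (-(scal (HIdx d N) (C ((N : ℂ) ^ (d - 1))) *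
      ∑ i, scal _ (shiftB i) * C (MvPolynomial.X i)))) =
    (C (((N : ℂ) ^ (n * (d - 1)))⁻¹) * rootSeries d ^ n * rootSeries d ^ Fintype.card (Idx d N)) *
      (pairSum σ s (1 - alphaMat x)⁻¹ * fexp (logTail (alphaMat x))) := by
  have hB := alphaMat_mem x
  have hlin := linear_mem_ordIdeal (shiftB (d := d) (N := N)) shiftB_mem (scal _ (C ((N : ℂ) ^ (d - 1))))
  have he : evalAt hcoord x (fexp (-(scal (HIdx d N) (C ((N : ℂ) ^ (d - 1))) *
      ∑ i, scal _ (shiftB i) * C (MvPolynomial.X i)))) = fexp (-(alphaMat x).trace) := by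
    rw [evalAt, map_fexp _ hlin, ← evalAt]
    congr 1
    rw [map_neg, map_mul, eval_scal, map_sum, alphaMat_trace]
    congr 2
    simp only [map_mul, eval_scal, MvPowerSeries.map_C, MvPolynomial.eval_X]
  have hd1 : constantCoeff (1 - alphaMat x).det = 1 := by
    rw [sub_eq_add_neg]
    exact det_constantCoeff fun i j => by simpa using hB i j
  have hG : constantCoeff (1 + C Complex.I * G d) = 1 := by
    have := congrArg constantCoeff (one_add_G_mul d)
    rwa [map_mul, rootSeries_constantCoeff, mul_one, map_one] at this
  have hK := evT_interp 1 x σ s (evT_one_fieldT x) (by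
    rw [Matrix.det_smul, map_mul, map_pow, hG, hd1]; simp)
  rw [evT, RingHom.comp_apply] at hK
  rw [map_mul, he, hK]
  have hinv : ((1 + C Complex.I * G d) • (1 - alphaMat x))⁻¹ =
      rootSeries d • (1 - alphaMat x)⁻¹ := by
    apply Matrix.inv_eq_right_inv
    rw [Matrix.smul_mul, Matrix.mul_smul, Matrix.mul_nonsing_inv, smul_smul, one_add_G_mul, one_smul]
    exact isUnit_of_constantCoeff_one hd1
  have ht : (alphaMat x).trace ∈ ordIdeal (Fin d) ℂ 1 := by
    have := trace_pow_mem hB 1; rwa [pow_one] at this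
  have hcancel : fexp (alphaMat x).trace * fexp (-(alphaMat x).trace) = 1 := by
    rw [← fexp_add ht (neg_mem ht), add_neg_cancel, fexp_zero]
  have hpow : ∀ k, ((1 + C Complex.I * G d) ^ k)⁻¹ = rootSeries d ^ k := by
    intro k
    symm
    rw [MvPowerSeries.eq_inv_iff_mul_eq_one (by rw [map_pow, hG]; simp), ← mul_pow, mul_comm,
      one_add_G_mul, one_pow]
  rw [hinv, pairSum_smul, Matrix.det_smul, MvPowerSeries.mul_inv_rev, hpow, inv_det_one_sub hB]
  linear_combination (C (((N : ℂ) ^ (n * (d - 1)))⁻¹) * rootSeries d ^ n *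
    rootSeries d ^ Fintype.card (Idx d N) *
      pairSum σ s (1 - alphaMat x)⁻¹ * fexp (logTail (alphaMat x))) * hcancel


theorem herm_smul (κ : ℝ) (x : Fin N → Fin N → ℝ) : herm (κ • x) = (κ : ℂ) • herm x := by
  ext a b
  simp only [herm, Matrix.of_apply, Matrix.smul_apply, Pi.smul_apply, smul_eq_mul]
  push_cast
  split_ifs <;> ring

theorem lift_smul (c : Fin d) (κ : ℂ) (M : Matrix (Fin N) (Fin N) ℂ) :
    lift c (κ • M) = κ • lift c M := by
  ext i j
  simp [lift]

theorem alphaMat_smul (κ : ℝ) (hκ : κ = (N : ℝ) ^ ((2 - (d : ℝ)) / 2)) (y : Herms d N) :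
    alphaMat (κ • y) = coupled y := by
  rw [alphaMat, coupled]
  refine Finset.sum_congr rfl fun c _ => ?_
  rw [Pi.smul_apply, herm_smul, lift_smul, ← hκ]
  ext i j : 1
  simp only [Matrix.smul_apply, Matrix.map_apply, smul_eq_mul, map_mul]
  ring

theorem potential_eq (y : Herms d N) : potential y = logTail (coupled y) := rfl

theorem formalIntegral_comp_smul (κ : ℝ) (F : Herms d N → Series d) :
    ∃ u : ℝ, u = |(κ ^ Module.finrank ℝ (Herms d N))⁻¹| ∧
      formalIntegral (fun y : Herms d N => F (κ • y)) = C (u : ℂ) * formalIntegral F := by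
  refine ⟨_, rfl, ?_⟩
  ext m
  change ∫ y : Herms d N, coeff m (F (κ • y)) = _
  haveI h1 : (volume : Measure (Fin N → Fin N → ℝ)).IsAddHaarMeasure :=
    Measure.pi.isAddHaarMeasure (fun _ => volume)
  haveI h2 : (volume : Measure (Herms d N)).IsAddHaarMeasure :=
    Measure.pi.isAddHaarMeasure (fun _ => volume)
  rw [Measure.integral_comp_smul volume (fun x => coeff m (F x)) κ, coeff_C_mul]
  rfl

/-- The weight of the matrix model, as a function of `x = N^{(2-d)/2} y`. -/
theorem matrixWeight_eq (hN : 1 ≤ N) (κ : ℝ) (hκ : κ = (N : ℝ) ^ ((2 - (d : ℝ)) / 2))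
    (hd : 1 ≤ d) (y : Herms d N) : matrixWeight y =
    Complex.exp (-((((N : ℝ) ^ (d - 1) : ℝ) : ℂ) / 2) *
        ∑ c, (herm ((κ • y) c) * herm ((κ • y) c)).trace) •
      fexp (logTail (alphaMat (κ • y))) := by
  have hN0 : (0 : ℝ) < N := by exact_mod_cast hN
  -- The exponent `(2 - d) / 2` is the one that turns the scale `N^{d-1}` into the scale `N` of the
  -- matrix model.
  have hk : (N : ℝ) ^ (d - 1) * κ ^ 2 = N := by
    rw [hκ, ← Real.rpow_natCast, ← Real.rpow_natCast, ← Real.rpow_mul hN0.le,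
      ← Real.rpow_add hN0]
    push_cast [hd]
    ring_nf
    exact Real.rpow_one _
  rw [alphaMat_smul κ hκ, matrixWeight, potential_eq, formalExp_eq]
  congr 2
  simp only [Pi.smul_apply, herm_smul, Matrix.smul_mul, Matrix.mul_smul, Matrix.trace_smul,
    smul_eq_mul, ← Finset.mul_sum]
  have hk' : (((N : ℝ) ^ (d - 1) : ℝ) : ℂ) * (κ : ℂ) ^ 2 = N := by exact_mod_cast hk
  linear_combination (1 / 2 * ∑ c, (herm (y c) * herm (y c)).trace) * hk'

/-- Translation followed by rescaling. `U` collects the Jacobian, the exponential of the square of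
the translation and the power of `1 + iG` from the determinant. It does not depend on `n`, `σ` or
`s`, so it drops out of the ratio with the case `n = 0`. -/
theorem wickTerm_numerator (hd : 1 ≤ d) (hN : 1 ≤ N) : ∃ U : Series d, constantCoeff U ≠ 0 ∧
    ∀ (n : ℕ) (σ : Fin d → Equiv.Perm (Fin n)) (s : Equiv.Perm (Fin n)),
      formalIntegral (fun x : Herms d N => pairingWeight σ s x * intermediateWeight x) =
        U * (C (((N : ℂ) ^ (n * (d - 1)))⁻¹) * rootSeries d ^ n *
          formalIntegral fun y : Herms d N => pairSum σ s (1 - coupled y)⁻¹ * matrixWeight y) := by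
  have hN0 : (0 : ℝ) < N := by exact_mod_cast hN
  have ha0 : (0 : ℝ) < (N : ℝ) ^ (d - 1) := by positivity
  obtain ⟨Z, hZ⟩ := isGaussian_herms d N ha0
  set w : Herms d N → ℂ := fun x =>
    Complex.exp (-((((N : ℝ) ^ (d - 1) : ℝ) : ℂ) / 2) * ∑ c, (herm (x c) * herm (x c)).trace) with hw
  set κ : ℝ := (N : ℝ) ^ ((2 - (d : ℝ)) / 2) with hκ
  have hκ0 : 0 < κ := Real.rpow_pos_of_pos hN0 _
  have ha1 : (((N : ℝ) ^ (d - 1) : ℝ) : ℂ) ≠ 0 := by exact_mod_cast ha0.ne'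
  have haC : (((N : ℝ) ^ (d - 1) : ℝ) : ℂ) = (N : ℂ) ^ (d - 1) := by push_cast; rfl
  set E := fexp (-(C ((((N : ℝ) ^ (d - 1) : ℝ) : ℂ) / 2) *
    ∑ i : HIdx d N, (shiftB i : Series d) ^ 2)) with hE
  set R' := rootSeries d ^ Fintype.card (Idx d N) with hR'
  set u : ℝ := |(κ ^ Module.finrank ℝ (Herms d N))⁻¹| with hu
  have hu0 : (u : ℂ) ≠ 0 := by
    have : u ≠ 0 := by
      rw [hu]; positivity
    exact_mod_cast this
  have hEm : -(C ((((N : ℝ) ^ (d - 1) : ℝ) : ℂ) / 2) *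
      ∑ i : HIdx d N, (shiftB i : Series d) ^ 2) ∈ ordIdeal (Fin d) ℂ 1 :=
    neg_mem (Ideal.mul_mem_left _ _ (Ideal.sum_mem _ fun i _ => by
      rw [sq]; exact Ideal.mul_mem_right _ _ (shiftB_mem i)))
  refine ⟨E * R' * C (u : ℂ)⁻¹, ?_, fun n σ s => ?_⟩
  · rw [map_mul, map_mul, hE, constantCoeff_fexp hEm, hR', map_pow, rootSeries_constantCoeff]
    simpa using hu0
  · set V := C (((N : ℂ) ^ (n * (d - 1)))⁻¹) * rootSeries d ^ n with hV
    have hV0 : constantCoeff (V * R') ≠ 0 := by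
      rw [hV, hR', map_mul, map_mul, map_pow, map_pow, rootSeries_constantCoeff]
      simp
      intro h; omega
    set Q := fexp (-(scal (HIdx d N) (C ((N : ℂ) ^ (d - 1))) *
      ∑ i : HIdx d N, scal _ (shiftB i) * C (MvPolynomial.X i))) with hQ
    have h1 : formalIntegral (fun x : Herms d N => pairingWeight σ s x * intermediateWeight x) =
        E * formalIntegral (fun x => w x • evalAt hcoord x (atT _ _ 1 (interp N σ s) * Q)) := by
      simp only [wick_integrand]
      rw [hZ.formalIntegral_eq, hZ.formalIntegral_eq,
        gaussF_shift ha1 shiftB shiftB_mem _ (sub_eq_zero.1 (by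
          rw [← dshift_apply]; exact dshift_interp σ s)), hE, hQ, haC]
      ring
    set H : Herms d N → Series d := fun x => w x •
      (pairSum σ s (1 - alphaMat x)⁻¹ * fexp (logTail (alphaMat x))) with hH
    have h2 : ∀ x, w x • evalAt hcoord x (atT _ _ 1 (interp N σ s) * Q) = (V * R') * H x := by
      intro x
      rw [hQ, shift_integrand, hH, mul_smul_comm]
    have h3 : ∀ x, H x = (V * R')⁻¹ *
        (w x • evalAt hcoord x (atT _ _ 1 (interp N σ s) * Q)) := by
      intro x
      rw [h2, ← mul_assoc, MvPowerSeries.inv_mul_cancel _ hV0, one_mul]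
    have hHi : ∀ m, Integrable fun x => coeff m (H x) := by
      intro m
      simp only [h3]
      exact integrable_const_mul _ (fun m => hZ.integrable_coeff _ m) m
    have h4 : formalIntegral (fun x => w x • evalAt hcoord x (atT _ _ 1 (interp N σ s) * Q)) =
        V * R' * formalIntegral H := by
      simp only [h2]
      exact formalIntegral_const_mul _ hHi
    obtain ⟨u', hu', h5⟩ := formalIntegral_comp_smul κ H
    have h6 : ∀ y : Herms d N, H (κ • y) = pairSum σ s (1 - coupled y)⁻¹ * matrixWeight y := by
      intro y
      rw [hH, matrixWeight_eq hN κ hκ hd]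
      simp only [hw]
      rw [← mul_smul_comm, alphaMat_smul κ hκ]
    rw [← hu] at hu'
    rw [hu'] at h5
    simp only [h6] at h5
    have hC : C (σ := Fin d) (u : ℂ)⁻¹ * C (u : ℂ) = 1 := by
      rw [← map_mul, inv_mul_cancel₀ hu0, map_one]
    rw [h1, h4, h5]
    linear_combination (-E * V * R' * formalIntegral H) * hC

/-- The contribution of a Wick pairing as an expectation in the matrix model. -/
theorem wickTerm_eq (hd : 1 ≤ d) (hN : 1 ≤ N) (σ : Fin d → Equiv.Perm (Fin n))
    (s : Equiv.Perm (Fin n)) : wickTerm N σ s =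
      C (((N : ℂ) ^ (n * (d - 1)))⁻¹) * rootSeries d ^ n *
        ((formalIntegral fun y : Herms d N => pairSum σ s (1 - coupled y)⁻¹ * matrixWeight y) *
          (formalIntegral fun y : Herms d N => matrixWeight y)⁻¹) := by
  obtain ⟨U, hU, h⟩ := wickTerm_numerator (d := d) hd hN
  have h1 := h n σ s
  have h0 := h 0 (fun _ => 1) 1
  simp only [pairingWeight_zero, pairSum_zero, one_mul, zero_mul, pow_zero, inv_one, map_one] at h0
  rw [wickTerm, h1, h0, mul_mul_inv_cancel hU, mul_assoc]

end Translation

/-! ### Loop equations of the Gaussian matrix model -/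

theorem deriv_multiset_prod {k R α : Type*} [CommRing k] [CommRing R] [Algebra k R]
    [DecidableEq α] (δ : Derivation k R R) (f : α → R) (w : Multiset α) :
    δ (w.map f).prod = (w.map fun x => ((w.erase x).map f).prod * δ (f x)).sum := by
  induction w using Multiset.induction_on with
  | empty => simp
  | cons a w ih =>
    rw [Multiset.map_cons, Multiset.prod_cons, δ.leibniz, ih, Multiset.map_cons, Multiset.sum_cons,
      Multiset.erase_cons_head, add_comm, smul_eq_mul, smul_eq_mul, ← Multiset.sum_map_mul_left]
    congr 2
    refine Multiset.map_congr rfl fun x hx => ?_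
    rw [Multiset.erase_cons_tail_of_mem hx, Multiset.map_cons, Multiset.prod_cons]
    ring

theorem sum_multiset_comm {ι α R : Type*} [AddCommMonoid R] (s : Finset ι) (w : Multiset α)
    (f : ι → α → R) :
    ∑ i ∈ s, (w.map (f i)).sum = (w.map fun x => ∑ i ∈ s, f i x).sum := by
  induction w using Multiset.induction_on with
  | empty => simp
  | cons a w ih => simp [Finset.sum_add_distrib, ih]

theorem mul_leibniz_sum {R α : Type*} [CommRing R] (u A W : R) (s : Finset ℕ) (f : ℕ → R)
    (w : Multiset α) (g g' : α → R) (h : ∀ x, u * (A * g x) = g' x) :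
    u * (A • (w.map g).sum + W • ∑ l ∈ s, f l) = ∑ l ∈ s, W * (u * f l) + (w.map g').sum := by
  rw [smul_eq_mul, smul_eq_mul, mul_add, ← Multiset.sum_map_mul_left, ← Multiset.sum_map_mul_left,
    Finset.mul_sum, Finset.mul_sum, add_comm]
  congr 1
  · exact Finset.sum_congr rfl fun l _ => by ring
  · simp only [h]

section Loop

variable {d N : ℕ}

/-- The product of the traces `tr M_c^q` over a multiset of pairs `(c, q)`. -/
def wordP (N : ℕ) (w : Multiset (Fin d × ℕ)) : MvPolynomial (HIdx d N) ℂ :=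
  (w.map fun x => (hermP (S := ℂ) x.1 ^ x.2).trace).prod

theorem wordP_cons (x : Fin d × ℕ) (w : Multiset (Fin d × ℕ)) :
    wordP N (x ::ₘ w) = (hermP (S := ℂ) x.1 ^ x.2).trace * wordP N w := by
  rw [wordP, Multiset.map_cons, Multiset.prod_cons, wordP]

/-- The derivative of the matrix `M_c` with respect to its coordinate `p`. -/
def unitP (d : ℕ) (p : Fin N × Fin N) : Matrix (Fin N) (Fin N) (MvPolynomial (HIdx d N) ℂ) :=
  Matrix.of fun a b => MvPolynomial.C (hcoef p a b)

theorem unitP_complete (a b a' b' : Fin N) :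
    ∑ p : Fin N × Fin N, unitP d p a b * unitP d p a' b' = if a = b' ∧ b = a' then 1 else 0 := by
  simp only [unitP, Matrix.of_apply, ← map_mul]
  rw [← map_sum, hcoef_complete]
  split_ifs <;> simp

theorem pderiv_hermP (c c' : Fin d) (p : Fin N × Fin N) :
    (hermP (S := ℂ) c').map (MvPolynomial.pderiv (c, p)) = if c' = c then unitP d p else 0 := by
  classical
  ext a b : 1
  rw [Matrix.map_apply, hermP, Matrix.of_apply, map_sum]
  simp only [Derivation.leibniz, MvPolynomial.pderiv_C, MvPolynomial.pderiv_X, smul_zero, add_zero,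
    smul_eq_mul, Pi.single_apply, Prod.mk.injEq]
  split_ifs with h
  · subst h
    simp [unitP]
  · have h' : c ≠ c' := fun e => h e.symm
    simp [h, h']

/-- Completeness of the Hermitian basis: a contraction inside one trace cuts it into two. -/
theorem contract_split (A B : Matrix (Fin N) (Fin N) (MvPolynomial (HIdx d N) ℂ)) :
    ∑ a, ∑ b, ∑ p, unitP d p a b * (A * unitP d p * B) b a = A.trace * B.trace := by
  have : ∀ a b, ∑ p, unitP d p a b * (A * unitP d p * B) b a = A b b * B a a := by
    intro a b
    simp only [Matrix.mul_apply, Finset.mul_sum, Finset.sum_mul]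
    rw [Finset.sum_comm]
    have h : ∀ y, ∑ p, ∑ x, unitP d p a b * (A b x * unitP d p x y * B y a) =
        ∑ x, (A b x * B y a) * if a = y ∧ b = x then 1 else 0 := by
      intro y
      rw [Finset.sum_comm]
      refine Finset.sum_congr rfl fun x _ => ?_
      rw [← unitP_complete, Finset.mul_sum]
      exact Finset.sum_congr rfl fun p _ => by ring
    simp only [h, ite_and]
    simp
  simp only [this]
  rw [Matrix.trace, Matrix.trace, Finset.sum_mul_sum, Finset.sum_comm]
  rfl

/-- Completeness of the Hermitian basis: a contraction between an entry of one power and a trace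
joins them into a single trace. -/
theorem contract_merge (A B : Matrix (Fin N) (Fin N) (MvPolynomial (HIdx d N) ℂ)) :
    ∑ a, ∑ b, ∑ p, unitP d p a b * (A b a * (B * unitP d p).trace) = (A * B).trace := by
  have : ∀ a b, ∑ p, unitP d p a b * (A b a * (B * unitP d p).trace) = A b a * B a b := by
    intro a b
    simp only [Matrix.trace, Matrix.diag_apply, Matrix.mul_apply, Finset.mul_sum]
    rw [Finset.sum_comm]
    have h : ∀ y, ∑ p, ∑ x, unitP d p a b * (A b a * (B y x * unitP d p x y)) =
        ∑ x, (A b a * B y x) * if a = y ∧ b = x then 1 else 0 := by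
      intro y
      rw [Finset.sum_comm]
      refine Finset.sum_congr rfl fun x _ => ?_
      rw [← unitP_complete, Finset.mul_sum]
      exact Finset.sum_congr rfl fun p _ => by ring
    simp only [h, ite_and]
    simp
  simp only [this]
  rw [Finset.sum_comm]
  simp [Matrix.trace, Matrix.mul_apply]

theorem hermP_eq_sum (c : Fin d) (a b : Fin N) :
    hermP (S := ℂ) c a b = ∑ p, unitP d p a b * MvPolynomial.X (c, p) := by
  simp [hermP, unitP]

theorem loop_poly (c : Fin d) (q : ℕ) (w : Multiset (Fin d × ℕ)) :
    ∑ a, ∑ b, ∑ p, unitP d p a b *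
      MvPolynomial.pderiv (c, p) ((hermP (S := ℂ) (N := N) c ^ q) b a * wordP N w) =
    ∑ l ∈ Finset.range q, wordP N ((c, l) ::ₘ (c, q - 1 - l) ::ₘ w) +
      (w.map fun x => if x.1 = c then (x.2 : MvPolynomial (HIdx d N) ℂ) *
        wordP N ((c, q + x.2 - 1) ::ₘ w.erase x) else 0).sum := by
  have h1 : ∀ (p : Fin N × Fin N) (a b : Fin N), unitP d p a b *
      MvPolynomial.pderiv (c, p) ((hermP (S := ℂ) (N := N) c ^ q) b a * wordP N w) =
      (∑ l ∈ Finset.range q, wordP N w * (unitP d p a b *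
        ((hermP (S := ℂ) (N := N) c) ^ l * unitP d p * (hermP (S := ℂ) (N := N) c) ^ (q - 1 - l)) b a)) +
      (w.map fun x => if x.1 = c then ((x.2 : MvPolynomial (HIdx d N) ℂ) * wordP N (w.erase x)) * (unitP d p a b *
        ((hermP (S := ℂ) (N := N) c ^ q) b a *
          ((hermP (S := ℂ) (N := N) c ^ (x.2 - 1)) * unitP d p).trace)) else 0).sum := by
    intro p a b
    have e1 : MvPolynomial.pderiv (c, p) ((hermP (S := ℂ) (N := N) c ^ q) b a) =
        ∑ l ∈ Finset.range q,
          ((hermP (S := ℂ) (N := N) c) ^ l * unitP d p * (hermP (S := ℂ) (N := N) c) ^ (q - 1 - l)) b a := by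
      have := congrFun (congrFun (deriv_matrix_pow (MvPolynomial.pderiv (c, p))
        (hermP (S := ℂ) (N := N) c) q) b) a
      rw [Matrix.map_apply] at this
      rw [this, pderiv_hermP, if_pos rfl, Matrix.sum_apply]
    have e2 : MvPolynomial.pderiv (c, p) (wordP N w) = (w.map fun x => if x.1 = c then
        wordP N (w.erase x) * ((x.2 : MvPolynomial (HIdx d N) ℂ) * ((hermP (S := ℂ) (N := N) c ^ (x.2 - 1)) * unitP d p).trace)
          else 0).sum := by
      rw [wordP, deriv_multiset_prod]
      congr 1
      refine Multiset.map_congr rfl fun x hx => ?_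
      rw [deriv_trace_pow, pderiv_hermP]
      split_ifs with h
      · rw [h]; rfl
      · simp
    rw [Derivation.leibniz, e1, e2]
    refine mul_leibniz_sum _ _ _ _ _ _ _ _ fun x => ?_
    split_ifs
    · ring
    · rw [mul_zero, mul_zero]
  simp only [h1, Finset.sum_add_distrib, sum_multiset_comm]
  congr 1
  · have h2 : ∀ l, ∑ a, ∑ b, ∑ p, wordP N w * (unitP d p a b *
        ((hermP (S := ℂ) (N := N) c) ^ l * unitP d p * (hermP (S := ℂ) (N := N) c) ^ (q - 1 - l)) b a) =
        wordP N ((c, l) ::ₘ (c, q - 1 - l) ::ₘ w) := by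
      intro l
      simp only [← Finset.mul_sum]
      rw [contract_split, wordP_cons, wordP_cons]
      ring
    simp only [← h2]
    have h3 : ∀ a b : Fin N, ∑ p, ∑ l ∈ Finset.range q, wordP N w * (unitP d p a b *
        ((hermP (S := ℂ) (N := N) c) ^ l * unitP d p * (hermP (S := ℂ) (N := N) c) ^ (q - 1 - l)) b a) =
        ∑ l ∈ Finset.range q, ∑ p, wordP N w * (unitP d p a b *
        ((hermP (S := ℂ) (N := N) c) ^ l * unitP d p * (hermP (S := ℂ) (N := N) c) ^ (q - 1 - l)) b a) :=
      fun a b => Finset.sum_comm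
    simp only [h3]
    rw [Finset.sum_comm (s := Finset.range q)]
    refine Finset.sum_congr rfl fun a _ => ?_
    rw [Finset.sum_comm (s := Finset.range q)]
  · congr 1
    refine Multiset.map_congr rfl fun x hx => ?_
    split_ifs with h
    · simp only [← Finset.mul_sum]
      rw [contract_merge, wordP_cons, ← pow_add]
      rcases Nat.eq_zero_or_pos x.2 with h0 | h0
      · simp [h0]
      · rw [show q + (x.2 - 1) = q + x.2 - 1 by omega]
        ring
    · simp

/-- One factor of `tr M_c^{q+1}` is removed by integration by parts. The derivative acts either on
the same trace, which splits, or on another trace of the same colour, which merges with it. The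
nonzero terms have total degree lower by two, so the equation determines all Gaussian moments
recursively. -/
theorem loop_equation (a : ℂ) (c : Fin d) (q : ℕ) (w : Multiset (Fin d × ℕ)) :
    gaussE a (wordP N ((c, q + 1) ::ₘ w)) = 1 / a *
      (∑ l ∈ Finset.range q, gaussE a (wordP N ((c, l) ::ₘ (c, q - 1 - l) ::ₘ w)) +
        (w.map fun x => if x.1 = c then (x.2 : ℂ) *
          gaussE a (wordP N ((c, q + x.2 - 1) ::ₘ w.erase x)) else 0).sum) := by
  have h0 : wordP N ((c, q + 1) ::ₘ w) = ∑ a, ∑ b, ∑ p, unitP d p a b *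
      (MvPolynomial.X (c, p) * ((hermP (S := ℂ) c ^ q) b a * wordP N w)) := by
    rw [wordP_cons, pow_succ']
    simp only [Matrix.trace, Matrix.diag_apply, Matrix.mul_apply, Finset.sum_mul]
    refine Finset.sum_congr rfl fun a _ => Finset.sum_congr rfl fun b _ => ?_
    rw [hermP_eq_sum c a b, Finset.sum_mul, Finset.sum_mul]
    exact Finset.sum_congr rfl fun p _ => by ring
  have h1 : ∀ (p) (x y : Fin N) (F : MvPolynomial (HIdx d N) ℂ),
      gaussE a (unitP d p x y * F) = hcoef p x y * gaussE a F := by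
    intro p x y F
    rw [unitP, Matrix.of_apply, ← MvPolynomial.smul_eq_C_mul, map_smul, smul_eq_mul]
  have h2 : gaussE a (wordP N ((c, q + 1) ::ₘ w)) = 1 / a * gaussE a (∑ a, ∑ b, ∑ p,
      unitP d p a b * MvPolynomial.pderiv (c, p) ((hermP (S := ℂ) c ^ q) b a * wordP N w)) := by
    rw [h0]
    simp only [map_sum, h1, gaussE_X_mul, Finset.mul_sum]
    refine Finset.sum_congr rfl fun x _ => Finset.sum_congr rfl fun y _ =>
      Finset.sum_congr rfl fun p _ => ?_
    simp only [Algebra.algebraMap_self, RingHom.id_apply]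
    ring
  rw [h2, loop_poly, map_add, map_sum, map_multiset_sum, Multiset.map_map]
  congr 3
  refine Multiset.map_congr rfl fun x hx => ?_
  simp only [Function.comp_apply]
  split_ifs
  · have : ((x.2 : MvPolynomial (HIdx d N) ℂ)) = MvPolynomial.C (x.2 : ℂ) := by simp
    rw [this, ← MvPolynomial.smul_eq_C_mul, map_smul, smul_eq_mul]
  · simp

end Loop

/-! ### A majorant for the genus expansion -/

section Majorant

/-- A majorant of the planar moments. -/
def majorant (L : ℕ) (n : ℕ) : ℝ :=
  (1 + 1 / (L : ℝ)) ^ n * if n % 2 = 0 then (catalan (n / 2) : ℝ) else 2 ^ n / (L : ℝ) ^ 2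

theorem majorant_even (L j : ℕ) : majorant L (2 * j) = (1 + 1 / (L : ℝ)) ^ (2 * j) * catalan j := by
  rw [majorant, if_pos (by omega), Nat.mul_div_cancel_left _ (by norm_num)]

theorem majorant_odd (L j : ℕ) : majorant L (2 * j + 1) =
    (1 + 1 / (L : ℝ)) ^ (2 * j + 1) * (2 ^ (2 * j + 1) / (L : ℝ) ^ 2) := by
  rw [majorant, if_neg (by omega)]

theorem catalan_le_four_pow (j : ℕ) : (catalan j : ℝ) ≤ 4 ^ j := by
  have h1 := succ_mul_catalan_eq_centralBinom j
  have h2 := Nat.centralBinom_le_four_pow j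
  have : catalan j ≤ 4 ^ j := by nlinarith [Nat.zero_le (j * catalan j)]
  exact_mod_cast this

theorem four_pow_le_catalan (j : ℕ) : (4 : ℝ) ^ (j + 1) ≤ 2 * (j + 1) * (j + 2) * catalan (j + 1) := by
  have h1 := succ_mul_catalan_eq_centralBinom (j + 1)
  have h2 := Nat.four_pow_le_two_mul_self_mul_centralBinom (j + 1) (by omega)
  rw [← h1] at h2
  have : 4 ^ (j + 1) ≤ 2 * (j + 1) * (j + 2) * catalan (j + 1) := by
    calc _ ≤ _ := h2
      _ = _ := by ring
  exact_mod_cast this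

/-- Only the resulting bound by `2` is used: it controls the products of an even and an odd term in
`majorant_conv`. -/
theorem sum_catalan_le (J : ℕ) :
    ∑ i ∈ Finset.range J, (catalan i : ℝ) / 4 ^ i = 2 - 2 * (J.centralBinom : ℝ) / 4 ^ J := by
  induction J with
  | zero => simp
  | succ J ih =>
    rw [Finset.sum_range_succ, ih]
    have h1 : ((J : ℝ) + 1) * catalan J = J.centralBinom := by
      exact_mod_cast succ_mul_catalan_eq_centralBinom J
    have h2 : ((J : ℝ) + 1) * (J + 1).centralBinom = 2 * (2 * J + 1) * J.centralBinom := by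
      exact_mod_cast Nat.succ_mul_centralBinom_succ J
    have h0 : (J : ℝ) + 1 ≠ 0 := by positivity
    have h3 : ((J + 1).centralBinom : ℝ) = 2 * (2 * J + 1) * catalan J := by
      apply mul_left_cancel₀ h0
      rw [h2, ← h1]; ring
    rw [h3, ← h1, pow_succ]
    field_simp
    ring

theorem sum_range_two_mul {R : Type*} [AddCommMonoid R] (f : ℕ → R) (n : ℕ) :
    ∑ l ∈ Finset.range (2 * n), f l = ∑ i ∈ Finset.range n, (f (2 * i) + f (2 * i + 1)) := by
  induction n with
  | zero => simp
  | succ n ih =>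
    rw [show 2 * (n + 1) = 2 * n + 1 + 1 by ring, Finset.sum_range_succ, Finset.sum_range_succ, ih,
      Finset.sum_range_succ, add_assoc]

variable {L : ℕ}

/-- The majorant satisfies the splitting recursion with a gain `(1 + 1/L)⁻¹`, which leaves room for
merging. In even degree the products of even terms reproduce the Catalan recursion exactly, while
the products of odd terms are small because of the factor `1 / L²`, and the powers of `1 + 1/L`
absorb them. In odd degree each product has one even and one odd term, and `∑ C_i / 4^i ≤ 2`
suffices. Odd terms are needed because joint moments of several odd traces do not vanish. -/
theorem majorant_conv (hL : 1 ≤ L) (q : ℕ) (hq : q + 1 ≤ L) :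
    ∑ l ∈ Finset.range q, majorant L l * majorant L (q - 1 - l) ≤
      (1 + 1 / (L : ℝ))⁻¹ * majorant L (q + 1) := by
  have hL0 : (0 : ℝ) < L := by exact_mod_cast hL
  set u : ℝ := 1 + 1 / (L : ℝ) with hu
  have hu1 : 1 ≤ u := by rw [hu]; have : 0 ≤ 1 / (L : ℝ) := by positivity
                         linarith
  have hu0 : 0 < u := by linarith
  rcases Nat.even_or_odd' q with ⟨J, rfl | rfl⟩
  · -- odd total degree
    rw [sum_range_two_mul]
    have h1 : ∀ i ∈ Finset.range J, majorant L (2 * i) * majorant L (2 * J - 1 - 2 * i) +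
        majorant L (2 * i + 1) * majorant L (2 * J - 1 - (2 * i + 1)) =
        u ^ (2 * J - 1) * 4 ^ J / (2 * L ^ 2) * (catalan i / 4 ^ i + catalan (J - 1 - i) / 4 ^ (J - 1 - i)) := by
      intro i hi
      rw [Finset.mem_range] at hi
      obtain ⟨k, rfl⟩ : ∃ k, J = i + k + 1 := ⟨J - i - 1, by omega⟩
      rw [show 2 * (i + k + 1) - 1 - 2 * i = 2 * k + 1 by omega,
        show 2 * (i + k + 1) - 1 - (2 * i + 1) = 2 * k by omega,
        show i + k + 1 - 1 - i = k by omega, show 2 * (i + k + 1) - 1 = 2 * i + 2 * k + 1 by omega,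
        majorant_even, majorant_even, majorant_odd, majorant_odd, ← hu]
      have e : ∀ j, (2 : ℝ) ^ (2 * j + 1) = 2 * 4 ^ j := by
        intro j; rw [pow_succ, pow_mul]; norm_num; ring
      rw [e, e]
      field_simp
      ring
    rw [Finset.sum_congr rfl h1, ← Finset.mul_sum, Finset.sum_add_distrib,
      Finset.sum_range_reflect (fun i => (catalan i : ℝ) / 4 ^ i) J, majorant_odd, ← hu]
    have h2 : ∑ i ∈ Finset.range J, (catalan i : ℝ) / 4 ^ i ≤ 2 := by
      rw [sum_catalan_le]
      have : 0 ≤ 2 * (J.centralBinom : ℝ) / 4 ^ J := by positivity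
      linarith
    rcases Nat.eq_zero_or_pos J with rfl | hJ
    · simp; positivity
    · obtain ⟨k, rfl⟩ : ∃ k, J = k + 1 := ⟨J - 1, by omega⟩
      have e : (2 : ℝ) ^ (2 * (k + 1) + 1) = 2 * 4 ^ (k + 1) := by
        rw [pow_succ, pow_mul]; norm_num; ring
      rw [e, show 2 * (k + 1) - 1 = 2 * k + 1 by omega]
      calc _ ≤ u ^ (2 * k + 1) * 4 ^ (k + 1) / (2 * L ^ 2) * (2 + 2) := by gcongr
        _ = u ^ (2 * k + 1) * (2 * 4 ^ (k + 1) / (L : ℝ) ^ 2) := by field_simp; norm_num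
        _ ≤ u ^ (2 * k + 2) * (2 * 4 ^ (k + 1) / (L : ℝ) ^ 2) := by
            gcongr <;> omega
        _ = _ := by
            rw [show 2 * (k + 1) + 1 = 2 * k + 2 + 1 by ring, pow_succ u (2 * k + 2)]
            field_simp
  · rw [Finset.sum_range_succ, sum_range_two_mul]
    have h1 : ∀ i ∈ Finset.range J, majorant L (2 * i) * majorant L (2 * J + 1 - 1 - 2 * i) +
        majorant L (2 * i + 1) * majorant L (2 * J + 1 - 1 - (2 * i + 1)) =
        u ^ (2 * J) * (catalan i * catalan (J - i)) + u ^ (2 * J) * (4 ^ J / (L : ℝ) ^ 4) := by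
      intro i hi
      rw [Finset.mem_range] at hi
      obtain ⟨k, rfl⟩ : ∃ k, J = i + k + 1 := ⟨J - i - 1, by omega⟩
      rw [show 2 * (i + k + 1) + 1 - 1 - 2 * i = 2 * (k + 1) by omega,
        show 2 * (i + k + 1) + 1 - 1 - (2 * i + 1) = 2 * k + 1 by omega,
        show i + k + 1 - i = k + 1 by omega,
        majorant_even, majorant_even, majorant_odd, majorant_odd, ← hu]
      have e : ∀ j, (2 : ℝ) ^ (2 * j + 1) = 2 * 4 ^ j := by
        intro j; rw [pow_succ, pow_mul]; norm_num; ring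
      rw [e, e]
      field_simp
      ring
    rw [Finset.sum_congr rfl h1, Finset.sum_add_distrib, ← Finset.mul_sum, Finset.sum_const,
      Finset.card_range, show 2 * J + 1 - 1 - 2 * J = 2 * 0 by omega, majorant_even, majorant_even,
      show 2 * J + 1 + 1 = 2 * (J + 1) by ring, majorant_even, ← hu]
    have hcat : (catalan (J + 1) : ℝ) = ∑ i ∈ Finset.range J, (catalan i : ℝ) * catalan (J - i) +
        catalan J := by
      rw [catalan_succ', Finset.Nat.sum_antidiagonal_eq_sum_range_succ_mk, Finset.sum_range_succ]
      simp
    have h4 := four_pow_le_catalan J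
    have hJL : 2 * (J : ℝ) + 2 ≤ L := by exact_mod_cast (show 2 * J + 2 ≤ L by omega)
    have hJ0 : (0 : ℝ) ≤ J := by positivity
    have hc0 : (0 : ℝ) ≤ catalan (J + 1) := by positivity
    have h5 : (J : ℝ) * (4 ^ J / (L : ℝ) ^ 4) ≤ 1 / L * catalan (J + 1) := by
      rw [pow_succ] at h4
      have h6 : (J : ℝ) * 4 ^ J ≤ (L : ℝ) ^ 3 * catalan (J + 1) := by
        calc (J : ℝ) * 4 ^ J ≤ J * ((J + 1) * (J + 2) * catalan (J + 1)) := by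
              gcongr
              have : 0 ≤ ((J : ℝ) + 1) * (J + 2) * catalan (J + 1) := by positivity
              linarith
          _ = (J * (J + 1) * (J + 2)) * catalan (J + 1) := by ring
          _ ≤ (L * L * L) * catalan (J + 1) := by
              gcongr <;> linarith
          _ = _ := by ring
      rw [mul_div_assoc', div_le_iff₀ (by positivity)]
      calc _ ≤ _ := h6
        _ = _ := by field_simp
    calc _ = u ^ (2 * J) * (catalan (J + 1) + J * (4 ^ J / (L : ℝ) ^ 4)) := by
          rw [hcat]; simp; ring
      _ ≤ u ^ (2 * J) * (catalan (J + 1) + 1 / L * catalan (J + 1)) := by gcongr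
      _ = u ^ (2 * J) * (u * catalan (J + 1)) := by rw [hu]; ring
      _ = _ := by
          rw [show 2 * (J + 1) = 2 * J + 1 + 1 by ring, pow_succ, pow_succ]
          field_simp

theorem majorant_nonneg (n : ℕ) : 0 ≤ majorant L n := by
  rw [majorant]; positivity

theorem majorant_le (hL : 1 ≤ L) (n : ℕ) : majorant L n ≤ (1 + 1 / (L : ℝ)) ^ n * 2 ^ n := by
  have hL0 : (1 : ℝ) ≤ L := by exact_mod_cast hL
  rw [majorant]
  gcongr
  split_ifs with h
  · obtain ⟨j, rfl⟩ : ∃ j, n = 2 * j := ⟨n / 2, by omega⟩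
    rw [Nat.mul_div_cancel_left _ (by norm_num), pow_mul]
    norm_num
    exact catalan_le_four_pow j
  · exact div_le_self (by positivity) (one_le_pow₀ hL0)

/-- Catalan numbers are at least `4^j` divided by a quadratic polynomial, so up to degree `L` the
majorant is smaller than its exponential bound by at most a factor polynomial in `L`. -/
theorem le_majorant (hL : 1 ≤ L) {n : ℕ} (hn : n ≤ L) :
    (1 + 1 / (L : ℝ)) ^ n * 2 ^ n ≤ 2 * (L : ℝ) ^ 2 * majorant L n := by
  have hL0 : (1 : ℝ) ≤ L := by exact_mod_cast hL
  have hu : (0 : ℝ) ≤ (1 + 1 / (L : ℝ)) ^ n := by positivity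
  rw [majorant, mul_left_comm]
  gcongr
  split_ifs with h
  · obtain ⟨j, rfl⟩ : ∃ j, n = 2 * j := ⟨n / 2, by omega⟩
    rw [Nat.mul_div_cancel_left _ (by norm_num), pow_mul]
    norm_num
    rcases j with _ | j
    · simp; nlinarith
    · have h4 := four_pow_le_catalan j
      have hJL : 2 * (j : ℝ) + 2 ≤ L := by exact_mod_cast (show 2 * j + 2 ≤ L by omega)
      have hj0 : (0 : ℝ) ≤ j := by positivity
      refine h4.trans ?_
      have : ((j : ℝ) + 1) * (j + 2) ≤ L ^ 2 := by
        rw [sq]; gcongr <;> linarith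
      rw [mul_assoc 2]
      gcongr
  · rw [mul_assoc, mul_div_cancel₀ _ (by positivity)]
    have : (0 : ℝ) ≤ 2 ^ n := by positivity
    linarith

/-- Both sides are comparable to powers of `2` up to polynomial factors, so merging two traces costs
only a power of `L`, compensated later by the small value `genusScale L`. -/
theorem majorant_merge (hL : 1 ≤ L) {q r : ℕ} (hq : q + 1 ≤ L) (hr : r ≤ L) (hr1 : 1 ≤ r) :
    majorant L (q + r - 1) ≤ 4 * (L : ℝ) ^ 4 * (majorant L (q + 1) * majorant L r) := by
  have hL0 : (1 : ℝ) ≤ L := by exact_mod_cast hL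
  have hu : (1 : ℝ) ≤ 1 + 1 / (L : ℝ) := by
    have : 0 ≤ 1 / (L : ℝ) := by positivity
    linarith
  calc majorant L (q + r - 1) ≤ (1 + 1 / (L : ℝ)) ^ (q + r - 1) * 2 ^ (q + r - 1) := majorant_le hL _
    _ ≤ (1 + 1 / (L : ℝ)) ^ (q + 1 + r) * 2 ^ (q + 1 + r) := by
        gcongr
        · omega
        · norm_num
        · omega
    _ = ((1 + 1 / (L : ℝ)) ^ (q + 1) * 2 ^ (q + 1)) * ((1 + 1 / (L : ℝ)) ^ r * 2 ^ r) := by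
        rw [pow_add _ (q + 1) r, pow_add 2 (q + 1) r]; ring
    _ ≤ (2 * (L : ℝ) ^ 2 * majorant L (q + 1)) * (2 * (L : ℝ) ^ 2 * majorant L r) := by
        have := le_majorant hL hq
        have := le_majorant hL hr
        have := majorant_nonneg (L := L) (q + 1)
        gcongr
    _ = _ := by ring

end Majorant

/-! ### The genus expansion of Gaussian moments -/

section Genus

variable {d : ℕ}

/-- The total degree of a product of traces. -/
def wdeg (w : Multiset (Fin d × ℕ)) : ℕ := (w.map Prod.snd).sum

theorem wdeg_cons (x : Fin d × ℕ) (w : Multiset (Fin d × ℕ)) : wdeg (x ::ₘ w) = x.2 + wdeg w := by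
  simp [wdeg]

theorem wdeg_erase {x : Fin d × ℕ} {w : Multiset (Fin d × ℕ)} (h : x ∈ w) :
    wdeg w = x.2 + wdeg (w.erase x) := by
  rw [← wdeg_cons, Multiset.cons_erase h]

/-- The value at which the polynomials of the genus expansion are bounded. -/
def genusScale (L : ℕ) : ℝ := 1 / (8 * (L : ℝ) ^ 6)

/-- This is the induction step of the bound: the right side of the loop equation, with `N⁻²`
replaced by `genusScale L` and moments by majorants, stays below the majorant. -/
theorem majorant_step {L : ℕ} (hL : 1 ≤ L) (c : Fin d) (q : ℕ) (w : Multiset (Fin d × ℕ))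
    (hw : q + 1 + wdeg w ≤ L) :
    ∑ l ∈ Finset.range q, (majorant L l * (majorant L (q - 1 - l) *
        (w.map fun x => majorant L x.2).prod)) +
      genusScale L * (w.map fun x => if x.1 = c then (x.2 : ℝ) *
        (majorant L (q + x.2 - 1) * ((w.erase x).map fun x => majorant L x.2).prod) else 0).sum ≤
      majorant L (q + 1) * (w.map fun x => majorant L x.2).prod := by
  have hL0 : (1 : ℝ) ≤ L := by exact_mod_cast hL
  set W := (w.map fun x => majorant L x.2).prod with hW
  have hW0 : 0 ≤ W := by
    refine Multiset.prod_nonneg fun a ha => ?_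
    obtain ⟨x, _, rfl⟩ := Multiset.mem_map.1 ha
    exact majorant_nonneg _
  have hm := majorant_nonneg (L := L) (q + 1)
  have h1 : ∑ l ∈ Finset.range q, (majorant L l * (majorant L (q - 1 - l) * W)) ≤
      (1 + 1 / (L : ℝ))⁻¹ * majorant L (q + 1) * W := by
    simp only [← mul_assoc]
    rw [← Finset.sum_mul]
    exact mul_le_mul_of_nonneg_right (majorant_conv hL q (by omega)) hW0
  have h2 : (w.map fun x => if x.1 = c then (x.2 : ℝ) *
      (majorant L (q + x.2 - 1) * ((w.erase x).map fun x => majorant L x.2).prod) else 0).sum ≤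
      (w.map fun x => (x.2 : ℝ) * (4 * (L : ℝ) ^ 4 * (majorant L (q + 1) * W))).sum := by
    refine Multiset.sum_map_le_sum_map _ _ fun x hx => ?_
    have hR : 0 ≤ (x.2 : ℝ) * (4 * (L : ℝ) ^ 4 * (majorant L (q + 1) * W)) := by positivity
    split_ifs
    · rcases Nat.eq_zero_or_pos x.2 with h0 | h0
      · simp [h0]
      · have hWx : W = majorant L x.2 * ((w.erase x).map fun x => majorant L x.2).prod := by
          rw [hW]; conv_lhs => rw [← Multiset.cons_erase hx]
          rw [Multiset.map_cons, Multiset.prod_cons]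
        have hE0 : 0 ≤ ((w.erase x).map fun x => majorant L x.2).prod := by
          refine Multiset.prod_nonneg fun a ha => ?_
          obtain ⟨x, _, rfl⟩ := Multiset.mem_map.1 ha
          exact majorant_nonneg _
        have hx2 := wdeg_erase hx
        rw [hWx]
        have := majorant_merge (q := q) (r := x.2) hL (by omega) (by omega) h0
        calc _ ≤ (x.2 : ℝ) * ((4 * (L : ℝ) ^ 4 * (majorant L (q + 1) * majorant L x.2)) *
              ((w.erase x).map fun x => majorant L x.2).prod) := by gcongr
          _ = _ := by ring
    · exact hR
  rw [Multiset.sum_map_mul_right] at h2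
  have hdeg : (w.map fun x => (x.2 : ℝ)).sum = wdeg w := by
    rw [wdeg, Nat.cast_multiset_sum, Multiset.map_map]
    rfl
  rw [hdeg] at h2
  have hwL : (wdeg w : ℝ) ≤ L := by exact_mod_cast (show wdeg w ≤ L by omega)
  have hs : 0 ≤ genusScale L := by rw [genusScale]; positivity
  -- Merging contributes a total weight of at most `L` and a cost `4 L⁴`; the value `1 / (8 L⁶)`
  -- reduces this to `1 / (2 L)`, which fits in the room `1 - (1 + 1/L)⁻¹ = 1 / (L + 1)`.
  have h3 : genusScale L * ((wdeg w : ℝ) * (4 * (L : ℝ) ^ 4 * (majorant L (q + 1) * W))) ≤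
      (1 / (2 * L)) * (majorant L (q + 1) * W) := by
    calc _ ≤ genusScale L * ((L : ℝ) * (4 * (L : ℝ) ^ 4 * (majorant L (q + 1) * W))) := by gcongr
      _ = _ := by rw [genusScale]; field_simp; ring
  have h4 : (1 + 1 / (L : ℝ))⁻¹ + 1 / (2 * L) ≤ 1 := by
    have e : (1 + 1 / (L : ℝ))⁻¹ = L / (L + 1) := by field_simp
    rw [e, div_add_div _ _ (by positivity) (by positivity), div_le_one (by positivity)]
    nlinarith
  calc _ ≤ (1 + 1 / (L : ℝ))⁻¹ * majorant L (q + 1) * W + genusScale L *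
        ((wdeg w : ℝ) * (4 * (L : ℝ) ^ 4 * (majorant L (q + 1) * W))) :=
        add_le_add h1 (mul_le_mul_of_nonneg_left h2 hs)
    _ ≤ (1 + 1 / (L : ℝ))⁻¹ * majorant L (q + 1) * W +
        (1 / (2 * L)) * (majorant L (q + 1) * W) := by gcongr
    _ = ((1 + 1 / (L : ℝ))⁻¹ + 1 / (2 * L)) * (majorant L (q + 1) * W) := by ring
    _ ≤ 1 * (majorant L (q + 1) * W) := by gcongr
    _ = _ := one_mul _

/-- Relative to the prefactor `N ^ (number of traces)`, splitting costs nothing in the loop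
equation, since the extra trace compensates the factor `1 / N`, and merging costs `N⁻²`. All terms
of the equation are positive, so the coefficients are natural numbers and a bound at a single
positive point controls each of them. The value at the empty word normalises the partition function.
-/
theorem exists_wordPoly (w : Multiset (Fin d × ℕ)) : ∃ P : Polynomial ℕ,
    (∀ N : ℕ, 1 ≤ N → gaussE (N : ℂ) (wordP N w) =
      (N : ℂ) ^ w.card * Polynomial.aeval (((N : ℂ) ^ 2)⁻¹) P) ∧
    (∀ L : ℕ, 1 ≤ L → wdeg w ≤ L →
      Polynomial.aeval (genusScale L) P ≤ (w.map fun x => majorant L x.2).prod) ∧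
    (w = 0 → P = 1) := by
  -- Removing `tr M^0` lowers the number of traces at constant degree; splitting adds one trace but
  -- lowers the degree by two. The measure decreases in all cases.
  induction h : 2 * wdeg w + w.card using Nat.strong_induction_on generalizing w with
  | _ n ih =>
  subst h
  rcases Multiset.empty_or_exists_mem w with rfl | ⟨⟨c, q⟩, hx⟩
  · refine ⟨1, fun N hN => ?_, fun L hL _ => ?_, fun _ => rfl⟩
    · simp [wordP, gaussE_one]
    · simp
  obtain ⟨w, rfl⟩ := Multiset.exists_cons_of_mem hx
  clear hx
  rcases q with _ | q
  · obtain ⟨P, h1, h2, -⟩ := ih _ (by rw [wdeg_cons, Multiset.card_cons]; omega) w rfl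
    refine ⟨P, fun N hN => ?_, fun L hL hd => ?_, fun h => absurd h (Multiset.cons_ne_zero)⟩
    · have : (hermP (S := ℂ) (d := d) (N := N) c ^ 0).trace = MvPolynomial.C (N : ℂ) := by
        simp
      rw [wordP_cons, this, ← MvPolynomial.smul_eq_C_mul, map_smul, h1 N hN, Multiset.card_cons,
        smul_eq_mul]
      ring
    · rw [Multiset.map_cons, Multiset.prod_cons]
      have := h2 L hL (by rw [wdeg_cons] at hd; omega)
      have e : majorant L 0 = 1 := by simp [majorant]
      rw [e, one_mul]
      exact this
  · have i1 : ∀ l, l ∈ Finset.range q → ∃ P : Polynomial ℕ,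
        (∀ N : ℕ, 1 ≤ N → gaussE (N : ℂ) (wordP N ((c, l) ::ₘ (c, q - 1 - l) ::ₘ w)) =
          (N : ℂ) ^ (w.card + 2) * Polynomial.aeval (((N : ℂ) ^ 2)⁻¹) P) ∧
        ∀ L : ℕ, 1 ≤ L → q - 1 + wdeg w ≤ L → Polynomial.aeval (genusScale L) P ≤
          majorant L l * (majorant L (q - 1 - l) * (w.map fun x => majorant L x.2).prod) := by
      intro l hl
      rw [Finset.mem_range] at hl
      obtain ⟨P, h1, h2, -⟩ := ih _ (by
        simp only [wdeg_cons, Multiset.card_cons]; omega) ((c, l) ::ₘ (c, q - 1 - l) ::ₘ w) rfl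
      refine ⟨P, fun N hN => ?_, fun L hL hd => ?_⟩
      · rw [h1 N hN, Multiset.card_cons, Multiset.card_cons]
      · have := h2 L hL (by simp only [wdeg_cons]; omega)
        simpa only [Multiset.map_cons, Multiset.prod_cons] using this
    have i2 : ∀ x, x ∈ w → ∃ P : Polynomial ℕ,
        (∀ N : ℕ, 1 ≤ N → (x.2 : ℂ) * gaussE (N : ℂ) (wordP N ((c, q + x.2 - 1) ::ₘ w.erase x)) =
          (x.2 : ℂ) * ((N : ℂ) ^ w.card * Polynomial.aeval (((N : ℂ) ^ 2)⁻¹) P)) ∧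
        ∀ L : ℕ, 1 ≤ L → q + 1 + wdeg w ≤ L → (x.2 : ℝ) * Polynomial.aeval (genusScale L) P ≤
          (x.2 : ℝ) * (majorant L (q + x.2 - 1) *
            ((w.erase x).map fun x => majorant L x.2).prod) := by
      intro x hx
      rcases Nat.eq_zero_or_pos x.2 with h0 | h0
      · exact ⟨0, by simp [h0], by simp [h0]⟩
      have hc : w.card = (w.erase x).card + 1 := by
        rw [← Multiset.card_cons, Multiset.cons_erase hx]
      have hdx := wdeg_erase hx
      obtain ⟨P, h1, h2, -⟩ := ih _ (by
        simp only [wdeg_cons, Multiset.card_cons]; omega) ((c, q + x.2 - 1) ::ₘ w.erase x) rfl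
      refine ⟨P, fun N hN => ?_, fun L hL hd => ?_⟩
      · rw [h1 N hN, Multiset.card_cons, hc]
      · have := h2 L hL (by simp only [wdeg_cons]; omega)
        rw [Multiset.map_cons, Multiset.prod_cons] at this
        gcongr
    choose! P1 h1 h1' using i1
    choose! P2 h2 h2' using i2
    refine ⟨∑ l ∈ Finset.range q, P1 l + Polynomial.X *
      (w.map fun x => if x.1 = c then (x.2 : Polynomial ℕ) * P2 x else 0).sum,
      fun N hN => ?_, fun L hL hd => ?_, fun h => absurd h (Multiset.cons_ne_zero)⟩
    · have hN0 : (N : ℂ) ≠ 0 := by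
        have : N ≠ 0 := by omega
        exact_mod_cast this
      rw [loop_equation, map_add, map_mul, map_sum, map_multiset_sum, Multiset.map_map,
        Polynomial.aeval_X, Multiset.card_cons, Finset.sum_congr rfl fun l hl => h1 l hl N hN,
        ← Finset.mul_sum]
      have e : (w.map fun x => if x.1 = c then (x.2 : ℂ) *
          gaussE (N : ℂ) (wordP N ((c, q + x.2 - 1) ::ₘ w.erase x)) else 0) =
          w.map fun x => (N : ℂ) ^ w.card * (Polynomial.aeval (((N : ℂ) ^ 2)⁻¹)
            (if x.1 = c then (x.2 : Polynomial ℕ) * P2 x else 0)) := by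
        refine Multiset.map_congr rfl fun x hx => ?_
        split_ifs
        · rw [h2 x hx N hN, map_mul, map_natCast]; ring
        · simp
      rw [e, Multiset.sum_map_mul_left]
      simp only [Function.comp_def]
      field_simp
      ring
    · rw [map_add, map_mul, map_sum, map_multiset_sum, Multiset.map_map, Polynomial.aeval_X,
        Multiset.map_cons, Multiset.prod_cons]
      rw [wdeg_cons] at hd
      refine le_trans ?_ (majorant_step hL c q w hd)
      have hs : 0 ≤ genusScale L := by rw [genusScale]; positivity
      refine add_le_add (Finset.sum_le_sum fun l hl => h1' l hl L hL (by omega)) ?_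
      refine mul_le_mul_of_nonneg_left ?_ hs
      refine Multiset.sum_map_le_sum_map _ _ fun x hx => ?_
      simp only [Function.comp_apply]
      split_ifs
      · rw [map_mul, map_natCast]
        exact h2' x hx L hL hd
      · simp

/-- The polynomial in `N⁻²` of the genus expansion. -/
def wordPoly (w : Multiset (Fin d × ℕ)) : Polynomial ℕ := (exists_wordPoly w).choose

theorem gaussE_wordP {N : ℕ} (hN : 1 ≤ N) (w : Multiset (Fin d × ℕ)) :
    gaussE (N : ℂ) (wordP N w) =
      (N : ℂ) ^ w.card * Polynomial.aeval (((N : ℂ) ^ 2)⁻¹) (wordPoly w) :=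
  (exists_wordPoly w).choose_spec.1 N hN

theorem wordPoly_zero : wordPoly (0 : Multiset (Fin d × ℕ)) = 1 :=
  (exists_wordPoly 0).choose_spec.2.2 rfl

/-- By positivity a coefficient is at most the value at `genusScale L` divided by `genusScale L ^
g`. With `L` one more than the degree, `(1 + 1/L) ^ degree` stays below `e < 3`. The remaining
exponential rate `2` is what yields convergence for `|x| > 2`. -/
theorem wordPoly_coeff_le (w : Multiset (Fin d × ℕ)) (g : ℕ) :
    ((wordPoly w).coeff g : ℝ) ≤ 3 * (8 * ((wdeg w : ℝ) + 1) ^ 6) ^ g * 2 ^ wdeg w := by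
  set L := wdeg w + 1 with hL
  have hL0 : (0 : ℝ) < L := by positivity
  have h1 := (exists_wordPoly w).choose_spec.2.1 L (by omega) (by omega)
  change Polynomial.aeval (genusScale L) (wordPoly w) ≤ _ at h1
  have hs : 0 < genusScale L := by rw [genusScale]; positivity
  have h2 : ((wordPoly w).coeff g : ℝ) * genusScale L ^ g ≤
      Polynomial.aeval (genusScale L) (wordPoly w) := by
    rw [Polynomial.aeval_eq_sum_range]
    by_cases hg : g ≤ (wordPoly w).natDegree
    · have := Finset.single_le_sum (f := fun i => (wordPoly w).coeff i • genusScale L ^ i)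
        (fun i _ => by positivity) (Finset.mem_range.2 (Nat.lt_succ_of_le hg))
      simpa using this
    · rw [Polynomial.coeff_eq_zero_of_natDegree_lt (by omega)]
      simp only [Nat.cast_zero, zero_mul]
      exact Finset.sum_nonneg fun i _ => by positivity
  have h3 : (w.map fun x => majorant L x.2).prod ≤ (w.map fun x =>
      ((1 + 1 / (L : ℝ)) ^ x.2 * 2 ^ x.2)).prod := by
    clear h1 h2
    refine Multiset.prod_map_le_prod_map₀ _ _ (fun x _ => majorant_nonneg _)
      fun x _ => majorant_le (by omega) _
  have h4 : (w.map fun x => ((1 + 1 / (L : ℝ)) ^ x.2 * (2 : ℝ) ^ x.2)).prod =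
      (1 + 1 / (L : ℝ)) ^ wdeg w * 2 ^ wdeg w := by
    clear h1 h2 h3
    clear hL
    clear_value L
    rw [wdeg, ← mul_pow]
    induction w using Multiset.induction_on with
    | empty => simp
    | cons a w ih => simp only [Multiset.map_cons, Multiset.prod_cons, Multiset.sum_cons, ← mul_pow,
        pow_add] at ih ⊢; rw [ih]
  have h5 : (1 + 1 / (L : ℝ)) ^ wdeg w ≤ 3 := by
    have e1 : 1 + 1 / (L : ℝ) ≤ Real.exp (1 / L) := by
      have := Real.add_one_le_exp (1 / (L : ℝ)); linarith
    calc (1 + 1 / (L : ℝ)) ^ wdeg w ≤ (1 + 1 / (L : ℝ)) ^ L := by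
          refine pow_le_pow_right₀ ?_ (by omega)
          have : 0 ≤ 1 / (L : ℝ) := by positivity
          linarith
      _ ≤ Real.exp (1 / L) ^ L := by gcongr
      _ = Real.exp 1 := by rw [← Real.exp_nat_mul]; congr 1; field_simp
      _ ≤ 3 := by have := Real.exp_one_lt_d9; linarith
  have h6 : ((wordPoly w).coeff g : ℝ) * genusScale L ^ g ≤ 3 * 2 ^ wdeg w := by
    refine h2.trans (h1.trans (h3.trans ?_))
    rw [h4]; gcongr
  have h7 : genusScale L ^ g * (8 * ((wdeg w : ℝ) + 1) ^ 6) ^ g = 1 := by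
    rw [← mul_pow, genusScale, hL]
    push_cast
    rw [one_div_mul_cancel (by positivity), one_pow]
  calc ((wordPoly w).coeff g : ℝ) = ((wordPoly w).coeff g * genusScale L ^ g) *
        (8 * ((wdeg w : ℝ) + 1) ^ 6) ^ g := by rw [mul_assoc, h7, mul_one]
    _ ≤ (3 * 2 ^ wdeg w) * (8 * ((wdeg w : ℝ) + 1) ^ 6) ^ g := by gcongr
    _ = _ := by ring

end Genus

/-! ### Traces along the cycles of a permutation -/

section Cycle

theorem sameCycle_invariant {α β : Type*} (τ : Equiv.Perm α) (F : α → β) (hF : ∀ u, F (τ u) = F u)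
    {u v : α} (h : τ.SameCycle u v) : F u = F v := by
  obtain ⟨i, rfl⟩ := h
  have hz : ∀ (i : ℤ) u, F ((τ ^ i) u) = F u := by
    intro i
    induction i using Int.induction_on with
    | zero => intro u; simp
    | succ n ih => intro u; rw [zpow_add, zpow_one, Equiv.Perm.mul_apply, ih, hF]
    | pred n ih =>
      intro u
      rw [zpow_sub, zpow_one, Equiv.Perm.mul_apply, ih]
      conv_rhs => rw [← Equiv.apply_symm_apply τ u]
      rw [hF]; rfl
  exact (hz i u).symm

theorem sameCycle_of_step {α β : Type*} (τ' : Equiv.Perm β) (τ : Equiv.Perm α) (g : β → α)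
    (h : ∀ x, τ.SameCycle (g x) (g (τ' x))) {x y : β} (hxy : τ'.SameCycle x y) :
    τ.SameCycle (g x) (g y) := by
  have := sameCycle_invariant τ' (fun x => (Quotient.mk (Equiv.Perm.SameCycle.setoid τ) (g x)))
    (fun u => Quotient.sound (h u).symm) hxy
  exact Quotient.exact this

open Equiv in
-- `Equiv.removeNone` deletes one point from its cycle and joins its predecessor to its successor,
-- which leaves the relation on the other points unchanged.
theorem sameCycle_removeNone {β : Type*} (τ : Equiv.Perm (Option β)) {x y : β} :
    Equiv.Perm.SameCycle (removeNone τ : Equiv.Perm β) x y ↔ τ.SameCycle (some x) (some y) := by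
  classical
  set τ' : Equiv.Perm β := removeNone τ
  constructor
  · refine sameCycle_of_step τ' τ some fun x => ?_
    by_cases h : ∃ x', τ (some x) = some x'
    · rw [show some (τ' x) = τ (some x) from removeNone_some τ h]
      exact (Equiv.Perm.SameCycle.refl _ _).apply_right
    · have h' : τ (some x) = none := by
        by_contra hne
        exact h (Option.ne_none_iff_exists'.1 hne)
      rw [show some (τ' x) = τ none from removeNone_none τ h', ← h']
      exact ((Equiv.Perm.SameCycle.refl _ _).apply_right).apply_right
  · intro h
    by_cases h0 : τ none = none
    · have := sameCycle_invariant τ (fun u : Option β =>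
        u.map (Quotient.mk (Equiv.Perm.SameCycle.setoid τ'))) (fun u => ?_) h
      · simp only [Option.map_some, Option.some.injEq] at this
        exact Quotient.exact this
      · rcases u with _ | u
        · rw [h0]
        · have hu : ∃ x', τ (some u) = some x' := by
            refine Option.ne_none_iff_exists'.1 fun e => ?_
            have := τ.injective (e.trans h0.symm)
            simp at this
          rw [← show some (τ' u) = τ (some u) from removeNone_some τ hu]
          simp only [Option.map_some, Option.some.injEq]
          exact Quotient.sound ((Equiv.Perm.SameCycle.refl _ _).apply_left)
    · obtain ⟨b, hb⟩ := Option.ne_none_iff_exists'.1 h0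
      -- The deleted point receives the class of its successor `b`; with this choice the labelling
      -- by cycles of the reduced permutation is invariant under `τ`.
      have := sameCycle_invariant τ (fun u : Option β =>
        Quotient.mk (Equiv.Perm.SameCycle.setoid τ') (u.getD b)) (fun u => ?_) h
      · exact Quotient.exact this
      · rcases u with _ | u
        · rw [hb]; rfl
        · by_cases hu : ∃ x', τ (some u) = some x'
          · rw [← show some (τ' u) = τ (some u) from removeNone_some τ hu]
            exact Quotient.sound ((Equiv.Perm.SameCycle.refl _ _).apply_left)
          · have h' : τ (some u) = none := by
              by_contra hne
              exact hu (Option.ne_none_iff_exists'.1 hne)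
            rw [h']
            have e : some (τ' u) = τ none := removeNone_none τ h'
            rw [hb, Option.some.injEq] at e
            simp only [Option.getD_none, Option.getD_some]
            rw [← e]
            exact Quotient.sound ((Equiv.Perm.SameCycle.refl _ _).apply_left)

/-- Summing indices along a cycle multiplies the matrices met on it, and powers of one matrix only
add their exponents. The induction deletes one point at a time: a fixed point yields a separate
trace, any other point passes its exponent to its predecessor. The map `π` to an arbitrary `Q`
labels the cycles, which keeps the labels stable under deletion. -/
theorem sum_prod_cycles {N : ℕ} {S : Type*} [CommRing S] (A : Matrix (Fin N) (Fin N) S)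
    (α : Type) [Fintype α] : ∀ [DecidableEq α] (Q : Type) [Fintype Q] [DecidableEq Q]
    (τ : Equiv.Perm α)
    (π : α → Q) (hπ : Function.Surjective π) (hc : ∀ a b, π a = π b ↔ τ.SameCycle a b) (k : α → ℕ),
    ∑ i : α → Fin N, ∏ a, (A ^ k a) (i a) (i (τ a)) =
      ∏ f : Q, (A ^ (∑ a, if π a = f then k a else 0)).trace := by
  refine Fintype.induction_empty_option (P := fun α _ => ∀ [DecidableEq α] (Q : Type) [Fintype Q]
    [DecidableEq Q] (τ : Equiv.Perm α)
    (π : α → Q) (hπ : Function.Surjective π) (hc : ∀ a b, π a = π b ↔ τ.SameCycle a b) (k : α → ℕ),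
    ∑ i : α → Fin N, ∏ a, (A ^ k a) (i a) (i (τ a)) =
      ∏ f : Q, (A ^ (∑ a, if π a = f then k a else 0)).trace) ?_ ?_ ?_ α
  · intro α β _ e ih _ Q _ _ τ π hπ hc k
    letI := Fintype.ofEquiv β e.symm
    letI : DecidableEq α := Classical.decEq α
    have h := ih Q ((e.trans τ).trans e.symm) (π ∘ e) (hπ.comp e.surjective) (fun a b => by
      rw [Function.comp_apply, Function.comp_apply, hc]
      constructor
      · intro hab
        have := sameCycle_of_step τ ((e.trans τ).trans e.symm) e.symm (fun x => by
          have := (Equiv.Perm.SameCycle.refl ((e.trans τ).trans e.symm) (e.symm x)).apply_right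
          simpa using this) hab
        simpa using this
      · intro hab
        exact sameCycle_of_step _ τ e (fun x => by
          have := (Equiv.Perm.SameCycle.refl τ (e x)).apply_right
          simpa using this) hab) (k ∘ e)
    rw [← (Equiv.arrowCongr e (Equiv.refl (Fin N))).sum_comp]
    have h1 : ∀ i : α → Fin N, ∏ a, (A ^ k a) ((Equiv.arrowCongr e (Equiv.refl (Fin N))) i a)
        ((Equiv.arrowCongr e (Equiv.refl (Fin N))) i (τ a)) =
        ∏ a, (A ^ (k ∘ e) a) (i a) (i (((e.trans τ).trans e.symm) a)) := by
      intro i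
      rw [← e.prod_comp]
      simp [Equiv.arrowCongr]
    simp only [h1]
    rw [h]
    refine Finset.prod_congr rfl fun f _ => ?_
    congr 2
    rw [← e.sum_comp]
    rfl
  · intro _ Q _ _ τ π hπ hc k
    haveI : IsEmpty Q := ⟨fun q => by obtain ⟨a, _⟩ := hπ q; exact a.elim⟩
    simp
  · intro β _ ih _ Q _ _ τ π hπ hc k
    letI : DecidableEq β := Classical.decEq β
    set τ' : Equiv.Perm β := Equiv.removeNone τ with hτ'
    let e : (Fin N × (β → Fin N)) ≃ (Option β → Fin N) :=
      { toFun := fun p o => o.elim p.1 p.2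
        invFun := fun f => (f none, fun x => f (some x))
        left_inv := fun _ => rfl
        right_inv := fun f => funext fun o => by cases o <;> rfl }
    have he : ∀ p o, e p o = o.elim p.1 p.2 := fun _ _ => rfl
    rw [← e.sum_comp, Fintype.sum_prod_type]
    simp only [Fintype.prod_option, he, Option.elim_none, Option.elim_some]
    by_cases h0 : τ none = none
    · have hsome : ∀ x, τ (some x) = some (τ' x) := by
        intro x
        refine (Equiv.removeNone_some τ (Option.ne_none_iff_exists'.1 fun e => ?_)).symm
        have := τ.injective (e.trans h0.symm)
        simp at this
      have hne : ∀ x, π (some x) ≠ π none := by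
        intro x hx
        have h1 := (hc _ _).1 hx
        have := sameCycle_invariant τ Option.isSome (fun u => by
          rcases u with _ | u
          · rw [h0]
          · rw [hsome]; rfl) h1
        simp at this
      have h := ih {f : Q // f ≠ π none} τ' (fun x => ⟨π (some x), hne x⟩) (fun f => by
        obtain ⟨a, ha⟩ := hπ f.1
        rcases a with _ | a
        · exact absurd ha.symm f.2
        · exact ⟨a, Subtype.ext ha⟩) (fun a b => by
          rw [Subtype.mk.injEq, hc, sameCycle_removeNone]) fun x => k (some x)
      simp only [h0, hsome, Option.elim_none, Option.elim_some]
      rw [← Finset.sum_mul_sum (Finset.univ : Finset (Fin N))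
        (Finset.univ : Finset (β → Fin N)) (fun x => (A ^ k none) x x)
        (fun i => ∏ x, (A ^ k (some x)) (i x) (i (τ' x))), h,
        Fintype.prod_eq_mul_prod_subtype_ne _ (π none)]
      congr 1
      · rw [Fintype.sum_option, if_pos rfl, Finset.sum_eq_zero fun x _ => if_neg (hne x), add_zero]
        rfl
      · refine Finset.prod_congr rfl fun f _ => ?_
        rw [Fintype.sum_option, if_neg fun e => f.2 e.symm, zero_add]
        congr 2
        exact Finset.sum_congr rfl fun x _ => by simp only [Subtype.ext_iff]
    · obtain ⟨b, hb⟩ := Option.ne_none_iff_exists'.1 h0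
      obtain ⟨a0', ha0'⟩ := τ.surjective none
      obtain ⟨a0, rfl⟩ : ∃ a0, a0' = some a0 := by
        refine Option.ne_none_iff_exists'.1 fun e => h0 ?_
        rw [← e, ha0', e]
      have hτa : τ' a0 = b := by
        have := Equiv.removeNone_none τ ha0'
        rw [hb, Option.some.injEq] at this
        exact this
      have hsome : ∀ x, x ≠ a0 → τ (some x) = some (τ' x) := by
        intro x hx
        refine (Equiv.removeNone_some τ (Option.ne_none_iff_exists'.1 fun e => hx ?_)).symm
        have := τ.injective (e.trans ha0'.symm)
        simpa using this
      have hπa : π (some a0) = π none := by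
        rw [hc, ← ha0']
        exact (Equiv.Perm.SameCycle.refl _ _).apply_right
      have h := ih Q τ' (fun x => π (some x)) (fun f => by
        obtain ⟨a, ha⟩ := hπ f
        rcases a with _ | a
        · exact ⟨a0, hπa.trans ha⟩
        · exact ⟨a, ha⟩) (fun a b => by rw [hc, sameCycle_removeNone])
          fun x => k (some x) + if x = a0 then k none else 0
      rw [Finset.sum_comm]
      -- Summing over the index of the deleted point performs the matrix product of the two adjacent
      -- powers of `A`.
      have h1 : ∀ i : β → Fin N, ∑ i0 : Fin N, ((A ^ k none) i0 (i b) *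
          ∏ x, (A ^ k (some x)) (i x) (Option.elim (τ (some x)) i0 i)) =
          ∏ x, (A ^ (k (some x) + if x = a0 then k none else 0)) (i x) (i (τ' x)) := by
        intro i
        rw [← Finset.mul_prod_erase _ _ (Finset.mem_univ a0), if_pos rfl, hτa, pow_add,
          Matrix.mul_apply, Finset.sum_mul]
        refine Finset.sum_congr rfl fun i0 _ => ?_
        rw [← Finset.mul_prod_erase _ _ (Finset.mem_univ a0), ha0', Option.elim_none]
        rw [Finset.prod_congr rfl (g := fun x => (A ^ (k (some x) + if x = a0 then k none else 0))
          (i x) (i (τ' x)))]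
        · ring
        · intro x hx
          have hx' := Finset.ne_of_mem_erase hx
          rw [hsome x hx', if_neg hx', add_zero, Option.elim_some]
      simp only [hb, Option.elim_some, h1]
      rw [h]
      refine Finset.prod_congr rfl fun f _ => ?_
      congr 2
      rw [Fintype.sum_option, ← Finset.add_sum_erase _ _ (Finset.mem_univ a0),
        ← Finset.add_sum_erase _ (fun x => if π (some x) = f then k (some x) else 0)
          (Finset.mem_univ a0), hπa, if_pos rfl]
      rw [Finset.sum_congr rfl (g := fun x => if π (some x) = f then k (some x) else 0)]
      · split_ifs <;> omega
      · intro x hx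
        rw [if_neg (Finset.ne_of_mem_erase hx), add_zero]

end Cycle

/-! ### Expansion of the weight of a Wick pairing in traces -/

section Faces

variable {d N n : ℕ} {R : Type*} [CommRing R]

/-- `pairSum` for a family of matrices. -/
def pairSumF (σ : Fin d → Equiv.Perm (Fin n)) (s : Equiv.Perm (Fin n))
    (L : Fin n → Matrix (Idx d N) (Idx d N) R) : R :=
  ∑ i : Fin n → Idx d N, ∑ j : Fin n → Idx d N,
    ∏ a, (L a (i a) (j (s a)) * ∏ c, if i a c = j (σ c a) c then (1 : R) else 0)

theorem pairSumF_sum {κ : Type*} [DecidableEq κ] (σ : Fin d → Equiv.Perm (Fin n)) (s : Equiv.Perm (Fin n))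
    (S : Finset κ) (β : κ → R) (M : κ → Matrix (Idx d N) (Idx d N) R) :
    pairSum σ s (∑ k ∈ S, β k • M k) =
      ∑ K ∈ Fintype.piFinset (fun _ : Fin n => S), (∏ a, β (K a)) *
        pairSumF σ s fun a => M (K a) := by
  simp only [pairSum, pairSumF, Matrix.sum_apply, Matrix.smul_apply, smul_eq_mul, Finset.sum_mul]
  simp only [Finset.prod_univ_sum, Finset.mul_sum]
  rw [Finset.sum_comm' (t' := Finset.univ) (s' := fun _ => Fintype.piFinset fun _ : Fin n => S)
    (by simp)]
  refine Finset.sum_congr rfl fun i _ => ?_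
  rw [Finset.sum_comm' (t' := Finset.univ) (s' := fun _ => Fintype.piFinset fun _ : Fin n => S)
    (by simp)]
  refine Finset.sum_congr rfl fun j _ => Finset.sum_congr rfl fun K _ => ?_
  rw [← Finset.prod_mul_distrib]
  exact Finset.prod_congr rfl fun a _ => by ring

open Classical in
/-- The sum over the edges `e` of the face `f` of the exponents `K e c`, `c` being the colour of
`f`. -/
def faceDeg (σ : Fin d → Equiv.Perm (Fin n)) (s : Equiv.Perm (Fin n)) (K : Fin n → Fin d → ℕ)
    (f : Faces σ s) : ℕ :=
  ∑ e, if faceOf σ s f.1 e = f then K e f.1 else 0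

/-- The Kronecker deltas of the graph determine `j` from `i`. The sums over indices of different
colours then decouple, and the sum of colour `c` runs along the cycles of `σ_c⁻¹ s`, which are the
faces of colour `(0c)`. -/
theorem pairSumF_tens (σ : Fin d → Equiv.Perm (Fin n)) (s : Equiv.Perm (Fin n))
    (A : Fin d → Matrix (Fin N) (Fin N) R) (K : Fin n → Fin d → ℕ) :
    pairSumF σ s (fun a => tens fun c => A c ^ K a c) =
      ∏ f : Faces σ s, (A f.1 ^ faceDeg σ s K f).trace := by
  classical
  have h1 : ∀ i : Fin n → Idx d N, ∑ j : Fin n → Idx d N,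
      ∏ a, (tens (fun c => A c ^ K a c) (i a) (j (s a)) *
        ∏ c, if i a c = j (σ c a) c then (1 : R) else 0) =
      ∏ c, ∏ a, (A c ^ K a c) (i a c) (i (((σ c)⁻¹ * s) a) c) := by
    intro i
    rw [Finset.sum_eq_single (fun b c => i ((σ c)⁻¹ b) c)]
    · rw [Finset.prod_comm]
      refine Finset.prod_congr rfl fun a _ => ?_
      simp [tens]
    · intro j _ hj
      have : ∃ b c, j b c ≠ i ((σ c)⁻¹ b) c := by
        by_contra h
        push Not at h
        exact hj (funext fun b => funext fun c => h b c)
      obtain ⟨b, c, hbc⟩ := this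
      refine Finset.prod_eq_zero (Finset.mem_univ ((σ c)⁻¹ b)) ?_
      rw [Finset.prod_eq_zero (Finset.mem_univ c), mul_zero]
      rw [if_neg]
      intro h
      apply hbc
      rw [h]; simp
    · intro h; exact absurd (Finset.mem_univ _) h
  rw [pairSumF]
  simp only [h1]
  rw [Fintype.prod_sigma, ← (Equiv.piComm fun (_ : Fin d) (_ : Fin n) => Fin N).sum_comp]
  have h2 : ∀ c, ∏ f : Face σ s c, (A c ^ faceDeg σ s K ⟨c, f⟩).trace =
      ∑ i : Fin n → Fin N, ∏ a, (A c ^ K a c) (i a) (i (((σ c)⁻¹ * s) a)) := by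
    intro c
    rw [sum_prod_cycles (A c) (Fin n) (Face σ s c) ((σ c)⁻¹ * s)
      (fun e => Quotient.mk (Equiv.Perm.SameCycle.setoid ((σ c)⁻¹ * s)) e) Quotient.mk_surjective
      (fun a b => Quotient.eq) fun a => K a c]
    refine Finset.prod_congr rfl fun f _ => ?_
    congr 2
    refine Finset.sum_congr rfl fun e _ => ?_
    have : faceOf σ s c e = ⟨c, f⟩ ↔
        Quotient.mk (Equiv.Perm.SameCycle.setoid ((σ c)⁻¹ * s)) e = f := by
      constructor
      · intro h
        exact eq_of_heq (Sigma.mk.inj h).2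
      · intro h
        exact congrArg (Sigma.mk c) h
    by_cases h : Quotient.mk (Equiv.Perm.SameCycle.setoid ((σ c)⁻¹ * s)) e = f
    · exact (if_pos (this.2 h)).trans (if_pos h).symm
    · exact (if_neg fun h' => h (this.1 h')).trans (if_neg h).symm
  rw [Finset.prod_congr rfl fun c _ => h2 c, Finset.prod_univ_sum, Fintype.piFinset_univ]
  rfl

/-- The coefficient of `∏_c A_c^{k_c}` in a power of `∑_c β_c A_c`. -/
def multiCoef (β : Fin d → R) (k : Fin d → ℕ) : R :=
  (Nat.multinomial Finset.univ k : R) * ∏ c, β c ^ k c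

theorem noncommProd_lift (β : Fin d → R) (A : Fin d → Matrix (Fin N) (Fin N) R) (k : Fin d → ℕ)
    (t : Finset (Fin d)) (h) :
    t.noncommProd (fun c => (β c • liftS c (A c)) ^ k c) h =
      (∏ c ∈ t, β c ^ k c) • tens (fun c => if c ∈ t then A c ^ k c else 1) := by
  induction t using Finset.induction_on with
  | empty => simp [tens_one]
  | insert a t ha ih =>
    rw [Finset.noncommProd_insert_of_notMem _ _ _ _ ha, ih, Finset.prod_insert ha, smul_pow,
      Matrix.smul_mul, Matrix.mul_smul, smul_smul]
    congr 1
    have hp : ∀ p, (liftS a (A a)) ^ p = liftS a (A a ^ p) := by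
      intro p
      induction p with
      | zero =>
        rw [pow_zero, pow_zero, liftS_eq_tens, ← tens_one]
        congr 1
        funext c
        by_cases hc : c = a
        · subst hc; simp
        · simp [Function.update_of_ne hc]
      | succ p ihp => rw [pow_succ, ihp, liftS_mul, pow_succ]
    rw [hp, liftS_eq_tens, tens_mul]
    congr 1
    funext c
    by_cases hc : c = a
    · subst hc; simp [ha]
    · simp [Function.update_of_ne hc, hc]

theorem liftS_commute {a b : Fin d} (hab : a ≠ b) (A B : Matrix (Fin N) (Fin N) R) :
    Commute (liftS a A) (liftS b B) := by
  rw [Commute, SemiconjBy, liftS_eq_tens, liftS_eq_tens, tens_mul, tens_mul]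
  congr 1
  funext c
  by_cases h1 : c = a
  · subst h1; simp [Function.update_of_ne hab]
  · simp [Function.update_of_ne h1]

/-- Lifts in different positions commute, so the multinomial theorem applies and each product of
powers is a tensor product. -/
theorem sum_lift_pow (β : Fin d → R) (A : Fin d → Matrix (Fin N) (Fin N) R) (p : ℕ) :
    (∑ c, β c • liftS c (A c)) ^ p = ∑ k ∈ Finset.piAntidiag Finset.univ p,
      multiCoef β k • tens fun c => A c ^ k c := by
  rw [Finset.sum_pow_eq_sum_piAntidiag_of_commute _ _ fun a _ b _ hab =>
    ((liftS_commute hab (A a) (A b)).smul_left _).smul_right _]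
  refine Finset.sum_congr rfl fun k _ => ?_
  rw [noncommProd_lift, multiCoef, mul_smul]
  simp only [Finset.mem_univ, if_true]
  rw [← nsmul_eq_mul, Nat.cast_smul_eq_nsmul]

/-- The multi-indices of degree less than `D`. -/
def simplexIdx (d D : ℕ) : Finset (Fin d → ℕ) :=
  (Finset.range D).biUnion fun p => Finset.piAntidiag Finset.univ p

theorem sum_simplexIdx {M : Type*} [AddCommMonoid M] (D : ℕ) (f : (Fin d → ℕ) → M) :
    ∑ k ∈ simplexIdx d D, f k =
      ∑ p ∈ Finset.range D, ∑ k ∈ Finset.piAntidiag Finset.univ p, f k := by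
  rw [simplexIdx, Finset.sum_biUnion]
  intro p _ q _ hpq
  rw [Function.onFun, Finset.disjoint_left]
  intro k hk hk'
  rw [Finset.mem_piAntidiag] at hk hk'
  exact hpq (hk.1.symm.trans hk'.1)

theorem pairSum_sub_mem {I : Type*} [CommRing I] {J : Ideal (MvPowerSeries (Fin d) I)}
    (σ : Fin d → Equiv.Perm (Fin n)) (s : Equiv.Perm (Fin n))
    {L L' : Matrix (Idx d N) (Idx d N) (MvPowerSeries (Fin d) I)} (h : ∀ i j, L i j - L' i j ∈ J) :
    pairSum σ s L - pairSum σ s L' ∈ J := by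
  refine sum_sub_sum_mem _ fun i _ => sum_sub_sum_mem _ fun j _ => prod_sub_prod_mem _ fun a _ => ?_
  rw [← sub_mul]
  exact Ideal.mul_mem_right _ _ (h _ _)

/-- Each coupling `β_c` has positive degree, so modulo degree `D` the Neumann series is a finite
sum; each choice of exponents on the edges yields one product of traces over the faces. -/
theorem pairSum_geom_mem {β : Fin d → Series d} (hβ : ∀ c, β c ∈ ordIdeal (Fin d) ℂ 1)
    (σ : Fin d → Equiv.Perm (Fin n)) (s : Equiv.Perm (Fin n))
    (A : Fin d → Matrix (Fin N) (Fin N) (Series d))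
    {B : Matrix (Idx d N) (Idx d N) (Series d)} (hB : B = ∑ c, β c • liftS c (A c)) (D : ℕ) :
    pairSum σ s (1 - B)⁻¹ - ∑ K ∈ Fintype.piFinset (fun _ : Fin n => simplexIdx d D),
      (∏ e, multiCoef β (K e)) * ∏ f : Faces σ s, (A f.1 ^ faceDeg σ s K f).trace ∈
        ordIdeal (Fin d) ℂ D := by
  classical
  have hB1 : ∀ i j, B i j ∈ ordIdeal (Fin d) ℂ 1 := by
    intro i j
    rw [hB, Matrix.sum_apply]
    exact Ideal.sum_mem _ fun c _ => Ideal.mul_mem_right _ _ (hβ c)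
  have hd1 : constantCoeff (1 - B).det = 1 := by
    rw [sub_eq_add_neg]
    exact det_constantCoeff fun i j => by simpa using hB1 i j
  have h1 : ∑ K ∈ Fintype.piFinset (fun _ : Fin n => simplexIdx d D),
      (∏ e, multiCoef β (K e)) * ∏ f : Faces σ s, (A f.1 ^ faceDeg σ s K f).trace =
      pairSum σ s (∑ p ∈ Finset.range D, B ^ p) := by
    have : ∑ p ∈ Finset.range D, B ^ p =
        ∑ k ∈ simplexIdx d D, multiCoef β k • tens fun c => A c ^ k c := by
      rw [sum_simplexIdx]
      exact Finset.sum_congr rfl fun p _ => by rw [hB, sum_lift_pow]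
    rw [this, pairSumF_sum]
    exact Finset.sum_congr rfl fun K _ => by rw [pairSumF_tens]
  rw [h1]
  exact pairSum_sub_mem σ s fun i j => inv_sub_geom_mem hB1
    (Matrix.mul_nonsing_inv _ (isUnit_of_constantCoeff_one hd1)) D i j

end Faces

/-! ### Expansion in powers of `N` -/

section Laurent

/-- The power series with the coefficients `f`. -/
def ofCoeff {σ S : Type*} [CommRing S] (f : (σ →₀ ℕ) → S) : MvPowerSeries σ S := f

theorem coeff_ofCoeff {σ S : Type*} [CommRing S] (f : (σ →₀ ℕ) → S) (m : σ →₀ ℕ) :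
    coeff m (ofCoeff f) = f m := rfl

/-- `√N` as a unit. -/
def sqrtUnit (N : ℕ) : ℂˣ :=
  -- The value `1` only fills the case `N = 0`.
  if h : ((Real.sqrt N : ℝ) : ℂ) ≠ 0 then Units.mk0 _ h else 1

theorem sqrtUnit_val {N : ℕ} (hN : 1 ≤ N) : (sqrtUnit N : ℂ) = ((Real.sqrt N : ℝ) : ℂ) := by
  have h : ((Real.sqrt N : ℝ) : ℂ) ≠ 0 := by
    have : (0 : ℝ) < Real.sqrt N := Real.sqrt_pos.2 (by exact_mod_cast hN)
    exact_mod_cast this.ne'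
  rw [sqrtUnit, dif_pos h]; rfl

/-- Evaluation of a Laurent polynomial at `N^{-1/2}`. -/
def evN (N : ℕ) : LaurentPolynomial ℂ →ₐ[ℂ] ℂ :=
  AddMonoidAlgebra.lift ℂ ℂ ℤ ((Units.coeHom ℂ).comp (zpowersHom ℂˣ (sqrtUnit N)⁻¹))

theorem evN_single {N : ℕ} (hN : 1 ≤ N) (j : ℤ) (a : ℂ) :
    evN N (AddMonoidAlgebra.single j a) = a * ((Real.sqrt N : ℝ) : ℂ) ^ (-j) := by
  rw [evN, AddMonoidAlgebra.lift_single, smul_eq_mul]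
  congr 1
  simp [zpowersHom_apply, sqrtUnit_val hN]

theorem evN_T {N : ℕ} (hN : 1 ≤ N) (j : ℤ) :
    evN N (LaurentPolynomial.T j) = ((Real.sqrt N : ℝ) : ℂ) ^ (-j) := by
  rw [LaurentPolynomial.T, evN_single hN, one_mul]

theorem evN_eq_finsum {N : ℕ} (hN : 1 ≤ N) (a : LaurentPolynomial ℂ) :
    evN N a = ∑ᶠ j : ℤ, a.coeff j * ((Real.sqrt N : ℝ) : ℂ) ^ (-j) := by
  rw [finsum_eq_sum_of_support_subset (s := a.coeff.support) _ (by
    intro j hj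
    simp only [Function.mem_support] at hj
    simpa using left_ne_zero_of_mul hj)]
  conv_lhs => rw [← AddMonoidAlgebra.sum_coeff_single a]
  rw [Finsupp.sum, map_sum]
  exact Finset.sum_congr rfl fun j _ => evN_single hN j _

/-- Laurent polynomials as Laurent series. -/
def toLaurent : LaurentPolynomial ℂ →ₐ[ℂ] HahnSeries ℤ ℂ :=
  AddMonoidAlgebra.lift ℂ (HahnSeries ℤ ℂ) ℤ
    { toFun := fun j => HahnSeries.single (Multiplicative.toAdd j) 1
      map_one' := rfl
      map_mul' := fun a b => by simp [HahnSeries.single_mul_single] }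

theorem toLaurent_single (j : ℤ) (a : ℂ) :
    toLaurent (AddMonoidAlgebra.single j a) = HahnSeries.single j a := by
  rw [toLaurent, AddMonoidAlgebra.lift_single, Algebra.smul_def]
  have h : algebraMap ℂ (HahnSeries ℤ ℂ) a = HahnSeries.C a := by
    rw [HahnSeries.algebraMap_apply']
    exact HahnSeries.ofPowerSeries_C a
  change _ * HahnSeries.single j 1 = _
  rw [h, HahnSeries.C_apply, HahnSeries.single_mul_single, zero_add, mul_one]

theorem toLaurent_coeff (a : LaurentPolynomial ℂ) (j : ℤ) : (toLaurent a).coeff j = a.coeff j := by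
  induction a using AddMonoidAlgebra.induction_linear with
  | zero => simp
  | add f g hf hg => rw [map_add, HahnSeries.coeff_add, hf, hg]; rfl
  | single i b =>
    rw [toLaurent_single, HahnSeries.coeff_single, AddMonoidAlgebra.coeff_single,
      Finsupp.single_apply]
    by_cases h : i = j
    · rw [if_pos h, if_pos h.symm]
    · rw [if_neg h, if_neg fun e => h e.symm]

theorem toLaurent_T (j : ℤ) : toLaurent (LaurentPolynomial.T j) = hpow j := toLaurent_single j 1

end Laurent

/-- Series in the couplings whose coefficients are Laurent polynomials in `N^{1/2}`. -/
abbrev LSeries (d : ℕ) : Type := MvPowerSeries (Fin d) (LaurentPolynomial ℂ)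

/-! ### Moments and Wick terms as series with Laurent polynomial coefficients. -/

section Traces

variable {d : ℕ}

/-- Series in the couplings, as series with Laurent polynomial coefficients. -/
abbrev toL (d : ℕ) : Series d →+* LSeries d :=
  MvPowerSeries.map (algebraMap ℂ (LaurentPolynomial ℂ))

/-- The value at `N` of a series with Laurent polynomial coefficients. -/
abbrev valN (d N : ℕ) : LSeries d →+* Series d :=
  MvPowerSeries.map ((evN N : LaurentPolynomial ℂ →ₐ[ℂ] ℂ) : LaurentPolynomial ℂ →+* ℂ)

theorem valN_toL (N : ℕ) (A : Series d) : valN d N (toL d A) = A := by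
  ext m
  rw [coeff_map, coeff_map]
  exact AlgHom.commutes (evN N) _

/-- Polynomials in the traces `tr M_c^q`. -/
abbrev TraceP (d : ℕ) : Type := MvPolynomial (Fin d × ℕ) (LaurentPolynomial ℂ)

/-- The Gaussian expectation of a product of traces, as a Laurent polynomial. -/
def wordVal (w : Multiset (Fin d × ℕ)) : LaurentPolynomial ℂ :=
  LaurentPolynomial.T (-2 * (w.card : ℤ)) * Polynomial.aeval (LaurentPolynomial.T 4) (wordPoly w)

/-- In the variable `N^{-1/2}` the monomial `T (-2 k)` stands for `N^k` and `T 4` for `N⁻²`. -/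
theorem evN_wordVal {N : ℕ} (hN : 1 ≤ N) (w : Multiset (Fin d × ℕ)) :
    evN N (wordVal w) = gaussE (N : ℂ) (wordP N w) := by
  have hN0 : (N : ℝ) ≠ 0 := by
    have : N ≠ 0 := by omega
    exact_mod_cast this
  have hs : ((Real.sqrt N : ℝ) : ℂ) ^ 2 = N := by
    rw [← Complex.ofReal_pow, Real.sq_sqrt (by positivity)]; simp
  have hs0 : ((Real.sqrt N : ℝ) : ℂ) ≠ 0 := by
    intro h; rw [h] at hs
    apply hN0
    have : (N : ℂ) = 0 := by rw [← hs]; simp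
    exact_mod_cast this
  rw [gaussE_wordP hN, wordVal, map_mul, evN_T hN, Polynomial.aeval_eq_sum_range,
    Polynomial.aeval_eq_sum_range, map_sum]
  congr 1
  · rw [← hs, ← pow_mul, ← zpow_natCast]
    congr 1; push_cast; ring
  · refine Finset.sum_congr rfl fun g _ => ?_
    rw [map_nsmul, map_pow, evN_T hN, ← hs]
    congr 2
    rw [← pow_mul, ← zpow_natCast, ← zpow_neg]
    norm_num

/-- The Gaussian expectation of a polynomial in the traces. -/
def traceE : TraceP d →ₗ[LaurentPolynomial ℂ] LaurentPolynomial ℂ :=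
  (MvPolynomial.basisMonomials (Fin d × ℕ) (LaurentPolynomial ℂ)).constr (LaurentPolynomial ℂ)
    fun w => wordVal (Finsupp.toMultiset w)

theorem traceE_monomial (w : Fin d × ℕ →₀ ℕ) (a : LaurentPolynomial ℂ) :
    traceE (MvPolynomial.monomial w a) = a * wordVal (Finsupp.toMultiset w) := by
  have h : MvPolynomial.monomial w a =
      a • MvPolynomial.basisMonomials (Fin d × ℕ) (LaurentPolynomial ℂ) w := by
    simp [MvPolynomial.smul_monomial]
  rw [h, map_smul, traceE, Module.Basis.constr_basis, smul_eq_mul]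

theorem wordVal_zero : wordVal (0 : Multiset (Fin d × ℕ)) = 1 := by
  rw [wordVal, wordPoly_zero, Multiset.card_zero, map_one]
  simp

/-- Substitution of the traces of the coordinate matrices. -/
def evalW (d N : ℕ) : TraceP d →+* MvPolynomial (HIdx d N) ℂ :=
  MvPolynomial.eval₂Hom (MvPolynomial.C.comp ((evN N : LaurentPolynomial ℂ →ₐ[ℂ] ℂ) : _ →+* ℂ))
    fun p => (hermP (S := ℂ) p.1 ^ p.2).trace

theorem gaussE_evalW {N : ℕ} (hN : 1 ≤ N) (p : TraceP d) :
    gaussE (N : ℂ) (evalW d N p) = evN N (traceE p) := by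
  induction p using MvPolynomial.induction_on' with
  | add p q hp hq => rw [map_add, map_add, hp, hq, map_add, map_add]
  | monomial w a =>
    have h : evalW d N (MvPolynomial.monomial w a) =
        MvPolynomial.C (evN N a) * wordP N (Finsupp.toMultiset w) := by
      rw [evalW, MvPolynomial.coe_eval₂Hom, MvPolynomial.eval₂_monomial, wordP,
        Finsupp.toMultiset_map, Finsupp.prod_toMultiset, Finsupp.prod_mapDomain_index (by simp)
          (by intros; rw [pow_add])]
      rfl
    rw [h, ← MvPolynomial.smul_eq_C_mul, map_smul, traceE_monomial, map_mul, evN_wordVal hN,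
      smul_eq_mul]

/-- Substitution of the traces of the matrices `herm (x c)`. -/
def evalX {N : ℕ} (x : Herms d N) : TraceP d →+* ℂ :=
  (MvPolynomial.eval fun i => hcoord i x).comp (evalW d N)

theorem evalX_C {N : ℕ} (x : Herms d N) (a : LaurentPolynomial ℂ) :
    evalX x (MvPolynomial.C a) = evN N a := by
  simp [evalX, evalW]

theorem evalX_X {N : ℕ} (x : Herms d N) (p : Fin d × ℕ) :
    evalX x (MvPolynomial.X p) = (herm (x p.1) ^ p.2).trace := by
  rw [evalX, RingHom.comp_apply, evalW, MvPolynomial.coe_eval₂Hom, MvPolynomial.eval₂_X,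
    ← eval_hermP]
  have h := map_pow (MvPolynomial.eval fun i => hcoord i x).mapMatrix (hermP (S := ℂ) (N := N) p.1) p.2
  rw [RingHom.mapMatrix_apply, RingHom.mapMatrix_apply] at h
  rw [← h]
  simp [Matrix.trace]

/-- The expectation of the coefficients. -/
def traceF (d : ℕ) : MvPowerSeries (Fin d) (TraceP d) →+ LSeries d where
  toFun F := fun m => traceE (coeff m F)
  map_zero' := funext fun _ => map_zero traceE
  map_add' _ _ := funext fun _ => map_add traceE _ _

theorem coeff_traceF (F : MvPowerSeries (Fin d) (TraceP d)) (m : Fin d →₀ ℕ) :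
    coeff m (traceF d F) = traceE (coeff m F) := rfl

theorem gaussF_evalW {N : ℕ} (hN : 1 ≤ N) (F : MvPowerSeries (Fin d) (TraceP d)) :
    gaussF (N : ℂ) (MvPowerSeries.map (evalW d N) F) = valN d N (traceF d F) := by
  ext m
  rw [coeff_gaussF, coeff_map, coeff_map, coeff_traceF, gaussE_evalW hN]
  rfl

/-- The coupling of the matrix `M_c`. -/
def betaL (c : Fin d) : LSeries d :=
  C (LaurentPolynomial.T ((d : ℤ) - 2)) * toL d (alpha c)

/-- The coupling of the matrix `M_c` at `N`. -/
def betaN (N : ℕ) (c : Fin d) : Series d :=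
  C (((N : ℝ) ^ ((2 - (d : ℝ)) / 2) : ℝ) : ℂ) * alpha c

theorem betaN_mem (N : ℕ) (c : Fin d) : betaN N c ∈ ordIdeal (Fin d) ℂ 1 :=
  Ideal.mul_mem_left _ _ (alpha_mem c)

theorem betaL_mem (c : Fin d) : betaL c ∈ ordIdeal (Fin d) (LaurentPolynomial ℂ) 1 :=
  Ideal.mul_mem_left _ _ (map_mem_ordIdeal _ (alpha_mem c))

theorem valN_betaL {N : ℕ} (hN : 1 ≤ N) (c : Fin d) : valN d N (betaL c) = betaN N c := by
  have hN0 : (0 : ℝ) < N := by exact_mod_cast hN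
  rw [betaL, map_mul, valN_toL, betaN, MvPowerSeries.map_C]
  congr 2
  change evN N _ = _
  rw [evN_T hN, Real.sqrt_eq_rpow, ← Complex.ofReal_zpow, ← Real.rpow_intCast,
    ← Real.rpow_mul hN0.le]
  congr 2
  push_cast
  ring

theorem map_multiCoef {R T : Type*} [CommRing R] [CommRing T] (φ : R →+* T) (β : Fin d → R)
    (k : Fin d → ℕ) : φ (multiCoef β k) = multiCoef (fun c => φ (β c)) k := by
  simp [multiCoef]

theorem valN_multiCoef {N : ℕ} (hN : 1 ≤ N) (k : Fin d → ℕ) :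
    valN d N (multiCoef betaL k) = multiCoef (betaN N) k := by
  rw [map_multiCoef]
  congr 1
  funext c
  exact valN_betaL hN c

theorem coupled_eq {N : ℕ} (y : Herms d N) :
    coupled y = ∑ c, betaN N c • liftS c ((herm (y c)).map C) := by
  rw [coupled]
  refine Finset.sum_congr rfl fun c _ => ?_
  rw [lift_eq_liftS, liftS_map]
  rfl

theorem trace_pow_map_C {N : ℕ} (M : Matrix (Fin N) (Fin N) ℂ) (p : ℕ) :
    ((M.map (C (σ := Fin d))) ^ p).trace = C ((M ^ p).trace) := by
  have h := map_pow (C (σ := Fin d) (R := ℂ)).mapMatrix M p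
  rw [RingHom.mapMatrix_apply, RingHom.mapMatrix_apply] at h
  rw [← h]
  simp [Matrix.trace]

theorem trace_coupled_pow {N : ℕ} (y : Herms d N) (p : ℕ) :
    (coupled y ^ p).trace = ∑ k ∈ Finset.piAntidiag Finset.univ p,
      multiCoef (betaN N) k * C (∏ c, (herm (y c) ^ k c).trace) := by
  rw [coupled_eq, sum_lift_pow, Matrix.trace_sum]
  refine Finset.sum_congr rfl fun k _ => ?_
  rw [Matrix.trace_smul, tens_trace, smul_eq_mul, map_prod]
  simp only [trace_pow_map_C]

/-- The potential of the matrix model, as a series with coefficients polynomial in the traces. -/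
def potT (d : ℕ) : MvPowerSeries (Fin d) (TraceP d) := fun m =>
  ∑ p ∈ Finset.Icc 2 m.degree, ∑ k ∈ Finset.piAntidiag Finset.univ p,
    MvPolynomial.C (algebraMap ℂ _ (1 / p) * coeff m (multiCoef (betaL (d := d)) k)) *
      ∏ c, MvPolynomial.X (c, k c)

theorem potT_mem (d : ℕ) : potT d ∈ ordIdeal (Fin d) (TraceP d) 1 := by
  intro m hm
  change ∑ p ∈ Finset.Icc 2 m.degree, _ = (0 : TraceP d)
  rw [Finset.Icc_eq_empty (by omega), Finset.sum_empty]

theorem evalX_potT {N : ℕ} (hN : 1 ≤ N) (x : Herms d N) :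
    MvPowerSeries.map (evalX x) (potT d) = potential x := by
  ext m
  rw [coeff_map]
  change evalX x (∑ p ∈ Finset.Icc 2 m.degree, _) =
    ∑ p ∈ Finset.Icc 2 m.degree, coeff m ((coupled x) ^ p).trace / (p : ℂ)
  rw [map_sum]
  refine Finset.sum_congr rfl fun p _ => ?_
  rw [map_sum, trace_coupled_pow, map_sum, Finset.sum_div]
  refine Finset.sum_congr rfl fun k _ => ?_
  rw [map_mul, evalX_C, map_mul, AlgHom.commutes, map_prod]
  simp only [evalX_X]
  rw [coeff_mul_C, ← valN_multiCoef hN, coeff_map]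
  change (1 / (p : ℂ)) * evN N _ * _ = evN N _ * _ / _
  ring

theorem matrixWeight_eval {N : ℕ} (hN : 1 ≤ N) (x : Herms d N) (P : TraceP d) :
    evalX x P • matrixWeight x =
    Complex.exp (-((N : ℝ) / 2 : ℂ) * ∑ c, (herm (x c) * herm (x c)).trace) •
      evalAt hcoord x (MvPowerSeries.map (evalW d N) (C P * fexp (potT d))) := by
  have h : evalAt hcoord x (MvPowerSeries.map (evalW d N) (C P * fexp (potT d))) =
      C (evalX x P) * fexp (potential x) := by
    have e : ∀ F : MvPowerSeries (Fin d) (TraceP d), evalAt hcoord x (MvPowerSeries.map (evalW d N) F) =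
        MvPowerSeries.map (evalX x) F := by
      intro F; ext m; simp only [coeff_map]; rfl
    rw [e, map_mul, MvPowerSeries.map_C, map_fexp _ (potT_mem d), evalX_potT hN]
  rw [h, matrixWeight, formalExp_eq, smul_comm, ← smul_eq_C_mul]
  norm_num

theorem exists_gaussian {N : ℕ} (hN : 1 ≤ N) : ∃ Z : ℂ, Z ≠ 0 ∧ ∀ P : TraceP d,
    (∀ m, Integrable fun x : Herms d N => coeff m (evalX x P • matrixWeight x)) ∧
    formalIntegral (fun x : Herms d N => evalX x P • matrixWeight x) =
      C Z * valN d N (traceF d (C P * fexp (potT d))) := by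
  obtain ⟨Z, hZ⟩ := isGaussian_herms d N (a := (N : ℝ)) (by exact_mod_cast hN)
  refine ⟨Z, hZ.ne_zero, fun P => ?_⟩
  simp only [matrixWeight_eval hN]
  refine ⟨fun m => hZ.integrable_coeff _ m, ?_⟩
  rw [hZ.formalIntegral_eq]
  congr 1
  exact gaussF_evalW hN _

/-- The partition function of the matrix model. -/
def denL (d : ℕ) : LSeries d := traceF d (fexp (potT d))

theorem traceE_one : traceE (1 : TraceP d) = 1 := by
  have h : (1 : TraceP d) = MvPolynomial.monomial 0 1 := rfl
  rw [h, traceE_monomial, one_mul, map_zero]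
  exact wordVal_zero

theorem denL_constantCoeff : constantCoeff (denL d) = 1 := by
  rw [← coeff_zero_eq_constantCoeff_apply, denL, coeff_traceF, coeff_zero_eq_constantCoeff_apply,
    constantCoeff_fexp (potT_mem d), traceE_one]

/-- The expansion of the moment of the product of the traces `tr M_{col v}^{q v}`. -/
def momL {V : Type} [Fintype V] (col : V → Fin d) (q : V → ℕ) : LSeries d :=
  traceF d (C (∏ v, MvPolynomial.X (col v, q v)) * fexp (potT d)) * Ring.inverse (denL d)

theorem valN_inverse (N : ℕ) {A : LSeries d} (hA : constantCoeff A = 1) :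
    valN d N (Ring.inverse A) = (valN d N A)⁻¹ := by
  have h1 : constantCoeff (valN d N A) = 1 := by
    rw [constantCoeff_map, hA, map_one]
  rw [MvPowerSeries.eq_inv_iff_mul_eq_one (by rw [h1]; exact one_ne_zero), ← map_mul,
    Ring.inverse_mul_cancel _ (isUnit_of_constantCoeff_one hA), map_one]

/-- The Gaussian mass cancels, and what remains is the value at `N` of one series that does not
depend on `N`: a quotient of Gaussian expectations of polynomials in the traces. -/
theorem moment_ratio {N : ℕ} (hN : 1 ≤ N) (P : TraceP d) :
    formalIntegral (fun x : Herms d N => evalX x P • matrixWeight x) *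
      (formalIntegral fun x : Herms d N => matrixWeight x)⁻¹ =
    valN d N (traceF d (C P * fexp (potT d)) * Ring.inverse (denL d)) := by
  obtain ⟨Z, hZ, h⟩ := exists_gaussian (d := d) hN
  have h1 := (h 1).2
  simp only [map_one, one_smul, one_mul] at h1
  rw [(h P).2, h1, mul_mul_inv_cancel (by simpa using hZ), map_mul (valN d N),
    valN_inverse N denL_constantCoeff]
  rfl

theorem evalX_prod {N : ℕ} {V : Type} [Fintype V] (col : V → Fin d) (q : V → ℕ) (x : Herms d N) :
    evalX x (∏ v, MvPolynomial.X (col v, q v)) = ∏ v, (herm (x (col v)) ^ q v).trace := by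
  rw [map_prod]
  simp only [evalX_X]

theorem moment_eq {N : ℕ} (hN : 1 ≤ N) {V : Type} [Fintype V] (col : V → Fin d) (q : V → ℕ) :
    moment N col q = valN d N (momL col q) := by
  rw [momL, ← moment_ratio hN, moment]
  simp only [evalX_prod]

theorem momL_equiv {V V' : Type} [Fintype V] [Fintype V'] (e : V ≃ V') (col : V' → Fin d)
    (q : V' → ℕ) : momL (col ∘ e) (q ∘ e) = momL col q := by
  have h : (∏ v, (MvPolynomial.X ((col ∘ e) v, (q ∘ e) v) : TraceP d)) =
      ∏ v, MvPolynomial.X (col v, q v) :=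
    e.prod_comp fun v => (MvPolynomial.X (col v, q v) : TraceP d)
  rw [momL, momL, h]

theorem momL_empty {V : Type} [Fintype V] [IsEmpty V] (col : V → Fin d) (q : V → ℕ) :
    momL col q = 1 := by
  rw [momL, Finset.univ_eq_empty, Finset.prod_empty, map_one, one_mul]
  exact Ring.mul_inverse_cancel _ (isUnit_of_constantCoeff_one denL_constantCoeff)

/-- The expansion of the contribution of a Wick pairing in the moments `F`, at the order `D`. -/
def wickSum {n : ℕ} {T : Type*} [CommRing T] (σ : Fin d → Equiv.Perm (Fin n))
    (s : Equiv.Perm (Fin n)) (r : MvPowerSeries (Fin d) T) (β : Fin d → MvPowerSeries (Fin d) T)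
    (F : (Faces σ s → ℕ) → MvPowerSeries (Fin d) T) (D : ℕ) : MvPowerSeries (Fin d) T :=
  r ^ n * ∑ K ∈ Fintype.piFinset (fun _ : Fin n => simplexIdx d D),
    (∏ e, multiCoef β (K e)) * F (faceDeg σ s K)

theorem map_wickSum {n : ℕ} {T T' : Type*} [CommRing T] [CommRing T'] (φ : T →+* T')
    (σ : Fin d → Equiv.Perm (Fin n)) (s : Equiv.Perm (Fin n)) (r : MvPowerSeries (Fin d) T)
    (β : Fin d → MvPowerSeries (Fin d) T)
    (F : (Faces σ s → ℕ) → MvPowerSeries (Fin d) T) (D : ℕ) :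
    MvPowerSeries.map φ (wickSum σ s r β F D) = wickSum σ s (MvPowerSeries.map φ r)
      (fun c => MvPowerSeries.map φ (β c)) (fun q => MvPowerSeries.map φ (F q)) D := by
  simp only [wickSum, map_mul, map_pow, map_sum, map_prod, map_multiCoef]

/-- The factor `N^{-(d-1)} (1 + iG)⁻¹` of an edge. -/
def rootL (d : ℕ) : LSeries d := C (LaurentPolynomial.T (2 * ((d : ℤ) - 1))) * toL d (rootSeries d)

theorem formalIntegral_sub_mem {Ω : Type} [MeasureSpace Ω] {F F' : Ω → Series d} {D : ℕ}
    (h : ∀ ω, F ω - F' ω ∈ ordIdeal (Fin d) ℂ D) :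
    formalIntegral F - formalIntegral F' ∈ ordIdeal (Fin d) ℂ D := by
  intro m hm
  rw [map_sub, sub_eq_zero]
  change ∫ ω, coeff m (F ω) = ∫ ω, coeff m (F' ω)
  congr 1
  funext ω
  exact coeff_eq_of_sub_mem (h ω) hm

/-- Modulo degree `D` the expansion of the inverse matrices is a finite sum, so it commutes with the
formal integral, and every summand is a moment of traces indexed by the faces. -/
theorem wickTerm_sub_mem {N n : ℕ} (hd : 1 ≤ d) (hN : 1 ≤ N) (σ : Fin d → Equiv.Perm (Fin n))
    (s : Equiv.Perm (Fin n)) (D : ℕ) :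
    wickTerm N σ s - valN d N (wickSum σ s (rootL d) betaL
      (fun q => momL (fun f : Faces σ s => f.1) q) D) ∈ ordIdeal (Fin d) ℂ D := by
  have hN0 : (0 : ℝ) < N := by exact_mod_cast hN
  have hr : valN d N (rootL d) = C (((N : ℂ) ^ (d - 1))⁻¹) * rootSeries d := by
    rw [rootL, map_mul, valN_toL, MvPowerSeries.map_C]
    congr 2
    change evN N _ = _
    have hs : ((Real.sqrt N : ℝ) : ℂ) ^ 2 = N := by
      rw [← Complex.ofReal_pow, Real.sq_sqrt hN0.le]; simp
    rw [evN_T hN, zpow_neg, ← hs, ← pow_mul, ← zpow_natCast]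
    congr 2
    push_cast [hd]
    ring
  set Q := fun K : Fin n → Fin d → ℕ => (∏ f : Faces σ s,
    (MvPolynomial.X (f.1, faceDeg σ s K f) : TraceP d)) with hQ
  have h1 : ∀ y : Herms d N, pairSum σ s (1 - coupled y)⁻¹ * matrixWeight y -
      ∑ K ∈ Fintype.piFinset (fun _ : Fin n => simplexIdx d D),
        (∏ e, multiCoef (betaN N) (K e)) * (evalX y (Q K) • matrixWeight y) ∈
        ordIdeal (Fin d) ℂ D := by
    intro y
    have := pairSum_geom_mem (fun c => betaN_mem N c) σ s _ (coupled_eq y) D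
    have h2 := Ideal.mul_mem_right (matrixWeight y) _ this
    rw [sub_mul, Finset.sum_mul] at h2
    convert h2 using 3 with K
    rw [hQ, evalX_prod, mul_assoc, smul_eq_C_mul, map_prod]
    simp only [trace_pow_map_C]
  obtain ⟨Z, hZ, hG⟩ := exists_gaussian (d := d) hN
  have h2 := formalIntegral_sub_mem h1
  rw [formalIntegral_sum _ _ fun K _ m => integrable_const_mul _ (hG (Q K)).1 m] at h2
  simp only [fun K => formalIntegral_const_mul (∏ e, multiCoef (betaN N) (K e)) (hG (Q K)).1] at h2
  have h3 := Ideal.mul_mem_left _ ((C (((N : ℂ) ^ (n * (d - 1)))⁻¹) * rootSeries d ^ n))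
    (Ideal.mul_mem_right (formalIntegral fun y : Herms d N => matrixWeight y)⁻¹ _ h2)
  rw [sub_mul, mul_sub, ← wickTerm_eq hd hN] at h3
  convert h3 using 2
  rw [map_wickSum, wickSum]
  change valN d N (rootL d) ^ n * _ = _
  rw [hr, mul_pow, ← map_pow, Finset.sum_mul]
  congr 1
  · rw [mul_comm n, pow_mul, inv_pow]
  · refine Finset.sum_congr rfl fun K _ => ?_
    rw [mul_assoc, moment_ratio hN]
    congr 1
    refine Finset.prod_congr rfl fun e _ => ?_
    congr 1
    funext c
    exact valN_betaL hN c

/-- The expansion of the contribution of a Wick pairing. -/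
def wickL {n : ℕ} (σ : Fin d → Equiv.Perm (Fin n)) (s : Equiv.Perm (Fin n)) : LSeries d :=
  ofCoeff fun m => coeff m (wickSum σ s (rootL d) betaL
    (fun q => momL (fun f : Faces σ s => f.1) q) (m.degree + 1))

theorem coeff_wickL {n : ℕ} (σ : Fin d → Equiv.Perm (Fin n)) (s : Equiv.Perm (Fin n))
    (m : Fin d →₀ ℕ) : coeff m (wickL σ s) = coeff m (wickSum σ s (rootL d) betaL
      (fun q => momL (fun f : Faces σ s => f.1) q) (m.degree + 1)) := by
  rw [wickL, coeff_ofCoeff]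

theorem wickTerm_eq_valN {N n : ℕ} (hd : 1 ≤ d) (hN : 1 ≤ N) (σ : Fin d → Equiv.Perm (Fin n))
    (s : Equiv.Perm (Fin n)) : wickTerm N σ s = valN d N (wickL σ s) := by
  ext m
  rw [coeff_eq_of_sub_mem (wickTerm_sub_mem hd hN σ s (m.degree + 1)) (Nat.lt_succ_self _),
    coeff_map, coeff_map, coeff_wickL]

theorem isExpansion_of_valN {F : ℕ → Series d} (A : LSeries d)
    (h : ∀ N, 1 ≤ N → F N = valN d N A) :
    IsExpansion F (MvPowerSeries.map (toLaurent : LaurentPolynomial ℂ →+* LaurentSeries ℂ) A) := by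
  intro m
  have h1 : (coeff m (MvPowerSeries.map (toLaurent : LaurentPolynomial ℂ →+* LaurentSeries ℂ)
      A)).coeff = (coeff m A).coeff := by
    funext j
    rw [coeff_map]
    exact toLaurent_coeff _ _
  rw [h1]
  refine ⟨?_, fun N hN => ?_⟩
  · refine ((coeff m A).coeff.support.finite_toSet).subset fun j hj => ?_
    simpa using hj
  · rw [h N hN, coeff_map]
    exact evN_eq_finsum hN _

end Traces

/-! ### Families of Laurent series of controlled growth -/

section Hahn

/-- The range of summation depends only on lower bounds for the orders and not on the series
themselves; families with uniformly bounded poles can thus be multiplied coefficient by coefficient.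
-/
theorem hahn_coeff_mul {x y : LaurentSeries ℂ} {jx jy : ℤ} (hx : ∀ j, j < jx → x.coeff j = 0)
    (hy : ∀ j, j < jy → y.coeff j = 0) (j : ℤ) :
    (x * y).coeff j = ∑ i ∈ Finset.Icc jx (j - jy), x.coeff i * y.coeff (j - i) := by
  rw [HahnSeries.coeff_mul]
  have h1 : ∑ i ∈ Finset.Icc jx (j - jy), x.coeff i * y.coeff (j - i) =
      ∑ p ∈ (Finset.Icc jx (j - jy)).image (fun i => (i, j - i)), x.coeff p.1 * y.coeff p.2 := by
    rw [Finset.sum_image]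
    intro a _ b _ h
    exact (Prod.mk.inj h).1
  rw [h1]
  refine Finset.sum_subset (fun p hp => ?_) fun p hp hp' => ?_
  · rw [Finset.mem_addAntidiagonal] at hp
    obtain ⟨h1, h2, h3⟩ := hp
    have e1 : jx ≤ p.1 := by
      by_contra h; exact h1 (hx _ (by omega))
    have e2 : jy ≤ p.2 := by
      by_contra h; exact h2 (hy _ (by omega))
    rw [Finset.mem_image]
    exact ⟨p.1, Finset.mem_Icc.2 ⟨e1, by omega⟩, Prod.ext rfl (by simp only; omega)⟩
  · rw [Finset.mem_image] at hp
    obtain ⟨i, hi, rfl⟩ := hp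
    rw [Finset.mem_addAntidiagonal] at hp'
    simp only [HahnSeries.mem_support, not_and_or, not_not] at hp'
    rcases hp' with h | h | h
    · rw [h, zero_mul]
    · rw [h, mul_zero]
    · simp at h

theorem hahn_coeff_mul_lt {x y : LaurentSeries ℂ} {jx jy : ℤ} (hx : ∀ j, j < jx → x.coeff j = 0)
    (hy : ∀ j, j < jy → y.coeff j = 0) {j : ℤ} (hj : j < jx + jy) : (x * y).coeff j = 0 := by
  rw [hahn_coeff_mul hx hy, Finset.Icc_eq_empty (by omega), Finset.sum_empty]

theorem hahn_bdd (x : LaurentSeries ℂ) : ∃ j0 : ℤ, ∀ j, j < j0 → x.coeff j = 0 := by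
  by_cases h : x = 0
  · exact ⟨0, fun j _ => by rw [h, HahnSeries.coeff_zero]⟩
  · exact ⟨x.order, fun j hj => HahnSeries.coeff_eq_zero_of_lt_order hj⟩

end Hahn

section Tame

variable {Q Q' : Type*} {ω ω' : Q → ℕ}

/-- The Laurent series `a q` have uniformly bounded poles, and coefficients of growth
`2 ^ ω q` up to polynomial factors. -/
def TameW (ω : Q → ℕ) (a : Q → LaurentSeries ℂ) : Prop :=
  (∃ j0 : ℤ, ∀ q j, j < j0 → (a q).coeff j = 0) ∧
    ∀ j, ∃ (K : ℝ) (D : ℕ), 0 ≤ K ∧ ∀ q, ‖(a q).coeff j‖ ≤ K * ((ω q : ℝ) + 1) ^ D * 2 ^ ω q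

theorem TameW.const (ω : Q → ℕ) (a : LaurentSeries ℂ) : TameW ω fun _ => a := by
  obtain ⟨j0, h⟩ := hahn_bdd a
  refine ⟨⟨j0, fun _ j hj => h j hj⟩, fun j => ⟨‖a.coeff j‖, 0, norm_nonneg _, fun q => ?_⟩⟩
  rw [pow_zero, mul_one]
  exact le_mul_of_one_le_right (norm_nonneg _) (one_le_pow₀ (by norm_num))

theorem TameW.add {a b : Q → LaurentSeries ℂ} (ha : TameW ω a) (hb : TameW ω b) :
    TameW ω fun q => a q + b q := by
  obtain ⟨⟨ja, ha1⟩, ha2⟩ := ha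
  obtain ⟨⟨jb, hb1⟩, hb2⟩ := hb
  refine ⟨⟨min ja jb, fun q j hj => ?_⟩, fun j => ?_⟩
  · rw [HahnSeries.coeff_add, ha1 q j (by omega), hb1 q j (by omega), add_zero]
  · obtain ⟨K, D, hK, h⟩ := ha2 j
    obtain ⟨K', D', hK', h'⟩ := hb2 j
    refine ⟨K + K', max D D', by positivity, fun q => ?_⟩
    have h1 : (1 : ℝ) ≤ (ω q : ℝ) + 1 := by
      have : (0 : ℝ) ≤ ω q := by positivity
      linarith
    rw [HahnSeries.coeff_add]
    calc _ ≤ ‖(a q).coeff j‖ + ‖(b q).coeff j‖ := norm_add_le _ _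
      _ ≤ K * ((ω q : ℝ) + 1) ^ D * 2 ^ ω q + K' * ((ω q : ℝ) + 1) ^ D' * 2 ^ ω q :=
          add_le_add (h q) (h' q)
      _ ≤ K * ((ω q : ℝ) + 1) ^ (max D D') * 2 ^ ω q +
          K' * ((ω q : ℝ) + 1) ^ (max D D') * 2 ^ ω q := by
          gcongr
          · exact le_max_left _ _
          · exact le_max_right _ _
      _ = _ := by ring

theorem TameW.sum {ι : Type*} (s : Finset ι) {a : ι → Q → LaurentSeries ℂ}
    (h : ∀ i ∈ s, TameW ω (a i)) : TameW ω fun q => ∑ i ∈ s, a i q := by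
  classical
  induction s using Finset.induction_on with
  | empty => simpa using TameW.const ω 0
  | insert i s hi ih =>
    simp only [Finset.sum_insert hi]
    exact (h i (by simp)).add (ih fun j hj => h j (by simp [hj]))

/-- Uniformly bounded poles leave finitely many products at each order. The exponential rates
multiply, so the weights add, and the polynomial factors are absorbed into the single exponent `E`.
-/
theorem TameW.mul {a b : Q → LaurentSeries ℂ} (ha : TameW ω a) (hb : TameW ω' b) :
    TameW (fun q => ω q + ω' q) fun q => a q * b q := by
  obtain ⟨⟨ja, ha1⟩, ha2⟩ := ha
  obtain ⟨⟨jb, hb1⟩, hb2⟩ := hb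
  refine ⟨⟨ja + jb, fun q j hj => hahn_coeff_mul_lt (ha1 q) (hb1 q) hj⟩, fun j => ?_⟩
  choose K D hK h using ha2
  choose K' D' hK' h' using hb2
  set I := Finset.Icc ja (j - jb)
  set E := ∑ i ∈ I, (D i + D' (j - i)) with hE
  refine ⟨∑ i ∈ I, K i * K' (j - i), E, Finset.sum_nonneg fun i _ => mul_nonneg (hK _) (hK' _),
    fun q => ?_⟩
  rw [hahn_coeff_mul (ha1 q) (hb1 q), Finset.sum_mul, Finset.sum_mul]
  refine (norm_sum_le _ _).trans (Finset.sum_le_sum fun i hi => ?_)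
  rw [norm_mul]
  have h0 : (0 : ℝ) ≤ ω q := by positivity
  have h0' : (0 : ℝ) ≤ ω' q := by positivity
  have hD : D i + D' (j - i) ≤ E :=
    Finset.single_le_sum (f := fun i => D i + D' (j - i)) (fun _ _ => Nat.zero_le _) hi
  calc _ ≤ (K i * ((ω q : ℝ) + 1) ^ D i * 2 ^ ω q) *
        (K' (j - i) * ((ω' q : ℝ) + 1) ^ D' (j - i) * 2 ^ ω' q) := by
        have := h i q
        have := h' (j - i) q
        have := hK i
        gcongr
    _ ≤ (K i * ((ω q : ℝ) + ω' q + 1) ^ D i * 2 ^ ω q) *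
        (K' (j - i) * ((ω q : ℝ) + ω' q + 1) ^ D' (j - i) * 2 ^ ω' q) := by
        have := hK i
        have := hK' (j - i)
        gcongr <;> linarith
    _ = (K i * K' (j - i)) * ((ω q : ℝ) + ω' q + 1) ^ (D i + D' (j - i)) * 2 ^ (ω q + ω' q) := by
        rw [pow_add, pow_add]; ring
    _ ≤ (K i * K' (j - i)) * ((ω q : ℝ) + ω' q + 1) ^ E * 2 ^ (ω q + ω' q) := by
        have := hK i
        have := hK' (j - i)
        gcongr
        linarith
    _ = _ := by push_cast; ring

/-- Every coefficient is tame. -/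
def TameN {d : ℕ} (ω : Q → ℕ) (A : Q → NSeries d) : Prop := ∀ m, TameW ω fun q => coeff m (A q)

variable {d : ℕ}

theorem TameN.const (ω : Q → ℕ) (A : NSeries d) : TameN ω fun _ => A := fun _ => TameW.const _ _

theorem TameN.mul {A B : Q → NSeries d} (hA : TameN ω A) (hB : TameN ω' B) :
    TameN (fun q => ω q + ω' q) fun q => A q * B q := by
  classical
  intro m
  simp only [coeff_mul]
  exact TameW.sum _ fun p _ => (hA p.1).mul (hB p.2)

theorem TameN.const_mul (A : NSeries d) {B : Q → NSeries d} (hB : TameN ω B) :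
    TameN ω fun q => A * B q := by
  have := (TameN.const (fun _ : Q => 0) A).mul hB
  simpa using this

theorem TameN.sum {ι : Type*} (s : Finset ι) {A : ι → Q → NSeries d}
    (h : ∀ i ∈ s, TameN ω (A i)) : TameN ω fun q => ∑ i ∈ s, A i q := by
  intro m
  simp only [map_sum]
  exact TameW.sum _ fun i hi => h i hi m

theorem TameN.prod {ι : Type*} (s : Finset ι) {A : ι → Q → NSeries d} {ω : ι → Q → ℕ}
    (h : ∀ i ∈ s, TameN (ω i) (A i)) :
    TameN (fun q => ∑ i ∈ s, ω i q) fun q => ∏ i ∈ s, A i q := by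
  classical
  induction s using Finset.induction_on with
  | empty => simpa using TameN.const (fun _ : Q => 0) (1 : NSeries d)
  | insert i s hi ih =>
    simp only [Finset.sum_insert hi, Finset.prod_insert hi]
    exact (h i (by simp)).mul (ih fun j hj => h j (by simp [hj]))

theorem TameN.comp {A : Q → NSeries d} (h : TameN ω A) (f : Q' → Q) :
    TameN (fun q => ω (f q)) fun q => A (f q) := by
  intro m
  obtain ⟨⟨j0, h1⟩, h2⟩ := h m
  refine ⟨⟨j0, fun q j hj => h1 _ _ hj⟩, fun j => ?_⟩
  obtain ⟨K, D, hK, hb⟩ := h2 j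
  exact ⟨K, D, hK, fun q => hb _⟩

end Tame

/-! ### Summation of families of series -/

section Sum

variable {d : ℕ} {Q Q' : Type*}

/-- Coefficientwise summation, with uniformly bounded poles. -/
def HasSumN (B : Q → NSeries d) (S : NSeries d) : Prop :=
  ∀ m, (∃ j0 : ℤ, ∀ q j, j < j0 → (coeff m (B q)).coeff j = 0) ∧
    ∀ j, HasSum (fun q => (coeff m (B q)).coeff j) ((coeff m S).coeff j)

theorem HasSumN.lt {B : Q → NSeries d} {S : NSeries d} (h : HasSumN B S) {m : Fin d →₀ ℕ} {j0 : ℤ}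
    (h0 : ∀ q j, j < j0 → (coeff m (B q)).coeff j = 0) (j : ℤ) (hj : j < j0) :
    (coeff m S).coeff j = 0 := by
  have h1 := (h m).2 j
  simp only [fun q => h0 q j hj] at h1
  exact h1.unique hasSum_zero

theorem hasSum_mul_prod {f : Q → ℂ} {g : Q' → ℂ} {a b : ℂ} (hf : HasSum f a) (hg : HasSum g b) :
    HasSum (fun p : Q × Q' => f p.1 * g p.2) (a * b) :=
  hf.mul hg (summable_mul_of_summable_norm hf.summable.norm hg.summable.norm)

/-- Each coefficient of a product is a finite sum of products of complex coefficients, over a range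
common to all indices. Convergent sums over `ℂ` are absolutely convergent here, so products of sums
become sums over pairs. -/
theorem HasSumN.mul {B : Q → NSeries d} {B' : Q' → NSeries d} {S S' : NSeries d}
    (h : HasSumN B S) (h' : HasSumN B' S') :
    HasSumN (fun p : Q × Q' => B p.1 * B' p.2) (S * S') := by
  classical
  choose j0 hj0 using fun m => (h m).1
  choose j0' hj0' using fun m => (h' m).1
  intro m
  have hc : ∀ (A A' : NSeries d) (j : ℤ), (coeff m (A * A')).coeff j =
      ∑ p ∈ Finset.HasAntidiagonal.antidiagonal m, (coeff p.1 A * coeff p.2 A').coeff j := by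
    intro A A' j
    rw [coeff_mul, HahnSeries.coeff_sum]
  constructor
  · obtain ⟨J, hJ⟩ : ∃ J : ℤ, ∀ p ∈ Finset.HasAntidiagonal.antidiagonal m, J ≤ j0 p.1 + j0' p.2 := by
      refine ⟨-∑ p ∈ Finset.HasAntidiagonal.antidiagonal m, |j0 p.1 + j0' p.2|, fun p hp => ?_⟩
      have := Finset.single_le_sum (f := fun p : (Fin d →₀ ℕ) × (Fin d →₀ ℕ) =>
        |j0 p.1 + j0' p.2|) (fun _ _ => abs_nonneg _) hp
      have h2 := neg_abs_le (j0 p.1 + j0' p.2)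
      linarith
    refine ⟨J, fun q j hj => ?_⟩
    rw [hc]
    refine Finset.sum_eq_zero fun p hp => hahn_coeff_mul_lt (hj0 _ _) (hj0' _ _) ?_
    exact lt_of_lt_of_le hj (hJ p hp)
  · intro j
    simp only [hc]
    refine hasSum_sum fun p hp => ?_
    have e1 : ∀ q : Q × Q', (coeff p.1 (B q.1) * coeff p.2 (B' q.2)).coeff j =
        ∑ i ∈ Finset.Icc (j0 p.1) (j - j0' p.2),
          (coeff p.1 (B q.1)).coeff i * (coeff p.2 (B' q.2)).coeff (j - i) :=
      fun q => hahn_coeff_mul (hj0 _ _) (hj0' _ _) j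
    rw [hahn_coeff_mul (h.lt (hj0 p.1)) (h'.lt (hj0' p.2))]
    rw [funext e1]
    exact hasSum_sum fun i _ => hasSum_mul_prod
      (f := fun q => (coeff p.1 (B q)).coeff i) (g := fun q => (coeff p.2 (B' q)).coeff (j - i))
      ((h p.1).2 i) ((h' p.2).2 (j - i))

theorem HasSumN.equiv {B : Q → NSeries d} {S : NSeries d} (h : HasSumN B S) (e : Q' ≃ Q) :
    HasSumN (fun q => B (e q)) S := by
  intro m
  obtain ⟨⟨j0, h1⟩, h2⟩ := h m
  exact ⟨⟨j0, fun q j hj => h1 _ _ hj⟩, fun j => (e.hasSum_iff (f := fun q =>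
    (coeff m (B q)).coeff j)).2 (h2 j)⟩

/-- A complex number as a constant series. -/
def scalN (d : ℕ) : ℂ →+* NSeries d := C.comp HahnSeries.C

theorem coeff_scalN_mul (z : ℂ) (A : NSeries d) (m : Fin d →₀ ℕ) (j : ℤ) :
    (coeff m (scalN d z * A)).coeff j = z * (coeff m A).coeff j := by
  rw [scalN, RingHom.comp_apply, coeff_C_mul, HahnSeries.C_mul_eq_smul, HahnSeries.coeff_smul,
    smul_eq_mul]

theorem summable_pi_prod (V : Type) [Fintype V] : ∀ (f : V → ℕ → ℝ), (∀ v n, 0 ≤ f v n) →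
    (∀ v, Summable (f v)) → Summable fun q : V → ℕ => ∏ v, f v (q v) := by
  refine Fintype.induction_empty_option (P := fun V inst => ∀ (f : V → ℕ → ℝ),
    (∀ v n, 0 ≤ f v n) → (∀ v, Summable (f v)) →
      Summable fun q : V → ℕ => Finset.prod (@Finset.univ V inst) fun v => f v (q v)) ?_ ?_ ?_ V
  · intro α β _ e ih f hf hs
    letI := Fintype.ofEquiv β e.symm
    have h := ih (fun a => f (e a)) (fun a => hf _) (fun a => hs _)
    rw [← (Equiv.arrowCongr e (Equiv.refl ℕ)).summable_iff]
    refine h.congr fun q => ?_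
    rw [Function.comp_apply, ← e.prod_comp]
    simp [Equiv.arrowCongr]
  · intro f _ _
    exact Summable.of_finite
  · intro β _ ih f hf hs
    let e : (ℕ × (β → ℕ)) ≃ (Option β → ℕ) :=
      { toFun := fun p o => o.elim p.1 p.2
        invFun := fun f => (f none, fun x => f (some x))
        left_inv := fun _ => rfl
        right_inv := fun f => funext fun o => by cases o <;> rfl }
    rw [← e.summable_iff]
    have h := (hs none).mul_of_nonneg (ih (fun b => f (some b)) (fun b => hf _) fun b => hs _)
      (hf none) (fun q => Finset.prod_nonneg fun b _ => hf _ _)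
    refine h.congr fun p => ?_
    rw [Function.comp_apply, Fintype.prod_option]
    rfl

/-- The inequality `∑ q_v + 1 ≤ ∏ (q_v + 1)` factorises the bound into series `∑ (n + 1)^D (2 /
|x_v|)^n` in one variable, which converge exactly because `|x_v| > 2`. -/
theorem summable_tame {V : Type} [Fintype V] {a : (V → ℕ) → LaurentSeries ℂ}
    (h : TameW (fun q => ∑ v, q v) a) (x : V → ℂ) (hx : ∀ v, 2 < ‖x v‖) (j : ℤ) :
    Summable fun q : V → ℕ => (∏ v, x v ^ (q v + 1))⁻¹ * (a q).coeff j := by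
  obtain ⟨K, D, hK, hb⟩ := h.2 j
  have h1 : ∀ v, Summable fun n : ℕ => ((n : ℝ) + 1) ^ D * (2 / ‖x v‖) ^ n := by
    intro v
    have hr : ‖2 / ‖x v‖‖ < 1 := by
      rw [Real.norm_of_nonneg (by positivity), div_lt_one (by linarith [hx v])]
      exact hx v
    have := (summable_pow_mul_geometric_of_norm_lt_one D hr)
    have h2 := (summable_nat_add_iff 1).2 this
    have hx0 : 0 < ‖x v‖ := by linarith [hx v]
    refine (h2.mul_left (‖x v‖ / 2)).congr fun n => ?_
    push_cast
    rw [pow_succ]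
    field_simp
  have h2 := (summable_pi_prod V _ (fun v n => by positivity) h1).mul_left
    (K * ∏ v, ‖x v‖⁻¹)
  refine Summable.of_norm_bounded h2 fun q => ?_
  rw [norm_mul, norm_inv, norm_prod]
  have e1 : ((∑ v, (q v : ℝ)) + 1) ≤ ∏ v, ((q v : ℝ) + 1) := by
    have : ∀ s : Finset V, ((∑ v ∈ s, (q v : ℝ)) + 1) ≤ ∏ v ∈ s, ((q v : ℝ) + 1) := by
      classical
      intro s
      induction s using Finset.induction_on with
      | empty => simp
      | insert a s ha ih =>
        rw [Finset.sum_insert ha, Finset.prod_insert ha]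
        have h3 : (0 : ℝ) ≤ q a := by positivity
        have h4 : (0 : ℝ) ≤ ∑ v ∈ s, (q v : ℝ) := by positivity
        nlinarith
    exact this _
  calc (∏ v, ‖x v ^ (q v + 1)‖)⁻¹ * ‖(a q).coeff j‖ ≤
        (∏ v, ‖x v ^ (q v + 1)‖)⁻¹ * (K * (((∑ v, q v : ℕ) : ℝ) + 1) ^ D * 2 ^ (∑ v, q v)) := by
        gcongr
        exact hb q
    _ ≤ (∏ v, ‖x v ^ (q v + 1)‖)⁻¹ * (K * (∏ v, ((q v : ℝ) + 1)) ^ D * 2 ^ (∑ v, q v)) := by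
        push_cast
        gcongr
    _ = _ := by
        rw [← Finset.prod_pow, ← Finset.prod_pow_eq_pow_sum, ← Finset.prod_inv_distrib, mul_assoc K,
          ← Finset.prod_mul_distrib, mul_left_comm, ← Finset.prod_mul_distrib, mul_assoc K,
          ← Finset.prod_mul_distrib]
        congr 1
        refine Finset.prod_congr rfl fun v _ => ?_
        have hx0 : ‖x v‖ ≠ 0 := by linarith [hx v]
        rw [norm_pow, pow_succ, div_pow]
        field_simp

end Sum

/-! ### Growth of the moments and cumulants. -/

section TameMoments

variable {d : ℕ}

theorem toLaurent_wordVal (w : Multiset (Fin d × ℕ)) : toLaurent (wordVal w) =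
    ∑ g ∈ Finset.range ((wordPoly w).natDegree + 1),
      HahnSeries.single (4 * (g : ℤ) - 2 * w.card) ((wordPoly w).coeff g : ℂ) := by
  rw [wordVal, Polynomial.aeval_eq_sum_range, map_mul, map_sum, Finset.mul_sum]
  refine Finset.sum_congr rfl fun g _ => ?_
  rw [map_nsmul, map_pow, toLaurent_T, toLaurent_T, hpow, hpow, HahnSeries.single_pow, one_pow,
    mul_smul_comm, HahnSeries.single_mul_single, one_mul]
  have e : -2 * (w.card : ℤ) + g • 4 = 4 * (g : ℤ) - 2 * w.card := by
    rw [nsmul_eq_mul]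
    ring
  rw [e]
  ext j
  rw [HahnSeries.coeff_smul, HahnSeries.coeff_single, HahnSeries.coeff_single]
  split_ifs <;> simp

theorem wordVal_coeff_eq_zero (w : Multiset (Fin d × ℕ)) {j : ℤ} (hj : j < -2 * w.card) :
    (toLaurent (wordVal w)).coeff j = 0 := by
  rw [toLaurent_wordVal, HahnSeries.coeff_sum]
  exact Finset.sum_eq_zero fun g _ => HahnSeries.coeff_single_of_ne (by omega)

theorem norm_wordVal_coeff_le (w : Multiset (Fin d × ℕ)) (j : ℤ) :
    ‖(toLaurent (wordVal w)).coeff j‖ ≤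
      3 * (8 * ((wdeg w : ℝ) + 1) ^ 6) ^ ((j + 2 * w.card) / 4).toNat * 2 ^ wdeg w := by
  -- The exponents `4 g - 2 k` are distinct, so at most one genus contributes to the order `j`.
  set g0 := ((j + 2 * w.card) / 4).toNat
  refine le_trans ?_ (wordPoly_coeff_le w g0)
  rw [toLaurent_wordVal, HahnSeries.coeff_sum]
  rw [Finset.sum_eq_single g0]
  · rw [HahnSeries.coeff_single]
    split_ifs with h
    · simp
    · simp
  · intro g _ hg
    refine HahnSeries.coeff_single_of_ne fun h => hg ?_
    omega
  · intro h
    rw [Finset.mem_range, not_lt] at h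
    rw [Polynomial.coeff_eq_zero_of_natDegree_lt (by omega)]
    simp

/-- The number of traces is fixed while their powers vary, so a given order `j` in `N^{-1/2}` fixes
the genus, and the bound on a single coefficient of `wordPoly` applies. -/
theorem wordVal_tame {V : Type} [Fintype V] (col : V → Fin d) (u : Multiset (Fin d × ℕ)) :
    TameW (fun q : V → ℕ => ∑ v, q v) fun q =>
      toLaurent (wordVal (u + Finset.univ.val.map fun v => (col v, q v))) := by
  have hc : ∀ q : V → ℕ, (u + Finset.univ.val.map fun v => (col v, q v)).card =
      u.card + Fintype.card V := by
    intro q; rw [Multiset.card_add, Multiset.card_map]; rfl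
  have hw : ∀ q : V → ℕ, wdeg (u + Finset.univ.val.map fun v => (col v, q v)) =
      wdeg u + ∑ v, q v := by
    intro q
    rw [wdeg, Multiset.map_add, Multiset.sum_add, Multiset.map_map]
    rfl
  refine ⟨⟨-2 * (u.card + Fintype.card V : ℕ), fun q j hj => wordVal_coeff_eq_zero _ ?_⟩,
    fun j => ?_⟩
  · rw [hc]; exact hj
  · set g := ((j + 2 * (u.card + Fintype.card V : ℕ)) / 4).toNat with hg
    refine ⟨3 * 2 ^ wdeg u * (8 * ((wdeg u : ℝ) + 1) ^ 6) ^ g, 6 * g, by positivity, fun q => ?_⟩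
    refine (norm_wordVal_coeff_le _ j).trans ?_
    rw [hc, hw, ← hg]
    have h0 : (0 : ℝ) ≤ wdeg u := by positivity
    have h1 : (0 : ℝ) ≤ ((∑ v, q v : ℕ) : ℝ) := by positivity
    calc _ ≤ 3 * (8 * (((wdeg u : ℝ) + 1) * (((∑ v, q v : ℕ) : ℝ) + 1)) ^ 6) ^ g *
          2 ^ (wdeg u + ∑ v, q v) := by
          gcongr
          push_cast
          push_cast at h1
          nlinarith
      _ = _ := by
          rw [pow_add, mul_pow, mul_pow, mul_pow, mul_pow, ← pow_mul _ 6 g, ← pow_mul _ 6 g]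
          ring

theorem TameW.const_mul {Q : Type*} {ω : Q → ℕ} (a : LaurentSeries ℂ) {b : Q → LaurentSeries ℂ}
    (hb : TameW ω b) : TameW ω fun q => a * b q := by
  have := (TameW.const (fun _ : Q => 0) a).mul hb
  simpa using this

theorem traceE_tame {V : Type} [Fintype V] (col : V → Fin d) (P : TraceP d) :
    TameW (fun q : V → ℕ => ∑ v, q v) fun q =>
      toLaurent (traceE ((∏ v, MvPolynomial.X (col v, q v)) * P)) := by
  induction P using MvPolynomial.induction_on' with
  | add P P' h h' =>
    simp only [mul_add, map_add]
    exact h.add h'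
  | monomial w a =>
    have e : ∀ q : V → ℕ, toLaurent (traceE ((∏ v, MvPolynomial.X (col v, q v)) *
        MvPolynomial.monomial w a)) = toLaurent a *
        toLaurent (wordVal (Finsupp.toMultiset w + Finset.univ.val.map fun v => (col v, q v))) := by
      intro q
      have h1 : (∏ v, MvPolynomial.X (col v, q v) : TraceP d) =
          MvPolynomial.monomial (∑ v, Finsupp.single (col v, q v) 1) 1 :=
        (MvPolynomial.monomial_sum_one Finset.univ fun v => Finsupp.single (col v, q v) 1).symm
      have h2 : Finsupp.toMultiset (∑ v, Finsupp.single (col v, q v) 1) =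
          Finset.univ.val.map fun v => (col v, q v) := by
        rw [map_sum]
        simp only [Finsupp.toMultiset_single, one_smul]
        rw [← Multiset.sum_map_singleton (Multiset.map (fun v => (col v, q v)) _),
          Multiset.map_map]
        rfl
      rw [h1, MvPolynomial.monomial_mul, one_mul, traceE_monomial, map_mul, map_add, h2, add_comm]
    simp only [e]
    exact (wordVal_tame col _).const_mul _

/-- Laurent polynomial coefficients, as Laurent series. -/
abbrev laurN (d : ℕ) : LSeries d →+* NSeries d :=
  MvPowerSeries.map (toLaurent : LaurentPolynomial ℂ →+* LaurentSeries ℂ)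

/-- At each order in the couplings the exponential of the potential is a fixed polynomial in the
traces. It inserts finitely many fixed traces and leaves the rate `2` unchanged, which is why the
cuts remain `[-2, 2]` order by order. -/
theorem momL_tame {V : Type} [Fintype V] (col : V → Fin d) :
    TameN (fun q : V → ℕ => ∑ v, q v) fun q => laurN d (momL col q) := by
  have h : TameN (fun q : V → ℕ => ∑ v, q v) fun q =>
      laurN d (traceF d (C (∏ v, MvPolynomial.X (col v, q v)) * fexp (potT d))) := by
    intro m
    simp only [coeff_map, coeff_traceF, coeff_C_mul]
    exact traceE_tame col _
  have := h.const_mul (laurN d (Ring.inverse (denL d)))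
  simp only [momL, map_mul (laurN d)]
  simpa only [mul_comm] using this

open Classical in
/-- The expansion of the joint cumulant. -/
def cumL {V : Type} [Fintype V] (col : V → Fin d) (q : V → ℕ) : LSeries d :=
  ∑ π : Finpartition (Finset.univ : Finset V),
    (-1) ^ (π.parts.card - 1) * ((π.parts.card - 1).factorial : LSeries d) *
      ∏ J ∈ π.parts, momL (fun v : J => col v) (fun v : J => q v)

theorem cumulant_eq {N : ℕ} (hN : 1 ≤ N) {V : Type} [Fintype V] (col : V → Fin d) (q : V → ℕ) :
    cumulant N col q = valN d N (cumL col q) := by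
  simp only [cumulant, cumL, map_sum, map_mul, map_prod, map_pow, map_neg, map_one, map_natCast,
    moment_eq hN]

theorem cumL_tame {V : Type} [Fintype V] (col : V → Fin d) :
    TameN (fun q : V → ℕ => ∑ v, q v) fun q => laurN d (cumL col q) := by
  classical
  simp only [cumL, map_sum, map_mul, map_prod]
  refine TameN.sum _ fun π _ => TameN.const_mul _ ?_
  have h : ∀ q : V → ℕ, ∑ v, q v = ∑ J ∈ π.parts, ∑ v : J, q v := by
    intro q
    have : ∀ J : Finset V, ∑ v : J, q v = ∑ v ∈ J, q v := fun J => Finset.sum_coe_sort J q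
    simp only [this]
    refine Eq.trans ?_ (Finset.sum_biUnion (t := id) (f := q) π.disjoint)
    rw [π.biUnion_parts]
  simp only [h]
  exact TameN.prod (ω := fun (J : Finset V) (q : V → ℕ) => ∑ v : J, q v) _ fun J _ =>
    (momL_tame fun v : J => col v).comp fun (q : V → ℕ) (v : J) => q v

end TameMoments

/-! ### The correlation functions -/

section Correlation

variable {d : ℕ} {V : Type} [Fintype V]

/-- The generating series of a family, in the inverse powers of the variables. -/
def corrTerm (x : V → ℂ) (A : (V → ℕ) → NSeries d) (q : V → ℕ) : NSeries d :=
  scalN d (∏ v, x v ^ (q v + 1))⁻¹ * A q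

theorem coeff_corrTerm (x : V → ℂ) (A : (V → ℕ) → NSeries d) (q : V → ℕ) (m : Fin d →₀ ℕ) (j : ℤ) :
    (coeff m (corrTerm x A q)).coeff j = (∏ v, x v ^ (q v + 1))⁻¹ * (coeff m (A q)).coeff j :=
  coeff_scalN_mul _ _ _ _

theorem exists_hasSumN {A : (V → ℕ) → NSeries d} (h : TameN (fun q => ∑ v, q v) A) :
    ∃ W : (V → ℂ) → NSeries d, ∀ x : V → ℂ, (∀ v, 2 < ‖x v‖) →
      HasSumN (corrTerm x A) (W x) := by
  choose j0 hj0 using fun m => (h m).1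
  have hz : ∀ (x : V → ℂ) m j, j < j0 m → ∀ q, (coeff m (corrTerm x A q)).coeff j = 0 := by
    intro x m j hj q
    rw [coeff_corrTerm, hj0 m q j hj, mul_zero]
  refine ⟨fun x => ofCoeff fun m => HahnSeries.ofSuppBddBelow
    (fun j => ∑' q, (coeff m (corrTerm x A q)).coeff j) ⟨j0 m, fun j hj => ?_⟩, fun x hx m =>
      ⟨⟨j0 m, fun q j hj => hz x m j hj q⟩, fun j => ?_⟩⟩
  · by_contra hlt
    rw [not_le] at hlt
    refine hj ?_
    simp only [hz x m j hlt, tsum_zero]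
  · rw [coeff_ofCoeff]
    refine Summable.hasSum ?_
    simp only [coeff_corrTerm]
    exact summable_tame (h m) x hx j

theorem isCorrelation_of_hasSumN {F : ℕ → (V → ℕ) → Series d} {A : (V → ℕ) → LSeries d}
    (hF : ∀ N, 1 ≤ N → ∀ q, F N q = valN d N (A q)) {W : (V → ℂ) → NSeries d}
    (h : ∀ x : V → ℂ, (∀ v, 2 < ‖x v‖) → HasSumN (corrTerm x fun q => laurN d (A q)) (W x)) :
    IsCorrelation F W := by
  refine ⟨fun q => laurN d (A q), fun q => isExpansion_of_valN (A q) fun N hN => hF N hN q,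
    fun x hx m j => ?_⟩
  have := (h x hx m).2 j
  simp only [coeff_corrTerm] at this
  simpa only [div_eq_mul_inv, mul_comm] using this

end Correlation

/-! ### Moments in terms of cumulants -/

section SetPartitions

variable {α : Type*} [DecidableEq α]

open Classical in
/-- The set partitions of `S`, as sets of parts. -/
def setParts (S : Finset α) : Finset (Finset (Finset α)) :=
  S.powerset.powerset.filter fun P => (P : Set (Finset α)).PairwiseDisjoint id ∧
    P.biUnion id = S ∧ ∅ ∉ P

open Classical in
theorem mem_setParts {S : Finset α} {P : Finset (Finset α)} : P ∈ setParts S ↔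
    (P : Set (Finset α)).PairwiseDisjoint id ∧ P.biUnion id = S ∧ ∅ ∉ P := by
  rw [setParts, Finset.mem_filter, Finset.mem_powerset, and_iff_right_iff_imp]
  rintro ⟨-, h, -⟩ B hB
  rw [Finset.mem_powerset, ← h]
  exact Finset.subset_biUnion_of_mem id hB

/-- Describing partitions by plain sets of parts allows parts to be added and removed while the
underlying set changes. -/
theorem sum_finpartition {R : Type*} [AddCommMonoid R] (S : Finset α)
    (f : Finset (Finset α) → R) :
    ∑ π : Finpartition S, f π.parts = ∑ P ∈ setParts S, f P := by
  refine Finset.sum_bij' (fun π _ => π.parts) (fun P hP =>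
    { parts := P
      supIndep := Finset.supIndep_iff_pairwiseDisjoint.2 (mem_setParts.1 hP).1
      sup_parts := by rw [Finset.sup_eq_biUnion]; exact (mem_setParts.1 hP).2.1
      bot_notMem := (mem_setParts.1 hP).2.2 }) ?_ ?_ ?_ ?_ ?_
  · intro π _
    exact mem_setParts.2 ⟨π.disjoint, π.biUnion_parts, π.bot_notMem⟩
  · intro _ _; exact Finset.mem_univ _
  · intro _ _; rfl
  · intro _ _; rfl
  · intro _ _; rfl

theorem mem_setParts_unique {S : Finset α} {P : Finset (Finset α)} (hP : P ∈ setParts S) {v : α}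
    (hv : v ∈ S) : ∃ E ∈ P, v ∈ E ∧ ∀ E' ∈ P, v ∈ E' → E' = E := by
  obtain ⟨h1, h2, h3⟩ := mem_setParts.1 hP
  rw [← h2, Finset.mem_biUnion] at hv
  obtain ⟨E, hE, hvE⟩ := hv
  refine ⟨E, hE, hvE, fun E' hE' hv' => ?_⟩
  by_contra hne
  exact Finset.disjoint_left.1 (h1 hE' hE hne) hv' hvE

/-- Double counting of pairs formed by a partition and a marked part. It serves both for the
recursion on the part containing a given element and for the Möbius sum. -/
theorem sum_setParts_erase {R : Type*} [AddCommMonoid R] (S : Finset α)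
    (φ : Finset α → Finset (Finset α) → R) :
    ∑ P ∈ setParts S, ∑ E ∈ P, φ E (P.erase E) =
      ∑ E ∈ S.powerset.erase ∅, ∑ P ∈ setParts (S \ E), φ E P := by
  rw [Finset.sum_sigma', Finset.sum_sigma']
  refine Finset.sum_bij' (fun p _ => ⟨p.2, p.1.erase p.2⟩) (fun p _ => ⟨insert p.1 p.2, p.1⟩)
    ?_ ?_ ?_ ?_ ?_
  · rintro ⟨P, E⟩ h
    simp only [Finset.mem_sigma, mem_setParts, Finset.mem_erase, Finset.mem_powerset] at h ⊢
    obtain ⟨⟨h1, h2, h3⟩, hE⟩ := h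
    refine ⟨⟨fun h => h3 (h ▸ hE), ?_⟩, ?_, ?_, ?_⟩
    · rw [← h2]; exact Finset.subset_biUnion_of_mem id hE
    · exact h1.subset (by simp)
    · ext x
      simp only [Finset.mem_biUnion, Finset.mem_erase, id, Finset.mem_sdiff, ← h2]
      constructor
      · rintro ⟨B, ⟨hB1, hB2⟩, hx⟩
        exact ⟨⟨B, hB2, hx⟩, fun hxE => Finset.disjoint_left.1 (h1 hB2 hE hB1) hx hxE⟩
      · rintro ⟨⟨B, hB, hx⟩, hxE⟩
        exact ⟨B, ⟨fun h => hxE (h ▸ hx), hB⟩, hx⟩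
    · exact fun h => h3 h.2
  · rintro ⟨E, P⟩ h
    simp only [Finset.mem_sigma, mem_setParts, Finset.mem_erase, Finset.mem_powerset] at h ⊢
    obtain ⟨⟨hE, hES⟩, h1, h2, h3⟩ := h
    refine ⟨⟨?_, ?_, ?_⟩, Finset.mem_insert_self _ _⟩
    · rw [Finset.coe_insert]
      refine h1.insert fun B hB _ => ?_
      have : B ⊆ S \ E := by rw [← h2]; exact Finset.subset_biUnion_of_mem id hB
      exact Finset.disjoint_left.2 fun x hx hxB => (Finset.mem_sdiff.1 (this hxB)).2 hx
    · rw [Finset.biUnion_insert, h2, id, Finset.union_sdiff_of_subset hES]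
    · rw [Finset.mem_insert, not_or]
      exact ⟨fun h => hE h.symm, h3⟩
  · rintro ⟨P, E⟩ h
    simp only [Finset.mem_sigma] at h
    simp only [Finset.insert_erase h.2]
  · rintro ⟨E, P⟩ h
    simp only [Finset.mem_sigma, mem_setParts, Finset.mem_erase, Finset.mem_powerset] at h
    obtain ⟨⟨hE, hES⟩, h1, h2, h3⟩ := h
    have : E ∉ P := by
      intro hEP
      have h4 : E ⊆ S \ E := by
        rw [← h2]; exact Finset.subset_biUnion_of_mem id hEP
      obtain ⟨x, hx⟩ := Finset.nonempty_iff_ne_empty.2 hE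
      exact (Finset.mem_sdiff.1 (h4 hx)).2 hx
    simp only [Finset.erase_insert this]
  · rintro ⟨P, E⟩ h
    rfl

theorem setParts_empty : setParts (∅ : Finset α) = {∅} := by
  ext P
  rw [mem_setParts, Finset.mem_singleton]
  constructor
  · rintro ⟨-, h2, h3⟩
    rw [Finset.eq_empty_iff_forall_notMem]
    intro B hB
    have : B ⊆ ∅ := by rw [← h2]; exact Finset.subset_biUnion_of_mem id hB
    exact h3 (Finset.subset_empty.1 this ▸ hB)
  · rintro rfl
    simp

theorem setParts_card_pos {S : Finset α} (hS : S.Nonempty) {P : Finset (Finset α)}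
    (hP : P ∈ setParts S) : 1 ≤ P.card := by
  obtain ⟨v, hv⟩ := hS
  obtain ⟨E, hE, -⟩ := mem_setParts_unique hP hv
  exact Finset.card_pos.2 ⟨E, hE⟩

variable {R : Type*} [CommRing R]

/-- The Möbius function of the lattice of set partitions, at a partition with `k` parts. -/
def moebius (R : Type*) [CommRing R] (k : ℕ) : R := (-1) ^ (k - 1) * ((k - 1).factorial : R)

/-- The joint cumulants attached to moments. -/
def cumul (M : Finset α → R) (S : Finset α) : R :=
  ∑ P ∈ setParts S, moebius R P.card * ∏ B ∈ P, M B

theorem sum_prod_setParts_eq (κ : Finset α → R) {S : Finset α} {v : α} (hv : v ∈ S) :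
    ∑ P ∈ setParts S, ∏ B ∈ P, κ B =
      ∑ E ∈ S.powerset.erase ∅, if v ∈ E then κ E * ∑ P ∈ setParts (S \ E), ∏ B ∈ P, κ B
        else 0 := by
  have h := sum_setParts_erase S fun E P => if v ∈ E then κ E * ∏ B ∈ P, κ B else 0
  have h1 : ∀ P ∈ setParts S, ∑ E ∈ P, (if v ∈ E then κ E * ∏ B ∈ P.erase E, κ B else 0) =
      ∏ B ∈ P, κ B := by
    intro P hP
    obtain ⟨E, hE, hvE, hu⟩ := mem_setParts_unique hP hv
    rw [Finset.sum_eq_single_of_mem E hE fun E' hE' hne => if_neg fun hv' => hne (hu E' hE' hv'),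
      if_pos hvE, Finset.mul_prod_erase P κ hE]
  rw [Finset.sum_congr rfl h1] at h
  rw [h]
  refine Finset.sum_congr rfl fun E _ => ?_
  split_ifs
  · rw [Finset.mul_sum]
  · rw [Finset.sum_const_zero]

theorem moebius_rec {k : ℕ} (hk : 1 ≤ k) :
    moebius R k + ((k - 1 : ℕ) : R) * moebius R (k - 1) = if k = 1 then 1 else 0 := by
  obtain ⟨k, rfl⟩ := Nat.exists_eq_add_of_le' hk
  cases k with
  | zero => simp [moebius]
  | succ k =>
    simp only [moebius, Nat.add_sub_cancel, Nat.factorial_succ, pow_succ]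
    rw [if_neg (by omega)]
    push_cast
    ring

/-- When the cumulant of `E` is expanded, the complement of `E` becomes one further part, which may
be any of the parts not containing `v`. A partition with `k` parts thus receives the coefficient of
`moebius_rec`, and only the partition with a single part survives. -/
theorem sum_cumul_mul (M : Finset α → R) (h0 : M ∅ = 1) {S : Finset α} {v : α} (hv : v ∈ S) :
    (∑ E ∈ S.powerset.erase ∅, if v ∈ E then cumul M E * M (S \ E) else 0) = M S := by
  have hS : S.Nonempty := ⟨v, hv⟩
  have h := sum_setParts_erase S fun E P =>
    if v ∈ E then 0 else moebius R P.card * (M E * ∏ B ∈ P, M B)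
  have h1 : ∀ P ∈ setParts S, (∑ E ∈ P, if v ∈ E then 0 else
      moebius R (P.erase E).card * (M E * ∏ B ∈ P.erase E, M B)) =
      ((P.card - 1 : ℕ) : R) * moebius R (P.card - 1) * ∏ B ∈ P, M B := by
    intro P hP
    obtain ⟨E, hE, hvE, hu⟩ := mem_setParts_unique hP hv
    rw [← Finset.add_sum_erase P _ hE, if_pos hvE, zero_add]
    have : ∀ E' ∈ P.erase E, (if v ∈ E' then 0 else
        moebius R (P.erase E').card * (M E' * ∏ B ∈ P.erase E', M B)) =
        moebius R (P.card - 1) * ∏ B ∈ P, M B := by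
      intro E' hE'
      rw [Finset.mem_erase] at hE'
      rw [if_neg fun hv' => hE'.1 (hu E' hE'.2 hv'), Finset.card_erase_of_mem hE'.2,
        Finset.mul_prod_erase P M hE'.2]
    rw [Finset.sum_congr rfl this, Finset.sum_const, Finset.card_erase_of_mem hE, nsmul_eq_mul,
      mul_assoc]
  rw [Finset.sum_congr rfl h1] at h
  have h2 : ∑ E ∈ S.powerset.erase ∅, ∑ P ∈ setParts (S \ E), (if v ∈ E then 0 else
      moebius R P.card * (M E * ∏ B ∈ P, M B)) =
      ∑ E ∈ (S.powerset.erase ∅).erase S, if v ∈ E then cumul M E * M (S \ E) else 0 := by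
    have h3 : ∑ E ∈ (S.powerset.erase ∅), ∑ P ∈ setParts (S \ E), (if v ∈ E then 0 else
        moebius R P.card * (M E * ∏ B ∈ P, M B)) = ∑ E ∈ (S.powerset.erase ∅).erase S,
        ∑ P ∈ setParts (S \ E), (if v ∈ E then 0 else
        moebius R P.card * (M E * ∏ B ∈ P, M B)) := by
      symm
      apply Finset.sum_erase
      simp only [if_pos hv, Finset.sum_const_zero]
    rw [h3]
    refine Finset.sum_bij' (fun E _ => S \ E) (fun E _ => S \ E) ?_ ?_ ?_ ?_ ?_
    · intro E hE
      simp only [Finset.mem_erase, Finset.mem_powerset] at hE ⊢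
      refine ⟨fun h => hE.2.1 ?_, fun h => hE.1 ?_, Finset.sdiff_subset⟩
      · rw [← Finset.sdiff_sdiff_eq_self hE.2.2, h, Finset.sdiff_self]
      · rw [← Finset.sdiff_sdiff_eq_self hE.2.2, h, Finset.sdiff_empty]
    · intro E hE
      simp only [Finset.mem_erase, Finset.mem_powerset] at hE ⊢
      refine ⟨fun h => hE.2.1 ?_, fun h => hE.1 ?_, Finset.sdiff_subset⟩
      · rw [← Finset.sdiff_sdiff_eq_self hE.2.2, h, Finset.sdiff_self]
      · rw [← Finset.sdiff_sdiff_eq_self hE.2.2, h, Finset.sdiff_empty]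
    · intro E hE
      simp only [Finset.mem_erase, Finset.mem_powerset] at hE
      exact Finset.sdiff_sdiff_eq_self hE.2.2
    · intro E hE
      simp only [Finset.mem_erase, Finset.mem_powerset] at hE
      exact Finset.sdiff_sdiff_eq_self hE.2.2
    · intro E hE
      simp only [Finset.mem_erase, Finset.mem_powerset] at hE
      rw [Finset.sdiff_sdiff_eq_self hE.2.2]
      by_cases hvE : v ∈ E
      · simp [hvE]
      · rw [if_pos (Finset.mem_sdiff.2 ⟨hv, hvE⟩), cumul, Finset.sum_mul]
        refine Finset.sum_congr rfl fun P _ => ?_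
        rw [if_neg hvE]
        ring
  rw [h2] at h
  have hS' : S ∈ S.powerset.erase ∅ := by
    simp [hS.ne_empty]
  rw [← Finset.add_sum_erase _ _ hS', if_pos hv, Finset.sdiff_self, h0, mul_one, ← h, cumul,
    ← Finset.sum_add_distrib]
  have h5 : {S} ∈ setParts S := by
    rw [mem_setParts]
    simp [hS.ne_empty.symm]
  rw [Finset.sum_eq_single_of_mem _ h5]
  · rw [← add_mul, Finset.card_singleton, moebius_rec le_rfl, if_pos rfl, Finset.prod_singleton,
      one_mul]
  · intro P hP hne
    rw [← add_mul, moebius_rec (setParts_card_pos hS hP), if_neg, zero_mul]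
    intro hc
    obtain ⟨B, rfl⟩ := Finset.card_eq_one.1 hc
    have := (mem_setParts.1 hP).2.1
    rw [Finset.singleton_biUnion, id] at this
    exact hne (by rw [this])

/-- Singling out the part that contains `v` gives the partition sum the same recursion as the one
satisfied by `M` in `sum_cumul_mul`. -/
theorem sum_prod_cumul (M : Finset α → R) (h0 : M ∅ = 1) (S : Finset α) :
    ∑ P ∈ setParts S, ∏ B ∈ P, cumul M B = M S := by
  induction S using Finset.strongInduction with
  | H S ih =>
    rcases S.eq_empty_or_nonempty with rfl | ⟨v, hv⟩
    · rw [setParts_empty, Finset.sum_singleton, Finset.prod_empty, h0]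
    · rw [sum_prod_setParts_eq _ hv, ← sum_cumul_mul M h0 hv]
      refine Finset.sum_congr rfl fun E hE => ?_
      split_ifs with hvE
      · rw [ih]
        refine Finset.sdiff_ssubset ?_ ⟨v, hvE⟩
        exact Finset.mem_powerset.1 (Finset.mem_of_mem_erase hE)
      · rfl

/-- Cumulants of a subset are defined on the subtype `J`; this transports their partitions to
partitions of `J` inside the ambient set, where the recursion takes place. -/
theorem sum_setParts_univ_subtype {T : Type*} [AddCommMonoid T] (J : Finset α) [DecidableEq J]
    (f : Finset (Finset α) → T) :
    ∑ P ∈ setParts (Finset.univ : Finset J),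
      f (P.map (Finset.mapEmbedding (Function.Embedding.subtype (· ∈ J))).toEmbedding) =
    ∑ P ∈ setParts J, f P := by
  refine Finset.sum_bij' (fun P _ =>
    P.map (Finset.mapEmbedding (Function.Embedding.subtype (· ∈ J))).toEmbedding)
    (fun P _ => P.image (Finset.subtype (· ∈ J))) ?_ ?_ ?_ ?_ ?_
  · intro P hP
    obtain ⟨h1, h2, h3⟩ := mem_setParts.1 hP
    refine mem_setParts.2 ⟨?_, ?_, ?_⟩
    · rw [Finset.coe_map]
      rintro _ ⟨A, hA, rfl⟩ _ ⟨B, hB, rfl⟩ hne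
      exact (Finset.disjoint_map _).2 (h1 hA hB fun h => hne (h ▸ rfl))
    · ext x
      simp only [Finset.mem_biUnion, Finset.mem_map, id]
      constructor
      · rintro ⟨_, ⟨A, hA, rfl⟩, hx⟩
        obtain ⟨y, -, rfl⟩ := Finset.mem_map.1 hx
        exact y.2
      · intro hx
        have : (⟨x, hx⟩ : J) ∈ P.biUnion id := by rw [h2]; exact Finset.mem_univ _
        obtain ⟨A, hA, hxA⟩ := Finset.mem_biUnion.1 this
        exact ⟨_, ⟨A, hA, rfl⟩, Finset.mem_map.2 ⟨_, hxA, rfl⟩⟩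
    · rintro h
      obtain ⟨A, hA, h⟩ := Finset.mem_map.1 h
      have : A = ∅ := Finset.map_eq_empty.1 h
      exact h3 (this ▸ hA)
  · intro P hP
    obtain ⟨h1, h2, h3⟩ := mem_setParts.1 hP
    refine mem_setParts.2 ⟨?_, ?_, ?_⟩
    · rw [Finset.coe_image]
      rintro _ ⟨A, hA, rfl⟩ _ ⟨B, hB, rfl⟩ hne
      refine Finset.disjoint_left.2 fun x hx hx' => ?_
      exact Finset.disjoint_left.1 (h1 hA hB fun h => hne (h ▸ rfl)) (Finset.mem_subtype.1 hx)
        (Finset.mem_subtype.1 hx')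
    · ext x
      simp only [Finset.mem_univ, iff_true, Finset.mem_biUnion, Finset.mem_image, id]
      have : x.1 ∈ P.biUnion id := by rw [h2]; exact x.2
      obtain ⟨A, hA, hxA⟩ := Finset.mem_biUnion.1 this
      exact ⟨_, ⟨A, hA, rfl⟩, Finset.mem_subtype.2 hxA⟩
    · rintro h
      obtain ⟨A, hA, h⟩ := Finset.mem_image.1 h
      obtain ⟨x, hx⟩ := Finset.nonempty_iff_ne_empty.2 fun h => h3 (h ▸ hA)
      have hxJ : x ∈ J := by rw [← h2]; exact Finset.mem_biUnion.2 ⟨A, hA, hx⟩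
      have : (⟨x, hxJ⟩ : J) ∈ Finset.subtype (· ∈ J) A := Finset.mem_subtype.2 hx
      rw [h] at this
      exact absurd this (Finset.notMem_empty _)
  · intro P hP
    rw [Finset.map_eq_image, Finset.image_image]
    refine (Finset.image_congr fun A _ => ?_).trans Finset.image_id
    ext x
    simp [Finset.mapEmbedding]
  · intro P hP
    obtain ⟨h1, h2, h3⟩ := mem_setParts.1 hP
    rw [Finset.map_eq_image, Finset.image_image]
    refine (Finset.image_congr fun A hA => ?_).trans Finset.image_id
    have : A ⊆ J := by rw [← h2]; exact Finset.subset_biUnion_of_mem id hA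
    ext x
    simp only [Function.comp_apply, Finset.mapEmbedding, RelEmbedding.coe_toEmbedding, id,
      OrderEmbedding.coe_ofMapLEIff, Finset.mem_map, Finset.mem_subtype,
      Function.Embedding.subtype_apply]
    exact ⟨fun ⟨y, hy, h⟩ => h ▸ hy, fun hx => ⟨⟨x, this hx⟩, hx, rfl⟩⟩
  · intro _ _; rfl

end SetPartitions

/-! ### Moments of the matrix model in terms of its cumulants. -/

section MomentCumulant

variable {d : ℕ} {V : Type} [Fintype V]

theorem cumL_eq_sum [i : DecidableEq V] (col : V → Fin d) (q : V → ℕ) :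
    cumL col q = ∑ P ∈ setParts (Finset.univ : Finset V), moebius (LSeries d) P.card *
      ∏ J ∈ P, momL (fun v : J => col v) (fun v : J => q v) := by
  -- `cumL` is defined with classical decidability, which has to be identified with the given
  -- instance.
  obtain rfl : i = fun a b => Classical.propDecidable (a = b) := Subsingleton.elim _ _
  classical
  exact sum_finpartition (R := LSeries d) Finset.univ fun P : Finset (Finset V) =>
    moebius (LSeries d) P.card * ∏ J ∈ P, momL (fun v : J => col v) (fun v : J => q v)

/-- A subset of a subset. -/
def subtypeMapEquiv {J : Finset V} (B : Finset J) :
    B ≃ ↥(B.map (Function.Embedding.subtype (· ∈ J))) :=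
  Equiv.ofBijective (fun b => ⟨b.1.1, Finset.mem_map.2 ⟨b.1, b.2, rfl⟩⟩)
    ⟨fun a b h => Subtype.ext (Subtype.ext (Subtype.mk.inj h)), fun b => by
      obtain ⟨a, ha, h⟩ := Finset.mem_map.1 b.2
      exact ⟨⟨a, ha⟩, Subtype.ext h⟩⟩

theorem cumL_eq_cumul [DecidableEq V] (col : V → Fin d) (q : V → ℕ) (J : Finset V) :
    cumL (fun v : J => col v) (fun v : J => q v) =
      cumul (fun B : Finset V => momL (fun v : B => col v) (fun v : B => q v)) J := by
  rw [cumL_eq_sum, cumul]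
  refine Eq.trans ?_ (sum_setParts_univ_subtype J fun P => moebius (LSeries d) P.card *
    ∏ B ∈ P, momL (fun v : B => col v) (fun v : B => q v))
  refine Finset.sum_congr rfl fun P _ => ?_
  rw [Finset.card_map, Finset.prod_map]
  refine congrArg₂ _ rfl (Finset.prod_congr rfl fun B _ => ?_)
  exact momL_equiv (subtypeMapEquiv B)
    (fun v : ↥(B.map (Function.Embedding.subtype (· ∈ J))) => col v) (fun v => q v)

theorem sum_prod_cumL [DecidableEq V] (col : V → Fin d) (q : V → ℕ) :
    ∑ π : Finpartition (Finset.univ : Finset V), ∏ J ∈ π.parts,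
      cumL (fun v : J => col v) (fun v : J => q v) = momL col q := by
  simp only [cumL_eq_cumul]
  rw [sum_finpartition Finset.univ fun P => ∏ J ∈ P, cumul
    (fun B : Finset V => momL (fun v : B => col v) (fun v : B => q v)) J, sum_prod_cumul]
  · exact momL_equiv (Equiv.subtypeUnivEquiv Finset.mem_univ) col q
  · exact momL_empty _ _

end MomentCumulant

/-! ### Products of correlation functions -/

section Products

variable {d : ℕ}

theorem hasSumN_unique {Q : Type*} [Unique Q] (B : Q → NSeries d) : HasSumN B (B default) := by
  intro m
  obtain ⟨j0, h⟩ := hahn_bdd (coeff m (B default))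
  refine ⟨⟨j0, fun q j hj => ?_⟩, fun j => ?_⟩
  · rw [Unique.eq_default q]; exact h j hj
  · exact hasSum_unique _

theorem HasSumN.pi (ι : Type) [Fintype ι] : ∀ (Q : ι → Type) (B : ∀ i, Q i → NSeries d)
    (S : ι → NSeries d), (∀ i, HasSumN (B i) (S i)) →
      HasSumN (fun p : ∀ i, Q i => ∏ i, B i (p i)) (∏ i, S i) := by
  refine Fintype.induction_empty_option (P := fun ι inst => ∀ (Q : ι → Type)
    (B : ∀ i, Q i → NSeries d) (S : ι → NSeries d), (∀ i, HasSumN (B i) (S i)) →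
      HasSumN (fun p : ∀ i, Q i => Finset.prod (@Finset.univ ι inst) fun i => B i (p i))
        (Finset.prod (@Finset.univ ι inst) S)) ?_ ?_ ?_ ι
  · intro α β _ e ih Q B S h
    letI := Fintype.ofEquiv β e.symm
    have h1 := (ih (fun a => Q (e a)) (fun a => B (e a)) (fun a => S (e a)) fun a => h _).equiv
      (Equiv.piCongrLeft Q e).symm
    rw [e.prod_comp S] at h1
    convert h1 using 2 with p
    simp only [Equiv.piCongrLeft_symm_apply]
    exact (e.prod_comp fun b => B b (p b)).symm
  · intro Q B S _
    have := hasSumN_unique (d := d) fun p : ∀ i : PEmpty, Q i => ∏ i, B i (p i)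
    simpa using this
  · intro β _ ih Q B S h
    have h1 := ((h none).mul (ih (fun b => Q (some b)) (fun b => B (some b)) (fun b => S (some b))
      fun b => h _)).equiv Equiv.piOptionEquivProd
    rw [Fintype.prod_option]
    convert h1 using 2 with p
    rw [Fintype.prod_option]
    rfl

variable {V : Type} [Fintype V] [DecidableEq V]

/-- Functions on a set, as families of functions on the parts of a partition. -/
def piPartsEquiv (π : Finpartition (Finset.univ : Finset V)) :
    (V → ℕ) ≃ ∀ J : π.parts, (J.1 → ℕ) :=
  Equiv.ofBijective (fun q J v => q v) ⟨fun q q' h => by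
    funext v
    obtain ⟨J, hJ, hv⟩ := π.exists_mem (Finset.mem_univ v)
    exact congrFun (congrFun h ⟨J, hJ⟩) ⟨v, hv⟩, fun p => by
    choose J hJ hv using fun v => π.exists_mem (Finset.mem_univ v)
    refine ⟨fun v => p ⟨J v, hJ v⟩ ⟨v, hv v⟩, ?_⟩
    funext B v
    have h : (⟨J v, hJ v⟩ : π.parts) = B := Subtype.ext (by
      by_contra hne
      exact Finset.disjoint_left.1 (π.disjoint (hJ v) B.2 hne) (hv v) v.2)
    have key : ∀ B' : π.parts, B' = B → ∀ hv' : v.1 ∈ B'.1, p B' ⟨v, hv'⟩ = p B v := by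
      rintro _ rfl _; rfl
    exact key _ h (hv v)⟩

theorem prod_parts {R : Type*} [CommMonoid R] (π : Finpartition (Finset.univ : Finset V))
    (f : V → R) : ∏ J ∈ π.parts, ∏ v : J, f v = ∏ v, f v := by
  have h : ∀ J : Finset V, ∏ v : J, f v = ∏ v ∈ J, f v := fun J => Finset.prod_coe_sort J f
  simp only [h]
  refine (Finset.prod_biUnion (t := id) (f := f) π.disjoint).symm.trans ?_
  rw [π.biUnion_parts]

/-- A family of exponents on `V` is the same as one family on each part, so a product of generating
series over the parts is the generating series of the products. -/
theorem hasSumN_prod_parts (π : Finpartition (Finset.univ : Finset V)) (x : V → ℂ)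
    (A : (J : Finset V) → (J → ℕ) → NSeries d) (W : Finset V → NSeries d)
    (h : ∀ J : Finset V, HasSumN (corrTerm (fun v : J => x v) (A J)) (W J)) :
    HasSumN (corrTerm x fun q => ∏ J ∈ π.parts, A J fun v => q v) (∏ J ∈ π.parts, W J) := by
  have h1 := (HasSumN.pi π.parts _ (fun J => corrTerm (fun v : J.1 => x v) (A J)) (fun J => W J)
    fun J => h J).equiv (piPartsEquiv π)
  rw [Finset.prod_coe_sort π.parts W] at h1
  convert h1 using 2 with q
  have h2 : ∏ J : π.parts, corrTerm (fun v : J.1 => x v) (A J) (piPartsEquiv π q J) =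
      ∏ J ∈ π.parts, corrTerm (fun v : J => x v) (A J) (fun v => q v) :=
    Finset.prod_coe_sort π.parts fun J => corrTerm (fun v : J => x v) (A J) (fun v => q v)
  rw [h2]
  simp only [corrTerm, Finset.prod_mul_distrib, ← map_prod, Finset.prod_inv_distrib]
  rw [prod_parts π fun v => x v ^ (q v + 1)]

theorem tameN_prod_parts (π : Finpartition (Finset.univ : Finset V))
    (A : (J : Finset V) → (J → ℕ) → NSeries d)
    (h : ∀ J : Finset V, TameN (fun q => ∑ v, q v) (A J)) :
    TameN (fun q : V → ℕ => ∑ v, q v) fun q => ∏ J ∈ π.parts, A J fun v => q v := by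
  have h1 : ∀ q : V → ℕ, ∑ v, q v = ∑ J ∈ π.parts, ∑ v : J, q v := fun q =>
    (Multiplicative.ofAdd.injective (by
      simpa using prod_parts π fun v => Multiplicative.ofAdd (q v))).symm
  simp only [h1]
  exact TameN.prod (ω := fun (J : Finset V) (q : V → ℕ) => ∑ v : J, q v) _ fun J _ =>
    (h J).comp fun (q : V → ℕ) (v : J) => q v

end Products

/-! ### Contour integrals -/

section Contours

variable {V : Type} [Fintype V]

/-- The measure `dx / (2 i π)` on the circle of radius `r`, in the angle. -/
def circW (r θ : ℝ) : ℂ := deriv (circleMap 0 r) θ / (2 * Real.pi * Complex.I)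

/-- The contour integral `∮ dx / (2 i π) g(x)` over the circle of radius `r`. -/
def cint (r : ℝ) (g : ℂ → ℂ) : ℂ :=
  ∫ θ in Set.Ioc 0 (2 * Real.pi), circW r θ * g (circleMap 0 r θ)

/-- The measure on the product of circles. -/
def volC (V : Type) [Fintype V] : Measure (V → ℝ) :=
  Measure.pi fun _ : V => (volume : Measure ℝ).restrict (Set.Ioc 0 (2 * Real.pi))

theorem volC_eq : volC V =
    (volume : Measure (V → ℝ)).restrict (Set.pi Set.univ fun _ => Set.Ioc 0 (2 * Real.pi)) :=
  (Measure.restrict_pi_pi _ _).symm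

theorem contour_eq (r : V → ℝ) (f : (V → ℂ) → ℂ) : contour r f =
    ∫ θ, (∏ v, circW (r v) (θ v)) * f (fun v => circleMap 0 (r v) (θ v)) ∂volC V := by
  rw [volC_eq]
  rfl

theorem integrable_volC {f : (V → ℝ) → ℂ} (hf : Continuous f) : Integrable f (volC V) := by
  rw [volC_eq]
  have h : IntegrableOn f (Set.pi Set.univ fun _ : V => Set.Icc 0 (2 * Real.pi)) :=
    hf.continuousOn.integrableOn_compact (isCompact_univ_pi fun _ => isCompact_Icc)
  exact h.mono_set (Set.pi_mono fun _ _ => Set.Ioc_subset_Icc_self)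

theorem continuous_circW (r : ℝ) : Continuous (circW r) := by
  unfold circW
  simp only [deriv_circleMap]
  exact ((continuous_circleMap 0 r).mul continuous_const).div_const _

theorem contour_congr {r : V → ℝ} (hr : ∀ v, 0 ≤ r v) {f g : (V → ℂ) → ℂ}
    (h : ∀ x, (∀ v, ‖x v‖ = r v) → f x = g x) : contour r f = contour r g := by
  rw [contour_eq, contour_eq]
  congr 1
  funext θ
  rw [h]
  intro v
  rw [norm_circleMap_zero, abs_of_nonneg (hr v)]

theorem continuous_weight (r : V → ℝ) : Continuous fun θ : V → ℝ => ∏ v, circW (r v) (θ v) :=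
  continuous_finsetProd _ fun v _ => (continuous_circW _).comp (continuous_apply v)

theorem contour_sum {ι : Type*} (s : Finset ι) (r : V → ℝ) {f : ι → (V → ℂ) → ℂ}
    (h : ∀ i ∈ s, Continuous fun θ : V → ℝ => f i fun v => circleMap 0 (r v) (θ v)) :
    contour r (fun x => ∑ i ∈ s, f i x) = ∑ i ∈ s, contour r (f i) := by
  simp only [contour_eq, Finset.mul_sum]
  exact integral_finsetSum _ fun i hi => integrable_volC ((continuous_weight r).mul (h i hi))

theorem contour_mul_const (r : V → ℝ) (f : (V → ℂ) → ℂ) (a : ℂ) :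
    contour r (fun x => f x * a) = contour r f * a := by
  simp only [contour_eq, ← mul_assoc]
  exact integral_mul_const _ _

theorem contour_prod (r : V → ℝ) (g : V → ℂ → ℂ) :
    contour r (fun x => ∏ v, g v (x v)) = ∏ v, cint (r v) (g v) := by
  rw [contour_eq]
  simp only [← Finset.prod_mul_distrib]
  exact integral_fintype_prod_eq_prod
    (fun v θ => circW (r v) θ * g v (circleMap 0 (r v) θ))

theorem cint_eq (r : ℝ) (g : ℂ → ℂ) :
    cint r g = (2 * Real.pi * Complex.I)⁻¹ * ∮ z in C(0, r), g z := by
  rw [cint, circleIntegral, intervalIntegral.integral_of_le Real.two_pi_pos.le,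
    ← integral_const_mul]
  congr 1
  funext θ
  rw [circW, smul_eq_mul]
  ring

theorem cint_cauchy {r : ℝ} {a : ℂ} (h : ‖a‖ < r) (k : ℕ) :
    cint r (fun z => 1 / (z - a) * z ^ k) = a ^ k := by
  have hd : DifferentiableOn ℂ (fun z : ℂ => z ^ k) (Metric.closedBall 0 r) :=
    (differentiable_id.pow k).differentiableOn
  have h1 := hd.circleIntegral_sub_inv_smul (w := a) (by simpa using h)
  simp only [smul_eq_mul] at h1
  rw [cint_eq]
  simp only [one_div, h1]
  have h2 : (2 * Real.pi * Complex.I : ℂ) ≠ 0 := by simp [Real.pi_ne_zero]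
  rw [inv_mul_cancel_left₀ h2]

theorem cint_monomial {r : ℝ} (hr : 0 < r) (k q : ℕ) :
    cint r (fun z => z ^ k * (z ^ (q + 1))⁻¹) = if k = q then 1 else 0 := by
  have h2 : (2 * Real.pi * Complex.I : ℂ) ≠ 0 := by simp [Real.pi_ne_zero]
  have h1 : (∮ z in C(0, r), z ^ k * (z ^ (q + 1))⁻¹) =
      ∮ z in C(0, r), (z - 0) ^ ((k : ℤ) - (q + 1 : ℕ)) := by
    refine circleIntegral.integral_congr hr.le fun z hz => ?_
    have hz0 : z ≠ 0 := by
      rintro rfl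
      simp at hz
      exact hr.ne hz
    simp only [sub_zero]
    rw [zpow_sub₀ hz0, zpow_natCast, zpow_natCast, div_eq_mul_inv]
  rw [cint_eq, h1]
  split_ifs with h
  · subst h
    have e : (k : ℤ) - (k + 1 : ℕ) = -1 := by push_cast; ring
    rw [e]
    simp only [zpow_neg_one]
    rw [circleIntegral.integral_sub_center_inv _ hr.ne', inv_mul_cancel₀ h2]
  · rw [circleIntegral.integral_sub_zpow_of_ne, mul_zero]
    push_cast
    omega

theorem contour_monomial {r : V → ℝ} (hr : ∀ v, 0 < r v) (k q : V → ℕ) :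
    contour r (fun x => (∏ v, x v ^ k v) * (∏ v, x v ^ (q v + 1))⁻¹) = if k = q then 1 else 0 := by
  classical
  have h := contour_prod r fun v z => z ^ k v * (z ^ (q v + 1))⁻¹
  simp only [Finset.prod_mul_distrib, Finset.prod_inv_distrib, fun v => cint_monomial (hr v)] at h
  rw [h]
  split_ifs with hk
  · subst hk; simp
  · obtain ⟨v, hv⟩ := Function.ne_iff.1 hk
    exact Finset.prod_eq_zero (Finset.mem_univ v) (if_neg hv)

/-- Cauchy's formula in each variable. It is applied to the edge variables, with the poles at the
variables of the faces. -/
theorem contour_cauchy {r : V → ℝ} {a : V → ℂ} (h : ∀ v, ‖a v‖ < r v) {ι : Type*} (s : Finset ι)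
    (k : ι → V → ℕ) (b : ι → ℂ) :
    contour r (fun x => (∏ v, 1 / (x v - a v)) * ∑ i ∈ s, (∏ v, x v ^ k i v) * b i) =
      ∑ i ∈ s, (∏ v, a v ^ k i v) * b i := by
  have hr : ∀ v, 0 < r v := fun v => (norm_nonneg _).trans_lt (h v)
  simp only [Finset.mul_sum]
  rw [contour_sum]
  · refine Finset.sum_congr rfl fun i _ => ?_
    simp only [← mul_assoc, ← Finset.prod_mul_distrib]
    rw [contour_mul_const, contour_prod r fun v z => 1 / (z - a v) * z ^ k i v]
    simp only [fun v => cint_cauchy (h v)]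
  · intro i _
    refine Continuous.mul (continuous_finsetProd _ fun v _ => ?_) (Continuous.mul
      (continuous_finsetProd _ fun v _ => ?_) continuous_const)
    · refine continuous_const.div (((continuous_circleMap _ _).comp (continuous_apply v)).sub
        continuous_const) fun θ h0 => ?_
      rw [sub_eq_zero] at h0
      have h1 := congrArg norm h0
      simp only [norm_circleMap_zero, abs_of_pos (hr v)] at h1
      exact (h v).ne h1.symm
    · exact ((continuous_circleMap _ _).comp (continuous_apply v)).pow _

/-! ### Contour integrals of series in inverse powers. -/

section Series

theorem continuous_term {r : V → ℝ} (hr : ∀ v, 0 < r v) (k : V → ℕ) {b : (V → ℕ) → ℂ}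
    (q : V → ℕ) : Continuous fun θ : V → ℝ =>
    (∏ v, circleMap 0 (r v) (θ v) ^ k v) *
      ((∏ v, circleMap 0 (r v) (θ v) ^ (q v + 1))⁻¹ * b q) := by
  refine (continuous_finsetProd _ fun v _ => ((continuous_circleMap _ _).comp
    (continuous_apply v)).pow _).mul (Continuous.mul (Continuous.inv₀
      (continuous_finsetProd _ fun v _ => ((continuous_circleMap _ _).comp
    (continuous_apply v)).pow _) fun θ => ?_) continuous_const)
  exact Finset.prod_ne_zero_iff.2 fun v _ => pow_ne_zero _ (circleMap_ne_center (hr v).ne')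

theorem norm_term {r : V → ℝ} (hr : ∀ v, 0 < r v) (k : V → ℕ) {b : (V → ℕ) → ℂ}
    (q : V → ℕ) (θ : V → ℝ) : ‖(∏ v, circleMap 0 (r v) (θ v) ^ k v) *
      ((∏ v, circleMap 0 (r v) (θ v) ^ (q v + 1))⁻¹ * b q)‖ =
    (∏ v, r v ^ k v) * ‖(∏ v, (r v : ℂ) ^ (q v + 1))⁻¹ * b q‖ := by
  simp only [norm_mul, norm_prod, norm_inv, norm_pow, norm_circleMap_zero, Complex.norm_real,
    Real.norm_eq_abs, fun v => abs_of_pos (hr v)]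

theorem continuous_series {r : V → ℝ} (hr : ∀ v, 0 < r v) (k : V → ℕ) {b : (V → ℕ) → ℂ}
    (hs : Summable fun q : V → ℕ => (∏ v, (r v : ℂ) ^ (q v + 1))⁻¹ * b q)
    {F : (V → ℂ) → ℂ} (hF : ∀ x, (∀ v, ‖x v‖ = r v) →
      HasSum (fun q : V → ℕ => (∏ v, x v ^ (q v + 1))⁻¹ * b q) (F x)) : Continuous fun θ : V → ℝ =>
    (∏ v, circleMap 0 (r v) (θ v) ^ k v) * F fun v => circleMap 0 (r v) (θ v) := by
  have e : (fun θ : V → ℝ =>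
      (∏ v, circleMap 0 (r v) (θ v) ^ k v) * F fun v => circleMap 0 (r v) (θ v)) = fun θ =>
      ∑' q, (∏ v, circleMap 0 (r v) (θ v) ^ k v) *
        ((∏ v, circleMap 0 (r v) (θ v) ^ (q v + 1))⁻¹ * b q) := by
    funext θ
    refine (HasSum.tsum_eq ((hF _ fun v => ?_).mul_left _)).symm
    rw [norm_circleMap_zero, abs_of_pos (hr v)]
  rw [e]
  exact continuous_tsum (continuous_term hr k) (hs.norm.mul_left (∏ v, r v ^ k v))
    fun q θ => (norm_term hr k q θ).le

/-- On the torus every term has constant modulus, so summability at the radii themselves justifies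
termwise integration; the residues keep only the index `q = k`. -/
theorem contour_series {r : V → ℝ} (hr : ∀ v, 0 < r v) (k : V → ℕ) {b : (V → ℕ) → ℂ}
    (hs : Summable fun q : V → ℕ => (∏ v, (r v : ℂ) ^ (q v + 1))⁻¹ * b q)
    {F : (V → ℂ) → ℂ} (hF : ∀ x, (∀ v, ‖x v‖ = r v) →
      HasSum (fun q : V → ℕ => (∏ v, x v ^ (q v + 1))⁻¹ * b q) (F x)) : contour r (fun x => (∏ v, x v ^ k v) * F x) = b k := by
  rw [contour_eq]
  set T : (V → ℕ) → (V → ℝ) → ℂ := fun q θ => (∏ v, circW (r v) (θ v)) *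
    ((∏ v, circleMap 0 (r v) (θ v) ^ k v) *
        ((∏ v, circleMap 0 (r v) (θ v) ^ (q v + 1))⁻¹ * b q)) with hT
  have hw : ∀ θ : V → ℝ, ‖∏ v, circW (r v) (θ v)‖ = ∏ v, (r v / (2 * Real.pi)) := by
    intro θ
    rw [norm_prod]
    refine Finset.prod_congr rfl fun v _ => ?_
    simp [circW, deriv_circleMap, abs_of_pos (hr v), abs_of_pos Real.pi_pos]
  have h1 := hasSum_integral_of_summable_integral_norm (μ := volC V) (F := T)
    (fun q => integrable_volC ((continuous_weight r).mul (continuous_term hr k q))) (by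
      simp only [hT, norm_mul (∏ v, circW _ _), hw, norm_term hr, integral_const, smul_eq_mul]
      exact ((hs.norm.mul_left _).mul_left _).mul_left _)
  have h2 : ∀ θ : V → ℝ, ∑' q, T q θ = (∏ v, circW (r v) (θ v)) *
      ((∏ v, circleMap 0 (r v) (θ v) ^ k v) * F fun v => circleMap 0 (r v) (θ v)) := by
    intro θ
    refine HasSum.tsum_eq (((hF _ fun v => ?_).mul_left _).mul_left _)
    rw [norm_circleMap_zero, abs_of_pos (hr v)]
  simp only [h2] at h1
  have h3 : ∀ q, ∫ θ, T q θ ∂volC V = (if k = q then 1 else 0) * b q := by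
    intro q
    rw [← contour_monomial hr k q, ← contour_mul_const, contour_eq]
    simp only [hT, mul_assoc]
  simp only [h3] at h1
  have h4 : HasSum (fun q => (if k = q then 1 else 0) * b q) (b k) := by
    have := hasSum_single (f := fun q => (if k = q then 1 else 0) * b q) k fun q hq => by
      simp only [if_neg (Ne.symm hq), zero_mul]
    simpa using this
  exact h1.unique h4

end Series

end Contours

/-! ### The Feynman rules -/

section Feynman

variable {d n : ℕ}

theorem inv_one_sub_sub_mem {S σ : Type*} [Field S] {u : MvPowerSeries σ S}
    (hu : u ∈ ordIdeal σ S 1) (D : ℕ) :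
    (1 - u)⁻¹ - ∑ p ∈ Finset.range D, u ^ p ∈ ordIdeal σ S D := by
  have h0 : constantCoeff (1 - u) ≠ 0 := by
    rw [map_sub, mem_ordIdeal_one.1 hu, map_one, sub_zero]; exact one_ne_zero
  have h : (1 - u)⁻¹ - ∑ p ∈ Finset.range D, u ^ p = u ^ D * (1 - u)⁻¹ := by
    have h1 := geom_sum_mul_neg u D
    have h2 := MvPowerSeries.mul_inv_cancel (1 - u) h0
    have h3 : ∑ p ∈ Finset.range D, u ^ p = (1 - u ^ D) * (1 - u)⁻¹ := by
      rw [← h1, mul_assoc, h2, mul_one]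
    rw [h3]; ring
  rw [h]
  exact Ideal.mul_mem_right _ _ (ordIdeal_pow_mem hu D)

/-- The factor `N^{-(d-1)} (1 + iG)⁻¹` of an edge. -/
def rootN (d : ℕ) : NSeries d := laurN d (rootL d)

/-- The coupling of `M_c`. -/
def betaH {d : ℕ} (c : Fin d) : NSeries d := laurN d (betaL c)

theorem laurN_toL (A : Series d) : laurN d (toL d A) = toN A := by
  ext m : 1
  rw [toN, coeff_map, coeff_map, coeff_map]
  refine (AlgHom.commutes toLaurent _).trans ?_
  rw [HahnSeries.algebraMap_apply']
  exact HahnSeries.ofPowerSeries_C _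

theorem laurN_C_T (j : ℤ) : laurN d (C (LaurentPolynomial.T j)) = C (hpow j) := by
  rw [MvPowerSeries.map_C]
  congr 1
  exact toLaurent_T j

theorem rootN_eq : rootN d = C (hpow (2 * ((d : ℤ) - 1))) * toN (rootSeries d) := by
  rw [rootN, rootL, map_mul (laurN d), laurN_C_T, laurN_toL]

theorem betaH_eq (c : Fin d) : betaH c = C (hpow ((d : ℤ) - 2)) * toN (alpha c) := by
  rw [betaH, betaL, map_mul (laurN d), laurN_C_T, laurN_toL]

theorem betaH_mem (c : Fin d) : betaH c ∈ ordIdeal (Fin d) (LaurentSeries ℂ) 1 :=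
  map_mem_ordIdeal _ (betaL_mem c)

theorem propagator_eq (y : Fin d → ℂ) :
    propagator y = rootN d * (1 - ∑ c, betaH c * scalN d (y c))⁻¹ := by
  have h1 : ∀ c, C (hpow ((d : ℤ) - 2) * HahnSeries.C (y c)) * toN (alpha c) =
      betaH c * scalN d (y c) := by
    intro c
    rw [betaH_eq, map_mul, scalN, RingHom.comp_apply, mul_right_comm]
  have h2 : (C (hpow (-2 * ((d : ℤ) - 1))) * toN (1 + C Complex.I * G d)) * rootN d = 1 := by
    rw [rootN_eq, mul_mul_mul_comm, ← map_mul, hpow, hpow, HahnSeries.single_mul_single, toN, toN,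
      ← map_mul, one_add_G_mul, map_one, mul_one, one_mul]
    have e : -2 * ((d : ℤ) - 1) + 2 * ((d : ℤ) - 1) = 0 := by ring
    rw [e]
    exact map_one _
  have h3 : constantCoeff (C (hpow (-2 * ((d : ℤ) - 1))) * toN (1 + C Complex.I * G d)) ≠ 0 := by
    intro h
    have := congrArg constantCoeff h2
    rw [map_mul, h, zero_mul, map_one] at this
    exact zero_ne_one this
  simp only [propagator, h1]
  rw [MvPowerSeries.mul_inv_rev, mul_comm]
  congr 1
  rw [MvPowerSeries.inv_eq_iff_mul_eq_one h3, mul_comm]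
  exact h2

theorem propagator_sub_mem (y : Fin d → ℂ) (D : ℕ) :
    propagator y - rootN d * ∑ k ∈ simplexIdx d D, multiCoef betaH k * scalN d (∏ c, y c ^ k c) ∈
      ordIdeal (Fin d) (LaurentSeries ℂ) D := by
  have hu : ∑ c, betaH c * scalN d (y c) ∈ ordIdeal (Fin d) (LaurentSeries ℂ) 1 :=
    Ideal.sum_mem _ fun c _ => Ideal.mul_mem_right _ _ (betaH_mem c)
  have h := Ideal.mul_mem_left _ (rootN d) (inv_one_sub_sub_mem hu D)
  rw [mul_sub, ← propagator_eq] at h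
  convert h using 3
  rw [sum_simplexIdx]
  refine Finset.sum_congr rfl fun p _ => ?_
  rw [Finset.sum_pow_eq_sum_piAntidiag]
  refine Finset.sum_congr rfl fun k _ => ?_
  simp only [mul_pow, Finset.prod_mul_distrib, multiCoef, map_prod, map_pow, mul_assoc]

theorem prod_propagator_sub_mem (x : Fin d × Fin n → ℂ) (D : ℕ) :
    (∏ e : Fin n, propagator fun c => x (c, e)) -
      ∑ K ∈ Fintype.piFinset (fun _ : Fin n => simplexIdx d D),
        scalN d (∏ ce : Fin d × Fin n, x ce ^ K ce.2 ce.1) *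
          (rootN d ^ n * ∏ e, multiCoef betaH (K e)) ∈ ordIdeal (Fin d) (LaurentSeries ℂ) D := by
  have h := prod_sub_prod_mem (I := ordIdeal (Fin d) (LaurentSeries ℂ) D) Finset.univ
    fun (e : Fin n) _ => propagator_sub_mem (fun c => x (c, e)) D
  convert h using 2
  rw [Finset.prod_mul_distrib, Finset.prod_const, Finset.card_univ, Fintype.card_fin,
    Finset.prod_univ_sum, Finset.mul_sum]
  refine Finset.sum_congr rfl fun K _ => ?_
  rw [Finset.prod_mul_distrib, Fintype.prod_prod_type_right, map_prod, mul_comm, mul_assoc]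

/-- At a given order in the couplings the product of the propagators is a polynomial in the edge
variables, so Cauchy's formula applies without any question of convergence. -/
theorem coeff_prod_propagator_mul (x : Fin d × Fin n → ℂ) (B : NSeries d) (m : Fin d →₀ ℕ) (j : ℤ) :
    (coeff m ((∏ e : Fin n, propagator fun c => x (c, e)) * B)).coeff j =
      ∑ K ∈ Fintype.piFinset (fun _ : Fin n => simplexIdx d (m.degree + 1)),
        (∏ ce : Fin d × Fin n, x ce ^ K ce.2 ce.1) *
          (coeff m (rootN d ^ n * (∏ e, multiCoef betaH (K e)) * B)).coeff j := by
  have h := Ideal.mul_mem_right B _ (prod_propagator_sub_mem x (m.degree + 1))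
  rw [sub_mul] at h
  rw [coeff_eq_of_sub_mem h (Nat.lt_succ_self _), Finset.sum_mul, map_sum, HahnSeries.coeff_sum]
  refine Finset.sum_congr rfl fun K _ => ?_
  rw [mul_assoc (scalN d _), coeff_scalN_mul]

theorem HasSumN.const_mul {Q : Type*} {B : Q → NSeries d} {S : NSeries d} (A : NSeries d)
    (h : HasSumN B S) : HasSumN (fun q => A * B q) (A * S) :=
  ((hasSumN_unique fun _ : Unit => A).mul h).equiv (Equiv.punitProd Q).symm

theorem corrTerm_const_mul {V : Type} [Fintype V] (x : V → ℂ) (B : NSeries d)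
    (A : (V → ℕ) → NSeries d) (q : V → ℕ) :
    corrTerm x (fun q => B * A q) q = B * corrTerm x A q := mul_left_comm _ _ _

open Classical in
-- Once every edge variable equals the variable of its face, the exponents of the edges of one face
-- add up to `faceDeg`.
theorem prod_face_pow (σ : Fin d → Equiv.Perm (Fin n)) (s : Equiv.Perm (Fin n))
    (K : Fin n → Fin d → ℕ) (x : Faces σ s → ℂ) :
    ∏ ce : Fin d × Fin n, x (faceOf σ s ce.1 ce.2) ^ K ce.2 ce.1 =
      ∏ f, x f ^ faceDeg σ s K f := by
  have h : ∀ f : Faces σ s, x f ^ faceDeg σ s K f =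
      ∏ ce : Fin d × Fin n, if faceOf σ s ce.1 ce.2 = f then x f ^ K ce.2 ce.1 else 1 := by
    intro f
    rw [faceDeg, ← Finset.prod_pow_eq_pow_sum, Fintype.prod_prod_type,
      Finset.prod_eq_single_of_mem f.1 (Finset.mem_univ _)]
    · refine Finset.prod_congr rfl fun e _ => ?_
      split_ifs
      · rfl
      · exact pow_zero _
    · intro c _ hc
      refine Finset.prod_eq_one fun e _ => if_neg fun h => hc ?_
      rw [← h]; rfl
  simp only [h]
  rw [Finset.prod_comm]
  refine Finset.prod_congr rfl fun ce _ => ?_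
  rw [Finset.prod_ite_eq, if_pos (Finset.mem_univ _)]

/-- The edge integrals identify edge variables with face variables, and the face integrals then
extract the coefficient of index `faceDeg` of the inserted function. The result is the expansion
`wickSum`. It holds for any tame family, so it covers both the moments and the products of
cumulants. -/
theorem feynmanIntegral_eq (σ : Fin d → Equiv.Perm (Fin n)) (s : Equiv.Perm (Fin n))
    {rf : Faces σ s → ℝ} {re : Fin d × Fin n → ℝ} (hrf : ∀ f, 2 < rf f)
    (hre : ∀ (c : Fin d) (e : Fin n), rf (faceOf σ s c e) < re (c, e))
    {A : (Faces σ s → ℕ) → NSeries d} (hA : TameN (fun q => ∑ v, q v) A)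
    {W : (Faces σ s → ℂ) → NSeries d}
    (hW : ∀ x : Faces σ s → ℂ, (∀ v, 2 < ‖x v‖) → HasSumN (corrTerm x A) (W x))
    (m : Fin d →₀ ℕ) (j : ℤ) :
    feynmanIntegral σ s rf re W m j =
      (coeff m (wickSum σ s (rootN d) betaH A (m.degree + 1))).coeff j := by
  have hrf0 : ∀ f, 0 < rf f := fun f => by linarith [hrf f]
  set Φ : (Fin n → Fin d → ℕ) → NSeries d := fun K =>
    rootN d ^ n * ∏ e, multiCoef betaH (K e) with hΦ
  set T := Fintype.piFinset (fun _ : Fin n => simplexIdx d (m.degree + 1)) with hT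
  have h1 : feynmanIntegral σ s rf re W m j = contour rf fun xf =>
      ∑ K ∈ T, (∏ f, xf f ^ faceDeg σ s K f) * (coeff m (Φ K * W xf)).coeff j := by
    refine contour_congr (fun f => (hrf0 f).le) fun xf hxf => ?_
    simp only [coeff_prod_propagator_mul]
    rw [contour_cauchy (a := fun ce : Fin d × Fin n => xf (faceOf σ s ce.1 ce.2))
      (fun ce => by rw [hxf]; exact hre ce.1 ce.2) T (fun K ce => K ce.2 ce.1)
      (fun K => (coeff m (Φ K * W xf)).coeff j)]
    simp only [prod_face_pow]
  have hb : ∀ K, TameN (fun q => ∑ v, q v) fun q => Φ K * A q := fun K => hA.const_mul _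
  have hs : ∀ K, Summable fun q : Faces σ s → ℕ =>
      (∏ v, (rf v : ℂ) ^ (q v + 1))⁻¹ * (coeff m (Φ K * A q)).coeff j := fun K =>
    summable_tame (hb K m) (fun v => (rf v : ℂ)) (fun v => by
      rw [Complex.norm_real, Real.norm_of_nonneg (hrf0 v).le]; exact hrf v) j
  have hF : ∀ K (x : Faces σ s → ℂ), (∀ v, ‖x v‖ = rf v) →
      HasSum (fun q : Faces σ s → ℕ => (∏ v, x v ^ (q v + 1))⁻¹ * (coeff m (Φ K * A q)).coeff j)
        ((coeff m (Φ K * W x)).coeff j) := by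
    intro K x hx
    have := (((hW x fun v => by rw [hx]; exact hrf v).const_mul (Φ K)) m).2 j
    simp only [← corrTerm_const_mul, coeff_corrTerm] at this
    exact this
  rw [h1, contour_sum T rf fun K _ => continuous_series hrf0 (faceDeg σ s K) (hs K) (hF K)]
  simp only [contour_series hrf0 _ (hs _) (hF _)]
  rw [wickSum, Finset.mul_sum, map_sum, HahnSeries.coeff_sum]
  simp only [hΦ, hT, mul_assoc]

end Feynman

/-! ### Assembly of the expansion of a Wick term and its form with cumulants. -/

section FeynmanExpansion

variable {d n : ℕ}

theorem wickSum_sum {T ι : Type*} [CommRing T] (t : Finset ι) (σ : Fin d → Equiv.Perm (Fin n))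
    (s : Equiv.Perm (Fin n)) (r : MvPowerSeries (Fin d) T) (β : Fin d → MvPowerSeries (Fin d) T)
    (F : ι → (Faces σ s → ℕ) → MvPowerSeries (Fin d) T) (D : ℕ) :
    wickSum σ s r β (fun q => ∑ i ∈ t, F i q) D = ∑ i ∈ t, wickSum σ s r β (F i) D := by
  simp only [wickSum, Finset.mul_sum]
  rw [Finset.sum_comm]

theorem coeff_laurN_wickL (σ : Fin d → Equiv.Perm (Fin n)) (s : Equiv.Perm (Fin n))
    (m : Fin d →₀ ℕ) : coeff m (laurN d (wickL σ s)) =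
      coeff m (wickSum σ s (rootN d) betaH
        (fun q => laurN d (momL (fun f : Faces σ s => f.1) q)) (m.degree + 1)) := by
  have h := congrArg (coeff m) (map_wickSum
    (toLaurent : LaurentPolynomial ℂ →+* LaurentSeries ℂ) σ s (rootL d) betaL
    (fun q => momL (fun f : Faces σ s => f.1) q) (m.degree + 1))
  refine Eq.trans ?_ h
  rw [coeff_map, coeff_map, coeff_wickL]

theorem laurN_momL_eq_sum {V : Type} [Fintype V] [DecidableEq V] (col : V → Fin d) (q : V → ℕ) :
    laurN d (momL col q) = ∑ π : Finpartition (Finset.univ : Finset V), ∏ J ∈ π.parts,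
      laurN d (cumL (fun v : J => col v) fun v => q v) := by
  rw [← sum_prod_cumL, map_sum]
  simp only [map_prod]

open Classical in
theorem feynmanIntegral_prod_parts (σ : Fin d → Equiv.Perm (Fin n)) (s : Equiv.Perm (Fin n))
    {rf : Faces σ s → ℝ} {re : Fin d × Fin n → ℝ} (hrf : ∀ f, 2 < rf f)
    (hre : ∀ (c : Fin d) (e : Fin n), rf (faceOf σ s c e) < re (c, e))
    {W : (J : Finset (Faces σ s)) → (J → ℂ) → NSeries d}
    (hW : ∀ (J : Finset (Faces σ s)) (x : J → ℂ), (∀ v, 2 < ‖x v‖) →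
      HasSumN (corrTerm x fun q => laurN d (cumL (fun f : J => f.1.1) q)) (W J x))
    (π : Finpartition (Finset.univ : Finset (Faces σ s))) (m : Fin d →₀ ℕ) (j : ℤ) :
    feynmanIntegral σ s rf re (fun x => ∏ J ∈ π.parts, W J fun f => x f) m j =
      (coeff m (wickSum σ s (rootN d) betaH (fun q => ∏ J ∈ π.parts,
        laurN d (cumL (fun f : J => f.1.1) fun f => q f)) (m.degree + 1))).coeff j :=
  feynmanIntegral_eq σ s hrf hre
    (tameN_prod_parts π (fun J q => laurN d (cumL (fun f : J => f.1.1) q)) fun J => cumL_tame _)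
    (fun x hx => hasSumN_prod_parts π x (fun J q => laurN d (cumL (fun f : J => f.1.1) q))
      (fun J => W J fun f => x f) fun J => hW J _ fun v => hx v) m j

theorem isCorrelation_moment {V : Type} [Fintype V] (col : V → Fin d) {W : (V → ℂ) → NSeries d}
    (h : ∀ x : V → ℂ, (∀ v, 2 < ‖x v‖) →
      HasSumN (corrTerm x fun q => laurN d (momL col q)) (W x)) :
    IsCorrelation (fun N q => moment N col q) W :=
  isCorrelation_of_hasSumN (A := momL col)
    (fun N hN q => (moment_eq hN col q : moment N col q = valN d N (momL col q))) h

theorem isCorrelation_cumulant {V : Type} [Fintype V] (col : V → Fin d) {W : (V → ℂ) → NSeries d}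
    (h : ∀ x : V → ℂ, (∀ v, 2 < ‖x v‖) →
      HasSumN (corrTerm x fun q => laurN d (cumL col q)) (W x)) :
    IsCorrelation (fun N q => cumulant N col q) W :=
  isCorrelation_of_hasSumN (A := cumL col)
    (fun N hN q => (cumulant_eq hN col q : cumulant N col q = valN d N (cumL col q))) h

open Classical in
theorem exists_feynman (hd : 1 ≤ d) (σ : Fin d → Equiv.Perm (Fin n)) (s : Equiv.Perm (Fin n)) :
    ∃ (A : NSeries d) (Wbar : (Faces σ s → ℂ) → NSeries d)
      (W : (J : Finset (Faces σ s)) → (J → ℂ) → NSeries d),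
      IsExpansion (fun N => wickTerm N σ s) A ∧
      IsCorrelation (fun N q => moment N (fun f : Faces σ s => f.1) q) Wbar ∧
      (∀ J : Finset (Faces σ s), IsCorrelation
        (fun N q => cumulant N (fun f : J => f.1.1) q) (W J)) ∧
      ∀ (rf : Faces σ s → ℝ) (re : Fin d × Fin n → ℝ),
        (∀ f, 2 < rf f) →
        (∀ (c : Fin d) (e : Fin n), rf (faceOf σ s c e) < re (c, e)) →
        ∀ (m : Fin d →₀ ℕ) (j : ℤ),
          ((coeff m A).coeff j = feynmanIntegral σ s rf re Wbar m j) ∧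
          feynmanIntegral σ s rf re Wbar m j =
            ∑ π : Finpartition (Finset.univ : Finset (Faces σ s)),
              feynmanIntegral σ s rf re (fun x => ∏ J ∈ π.parts, W J fun f => x f) m j := by
  have hM := momL_tame fun f : Faces σ s => f.1
  obtain ⟨Wbar, hWbar⟩ := exists_hasSumN hM
  have hC : ∀ J : Finset (Faces σ s), TameN (fun q : J → ℕ => ∑ v, q v) fun q =>
      laurN d (cumL (fun f : J => f.1.1) q) := fun J => cumL_tame _
  choose W hW using fun J => exists_hasSumN (hC J)
  refine ⟨laurN d (wickL σ s), Wbar, W,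
    isExpansion_of_valN _ fun N hN => wickTerm_eq_valN hd hN σ s,
    isCorrelation_moment _ hWbar,
    fun J => isCorrelation_cumulant _ (hW J),
    fun rf re hrf hre m j => ?_⟩
  have hfey := feynmanIntegral_eq σ s hrf hre hM hWbar m j
  refine ⟨?_, ?_⟩
  · rw [hfey, coeff_laurN_wickL]
  -- `wickSum` is linear in the inserted family, so the sum over partitions can be moved inside,
  -- where it is the expression of a moment in cumulants.
  · rw [hfey, Finset.sum_congr rfl fun π _ =>
      feynmanIntegral_prod_parts σ s hrf hre hW π m j, ← HahnSeries.coeff_sum, ← map_sum,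
      ← wickSum_sum]
    simp only [laurN_momL_eq_sum]

end FeynmanExpansion

end QuarticTensor

end

open Classical in
theorem mainTheorem7 (d : ℕ) (hd : 2 ≤ d) (n : ℕ) (σ : Fin d → Equiv.Perm (Fin n)) :
    (∀ N : ℕ, 1 ≤ N →
      QuarticTensor.tensorExpectation (fun T : QuarticTensor.Tensor d N =>
          QuarticTensor.invariant σ T) =
        ∑ s : Equiv.Perm (Fin n), QuarticTensor.wickTerm N σ s) ∧
    ∀ s : Equiv.Perm (Fin n),
      ∃ (A : QuarticTensor.NSeries d)
        (Wbar : (QuarticTensor.Faces σ s → ℂ) → QuarticTensor.NSeries d)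
        (W : (J : Finset (QuarticTensor.Faces σ s)) → (J → ℂ) → QuarticTensor.NSeries d),
        QuarticTensor.IsExpansion (fun N => QuarticTensor.wickTerm N σ s) A ∧
        QuarticTensor.IsCorrelation
          (fun N q => QuarticTensor.moment N (fun f : QuarticTensor.Faces σ s => f.1) q) Wbar ∧
        (∀ J : Finset (QuarticTensor.Faces σ s), QuarticTensor.IsCorrelation
          (fun N q => QuarticTensor.cumulant N (fun f : J => f.1.1) q) (W J)) ∧
        ∀ (rf : QuarticTensor.Faces σ s → ℝ) (re : Fin d × Fin n → ℝ),
          (∀ f, 2 < rf f) →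
          (∀ (c : Fin d) (e : Fin n), rf (QuarticTensor.faceOf σ s c e) < re (c, e)) →
          ∀ (m : Fin d →₀ ℕ) (j : ℤ),
            ((MvPowerSeries.coeff m A).coeff j =
              QuarticTensor.feynmanIntegral σ s rf re Wbar m j) ∧
            QuarticTensor.feynmanIntegral σ s rf re Wbar m j =
              ∑ π : Finpartition (Finset.univ : Finset (QuarticTensor.Faces σ s)),
                QuarticTensor.feynmanIntegral σ s rf re
                  (fun x => ∏ J ∈ π.parts, W J fun f => x f) m j := by
  refine ⟨fun N hN => QuarticTensor.tensorExpectation_eq hN σ, fun s => ?_⟩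
  exact QuarticTensor.exists_feynman (by omega) σ s
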